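/- All categories are unitary ribbon fusion categories over $\mathbb{C}$: semisimple rigid $\mathbb{C}$-linear braided monoidal categories with finitely many simple objects up to isomorphism, finite-dimensional spaces of morphisms and simple unit, which admit a compatible unitary (positive $\dagger$-) structure and carry the twist $\theta$ for which all quantum dimensions $d_X$ of simple objects are positive. Let $c$ denote the braiding, $\tilde s_{X,Y}=\operatorname{Tr}(c_{Y,X}c_{X,Y})$ the unnormalized $S$-matrix, $\dim(\mathcal C)=\sum_{X} d_X^2$, and $\xi(\mathcal C)=\dim(\mathcal C)^{-1/2}\sum_{X}\theta_X d_X^2$ the multiplicative central charge, the sums running over isomorphism classes of simple objects. Such a category is modular if its $S$-matrix is invertible. An object $X$ is transparent if $c_{Y,X}c_{X,Y}=\operatorname{id}$ for all $Y$; the transparent objects form the Müger center $\mathcal B'$ of $\mathcal B$. The pair $(\mathcal B,f)$ is super-modular if $f$ is a transparent simple object with $f\otimes f\cong\mathbf 1$ and $\theta_f=-1$, and every transparent simple object is isomorphic to $\mathbf 1$ or $f$. A modular closure of $\mathcal B$ is a modular category $\mathcal C$ with a fully faithful $\mathbb{C}$-linear braided tensor functor $\mathcal B\to\mathcal C$ such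 that $\dim(\mathcal C)=\dim(\mathcal B')\dim(\mathcal B)$. Two modular closures are equivalent if there is a $\mathbb{C}$-linear braided equivalence between them whose restriction to $\mathcal B$ is the identity, up to a monoidal natural isomorphism. Let $(\mathcal B,f)$ be super-modular and $\mathcal C\supset\mathcal B$ a modular closure. An object $X$ of $\mathcal C$ has degree $\sigma\in\mathbb Z_2=\{0,1\}$, written $X=X_\sigma$, if $c_{f,X}c_{X,f}=(-1)^\sigma\operatorname{id}$. Let $\chi(\sigma,\tau)=\sigma\tau\in\{0,1\}$. Let $\alpha(1,1)=f$ and $\alpha(\sigma,\tau)=\mathbf 1$ otherwise; let $w(1,1,1)=i$ and $w(\sigma,\tau,\rho)=1$ otherwise. Let $\mathcal C_\alpha$ be the $\mathbb C$-linear category $\mathcal C$ with, on homogeneous objects (and extended to all objects by additivity), the tensor product $$X_\sigma\bar\otimes Y_\tau=\alpha(\sigma,\tau)\otimes X_\sigma\otimes Y_\tau,$$ the associator $$w(\sigma,\tau,\rho)\,\operatorname{Id}_{\alpha(\sigma,\tau+\rho)}\otimes c_{X_\sigma,\alpha(\tau,\rho)}^{-1}\otimes\operatorname{Id}_{Y_\tau\otimes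 Z_\rho}$$ (preceded by the canonical isomorphism $\alpha(\sigma+\tau,\rho)\otimes\alpha(\sigma,\tau)\cong\alpha(\sigma,\tau+\rho)\otimes\alpha(\tau,\rho)$, and up to the associativity and unit constraints of $\mathcal C$), the unit object and unit constraints of $\mathcal C$, and the braiding $$c^\alpha_{X_\sigma,Y_\tau}=(e^{\pi i/4})^{\chi(\sigma,\tau)}\operatorname{Id}_{\alpha(\sigma,\tau)}\otimes c_{X_\sigma,Y_\tau},$$ and with the same inclusion of $\mathcal B$. Then: 1. $\mathcal C_\alpha\supset\mathcal B$ is a modular closure of $\mathcal B$, and it is not equivalent to $\mathcal C\supset\mathcal B$. 2. Every simple object of $\mathcal C$ is homogeneous, and for all simple $X_\sigma$, $Y_\tau$ of degrees $\sigma$, $\tau$, $$\tilde s^{\alpha}_{X_\sigma,Y_\tau}=i^{\chi(\sigma,\tau)}\,\tilde s_{X_\sigma,Y_\tau},\qquad \theta^\alpha_{X_\sigma}=(e^{\pi i/4})^{\chi(\sigma,\sigma)}\,\theta_{X_\sigma}.$$ Moreover $\xi(\mathcal C_\alpha)=e^{\pi i/4}\,\xi(\mathcal C)$. 3. The rule $\mathcal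 C\mapsto\mathcal C_\alpha$ is well defined on equivalence classes, and defines a free action of $\mathbb Z_8$ on the set of equivalence classes of modular closures of $\mathcal B$, in which the generator $1$ acts by $\mathcal C\mapsto\mathcal C_\alpha$. -/

import Mathlib

open CategoryTheory MonoidalCategory Category Limits

universe u v u₁ v₁ u₂ v₂

noncomputable section

namespace FermionicZesting

/-! ### Ribbon categories, traces, dimensions, the `S`- and `T`-matrix -/

/-- A twist (ribbon structure) on a braided rigid monoidal category: a natural automorphism `θ`
of the identity functor that satisfies the balancing equation and is compatible with duals. -/
class RibbonStructure (C : Type u) [Category.{v} C] [MonoidalCategory C] [BraidedCategory C]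
    [RigidCategory C] where
  twist : ∀ X : C, X ≅ X
  twist_naturality : ∀ {X Y : C} (g : X ⟶ Y), g ≫ (twist Y).hom = (twist X).hom ≫ g
  twist_tensor : ∀ X Y : C, (twist (X ⊗ Y)).hom =
    ((twist X).hom ⊗ₘ (twist Y).hom) ≫ (β_ X Y).hom ≫ (β_ Y X).hom
  twist_dual : ∀ X : C, (twist (Xᘁ)).hom = ((twist X).hom)ᘁ

section Braided

variable {C : Type u} [Category.{v} C] [MonoidalCategory C] [BraidedCategory C]

/-- The double braiding `c_{Y,X} ∘ c_{X,Y}`. -/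
def doubleBraiding (X Y : C) : X ⊗ Y ⟶ X ⊗ Y := (β_ X Y).hom ≫ (β_ Y X).hom

/-- Transparent objects, that is, objects of the Müger center. -/
def IsTransparent (X : C) : Prop := ∀ Y : C, doubleBraiding X Y = 𝟙 (X ⊗ Y)

variable [RigidCategory C] [RibbonStructure C]

/-- The quantum trace `ev ∘ c ∘ (θ g ⊗ id) ∘ coev` of an endomorphism of `X`,
as an endomorphism of the unit object. -/
def qTrace {X : C} (g : X ⟶ X) : 𝟙_ C ⟶ 𝟙_ C :=
  η_ X (Xᘁ) ≫ (g ≫ (RibbonStructure.twist X).hom) ▷ (Xᘁ) ≫ (β_ X (Xᘁ)).hom ≫ ε_ X (Xᘁ)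

end Braided

open Classical in
/-- The scalar `z` with `g = z • id` (unique if `X` is simple; `0` if there is none). -/
def endScalar {C : Type u} [Category.{v} C] [Preadditive C] [Linear ℂ C] {X : C}
    (g : X ⟶ X) : ℂ :=
  if h : ∃ z : ℂ, g = z • 𝟙 X then h.choose else 0

section Data

variable {C : Type u} [Category.{v} C] [Preadditive C] [Linear ℂ C] [MonoidalCategory C]
  [BraidedCategory C] [RigidCategory C] [RibbonStructure C]

/-- The quantum dimension `d_X`. -/
def qDim (X : C) : ℂ := endScalar (qTrace (𝟙 X))

/-- The twist `θ_X` of a simple object as a number. -/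
def twistScalar (X : C) : ℂ := endScalar (RibbonStructure.twist X).hom

/-- The entry `s̃_{X,Y} = Tr (c_{Y,X} ∘ c_{X,Y})` of the unnormalized `S`-matrix. -/
def sEntry (X Y : C) : ℂ := endScalar (qTrace (doubleBraiding X Y))

end Data

section Labels

variable (C : Type u) [Category.{v} C] [HasZeroMorphisms C]

/-- Two simple objects have the same label iff they are isomorphic. -/
def simpleSetoid : Setoid {X : C // Simple X} where
  r X Y := Nonempty (X.1 ≅ Y.1)
  iseqv :=
    { refl := fun X => ⟨Iso.refl X.1⟩
      symm := fun ⟨e⟩ => ⟨e.symm⟩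
      trans := fun ⟨e⟩ ⟨e'⟩ => ⟨e.trans e'⟩ }

/-- The label set: isomorphism classes of simple objects. -/
def Label : Type u := Quotient (simpleSetoid C)

variable {C}

/-- A representative simple object of a label. -/
def Label.rep (i : Label C) : C := (Quotient.out i).1

end Labels

/-! ### Unitary ribbon fusion categories -/

/-- A unitary structure on a `ℂ`-linear ribbon category: a positive conjugate-linear
involution `†` on morphisms, compatible with the tensor product, for which all structural
isomorphisms are unitary. -/
structure UnitaryStructure (C : Type u) [Category.{v} C] [Preadditive C] [Linear ℂ C]
    [MonoidalCategory C] [BraidedCategory C] [RigidCategory C] [RibbonStructure C] where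
  dag : ∀ {X Y : C}, (X ⟶ Y) → (Y ⟶ X)
  dag_dag : ∀ {X Y : C} (g : X ⟶ Y), dag (dag g) = g
  dag_comp : ∀ {X Y Z : C} (g : X ⟶ Y) (h : Y ⟶ Z), dag (g ≫ h) = dag h ≫ dag g
  dag_add : ∀ {X Y : C} (g h : X ⟶ Y), dag (g + h) = dag g + dag h
  dag_smul : ∀ {X Y : C} (z : ℂ) (g : X ⟶ Y), dag (z • g) = starRingEnd ℂ z • dag g
  dag_tensor : ∀ {X Y X' Y' : C} (g : X ⟶ Y) (h : X' ⟶ Y'), dag (g ⊗ₘ h) = dag g ⊗ₘ dag h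
  dag_associator : ∀ X Y Z : C, dag (α_ X Y Z).hom = (α_ X Y Z).inv
  dag_leftUnitor : ∀ X : C, dag (λ_ X).hom = (λ_ X).inv
  dag_rightUnitor : ∀ X : C, dag (ρ_ X).hom = (ρ_ X).inv
  dag_braiding : ∀ X Y : C, dag (β_ X Y).hom = (β_ X Y).inv
  dag_twist : ∀ X : C, dag (RibbonStructure.twist X).hom = (RibbonStructure.twist X).inv
  dag_pos : ∀ {X Y : C} (g : X ⟶ Y), g ≫ dag g = 0 → g = 0

section

attribute [local instance] Abelian.hasFiniteBiproducts

/-- A unitary ribbon fusion category (unitary pre-modular category): a semisimple rigid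
`ℂ`-linear abelian braided monoidal category with finitely many simple objects up to
isomorphism, finite-dimensional spaces of morphisms and simple unit object, with a twist for
which the dimensions of simple objects are positive, and which admits a unitary structure. -/
structure URFC where
  Obj : Type u
  [category : Category.{v} Obj]
  [abelian : Abelian Obj]
  [linear : Linear ℂ Obj]
  [monoidal : MonoidalCategory Obj]
  [monoidalPreadditive : MonoidalPreadditive Obj]
  [monoidalLinear : MonoidalLinear ℂ Obj]
  [braided : BraidedCategory Obj]
  [rigid : RigidCategory Obj]
  [ribbon : RibbonStructure Obj]
  hom_finite : ∀ X Y : Obj, FiniteDimensional ℂ (X ⟶ Y)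
  unit_simple : Simple (𝟙_ Obj)
  semisimple : ∀ X : Obj, ∃ (n : ℕ) (S : Fin n → Obj),
    (∀ i, Simple (S i)) ∧ Nonempty (X ≅ ⨁ S)
  finite_label : Finite (Label Obj)
  qDim_pos : ∀ X : Obj, Simple X → ∃ r : ℝ, 0 < r ∧ qDim X = (r : ℂ)
  unitary : Nonempty (UnitaryStructure Obj)

end

instance : CoeSort URFC.{u, v} (Type u) := ⟨URFC.Obj⟩

attribute [instance] URFC.category URFC.abelian URFC.linear URFC.monoidal
  URFC.monoidalPreadditive URFC.monoidalLinear URFC.braided URFC.rigid URFC.ribbon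
  URFC.finite_label

namespace URFC

/-- The global dimension `D² = ∑ d_X²`, the sum running over all labels. -/
def dim (C : URFC.{u, v}) : ℂ := ∑ᶠ i : Label C, qDim i.rep ^ 2

open Classical in
/-- The global dimension of the Müger center. -/
def centerDim (C : URFC.{u, v}) : ℂ :=
  ∑ᶠ i : Label C, if IsTransparent i.rep then qDim i.rep ^ 2 else 0

/-- The multiplicative central charge `ξ = (∑ θ_X d_X²) / √(dim C)`. -/
def centralCharge (C : URFC.{u, v}) : ℂ :=
  (∑ᶠ i : Label C, twistScalar i.rep * qDim i.rep ^ 2) / (Real.sqrt C.dim.re : ℂ)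

/-- The unnormalized `S`-matrix. -/
def sMatrix (C : URFC.{u, v}) : Matrix (Label C) (Label C) ℂ :=
  Matrix.of fun i j => sEntry i.rep j.rep

open Classical in
/-- A unitary ribbon fusion category is modular if its `S`-matrix is invertible. -/
def IsModular (C : URFC.{u, v}) : Prop :=
  letI := Fintype.ofFinite (Label C)
  C.sMatrix.det ≠ 0

/-- `f` is a fermion: a simple object with `f ⊗ f ≅ 𝟙` and `θ_f = -1`. -/
def IsFermion {C : URFC.{u, v}} (f : C) : Prop :=
  Simple f ∧ Nonempty (f ⊗ f ≅ 𝟙_ C) ∧ (RibbonStructure.twist f).hom = -𝟙 f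

/-- `(B, f)` is super-modular: `f` is a transparent fermion, and every transparent simple object
is isomorphic to `𝟙` or to `f`. -/
def IsSuperModular (B : URFC.{u, v}) (f : B) : Prop :=
  IsFermion f ∧ IsTransparent f ∧
    ∀ X : B, Simple X → IsTransparent X → Nonempty (X ≅ 𝟙_ B) ∨ Nonempty (X ≅ f)

end URFC

/-! ### Modular closures -/

/-- A modular closure (minimal modular extension) of `B`: a unitary modular category `C` with a
fully faithful `ℂ`-linear braided tensor functor `ι : B ⥤ C` such that
`dim C = dim B' * dim B`, where `B'` is the Müger center of `B`. -/
structure ModularClosure (B : URFC.{u₁, v₁}) where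
  cat : URFC.{u₂, v₂}
  modular : cat.IsModular
  ι : B.Obj ⥤ cat.Obj
  [full : ι.Full]
  [faithful : ι.Faithful]
  [additive : ι.Additive]
  [linear : ι.Linear ℂ]
  [braided : ι.Braided]
  dim_eq : cat.dim = B.centerDim * B.dim

attribute [instance] ModularClosure.full ModularClosure.faithful ModularClosure.additive
  ModularClosure.linear ModularClosure.braided

/-- An inverse of a braided equivalence is braided, and the unit is monoidal. -/
theorem exists_braided_inverse {C : Type u₁} [Category.{v₁} C] [MonoidalCategory C]
    [BraidedCategory C] {D : Type u₂} [Category.{v₂} D] [MonoidalCategory D] [BraidedCategory D]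
    (e : C ≌ D) [e.functor.Braided] :
    ∃ _ : e.inverse.Braided, NatTrans.IsMonoidal e.unitIso.inv := by
  have h0 : @Adjunction.IsMonoidal _ _ _ _ _ _ _ _ e.toAdjunction _
      e.toAdjunction.rightAdjointLaxMonoidal := by
    let := e.toAdjunction.rightAdjointLaxMonoidal
    exact inferInstance
  let m : e.inverse.Monoidal := e.inverseMonoidal
  have h : e.toAdjunction.IsMonoidal := h0
  let b : e.inverse.Braided :=
    { toMonoidal := m
      braided := fun X Y => by
        apply e.functor.map_injective
        rw [← cancel_mono (e.toAdjunction.counit.app (Y ⊗ X))]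
        have h1 := e.toAdjunction.map_μ_comp_counit_app_tensor X Y
        have h2 := e.toAdjunction.map_μ_comp_counit_app_tensor Y X
        simp only [Functor.map_comp, assoc]
        erw [h2]
        rw [Functor.map_braiding e.functor]
        have h3 := e.toAdjunction.counit.naturality (β_ X Y).hom
        simp only [Functor.comp_map, Functor.id_map] at h3
        erw [h3, reassoc_of% h1]
        simp }
  refine ⟨b, ?_⟩
  have h1 : NatTrans.IsMonoidal e.toAdjunction.unit := inferInstance
  have : NatTrans.IsMonoidal e.unitIso.hom := h1
  infer_instance

namespace ModularClosure

variable {B : URFC.{u₁, v₁}}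

/-- Equivalence of modular closures: a `ℂ`-linear braided equivalence `F` that restricts to the
identity on `B`, up to a monoidal natural isomorphism. -/
def Equivalent (C D : ModularClosure.{u₁, v₁, u₂, v₂} B) : Prop :=
  ∃ (F : C.cat.Obj ⥤ D.cat.Obj) (_ : F.Braided) (κ : C.ι ⋙ F ≅ D.ι),
    F.IsEquivalence ∧ F.Additive ∧ F.Linear ℂ ∧ NatTrans.IsMonoidal κ.hom

theorem Equivalent.refl (C : ModularClosure.{u₁, v₁, u₂, v₂} B) : C.Equivalent C :=
  ⟨𝟭 _, inferInstance, C.ι.rightUnitor, inferInstance, inferInstance, inferInstance,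
    inferInstance⟩

theorem Equivalent.trans {C D E : ModularClosure.{u₁, v₁, u₂, v₂} B} :
    C.Equivalent D → D.Equivalent E → C.Equivalent E := by
  rintro ⟨F, hF, κ, h1, h2, h3, h4⟩ ⟨G, hG, κ', h1', h2', h3', h4'⟩
  refine ⟨F ⋙ G, inferInstance, (Functor.associator _ _ _).symm ≪≫
    Functor.isoWhiskerRight κ G ≪≫ κ', inferInstance, inferInstance, inferInstance, ?_⟩
  simp only [Iso.trans_hom, Functor.isoWhiskerRight_hom, Iso.symm_hom]
  infer_instance

theorem Equivalent.symm {C D : ModularClosure.{u₁, v₁, u₂, v₂} B} :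
    C.Equivalent D → D.Equivalent C := by
  rintro ⟨F, hF, κ, h1, h2, h3, h4⟩
  let e := F.asEquivalence
  let b1 : e.functor.Braided := hF
  have a1 : e.functor.Additive := h2
  have l1 : e.functor.Linear ℂ := h3
  obtain ⟨b2, hm⟩ := exists_braided_inverse e
  have h5 : NatTrans.IsMonoidal (F₁ := C.ι ⋙ e.functor) (F₂ := D.ι) κ.hom := h4
  let κ1 : C.ι ⋙ e.functor ≅ D.ι := κ
  have h6 : NatTrans.IsMonoidal κ1.hom := h5
  refine ⟨e.inverse, b2, Functor.isoWhiskerRight κ1.symm e.inverse ≪≫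
    Functor.associator _ _ _ ≪≫ Functor.isoWhiskerLeft C.ι e.unitIso.symm ≪≫ C.ι.rightUnitor,
    inferInstance, inferInstance, inferInstance, ?_⟩
  simp only [Iso.trans_hom, Functor.isoWhiskerRight_hom, Functor.isoWhiskerLeft_hom,
    Iso.symm_hom]
  infer_instance

/-- Equivalence of modular closures is an equivalence relation. -/
def setoid (B : URFC.{u₁, v₁}) : Setoid (ModularClosure.{u₁, v₁, u₂, v₂} B) where
  r := Equivalent
  iseqv := ⟨Equivalent.refl, Equivalent.symm, Equivalent.trans⟩

/-- The set of equivalence classes of modular closures of `B`. -/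
def Classes (B : URFC.{u₁, v₁}) := Quotient (setoid.{u₁, v₁, u₂, v₂} B)

/-- The equivalence class of a modular closure. -/
def toClass (C : ModularClosure.{u₁, v₁, u₂, v₂} B) : Classes.{u₁, v₁, u₂, v₂} B :=
  Quotient.mk (setoid B) C

end ModularClosure

/-! ### Zesting -/

section Zesting

variable {C : Type u} [Category.{v} C] [MonoidalCategory C] [BraidedCategory C]

/-- Degrees in `ℤ/2` are written as Booleans, with addition `xor` and bicharacter
`χ (σ, τ) = σ && τ`. `HasParity f σ X` says that `X` is homogeneous of degree `σ`: the double
braiding of `X` with `f` is `(-1) ^ σ`. -/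
def HasParity [Preadditive C] (f : C) : Bool → C → Prop
  | false, X => doubleBraiding X f = 𝟙 (X ⊗ f)
  | true, X => doubleBraiding X f = -𝟙 (X ⊗ f)

theorem doubleBraiding_tensor (X Y f : C) : doubleBraiding (X ⊗ Y) f =
    (α_ X Y f).hom ≫ X ◁ (β_ Y f).hom ≫ (α_ X f Y).inv ≫ doubleBraiding X f ▷ Y ≫
      (α_ X f Y).hom ≫ X ◁ (β_ f Y).hom ≫ (α_ X Y f).inv := by
  simp [doubleBraiding]

theorem hasParity_unit [Preadditive C] (f : C) : HasParity f false (𝟙_ C) := by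
  simp [HasParity, doubleBraiding]

/-- Parities add under the tensor product. -/
theorem HasParity.tensor [Preadditive C] [MonoidalPreadditive C] {f : C} {σ τ : Bool} {X Y : C}
    (hX : HasParity f σ X) (hY : HasParity f τ Y) : HasParity f (xor σ τ) (X ⊗ Y) := by
  have key : ∀ g : Y ⊗ f ⟶ Y ⊗ f, doubleBraiding Y f = g →
      X ◁ (β_ Y f).hom ≫ X ◁ (β_ f Y).hom = X ◁ g := by
    intro g hg
    rw [← MonoidalCategory.whiskerLeft_comp, ← hg, doubleBraiding]
  have e1 : (-𝟙 (X ⊗ f)) ▷ Y = -𝟙 ((X ⊗ f) ⊗ Y) := by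
    have := (tensorRight Y).map_neg (f := 𝟙 (X ⊗ f))
    rw [CategoryTheory.Functor.map_id] at this
    exact this
  have e2 : X ◁ (-𝟙 (Y ⊗ f)) = -𝟙 (X ⊗ Y ⊗ f) := by
    have := (tensorLeft X).map_neg (f := 𝟙 (Y ⊗ f))
    simpa using this
  cases σ <;> cases τ <;> change doubleBraiding X f = _ at hX <;>
    change doubleBraiding Y f = _ at hY <;> change doubleBraiding (X ⊗ Y) f = _ <;>
    rw [doubleBraiding_tensor, hX] <;> simp [reassoc_of% (key _ hY), e1, e2]

/-- The 2-cocycle `α` on `ℤ/2` with `α(1,1) = f` and all other values `𝟙`. -/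
def zAlpha (f : C) : Bool → Bool → C
  | true, true => f
  | _, _ => 𝟙_ C

/-- The 3-cochain `w` on `ℤ/2` with `w(1,1,1) = i` and all other values `1`. -/
def zW (σ τ ρ : Bool) : ℂ := if σ && τ && ρ then Complex.I else 1

/-- The factor `(e^{πi/4}) ^ χ(σ,τ)` of the braiding. -/
def zB (σ τ : Bool) : ℂ := if σ && τ then Complex.exp (Real.pi * Complex.I / 4) else 1

/-- The zested tensor product `α(σ,τ) ⊗ (X ⊗ Y)` of objects of degrees `σ` and `τ`. -/
def zTensor (f : C) (σ τ : Bool) (X Y : C) : C := zAlpha f σ τ ⊗ (X ⊗ Y)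

/-- Parities add under the zested tensor product, if the double braiding of `f` with itself is
trivial. -/
theorem HasParity.zTensor [Preadditive C] [MonoidalPreadditive C] {f : C}
    (hf : doubleBraiding f f = 𝟙 (f ⊗ f)) {σ τ : Bool} {X Y : C}
    (hX : HasParity f σ X) (hY : HasParity f τ Y) :
    HasParity f (xor σ τ) (zTensor f σ τ X Y) := by
  have h : HasParity f false (zAlpha f σ τ) := by
    cases σ <;> cases τ <;> first | exact hasParity_unit f | exact hf
  have h' := h.tensor (hX.tensor hY)
  rw [Bool.false_xor] at h'
  exact h'

/-- The zested tensor product of morphisms between objects of degrees `σ` and `τ`. -/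
def zTensorHom (f : C) (σ τ : Bool) {X X' Y Y' : C} (g : X ⟶ X') (h : Y ⟶ Y') :
    zTensor f σ τ X Y ⟶ zTensor f σ τ X' Y' :=
  zAlpha f σ τ ◁ (g ⊗ₘ h)

/-- The canonical isomorphism expressing that `α` is a 2-cocycle; each side has at most one
factor `f`, and the isomorphism is the identity up to unit constraints. -/
def zCocycle (f : C) : ∀ σ τ ρ : Bool,
    zAlpha f (xor σ τ) ρ ⊗ zAlpha f σ τ ≅ zAlpha f σ (xor τ ρ) ⊗ zAlpha f τ ρ
  | false, false, false => Iso.refl (𝟙_ C ⊗ 𝟙_ C)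
  | false, false, true => Iso.refl (𝟙_ C ⊗ 𝟙_ C)
  | false, true, false => Iso.refl (𝟙_ C ⊗ 𝟙_ C)
  | true, false, false => Iso.refl (𝟙_ C ⊗ 𝟙_ C)
  | true, false, true => Iso.refl (f ⊗ 𝟙_ C)
  | true, true, true => Iso.refl (𝟙_ C ⊗ f)
  | true, true, false => (λ_ f) ≪≫ (ρ_ f).symm
  | false, true, true => (ρ_ f) ≪≫ (λ_ f).symm

/-- The zested associator on objects of degrees `σ`, `τ`, `ρ`: up to associativity, it moves
`α(τ,ρ)` past `X` by the inverse braiding and multiplies by `w(σ,τ,ρ)`. -/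
def zAssoc [Preadditive C] [Linear ℂ C] (f : C) (σ τ ρ : Bool) (X Y Z : C) :
    zTensor f (xor σ τ) ρ (zTensor f σ τ X Y) Z ⟶ zTensor f σ (xor τ ρ) X (zTensor f τ ρ Y Z) :=
  zW σ τ ρ •
    (zAlpha f (xor σ τ) ρ ◁ ((α_ (zAlpha f σ τ) (X ⊗ Y) Z).hom ≫
        zAlpha f σ τ ◁ (α_ X Y Z).hom) ≫
      (α_ (zAlpha f (xor σ τ) ρ) (zAlpha f σ τ) (X ⊗ (Y ⊗ Z))).inv ≫
      (zCocycle f σ τ ρ).hom ▷ (X ⊗ (Y ⊗ Z)) ≫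
      (α_ (zAlpha f σ (xor τ ρ)) (zAlpha f τ ρ) (X ⊗ (Y ⊗ Z))).hom ≫
      zAlpha f σ (xor τ ρ) ◁ ((α_ (zAlpha f τ ρ) X (Y ⊗ Z)).inv ≫
        (β_ X (zAlpha f τ ρ)).inv ▷ (Y ⊗ Z) ≫ (α_ X (zAlpha f τ ρ) (Y ⊗ Z)).hom))

/-- `α` is symmetric. -/
def zSymm (f : C) : ∀ σ τ : Bool, zAlpha f σ τ ≅ zAlpha f τ σ
  | true, true => Iso.refl f
  | true, false => Iso.refl (𝟙_ C)
  | false, true => Iso.refl (𝟙_ C)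
  | false, false => Iso.refl (𝟙_ C)

/-- The zested braiding on objects of degrees `σ` and `τ`: the braiding of the last two factors,
times `(e^{πi/4}) ^ χ(σ,τ)`. -/
def zBraiding [Preadditive C] [Linear ℂ C] (f : C) (σ τ : Bool) (X Y : C) :
    zTensor f σ τ X Y ⟶ zTensor f τ σ Y X :=
  zB σ τ • ((zSymm f σ τ).hom ⊗ₘ (β_ X Y).hom)

/-- `α` is normalized. -/
def zAlphaLeft (f : C) : ∀ τ : Bool, zAlpha f false τ ≅ 𝟙_ C
  | true => Iso.refl (𝟙_ C)
  | false => Iso.refl (𝟙_ C)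

/-- `α` is normalized. -/
def zAlphaRight (f : C) : ∀ σ : Bool, zAlpha f σ false ≅ 𝟙_ C
  | true => Iso.refl (𝟙_ C)
  | false => Iso.refl (𝟙_ C)

/-- The zested left unit constraint. -/
def zLeftUnitor (f : C) (τ : Bool) (X : C) : zTensor f false τ (𝟙_ C) X ⟶ X :=
  ((zAlphaLeft f τ).hom ⊗ₘ (λ_ X).hom) ≫ (λ_ X).hom

/-- The zested right unit constraint. -/
def zRightUnitor (f : C) (σ : Bool) (X : C) : zTensor f σ false X (𝟙_ C) ⟶ X :=
  ((zAlphaRight f σ).hom ⊗ₘ (ρ_ X).hom) ≫ (λ_ X).hom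

/-- On even objects the zested tensor product is the old one. -/
def zEven (f : C) (X Y : C) : zTensor f false false X Y ⟶ X ⊗ Y := (λ_ (X ⊗ Y)).hom

end Zesting

/-- `D` is the zesting `C_α` of the modular closure `C` of `(B, f)`: up to an equivalence `Φ` of
`ℂ`-linear categories, `D` is `C` with the zested tensor product, associator, unit constraints
and braiding, and with the same inclusion of `B`. The structure is prescribed on homogeneous
objects, which determines it on all objects by additivity. -/
structure Zesting {B : URFC.{u₁, v₁}} (f : B) (C D : ModularClosure.{u₁, v₁, u₂, v₂} B) where
  Φ : C.cat.Obj ⥤ D.cat.Obj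
  equivalence : Φ.IsEquivalence
  additive : Φ.Additive
  linear : Φ.Linear ℂ
  /-- the tensor product of `D` is the zested tensor product -/
  J : ∀ (σ τ : Bool) (X Y : C.cat), HasParity (C.ι.obj f) σ X → HasParity (C.ι.obj f) τ Y →
    (Φ.obj X ⊗ Φ.obj Y ≅ Φ.obj (zTensor (C.ι.obj f) σ τ X Y))
  J_natural : ∀ (σ τ : Bool) {X X' Y Y' : C.cat} (g : X ⟶ X') (h : Y ⟶ Y')
    (hX : HasParity (C.ι.obj f) σ X) (hX' : HasParity (C.ι.obj f) σ X')
    (hY : HasParity (C.ι.obj f) τ Y) (hY' : HasParity (C.ι.obj f) τ Y'),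
    (Φ.map g ⊗ₘ Φ.map h) ≫ (J σ τ X' Y' hX' hY').hom =
      (J σ τ X Y hX hY).hom ≫ Φ.map (zTensorHom (C.ι.obj f) σ τ g h)
  /-- the associator of `D` is the zested associator (the last two hypotheses on parities follow
  from the others when `f` is transparent in `B`, see `HasParity.zTensor`) -/
  J_assoc : ∀ (σ τ ρ : Bool) (X Y Z : C.cat)
    (hX : HasParity (C.ι.obj f) σ X) (hY : HasParity (C.ι.obj f) τ Y)
    (hZ : HasParity (C.ι.obj f) ρ Z)
    (hXY : HasParity (C.ι.obj f) (xor σ τ) (zTensor (C.ι.obj f) σ τ X Y))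
    (hYZ : HasParity (C.ι.obj f) (xor τ ρ) (zTensor (C.ι.obj f) τ ρ Y Z)),
    (J σ τ X Y hX hY).hom ▷ Φ.obj Z ≫ (J (xor σ τ) ρ _ Z hXY hZ).hom ≫
        Φ.map (zAssoc (C.ι.obj f) σ τ ρ X Y Z) =
      (α_ (Φ.obj X) (Φ.obj Y) (Φ.obj Z)).hom ≫ Φ.obj X ◁ (J τ ρ Y Z hY hZ).hom ≫
        (J σ (xor τ ρ) X _ hX hYZ).hom
  /-- the unit object and the unit constraints of `D` are those of the zesting -/
  unit : 𝟙_ D.cat ≅ Φ.obj (𝟙_ C.cat)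
  J_leftUnit : ∀ (τ : Bool) (X : C.cat) (h1 : HasParity (C.ι.obj f) false (𝟙_ C.cat))
    (hX : HasParity (C.ι.obj f) τ X),
    unit.hom ▷ Φ.obj X ≫ (J false τ (𝟙_ C.cat) X h1 hX).hom ≫
      Φ.map (zLeftUnitor (C.ι.obj f) τ X) = (λ_ (Φ.obj X)).hom
  J_rightUnit : ∀ (σ : Bool) (X : C.cat) (h1 : HasParity (C.ι.obj f) false (𝟙_ C.cat))
    (hX : HasParity (C.ι.obj f) σ X),
    Φ.obj X ◁ unit.hom ≫ (J σ false X (𝟙_ C.cat) hX h1).hom ≫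
      Φ.map (zRightUnitor (C.ι.obj f) σ X) = (ρ_ (Φ.obj X)).hom
  /-- the braiding of `D` is the zested braiding -/
  J_braiding : ∀ (σ τ : Bool) (X Y : C.cat)
    (hX : HasParity (C.ι.obj f) σ X) (hY : HasParity (C.ι.obj f) τ Y),
    (β_ (Φ.obj X) (Φ.obj Y)).hom ≫ (J τ σ Y X hY hX).hom =
      (J σ τ X Y hX hY).hom ≫ Φ.map (zBraiding (C.ι.obj f) σ τ X Y)
  /-- `D` contains `B` through `Φ`, compatibly with the tensor structures -/
  incl : C.ι ⋙ Φ ≅ D.ι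
  incl_unit : unit.hom ≫ Φ.map (Functor.LaxMonoidal.ε C.ι) ≫ incl.hom.app (𝟙_ B.Obj) =
    Functor.LaxMonoidal.ε D.ι
  incl_tensor : ∀ (b b' : B) (hb : HasParity (C.ι.obj f) false (C.ι.obj b))
    (hb' : HasParity (C.ι.obj f) false (C.ι.obj b')),
    (J false false (C.ι.obj b) (C.ι.obj b') hb hb').hom ≫
        Φ.map (zEven (C.ι.obj f) (C.ι.obj b) (C.ι.obj b') ≫ Functor.LaxMonoidal.μ C.ι b b') ≫
        incl.hom.app (b ⊗ b') =
      (incl.hom.app b ⊗ₘ incl.hom.app b') ≫ Functor.LaxMonoidal.μ D.ι b b'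

end FermionicZesting

/-! Write ζ = e^{πi/4}, so that ζ² = i and ζ⁴ = -1.

Every simple object is homogeneous, and there are no nonzero morphisms between homogeneous objects
of different degrees. So it suffices to zest the homogeneous objects (`Zest`) and to adjoin finite
sums (`Fam`). On homogeneous objects each coherence axiom splits into an identity between maps of
the values of α and an identity between scalars. The fermion braids with itself by -1
(`IsFermion.braiding_and_dim`, which uses that dimensions are positive). This disturbs the pentagon
exactly when all four degrees are odd, and there w(1,1,1)² = -1 repairs it. The hexagons hold
because ζ² = i and because f passes odd objects with the sign -1.

The dual of an odd object X is f ⊗ X*. Formed with it, the trace without twist (`pTrace`) is divided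
by ζ on odd objects, while the twist is multiplied by ζ. Hence quantum traces and dimensions do not
change, and the S-matrix changes only by the factor ζ² = i of the double braiding of two odd
objects. A braided functor is not assumed to respect twists, but |θ| = 1 and d > 0 recover both
numbers from `pTrace` (`URFC.twist_compare`), so the same formulas hold for every realization of the
zesting. Modularity survives because tensoring with f separates the even from the odd columns of the
S-matrix. For the unitary structure on finite sums it is needed that a sum of terms g g† vanishes
only if every g does. The definition gives this for a single g only; `URFC.exists_isPositive`
corrects the signs.

Tensoring with f negates the twists of even simple objects and keeps their dimensions. So even
objects contribute nothing to the Gauss sum, and zesting multiplies ξ by ζ. In a modular category ξ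
≠ 0: the S-matrix sends the nonzero vector (θ_X d_X) to a vector that is proportional to the Gauss
sum. Since ξ is an invariant of equivalence and ζ is a primitive eighth root of unity, the n-fold
zesting of C is equivalent to C only if 8 divides n. This gives the inequivalence and the freeness
of the action.

Any zesting D of C gives a braided functor from `Zest` to D whose additive extension is an
equivalence, so the zesting is unique (`ModularClosure.zest_equivalent`). If C and C' are
equivalent, the zesting of C' is also a zesting of C, and the rule descends to classes. Finally,
contracting f ⊗ f to the unit identifies the twice zested tensor product with the original one, up
to (-1)^{στρ} in the associator and i^{στ} in the braiding (`doubleZestTwisted`). These scalars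
multiply under composition and their fourth powers are 1, so the eighth power of the zesting is
trivial. -/

namespace FermionicZesting

/-! ### The zested associator for arbitrary coefficient objects: pentagon, naturality, hexagons. -/

section

open BraidedCategory
section Geometry

variable {C : Type u} [Category.{v} C] [MonoidalCategory C] [BraidedCategory C]

/-- The associator of a zested tensor product, for general objects in place of the values of the
cocycle `α`. -/
def crossAssoc {A₁ A₂ B₁ B₂ : C} (φ : A₂ ⊗ A₁ ⟶ B₂ ⊗ B₁) (X Y Z : C) :
    A₂ ⊗ ((A₁ ⊗ (X ⊗ Y)) ⊗ Z) ⟶ B₂ ⊗ (X ⊗ (B₁ ⊗ (Y ⊗ Z))) :=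
  A₂ ◁ ((α_ A₁ (X ⊗ Y) Z).hom ≫ A₁ ◁ (α_ X Y Z).hom) ≫
    (α_ A₂ A₁ (X ⊗ (Y ⊗ Z))).inv ≫ φ ▷ (X ⊗ (Y ⊗ Z)) ≫ (α_ B₂ B₁ (X ⊗ (Y ⊗ Z))).hom ≫
    B₂ ◁ ((α_ B₁ X (Y ⊗ Z)).inv ≫ (β_ X B₁).inv ▷ (Y ⊗ Z) ≫ (α_ X B₁ (Y ⊗ Z)).hom)

/-- The string diagram behind the definition: one cocycle map and one crossing. Once the associators
are absorbed in `⊗≫`, the `monoidal` tactic settles every step that moves neither of the two. -/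
theorem crossAssoc_eq {A₁ A₂ B₁ B₂ : C} (φ : A₂ ⊗ A₁ ⟶ B₂ ⊗ B₁) (X Y Z : C) :
    crossAssoc φ X Y Z = 𝟙 _ ⊗≫ φ ▷ (X ⊗ Y ⊗ Z) ⊗≫ B₂ ◁ (β_ X B₁).inv ▷ (Y ⊗ Z) ⊗≫ 𝟙 _ := by
  rw [crossAssoc]; monoidal

/-- The right-hand side is a normal form shared with `crossAssoc_pentagon_right`: first all maps
between coefficients, then the same two crossings with `X` and `Y`. The two sides of the pentagon
can then differ only in the coefficients. -/
theorem crossAssoc_pentagon_left {A₁ A₂ A₃ B₁ B₂ E G H I : C} (φ₁ : A₂ ⊗ A₁ ⟶ B₂ ⊗ B₁)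
    (φ₂ : A₃ ⊗ B₂ ⟶ E ⊗ G) (φ₃ : G ⊗ B₁ ⟶ H ⊗ I) (X Y Z W : C) :
    A₃ ◁ (crossAssoc φ₁ X Y Z ▷ W) ≫ crossAssoc φ₂ X (B₁ ⊗ (Y ⊗ Z)) W ≫
        E ◁ (X ◁ crossAssoc φ₃ Y Z W) =
      𝟙 _ ⊗≫ (A₃ ◁ φ₁ ≫ (α_ _ _ _).inv ≫ φ₂ ▷ B₁ ≫ (α_ _ _ _).hom ≫ E ◁ φ₃) ▷
        (X ⊗ Y ⊗ Z ⊗ W) ⊗≫ E ◁ (β_ X (H ⊗ I)).inv ▷ (Y ⊗ Z ⊗ W) ⊗≫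
        E ◁ X ◁ H ◁ (β_ Y I).inv ▷ (Z ⊗ W) ⊗≫ 𝟙 _ := by
  simp only [crossAssoc_eq]
  calc
    _ = 𝟙 _ ⊗≫ A₃ ◁ φ₁ ▷ (X ⊗ Y ⊗ Z ⊗ W) ⊗≫
        ((A₃ ⊗ B₂) ◁ ((β_ X B₁).inv ▷ (Y ⊗ Z ⊗ W)) ≫ φ₂ ▷ ((X ⊗ B₁) ⊗ Y ⊗ Z ⊗ W)) ⊗≫
        E ◁ (β_ X G).inv ▷ (B₁ ⊗ Y ⊗ Z ⊗ W) ⊗≫ E ◁ X ◁ φ₃ ▷ (Y ⊗ Z ⊗ W) ⊗≫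
        E ◁ X ◁ H ◁ (β_ Y I).inv ▷ (Z ⊗ W) ⊗≫ 𝟙 _ := by monoidal
    _ = 𝟙 _ ⊗≫ (A₃ ◁ φ₁ ≫ (α_ _ _ _).inv ≫ φ₂ ▷ B₁ ≫ (α_ _ _ _).hom) ▷ (X ⊗ Y ⊗ Z ⊗ W) ⊗≫
        E ◁ ((G ◁ (β_ X B₁).inv ⊗≫ (β_ X G).inv ▷ B₁ ≫ (α_ _ _ _).hom) ≫ X ◁ φ₃) ▷
          (Y ⊗ Z ⊗ W) ⊗≫
        E ◁ X ◁ H ◁ (β_ Y I).inv ▷ (Z ⊗ W) ⊗≫ 𝟙 _ := by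
      rw [whisker_exchange]; monoidal
    _ = 𝟙 _ ⊗≫ (A₃ ◁ φ₁ ≫ (α_ _ _ _).inv ≫ φ₂ ▷ B₁ ≫ (α_ _ _ _).hom) ▷ (X ⊗ Y ⊗ Z ⊗ W) ⊗≫
        E ◁ ((α_ _ _ _).inv ≫ (β_ X (G ⊗ B₁)).inv ≫ X ◁ φ₃) ▷
          (Y ⊗ Z ⊗ W) ⊗≫
        E ◁ X ◁ H ◁ (β_ Y I).inv ▷ (Z ⊗ W) ⊗≫ 𝟙 _ := by
      -- The crossings of `X` with `B₁` and with `G` are merged into a single crossing with `G ⊗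
      -- B₁`, through which `φ₃` slides by naturality.
      rw [braiding_tensor_right_inv]; monoidal
    _ = _ := by
      rw [← braiding_inv_naturality_left]; monoidal

/-- The coefficient `I` is moved past the whole object `A₁ ⊗ (X ⊗ Y)`. This produces the crossing of
the coefficients `A₁` and `I`, the source of the sign in the pentagon when both are the fermion. -/
theorem crossAssoc_pentagon_right {A₁ A₂ A₃ E H I M : C} (φ₄ : A₃ ⊗ A₂ ⟶ M ⊗ I)
    (φ₅ : M ⊗ A₁ ⟶ E ⊗ H) (X Y Z W : C) :
    crossAssoc φ₄ (A₁ ⊗ (X ⊗ Y)) Z W ≫ crossAssoc φ₅ X Y (I ⊗ (Z ⊗ W)) =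
      𝟙 _ ⊗≫ ((α_ _ _ _).inv ≫ φ₄ ▷ A₁ ≫ (α_ _ _ _).hom ≫ M ◁ (β_ A₁ I).inv ≫
        (α_ _ _ _).inv ≫ φ₅ ▷ I ≫ (α_ _ _ _).hom) ▷
        (X ⊗ Y ⊗ Z ⊗ W) ⊗≫ E ◁ (β_ X (H ⊗ I)).inv ▷ (Y ⊗ Z ⊗ W) ⊗≫
        E ◁ X ◁ H ◁ (β_ Y I).inv ▷ (Z ⊗ W) ⊗≫ 𝟙 _ := by
  simp only [crossAssoc_eq, braiding_tensor_right_inv, braiding_tensor_left_inv]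
  calc
    _ = 𝟙 _ ⊗≫ (φ₄ ▷ A₁ ≫ (α_ _ _ _).hom ≫ M ◁ (β_ A₁ I).inv) ▷ (X ⊗ Y ⊗ Z ⊗ W) ⊗≫
        ((M ⊗ A₁) ◁ ((β_ X I).inv ▷ (Y ⊗ Z ⊗ W) ≫ (α_ _ _ _).hom ≫
            X ◁ ((α_ _ _ _).inv ≫ (β_ Y I).inv ▷ (Z ⊗ W) ≫ (α_ _ _ _).hom)) ≫
          φ₅ ▷ (X ⊗ Y ⊗ I ⊗ Z ⊗ W)) ⊗≫
        E ◁ (β_ X H).inv ▷ (Y ⊗ I ⊗ Z ⊗ W) ⊗≫ 𝟙 _ := by monoidal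
    _ = 𝟙 _ ⊗≫ (φ₄ ▷ A₁ ≫ (α_ _ _ _).hom ≫ M ◁ (β_ A₁ I).inv ≫
        (α_ _ _ _).inv ≫ φ₅ ▷ I ≫ (α_ _ _ _).hom) ▷ (X ⊗ Y ⊗ Z ⊗ W) ⊗≫
        E ◁ H ◁ (β_ X I).inv ▷ (Y ⊗ Z ⊗ W) ⊗≫
        E ◁ ((H ⊗ X) ◁ ((β_ Y I).inv ▷ (Z ⊗ W) ≫ (α_ _ _ _).hom) ≫
          (β_ X H).inv ▷ (Y ⊗ I ⊗ Z ⊗ W)) ⊗≫ 𝟙 _ := by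
      rw [whisker_exchange]; monoidal
    _ = _ := by
      rw [whisker_exchange]; monoidal

/-- The pentagon for `crossAssoc` follows from the corresponding identity for the cocycle. -/
theorem crossAssoc_pentagon [Preadditive C] [Linear ℂ C] [MonoidalPreadditive C]
    [MonoidalLinear ℂ C] {A₁ A₂ A₃ B₁ B₂ E G H I M : C}
    (φ₁ : A₂ ⊗ A₁ ⟶ B₂ ⊗ B₁) (φ₂ : A₃ ⊗ B₂ ⟶ E ⊗ G) (φ₃ : G ⊗ B₁ ⟶ H ⊗ I)
    (φ₄ : A₃ ⊗ A₂ ⟶ M ⊗ I) (φ₅ : M ⊗ A₁ ⟶ E ⊗ H) (z : ℂ)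
    (h : A₃ ◁ φ₁ ≫ (α_ _ _ _).inv ≫ φ₂ ▷ B₁ ≫ (α_ _ _ _).hom ≫ E ◁ φ₃ =
      z • ((α_ _ _ _).inv ≫ φ₄ ▷ A₁ ≫ (α_ _ _ _).hom ≫ M ◁ (β_ A₁ I).inv ≫
        (α_ _ _ _).inv ≫ φ₅ ▷ I ≫ (α_ _ _ _).hom)) (X Y Z W : C) :
    A₃ ◁ (crossAssoc φ₁ X Y Z ▷ W) ≫ crossAssoc φ₂ X (B₁ ⊗ (Y ⊗ Z)) W ≫
        E ◁ (X ◁ crossAssoc φ₃ Y Z W) =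
      z • (crossAssoc φ₄ (A₁ ⊗ (X ⊗ Y)) Z W ≫ crossAssoc φ₅ X Y (I ⊗ (Z ⊗ W))) := by
  rw [crossAssoc_pentagon_left, crossAssoc_pentagon_right, h]
  simp only [monoidalComp, MonoidalLinear.smul_whiskerRight, Linear.comp_smul, Linear.smul_comp]

/-- The inverse of `crossAssoc`, if `ψ` is the inverse of `φ`. -/
def crossAssocInv {A₁ A₂ B₁ B₂ : C} (ψ : B₂ ⊗ B₁ ⟶ A₂ ⊗ A₁) (X Y Z : C) :
    B₂ ⊗ (X ⊗ (B₁ ⊗ (Y ⊗ Z))) ⟶ A₂ ⊗ ((A₁ ⊗ (X ⊗ Y)) ⊗ Z) :=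
  B₂ ◁ ((α_ X B₁ (Y ⊗ Z)).inv ≫ (β_ X B₁).hom ▷ (Y ⊗ Z) ≫ (α_ B₁ X (Y ⊗ Z)).hom) ≫
    (α_ B₂ B₁ (X ⊗ (Y ⊗ Z))).inv ≫ ψ ▷ (X ⊗ (Y ⊗ Z)) ≫ (α_ A₂ A₁ (X ⊗ (Y ⊗ Z))).hom ≫
    A₂ ◁ (A₁ ◁ (α_ X Y Z).inv ≫ (α_ A₁ (X ⊗ Y) Z).inv)

theorem crossAssocInv_eq {A₁ A₂ B₁ B₂ : C} (ψ : B₂ ⊗ B₁ ⟶ A₂ ⊗ A₁) (X Y Z : C) :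
    crossAssocInv ψ X Y Z =
      𝟙 _ ⊗≫ B₂ ◁ (β_ X B₁).hom ▷ (Y ⊗ Z) ⊗≫ ψ ▷ (X ⊗ Y ⊗ Z) ⊗≫ 𝟙 _ := by
  rw [crossAssocInv]; monoidal

theorem crossAssoc_comp_inv {A₁ A₂ B₁ B₂ : C} (φ : A₂ ⊗ A₁ ≅ B₂ ⊗ B₁) (X Y Z : C) :
    crossAssoc φ.hom X Y Z ≫ crossAssocInv φ.inv X Y Z = 𝟙 _ := by
  simp only [crossAssoc_eq, crossAssocInv_eq]
  calc
    _ = 𝟙 _ ⊗≫ φ.hom ▷ (X ⊗ Y ⊗ Z) ⊗≫ B₂ ◁ ((β_ X B₁).inv ≫ (β_ X B₁).hom) ▷ (Y ⊗ Z) ⊗≫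
        φ.inv ▷ (X ⊗ Y ⊗ Z) ⊗≫ 𝟙 _ := by monoidal
    _ = 𝟙 _ ⊗≫ (φ.hom ≫ φ.inv) ▷ (X ⊗ Y ⊗ Z) ⊗≫ 𝟙 _ := by rw [Iso.inv_hom_id]; monoidal
    _ = _ := by rw [Iso.hom_inv_id]; monoidal

theorem crossAssocInv_comp {A₁ A₂ B₁ B₂ : C} (φ : A₂ ⊗ A₁ ≅ B₂ ⊗ B₁) (X Y Z : C) :
    crossAssocInv φ.inv X Y Z ≫ crossAssoc φ.hom X Y Z = 𝟙 _ := by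
  simp only [crossAssoc_eq, crossAssocInv_eq]
  calc
    _ = 𝟙 _ ⊗≫ B₂ ◁ (β_ X B₁).hom ▷ (Y ⊗ Z) ⊗≫ (φ.inv ≫ φ.hom) ▷ (X ⊗ Y ⊗ Z) ⊗≫
        B₂ ◁ (β_ X B₁).inv ▷ (Y ⊗ Z) ⊗≫ 𝟙 _ := by monoidal
    _ = 𝟙 _ ⊗≫ B₂ ◁ ((β_ X B₁).hom ≫ (β_ X B₁).inv) ▷ (Y ⊗ Z) ⊗≫ 𝟙 _ := by
      rw [Iso.inv_hom_id]; monoidal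
    _ = _ := by rw [Iso.hom_inv_id]; monoidal

theorem crossAssoc_naturality {A₁ A₂ B₁ B₂ : C} (φ : A₂ ⊗ A₁ ⟶ B₂ ⊗ B₁) {X X' Y Y' Z Z' : C}
    (a : X ⟶ X') (b : Y ⟶ Y') (c : Z ⟶ Z') :
    A₂ ◁ (A₁ ◁ (a ⊗ₘ b) ⊗ₘ c) ≫ crossAssoc φ X' Y' Z' =
      crossAssoc φ X Y Z ≫ B₂ ◁ (a ⊗ₘ B₁ ◁ (b ⊗ₘ c)) := by
  simp only [crossAssoc_eq, MonoidalCategory.tensorHom_def]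
  calc
    _ = 𝟙 _ ⊗≫ ((A₂ ⊗ A₁) ◁ (a ▷ (Y ⊗ Z) ≫ X' ◁ (b ▷ Z ≫ Y' ◁ c)) ≫ φ ▷ (X' ⊗ Y' ⊗ Z')) ⊗≫
        B₂ ◁ (β_ X' B₁).inv ▷ (Y' ⊗ Z') ⊗≫ 𝟙 _ := by monoidal
    _ = 𝟙 _ ⊗≫ φ ▷ (X ⊗ Y ⊗ Z) ⊗≫ B₂ ◁ B₁ ◁ a ▷ (Y ⊗ Z) ⊗≫
        B₂ ◁ ((B₁ ⊗ X') ◁ (b ▷ Z ≫ Y' ◁ c) ≫ (β_ X' B₁).inv ▷ (Y' ⊗ Z')) ⊗≫ 𝟙 _ := by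
      rw [whisker_exchange]; monoidal
    _ = 𝟙 _ ⊗≫ φ ▷ (X ⊗ Y ⊗ Z) ⊗≫ B₂ ◁ (B₁ ◁ a ≫ (β_ X' B₁).inv) ▷ (Y ⊗ Z) ⊗≫
        B₂ ◁ X' ◁ B₁ ◁ (b ▷ Z ≫ Y' ◁ c) ⊗≫ 𝟙 _ := by
      rw [whisker_exchange]; monoidal
    _ = _ := by rw [braiding_inv_naturality_right]; monoidal

/-- The braiding of `X` with `B₁ ⊗ (Y ⊗ Z)` contains the crossing of `X` and `B₁`, which cancels the
inverse crossing in the first associator. So no double braiding is left over and the coefficients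
only have to satisfy `h`. -/
theorem crossAssoc_hexagon {A₁ A₂ A' B₁ B₂ B' D₁ D₂ D' : C} (φ₁ : A₂ ⊗ A₁ ⟶ B₂ ⊗ B₁)
    (s : B₂ ⟶ B') (φ₂ : B' ⊗ B₁ ⟶ D₂ ⊗ D₁) (s₁ : A₁ ⟶ A') (φ₃ : A₂ ⊗ A' ⟶ D₂ ⊗ D')
    (s₂ : D' ⟶ D₁) (h : φ₁ ≫ s ▷ B₁ ≫ φ₂ = A₂ ◁ s₁ ≫ φ₃ ≫ D₂ ◁ s₂) (X Y Z : C) :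
    crossAssoc φ₁ X Y Z ≫ (s ⊗ₘ (β_ X (B₁ ⊗ (Y ⊗ Z))).hom) ≫ crossAssoc φ₂ Y Z X =
      A₂ ◁ ((s₁ ⊗ₘ (β_ X Y).hom) ▷ Z) ≫ crossAssoc φ₃ Y X Z ≫
        D₂ ◁ (Y ◁ (s₂ ⊗ₘ (β_ X Z).hom)) := by
  simp only [crossAssoc_eq, braiding_tensor_right_hom, MonoidalCategory.tensorHom_def]
  calc
    _ = 𝟙 _ ⊗≫ φ₁ ▷ (X ⊗ Y ⊗ Z) ⊗≫ B₂ ◁ (β_ X B₁).inv ▷ (Y ⊗ Z) ⊗≫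
        (s ▷ ((X ⊗ B₁) ⊗ Y ⊗ Z) ≫ B' ◁ ((β_ X B₁).hom ▷ (Y ⊗ Z))) ⊗≫
        B' ◁ B₁ ◁ ((β_ X Y).hom ▷ Z ⊗≫ Y ◁ (β_ X Z).hom) ⊗≫
        φ₂ ▷ (Y ⊗ Z ⊗ X) ⊗≫ D₂ ◁ (β_ Y D₁).inv ▷ (Z ⊗ X) ⊗≫ 𝟙 _ := by monoidal
    _ = 𝟙 _ ⊗≫ φ₁ ▷ (X ⊗ Y ⊗ Z) ⊗≫ B₂ ◁ ((β_ X B₁).inv ≫ (β_ X B₁).hom) ▷ (Y ⊗ Z) ⊗≫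
        s ▷ (B₁ ⊗ X ⊗ Y ⊗ Z) ⊗≫
        B' ◁ B₁ ◁ ((β_ X Y).hom ▷ Z ⊗≫ Y ◁ (β_ X Z).hom) ⊗≫
        φ₂ ▷ (Y ⊗ Z ⊗ X) ⊗≫ D₂ ◁ (β_ Y D₁).inv ▷ (Z ⊗ X) ⊗≫ 𝟙 _ := by
      rw [← whisker_exchange]; monoidal
    _ = 𝟙 _ ⊗≫ (φ₁ ≫ s ▷ B₁) ▷ (X ⊗ Y ⊗ Z) ⊗≫ ((B' ⊗ B₁) ◁ ((β_ X Y).hom ▷ Z ⊗≫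
        Y ◁ (β_ X Z).hom) ≫ φ₂ ▷ (Y ⊗ Z ⊗ X)) ⊗≫ D₂ ◁ (β_ Y D₁).inv ▷ (Z ⊗ X) ⊗≫ 𝟙 _ := by
      rw [Iso.inv_hom_id]; monoidal
    _ = 𝟙 _ ⊗≫ (φ₁ ≫ s ▷ B₁ ≫ φ₂) ▷ (X ⊗ Y ⊗ Z) ⊗≫ D₂ ◁ D₁ ◁ (β_ X Y).hom ▷ Z ⊗≫
        D₂ ◁ ((D₁ ⊗ Y) ◁ (β_ X Z).hom ≫ (β_ Y D₁).inv ▷ (Z ⊗ X)) ⊗≫ 𝟙 _ := by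
      rw [whisker_exchange]; monoidal
    _ = 𝟙 _ ⊗≫ (A₂ ◁ s₁ ≫ φ₃) ▷ (X ⊗ Y ⊗ Z) ⊗≫ D₂ ◁ (s₂ ▷ (X ⊗ Y ⊗ Z) ≫
        D₁ ◁ ((α_ X Y Z).inv ≫ (β_ X Y).hom ▷ Z ≫ (α_ Y X Z).hom)) ⊗≫
        D₂ ◁ (β_ Y D₁).inv ▷ (X ⊗ Z) ⊗≫ D₂ ◁ Y ◁ D₁ ◁ (β_ X Z).hom ⊗≫ 𝟙 _ := by
      rw [whisker_exchange, h]; monoidal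
    _ = 𝟙 _ ⊗≫ (A₂ ◁ s₁ ≫ φ₃) ▷ (X ⊗ Y ⊗ Z) ⊗≫ D₂ ◁ D' ◁ (β_ X Y).hom ▷ Z ⊗≫
        D₂ ◁ (s₂ ▷ Y ≫ (β_ Y D₁).inv) ▷ (X ⊗ Z) ⊗≫ D₂ ◁ Y ◁ D₁ ◁ (β_ X Z).hom ⊗≫ 𝟙 _ := by
      rw [← whisker_exchange]; monoidal
    _ = 𝟙 _ ⊗≫ A₂ ◁ s₁ ▷ (X ⊗ Y ⊗ Z) ⊗≫ (φ₃ ▷ (X ⊗ Y ⊗ Z) ≫ (D₂ ⊗ D') ◁ ((α_ X Y Z).inv ≫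
        (β_ X Y).hom ▷ Z ≫ (α_ Y X Z).hom)) ⊗≫ D₂ ◁ (β_ Y D').inv ▷ (X ⊗ Z) ⊗≫ D₂ ◁ Y ◁ (s₂ ▷ (X ⊗ Z) ≫ D₁ ◁ (β_ X Z).hom) ⊗≫ 𝟙 _ := by
      rw [braiding_inv_naturality_left]; monoidal
    _ = _ := by rw [← whisker_exchange]; monoidal

/-- Unlike in the other hexagon, the crossings do not cancel: `A₁` and `Z` cross once in the
braiding and once more in the same sense in the last associator. The double braiding that remains is
the scalar `d`. -/
theorem crossAssocInv_hexagon [Preadditive C] [Linear ℂ C] [MonoidalPreadditive C]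
    [MonoidalLinear ℂ C] {A₁ A₂ A' B₁ B₂ B' E₁ E₂ E' : C} (ψ₁ : B₂ ⊗ B₁ ⟶ A₂ ⊗ A₁)
    (s : A₂ ⟶ A') (ψ₂ : A' ⊗ A₁ ⟶ E₂ ⊗ E₁) (s₁ : B₁ ⟶ B') (ψ₃ : B₂ ⊗ B' ⟶ E₂ ⊗ E')
    (s₂ : E' ⟶ E₁) (h : ψ₁ ≫ s ▷ A₁ ≫ ψ₂ = B₂ ◁ s₁ ≫ ψ₃ ≫ E₂ ◁ s₂) (X Y Z : C) (d : ℂ)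
    (hd : doubleBraiding A₁ Z = d • 𝟙 (A₁ ⊗ Z)) :
    crossAssocInv ψ₁ X Y Z ≫ (s ⊗ₘ (β_ (A₁ ⊗ (X ⊗ Y)) Z).hom) ≫ crossAssocInv ψ₂ Z X Y =
      d • (B₂ ◁ (X ◁ (s₁ ⊗ₘ (β_ Y Z).hom)) ≫ crossAssocInv ψ₃ X Z Y ≫
        E₂ ◁ ((s₂ ⊗ₘ (β_ X Z).hom) ▷ Y)) := by
  have hd' : (β_ A₁ Z).hom ≫ (β_ Z A₁).hom = d • 𝟙 (A₁ ⊗ Z) := hd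
  simp only [crossAssocInv_eq, braiding_tensor_left_hom, MonoidalCategory.tensorHom_def]
  calc
    _ = 𝟙 _ ⊗≫ B₂ ◁ (β_ X B₁).hom ▷ (Y ⊗ Z) ⊗≫ ψ₁ ▷ (X ⊗ Y ⊗ Z) ⊗≫ s ▷ (A₁ ⊗ X ⊗ Y ⊗ Z) ⊗≫
        A' ◁ A₁ ◁ (X ◁ (β_ Y Z).hom ⊗≫ (β_ X Z).hom ▷ Y) ⊗≫
        A' ◁ ((β_ A₁ Z).hom ≫ (β_ Z A₁).hom) ▷ (X ⊗ Y) ⊗≫ ψ₂ ▷ (Z ⊗ X ⊗ Y) ⊗≫ 𝟙 _ := by monoidal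
    _ = d • (𝟙 _ ⊗≫ B₂ ◁ (β_ X B₁).hom ▷ (Y ⊗ Z) ⊗≫ (ψ₁ ≫ s ▷ A₁) ▷ (X ⊗ Y ⊗ Z) ⊗≫
        ((A' ⊗ A₁) ◁ (X ◁ (β_ Y Z).hom ⊗≫ (β_ X Z).hom ▷ Y ≫ (α_ _ _ _).hom) ≫ ψ₂ ▷ (Z ⊗ X ⊗ Y)) ⊗≫
          𝟙 _) := by
      rw [hd', MonoidalLinear.smul_whiskerRight, MonoidalLinear.whiskerLeft_smul]
      simp only [monoidalComp, Linear.comp_smul, Linear.smul_comp]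
      congr 1
      change _ = 𝟙 _ ⊗≫ B₂ ◁ (β_ X B₁).hom ▷ (Y ⊗ Z) ⊗≫ (ψ₁ ≫ s ▷ A₁) ▷ (X ⊗ Y ⊗ Z) ⊗≫
        ((A' ⊗ A₁) ◁ (X ◁ (β_ Y Z).hom ⊗≫ (β_ X Z).hom ▷ Y ≫ (α_ _ _ _).hom) ≫ ψ₂ ▷ (Z ⊗ X ⊗ Y)) ⊗≫ 𝟙 _
      monoidal
    _ = d • (𝟙 _ ⊗≫ B₂ ◁ (β_ X B₁).hom ▷ (Y ⊗ Z) ⊗≫ (ψ₁ ≫ s ▷ A₁ ≫ ψ₂) ▷ (X ⊗ Y ⊗ Z) ⊗≫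
        (E₂ ⊗ E₁) ◁ (X ◁ (β_ Y Z).hom ⊗≫ (β_ X Z).hom ▷ Y ≫ (α_ _ _ _).hom) ⊗≫ 𝟙 _) := by
      rw [whisker_exchange]; congr 1; monoidal
    _ = d • (𝟙 _ ⊗≫ B₂ ◁ ((β_ X B₁).hom ≫ s₁ ▷ X) ▷ (Y ⊗ Z) ⊗≫
        (ψ₃ ▷ (X ⊗ Y ⊗ Z) ≫ (E₂ ⊗ E') ◁ (X ◁ (β_ Y Z).hom)) ⊗≫
        E₂ ◁ (s₂ ▷ (X ⊗ Z ⊗ Y) ≫ E₁ ◁ ((α_ _ _ _).inv ≫ (β_ X Z).hom ▷ Y)) ⊗≫ 𝟙 _) := by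
      have := whisker_exchange s₂ (X ◁ (β_ Y Z).hom)
      congr 1
      calc
        _ = 𝟙 _ ⊗≫ B₂ ◁ ((β_ X B₁).hom ≫ s₁ ▷ X) ▷ (Y ⊗ Z) ⊗≫
          ψ₃ ▷ (X ⊗ Y ⊗ Z) ⊗≫ E₂ ◁ (s₂ ▷ (X ⊗ Y ⊗ Z) ≫ E₁ ◁ (X ◁ (β_ Y Z).hom)) ⊗≫
          E₂ ◁ E₁ ◁ (β_ X Z).hom ▷ Y ⊗≫ 𝟙 _ := by rw [h]; monoidal
        _ = _ := by rw [← this]; monoidal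
    _ = d • (𝟙 _ ⊗≫ B₂ ◁ X ◁ s₁ ▷ (Y ⊗ Z) ⊗≫
        B₂ ◁ ((β_ X B').hom ▷ (Y ⊗ Z) ≫ (B' ⊗ X) ◁ (β_ Y Z).hom) ⊗≫ ψ₃ ▷ (X ⊗ Z ⊗ Y) ⊗≫
        E₂ ◁ (s₂ ▷ (X ⊗ Z) ≫ E₁ ◁ (β_ X Z).hom) ▷ Y ⊗≫ 𝟙 _) := by
      rw [← braiding_naturality_right, ← whisker_exchange]; congr 1; monoidal
    _ = _ := by
      rw [← whisker_exchange]; congr 1; monoidal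

end Geometry

end

/-! ### Parities, and the zested tensor product of homogeneous objects. -/

section

open BraidedCategory
set_option linter.unusedSectionVars false
set_option linter.unnecessarySeqFocus false

section Graded

variable {C : Type u} [Category.{v} C] [Preadditive C] [Linear ℂ C] [MonoidalCategory C]
  [MonoidalPreadditive C] [MonoidalLinear ℂ C] [BraidedCategory C]

/-- An invertible object of order two with fermionic self-braiding. -/
class SelfFermionic (f : C) : Prop where
  square : Nonempty (f ⊗ f ≅ 𝟙_ C)
  braiding : (β_ f f).hom = -𝟙 (f ⊗ f)

theorem SelfFermionic.doubleBraiding (f : C) [SelfFermionic f] :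
    doubleBraiding f f = 𝟙 (f ⊗ f) := by
  simp [FermionicZesting.doubleBraiding, SelfFermionic.braiding]

theorem SelfFermionic.braiding_inv (f : C) [SelfFermionic f] :
    (β_ f f).inv = -𝟙 (f ⊗ f) := by
  rw [← cancel_epi (β_ f f).hom, Iso.hom_inv_id, SelfFermionic.braiding]; simp

theorem whiskerRight_fermion_injective (f : C) [SelfFermionic f] {X Y : C} {g h : X ⟶ Y}
    (e : g ▷ f = h ▷ f) : g = h := by
  obtain ⟨t⟩ := SelfFermionic.square (f := f)
  have e' : g ▷ (f ⊗ f) = h ▷ (f ⊗ f) := by simp [whiskerRight_tensor, e]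
  have e'' : g ▷ 𝟙_ C = h ▷ 𝟙_ C := by
    rw [← cancel_epi (X ◁ t.hom), whisker_exchange, whisker_exchange, e']
  simpa using e''

theorem whiskerLeft_fermion_injective (f : C) [SelfFermionic f] {X Y : C} {g h : X ⟶ Y}
    (e : f ◁ g = f ◁ h) : g = h := by
  obtain ⟨t⟩ := SelfFermionic.square (f := f)
  have e' : (f ⊗ f) ◁ g = (f ⊗ f) ◁ h := by simp [tensor_whiskerLeft, e]
  have e'' : 𝟙_ C ◁ g = 𝟙_ C ◁ h := by
    rw [← cancel_epi (t.hom ▷ X), ← whisker_exchange, ← whisker_exchange, e']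
  simpa using e''

/-- The sign by which an object of degree `σ` braids with the fermion. -/
def pSign (σ : Bool) : ℂ := if σ then -1 else 1

theorem hasParity_iff {f : C} {σ : Bool} {X : C} :
    HasParity f σ X ↔ doubleBraiding X f = pSign σ • 𝟙 (X ⊗ f) := by
  cases σ <;> simp [HasParity, pSign]

theorem doubleBraiding_swap {X Y : C} {z : ℂ} (h : doubleBraiding X Y = z • 𝟙 (X ⊗ Y)) :
    doubleBraiding Y X = z • 𝟙 (Y ⊗ X) := by
  rw [← cancel_epi (β_ X Y).hom]
  have : (β_ X Y).hom ≫ doubleBraiding Y X = doubleBraiding X Y ≫ (β_ X Y).hom := by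
    simp [doubleBraiding]
  rw [this, h]; simp

theorem doubleBraiding_naturality_left {X X' : C} (g : X ⟶ X') (Y : C) :
    g ▷ Y ≫ doubleBraiding X' Y = doubleBraiding X Y ≫ g ▷ Y := by
  simp [doubleBraiding]

/-- There are no nonzero morphisms between homogeneous objects of different degrees. -/
theorem HasParity.hom_eq_zero {f : C} [SelfFermionic f] {σ τ : Bool} {X Y : C}
    (hX : HasParity f σ X) (hY : HasParity f τ Y) (h : σ ≠ τ) (g : X ⟶ Y) : g = 0 := by
  apply whiskerRight_fermion_injective f
  have := doubleBraiding_naturality_left g f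
  rw [hasParity_iff.1 hX, hasParity_iff.1 hY, Linear.comp_smul, Linear.smul_comp, id_comp, comp_id,
    ← sub_eq_zero, ← sub_smul] at this
  -- Naturality of the double braiding with `f` makes this difference of signs annihilate `g ▷ f`.
  have hz : pSign τ - pSign σ ≠ 0 := by
    cases σ <;> cases τ <;> simp [pSign] at h ⊢ <;> norm_num
  rw [(smul_eq_zero.1 this).resolve_left hz]; simp

theorem HasParity.of_iso {f : C} {σ : Bool} {X Y : C} (hX : HasParity f σ X) (e : X ≅ Y) :
    HasParity f σ Y := by
  rw [hasParity_iff] at *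
  rw [← cancel_epi (e.hom ▷ f), doubleBraiding_naturality_left, hX]; simp

variable (C) in
/-- Homogeneous objects together with their degree; morphisms are those of `C`. -/
structure Homog (f : C) where
  obj : C
  deg : Bool
  parity : HasParity f deg obj

/-- Homogeneous objects, with the zested tensor product. -/
structure Zest (f : C) extends Homog C f

instance (f : C) : Category.{v} (Zest f) where
  Hom X Y := X.obj ⟶ Y.obj
  id X := 𝟙 X.obj
  comp g h := g ≫ h

instance (f : C) : Category.{v} (Homog C f) where
  Hom X Y := X.obj ⟶ Y.obj
  id X := 𝟙 X.obj
  comp g h := g ≫ h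

/-- The canonical map between two values of `α`: the identity or zero. -/
def zAlphaMap (f : C) (σ τ σ' τ' : Bool) : zAlpha f σ τ ⟶ zAlpha f σ' τ' :=
  if h : σ = σ' ∧ τ = τ' then eqToHom (by rw [h.1, h.2]) else 0

@[simp]
theorem zAlphaMap_self (f : C) (σ τ : Bool) : zAlphaMap f σ τ σ τ = 𝟙 _ := by simp [zAlphaMap]

theorem zW_ne_zero (σ τ ρ : Bool) : zW σ τ ρ ≠ 0 := by
  cases σ <;> cases τ <;> cases ρ <;> simp [zW]

theorem zB_ne_zero (σ τ : Bool) : zB σ τ ≠ 0 := by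
  cases σ <;> cases τ <;> simp [zB]

theorem zB_mul_self : zB true true * zB true true = Complex.I := by
  rw [zB, if_pos (by rfl), ← Complex.exp_add,
    show (Real.pi * Complex.I / 4 + Real.pi * Complex.I / 4 : ℂ) = Real.pi / 2 * Complex.I by ring,
    Complex.exp_pi_div_two_mul_I]

/-- A nonzero multiple of an isomorphism. -/
@[simps]
def smulIso {X Y : C} (z : ℂ) (hz : z ≠ 0) (e : X ≅ Y) : X ≅ Y where
  hom := z • e.hom
  inv := z⁻¹ • e.inv
  hom_inv_id := by simp [smul_smul, hz]
  inv_hom_id := by simp [smul_smul, hz]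

/-- `crossAssoc` as an isomorphism. -/
@[simps]
def crossAssocIso {A₁ A₂ B₁ B₂ : C} (φ : A₂ ⊗ A₁ ≅ B₂ ⊗ B₁) (X Y Z : C) :
    A₂ ⊗ ((A₁ ⊗ (X ⊗ Y)) ⊗ Z) ≅ B₂ ⊗ (X ⊗ (B₁ ⊗ (Y ⊗ Z))) where
  hom := crossAssoc φ.hom X Y Z
  inv := crossAssocInv φ.inv X Y Z
  hom_inv_id := crossAssoc_comp_inv φ X Y Z
  inv_hom_id := crossAssocInv_comp φ X Y Z

/-- The zested associator as an isomorphism. -/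
def zAssocIso (f : C) (σ τ ρ : Bool) (X Y Z : C) :
    zAlpha f (xor σ τ) ρ ⊗ ((zAlpha f σ τ ⊗ (X ⊗ Y)) ⊗ Z) ≅
      zAlpha f σ (xor τ ρ) ⊗ (X ⊗ (zAlpha f τ ρ ⊗ (Y ⊗ Z))) :=
  smulIso _ (zW_ne_zero σ τ ρ) (crossAssocIso (zCocycle f σ τ ρ) X Y Z)

/-- The zested braiding as an isomorphism. -/
def zBraidingIso (f : C) (σ τ : Bool) (X Y : C) :
    zAlpha f σ τ ⊗ (X ⊗ Y) ≅ zAlpha f τ σ ⊗ (Y ⊗ X) :=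
  smulIso _ (zB_ne_zero σ τ) (zSymm f σ τ ⊗ᵢ β_ X Y)

/-- The zested left unit constraint as an isomorphism. -/
def zLeftUnitorIso (f : C) (τ : Bool) (X : C) : zAlpha f false τ ⊗ (𝟙_ C ⊗ X) ≅ X :=
  (zAlphaLeft f τ ⊗ᵢ λ_ X) ≪≫ λ_ X

/-- The zested right unit constraint as an isomorphism. -/
def zRightUnitorIso (f : C) (σ : Bool) (X : C) : zAlpha f σ false ⊗ (X ⊗ 𝟙_ C) ≅ X :=
  (zAlphaRight f σ ⊗ᵢ ρ_ X) ≪≫ λ_ X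

/-- Here and in the two variants below, the identity between scalars is separated from the identity
between coefficients. Identities are written with `⊗ₘ` instead of whiskerings because this is what
tensor products in `Zest` unfold to. -/
theorem crossAssoc_pentagon_smul {A₁ A₂ A₃ B₁ B₂ E G H I M : C}
    (φ₁ : A₂ ⊗ A₁ ⟶ B₂ ⊗ B₁) (φ₂ : A₃ ⊗ B₂ ⟶ E ⊗ G) (φ₃ : G ⊗ B₁ ⟶ H ⊗ I)
    (φ₄ : A₃ ⊗ A₂ ⟶ M ⊗ I) (φ₅ : M ⊗ A₁ ⟶ E ⊗ H) (w₁ w₂ w₃ w₄ w₅ z : ℂ)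
    (hz : w₁ * w₂ * w₃ * z = w₄ * w₅)
    (h : A₃ ◁ φ₁ ≫ (α_ _ _ _).inv ≫ φ₂ ▷ B₁ ≫ (α_ _ _ _).hom ≫ E ◁ φ₃ =
      z • ((α_ _ _ _).inv ≫ φ₄ ▷ A₁ ≫ (α_ _ _ _).hom ≫ M ◁ (β_ A₁ I).inv ≫
        (α_ _ _ _).inv ≫ φ₅ ▷ I ≫ (α_ _ _ _).hom)) (X Y Z W : C) :
    (𝟙 A₃ ⊗ₘ ((w₁ • crossAssoc φ₁ X Y Z) ⊗ₘ 𝟙 W)) ≫ (w₂ • crossAssoc φ₂ X (B₁ ⊗ (Y ⊗ Z)) W) ≫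
        (𝟙 E ⊗ₘ (𝟙 X ⊗ₘ (w₃ • crossAssoc φ₃ Y Z W))) =
      (w₄ • crossAssoc φ₄ (A₁ ⊗ (X ⊗ Y)) Z W) ≫ (w₅ • crossAssoc φ₅ X Y (I ⊗ (Z ⊗ W))) := by
  simp only [id_tensorHom, tensorHom_id, MonoidalLinear.smul_whiskerRight,
    MonoidalLinear.whiskerLeft_smul, Linear.comp_smul, Linear.smul_comp, smul_smul,
    crossAssoc_pentagon φ₁ φ₂ φ₃ φ₄ φ₅ z h]
  congr 1
  linear_combination hz

theorem crossAssoc_hexagon_smul {A₁ A₂ A' B₁ B₂ B' D₁ D₂ D' : C} (φ₁ : A₂ ⊗ A₁ ⟶ B₂ ⊗ B₁)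
    (s : B₂ ⟶ B') (φ₂ : B' ⊗ B₁ ⟶ D₂ ⊗ D₁) (s₁ : A₁ ⟶ A') (φ₃ : A₂ ⊗ A' ⟶ D₂ ⊗ D')
    (s₂ : D' ⟶ D₁) (w₁ w₂ w₃ w₄ w₅ w₆ : ℂ) (hz : w₁ * w₂ * w₃ = w₄ * w₅ * w₆)
    (h : φ₁ ≫ s ▷ B₁ ≫ φ₂ = A₂ ◁ s₁ ≫ φ₃ ≫ D₂ ◁ s₂) (X Y Z : C) :
    (w₁ • crossAssoc φ₁ X Y Z) ≫ (w₂ • (s ⊗ₘ (β_ X (B₁ ⊗ (Y ⊗ Z))).hom)) ≫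
        (w₃ • crossAssoc φ₂ Y Z X) =
      (𝟙 A₂ ⊗ₘ ((w₄ • (s₁ ⊗ₘ (β_ X Y).hom)) ⊗ₘ 𝟙 Z)) ≫ (w₅ • crossAssoc φ₃ Y X Z) ≫
        (𝟙 D₂ ⊗ₘ (𝟙 Y ⊗ₘ (w₆ • (s₂ ⊗ₘ (β_ X Z).hom)))) := by
  simp only [id_tensorHom, tensorHom_id, MonoidalLinear.smul_whiskerRight,
    MonoidalLinear.whiskerLeft_smul, Linear.comp_smul, Linear.smul_comp, smul_smul,
    crossAssoc_hexagon φ₁ s φ₂ s₁ φ₃ s₂ h]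
  congr 1
  linear_combination hz

theorem crossAssocInv_hexagon_smul {A₁ A₂ A' B₁ B₂ B' E₁ E₂ E' : C} (ψ₁ : B₂ ⊗ B₁ ⟶ A₂ ⊗ A₁)
    (s : A₂ ⟶ A') (ψ₂ : A' ⊗ A₁ ⟶ E₂ ⊗ E₁) (s₁ : B₁ ⟶ B') (ψ₃ : B₂ ⊗ B' ⟶ E₂ ⊗ E')
    (s₂ : E' ⟶ E₁) (w₁ w₂ w₃ w₄ w₅ w₆ d : ℂ) (hz : w₁ * w₂ * w₃ * d = w₄ * w₅ * w₆)
    (h : ψ₁ ≫ s ▷ A₁ ≫ ψ₂ = B₂ ◁ s₁ ≫ ψ₃ ≫ E₂ ◁ s₂) (X Y Z : C)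
    (hd : doubleBraiding A₁ Z = d • 𝟙 (A₁ ⊗ Z)) :
    (w₁ • crossAssocInv ψ₁ X Y Z) ≫ (w₂ • (s ⊗ₘ (β_ (A₁ ⊗ (X ⊗ Y)) Z).hom)) ≫
        (w₃ • crossAssocInv ψ₂ Z X Y) =
      (𝟙 B₂ ⊗ₘ (𝟙 X ⊗ₘ (w₄ • (s₁ ⊗ₘ (β_ Y Z).hom)))) ≫ (w₅ • crossAssocInv ψ₃ X Z Y) ≫
        (𝟙 E₂ ⊗ₘ ((w₆ • (s₂ ⊗ₘ (β_ X Z).hom)) ⊗ₘ 𝟙 Y)) := by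
  simp only [id_tensorHom, tensorHom_id, MonoidalLinear.smul_whiskerRight,
    MonoidalLinear.whiskerLeft_smul, Linear.comp_smul, Linear.smul_comp, smul_smul,
    crossAssocInv_hexagon ψ₁ s ψ₂ s₁ ψ₃ s₂ h X Y Z d hd]
  congr 1
  linear_combination hz

namespace Zest

variable {f : C} [SelfFermionic f]

theorem hom_eq_zero {X Y : Zest f} (h : X.deg ≠ Y.deg) (g : X.obj ⟶ Y.obj) : g = 0 :=
  X.parity.hom_eq_zero Y.parity h g

/-- Isomorphisms of the underlying objects. -/
@[simps]
def mkIso {X Y : Zest f} (e : X.obj ≅ Y.obj) : X ≅ Y where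
  hom := e.hom
  inv := e.inv
  hom_inv_id := e.hom_inv_id
  inv_hom_id := e.inv_hom_id

/-- The zested tensor product of objects. -/
abbrev tObj (X Y : Zest f) : Zest f where
  obj := zAlpha f X.deg Y.deg ⊗ (X.obj ⊗ Y.obj)
  deg := xor X.deg Y.deg
  parity := X.parity.zTensor (SelfFermionic.doubleBraiding f) Y.parity

/-- The zested tensor product of morphisms. -/
def tHom {X X' Y Y' : Zest f} (g : X.obj ⟶ X'.obj) (h : Y.obj ⟶ Y'.obj) :
    zAlpha f X.deg Y.deg ⊗ (X.obj ⊗ Y.obj) ⟶ zAlpha f X'.deg Y'.deg ⊗ (X'.obj ⊗ Y'.obj) :=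
  zAlphaMap f X.deg Y.deg X'.deg Y'.deg ⊗ₘ (g ⊗ₘ h)

theorem tHom_zero_left {X X' Y Y' : Zest f} (h : Y.obj ⟶ Y'.obj) :
    tHom (0 : X.obj ⟶ X'.obj) h = 0 := by
  simp [tHom]

theorem tHom_zero_right {X X' Y Y' : Zest f} (h : X.obj ⟶ X'.obj) :
    tHom h (0 : Y.obj ⟶ Y'.obj) = 0 := by
  simp [tHom]

@[simp]
theorem tHom_id (X Y : Zest f) : tHom (𝟙 X.obj) (𝟙 Y.obj) = 𝟙 (zAlpha f X.deg Y.deg ⊗ (X.obj ⊗ Y.obj)) := by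
  simp [tHom]

/-- If some morphism relates different degrees, it is zero and both sides vanish. Otherwise the
degrees may be identified, and the maps between the values of α are identities. The naturality
statements below rest on the same distinction. -/
theorem tHom_comp {X X' X'' Y Y' Y'' : Zest f} (g : X.obj ⟶ X'.obj) (g' : X'.obj ⟶ X''.obj)
    (h : Y.obj ⟶ Y'.obj) (h' : Y'.obj ⟶ Y''.obj) :
    tHom g h ≫ tHom g' h' = tHom (g ≫ g') (h ≫ h') := by
  by_cases h1 : X.deg = X'.deg
  swap; · simp [hom_eq_zero h1 g, tHom_zero_left]
  by_cases h2 : X'.deg = X''.deg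
  swap; · simp [hom_eq_zero h2 g', tHom_zero_left]
  by_cases h3 : Y.deg = Y'.deg
  swap; · simp [hom_eq_zero h3 h, tHom_zero_right]
  by_cases h4 : Y'.deg = Y''.deg
  swap; · simp [hom_eq_zero h4 h', tHom_zero_right]
  obtain ⟨⟨X, σ, hX⟩⟩ := X
  obtain ⟨⟨X', σ', hX'⟩⟩ := X'
  obtain ⟨⟨X'', σ'', hX''⟩⟩ := X''
  obtain ⟨⟨Y, τ, hY⟩⟩ := Y
  obtain ⟨⟨Y', τ', hY'⟩⟩ := Y'
  obtain ⟨⟨Y'', τ'', hY''⟩⟩ := Y''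
  dsimp only at *
  subst h1 h2 h3 h4
  simp only [tHom, zAlphaMap_self]
  rw [tensorHom_comp_tensorHom, tensorHom_comp_tensorHom, id_comp]

instance : MonoidalCategoryStruct (Zest f) where
  tensorObj := tObj
  tensorHom g h := tHom g h
  whiskerLeft X _ _ g := tHom (𝟙 X.obj) g
  whiskerRight g Y := tHom g (𝟙 Y.obj)
  tensorUnit := ⟨⟨𝟙_ C, false, hasParity_unit f⟩⟩
  associator X Y Z := mkIso (zAssocIso f X.deg Y.deg Z.deg X.obj Y.obj Z.obj)
  leftUnitor X := mkIso (zLeftUnitorIso f X.deg X.obj)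
  -- Morphisms ignore the recorded degree, so it does no harm that `xor X.deg false` is not
  -- syntactically `X.deg`.
  rightUnitor X := mkIso
    (Y := X) (X := tObj X ⟨⟨𝟙_ C, false, hasParity_unit f⟩⟩) (zRightUnitorIso f X.deg X.obj)

theorem associator_naturality {X X' Y Y' Z Z' : Zest f} (a : X.obj ⟶ X'.obj) (b : Y.obj ⟶ Y'.obj)
    (c : Z.obj ⟶ Z'.obj) :
    tHom (X := tObj X Y) (X' := tObj X' Y') (tHom a b) c ≫
        (zAssocIso f X'.deg Y'.deg Z'.deg X'.obj Y'.obj Z'.obj).hom =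
      (zAssocIso f X.deg Y.deg Z.deg X.obj Y.obj Z.obj).hom ≫
        tHom (Y := tObj Y Z) (Y' := tObj Y' Z') a (tHom b c) := by
  by_cases h1 : X.deg = X'.deg
  swap
  · rw [hom_eq_zero h1 a, tHom_zero_left, tHom_zero_left, tHom_zero_left, zero_comp, comp_zero]
  by_cases h2 : Y.deg = Y'.deg
  swap
  · rw [hom_eq_zero h2 b, tHom_zero_right, tHom_zero_left, tHom_zero_left, tHom_zero_right,
      zero_comp, comp_zero]
  by_cases h3 : Z.deg = Z'.deg
  swap
  · rw [hom_eq_zero h3 c, tHom_zero_right, tHom_zero_right, tHom_zero_right,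
      zero_comp, comp_zero]
  obtain ⟨⟨X, σ, hX⟩⟩ := X
  obtain ⟨⟨X', σ', hX'⟩⟩ := X'
  obtain ⟨⟨Y, τ, hY⟩⟩ := Y
  obtain ⟨⟨Y', τ', hY'⟩⟩ := Y'
  obtain ⟨⟨Z, ρ, hZ⟩⟩ := Z
  obtain ⟨⟨Z', ρ', hZ'⟩⟩ := Z'
  dsimp only at h1 h2 h3 a b c
  subst h1 h2 h3
  have := crossAssoc_naturality (zCocycle f σ τ ρ).hom a b c
  simp only [tHom, tObj, zAlphaMap_self, zAssocIso, smulIso, crossAssocIso, id_tensorHom,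
    Linear.comp_smul, Linear.smul_comp, this]

end Zest

end Graded

end

/-! ### Pentagon, triangle and hexagons of the zesting, degree by degree. -/

section

open BraidedCategory
set_option linter.unusedSectionVars false
set_option linter.unusedSimpArgs false

section Graded

variable {C : Type u} [Category.{v} C] [Preadditive C] [Linear ℂ C] [MonoidalCategory C]
  [MonoidalPreadditive C] [MonoidalLinear ℂ C] [BraidedCategory C]

theorem xor_false_false : (false ^^ false) = false := rfl
theorem xor_false_true : (false ^^ true) = true := rfl
theorem xor_true_false : (true ^^ false) = true := rfl
theorem xor_true_true : (true ^^ true) = false := rfl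

/-- The cocycle condition, up to a scalar, that makes `crossAssoc` satisfy the pentagon. -/
def PentagonCocycle {A₁ A₂ A₃ B₁ B₂ E G H I M : C}
    (φ₁ : A₂ ⊗ A₁ ⟶ B₂ ⊗ B₁) (φ₂ : A₃ ⊗ B₂ ⟶ E ⊗ G) (φ₃ : G ⊗ B₁ ⟶ H ⊗ I)
    (φ₄ : A₃ ⊗ A₂ ⟶ M ⊗ I) (φ₅ : M ⊗ A₁ ⟶ E ⊗ H) (z : ℂ) : Prop :=
  A₃ ◁ φ₁ ≫ (α_ _ _ _).inv ≫ φ₂ ▷ B₁ ≫ (α_ _ _ _).hom ≫ E ◁ φ₃ =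
      z • ((α_ _ _ _).inv ≫ φ₄ ▷ A₁ ≫ (α_ _ _ _).hom ≫ M ◁ (β_ A₁ I).inv ≫
        (α_ _ _ _).inv ≫ φ₅ ▷ I ≫ (α_ _ _ _).hom)

/-- The compatibility of the cocycle with the symmetry that makes `crossAssoc` satisfy the
hexagons. -/
def HexagonCocycle {A₁ A₂ A' B₁ B₂ B' D₁ D₂ D' : C} (φ₁ : A₂ ⊗ A₁ ⟶ B₂ ⊗ B₁)
    (s : B₂ ⟶ B') (φ₂ : B' ⊗ B₁ ⟶ D₂ ⊗ D₁) (s₁ : A₁ ⟶ A') (φ₃ : A₂ ⊗ A' ⟶ D₂ ⊗ D')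
    (s₂ : D' ⟶ D₁) : Prop :=
  φ₁ ≫ s ▷ B₁ ≫ φ₂ = A₂ ◁ s₁ ≫ φ₃ ≫ D₂ ◁ s₂

theorem tensorHom_smul {X X' Y Y' : C} (g : X ⟶ X') (h : Y ⟶ Y') (z : ℂ) :
    g ⊗ₘ (z • h) = z • (g ⊗ₘ h) := by
  simp [MonoidalCategory.tensorHom_def]

theorem smul_tensorHom {X X' Y Y' : C} (g : X ⟶ X') (h : Y ⟶ Y') (z : ℂ) :
    (z • g) ⊗ₘ h = z • (g ⊗ₘ h) := by
  simp [MonoidalCategory.tensorHom_def]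

namespace Zest

variable {f : C} [SelfFermionic f]

/-- Two fermions cross only if α takes the value `f` both on the first two and on the last two
degrees, that is, if all four are odd. The resulting -1 is balanced by the two factors w(1,1,1) = i
on the left; in all other cases both scalars are 1. -/
theorem pentagon (W X Y Z : Zest f) : tHom (X := tObj (tObj W X) Y) (X' := tObj W (tObj X Y)) (zAssocIso f W.deg X.deg Y.deg W.obj X.obj Y.obj).hom (𝟙 Z.obj) ≫
      (zAssocIso f W.deg (xor X.deg Y.deg) Z.deg W.obj _ Z.obj).hom ≫
      tHom (Y := tObj (tObj X Y) Z) (Y' := tObj X (tObj Y Z)) (𝟙 W.obj) (zAssocIso f X.deg Y.deg Z.deg X.obj Y.obj Z.obj).hom =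
    (zAssocIso f (xor W.deg X.deg) Y.deg Z.deg _ Y.obj Z.obj).hom ≫
      (zAssocIso f W.deg X.deg (xor Y.deg Z.deg) W.obj X.obj _).hom := by
  obtain ⟨⟨W, σ, hW⟩⟩ := W
  obtain ⟨⟨X, τ, hX⟩⟩ := X
  obtain ⟨⟨Y, ρ, hY⟩⟩ := Y
  obtain ⟨⟨Z, κ, hZ⟩⟩ := Z
  cases σ <;> cases τ <;> cases ρ <;> cases κ
  case true.true.true.true =>
    dsimp only [tHom, tObj, zAssocIso, smulIso, crossAssocIso]
    erw [zAlphaMap_self]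
    refine crossAssoc_pentagon_smul _ _ _ _ _ _ _ _ _ _ (-1) ?_ ?_ _ _ _ _
    · simp [zW]
    · change PentagonCocycle _ _ _ _ _ _
      dsimp only [zCocycle, zAlpha, Iso.refl_hom, Iso.trans_hom, Iso.symm_hom, xor_false_false, xor_false_true, xor_true_false, xor_true_true]
      simp [PentagonCocycle, SelfFermionic.braiding_inv]
      try monoidal
  all_goals
    dsimp only [tHom, tObj, zAssocIso, smulIso, crossAssocIso]
    erw [zAlphaMap_self]
    try erw [zAlphaMap_self]
    refine crossAssoc_pentagon_smul _ _ _ _ _ _ _ _ _ _ 1 ?_ ?_ _ _ _ _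
    · simp [zW]
    · change PentagonCocycle _ _ _ _ _ _
      dsimp only [zCocycle, zAlpha, Iso.refl_hom, Iso.trans_hom, Iso.symm_hom, xor_false_false, xor_false_true, xor_true_false, xor_true_true]
      simp [PentagonCocycle, braiding_inv_tensorUnit_left,braiding_inv_tensorUnit_right]
      try monoidal


theorem triangle (X Y : Zest f) :
    (zAssocIso f X.deg false Y.deg X.obj (𝟙_ C) Y.obj).hom ≫
      tHom (Y := tObj ⟨⟨𝟙_ C, false, hasParity_unit f⟩⟩ Y) (𝟙 X.obj) (zLeftUnitorIso f Y.deg Y.obj).hom =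
    tHom (X := tObj X ⟨⟨𝟙_ C, false, hasParity_unit f⟩⟩) (X' := X) (zRightUnitorIso f X.deg X.obj).hom (𝟙 Y.obj) := by
  obtain ⟨⟨X, σ, hX⟩⟩ := X
  obtain ⟨⟨Y, τ, hY⟩⟩ := Y
  have key : ∀ (A : C) (φ : A ⊗ 𝟙_ C ⟶ A ⊗ 𝟙_ C), φ = 𝟙 _ → crossAssoc φ X (𝟙_ C) Y ≫ (𝟙 A ⊗ₘ (𝟙 X ⊗ₘ ((𝟙 (𝟙_ C) ⊗ₘ (λ_ Y).hom) ≫ (λ_ Y).hom))) = 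
    𝟙 A ⊗ₘ (((𝟙 (𝟙_ C) ⊗ₘ (ρ_ X).hom) ≫ (λ_ X).hom) ⊗ₘ 𝟙 Y) := by
    rintro A φ rfl
    simp only [crossAssoc, braiding_inv_tensorUnit_right, MonoidalCategory.tensorHom_def]
    monoidal
  cases σ <;> cases τ <;>
  · dsimp only [tHom, tObj, zAssocIso, smulIso, crossAssocIso]
    erw [zAlphaMap_self]
    try erw [zAlphaMap_self]
    rw [zW, if_neg (by decide), one_smul]
    exact key _ _ rfl

theorem leftUnitor_naturality {X Y : Zest f} (g : X.obj ⟶ Y.obj) :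
    tHom (X := ⟨⟨𝟙_ C, false, hasParity_unit f⟩⟩) (X' := ⟨⟨𝟙_ C, false, hasParity_unit f⟩⟩)
      (𝟙 (𝟙_ C)) g ≫ (zLeftUnitorIso f Y.deg Y.obj).hom =
      (zLeftUnitorIso f X.deg X.obj).hom ≫ g := by
  by_cases h1 : X.deg = Y.deg
  swap
  · rw [hom_eq_zero h1 g, tHom_zero_right, zero_comp, comp_zero]
  obtain ⟨⟨X, σ, hX⟩⟩ := X
  obtain ⟨⟨Y, τ, hY⟩⟩ := Y
  dsimp only at h1 g
  subst h1
  simp only [tHom, zAlphaMap_self, zLeftUnitorIso, Iso.trans_hom, tensorIso_hom]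
  rw [assoc, ← MonoidalCategory.leftUnitor_naturality, ← id_tensorHom, tensorHom_comp_tensorHom_assoc,
    tensorHom_comp_tensorHom_assoc]
  simp

theorem rightUnitor_naturality {X Y : Zest f} (g : X.obj ⟶ Y.obj) :
    tHom (Y := ⟨⟨𝟙_ C, false, hasParity_unit f⟩⟩) (Y' := ⟨⟨𝟙_ C, false, hasParity_unit f⟩⟩)
      g (𝟙 (𝟙_ C)) ≫ (zRightUnitorIso f Y.deg Y.obj).hom =
      (zRightUnitorIso f X.deg X.obj).hom ≫ g := by
  by_cases h1 : X.deg = Y.deg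
  swap
  · rw [hom_eq_zero h1 g, tHom_zero_left, zero_comp, comp_zero]
  obtain ⟨⟨X, σ, hX⟩⟩ := X
  obtain ⟨⟨Y, τ, hY⟩⟩ := Y
  dsimp only at h1 g
  subst h1
  simp only [tHom, zAlphaMap_self, zRightUnitorIso, Iso.trans_hom, tensorIso_hom]
  rw [assoc, ← MonoidalCategory.leftUnitor_naturality, ← id_tensorHom, tensorHom_comp_tensorHom_assoc,
    tensorHom_comp_tensorHom_assoc]
  simp

instance : MonoidalCategory (Zest f) :=
  MonoidalCategory.ofTensorHom
    (id_tensorHom_id := fun X Y => tHom_id X Y)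
    (id_tensorHom := fun _ _ _ _ => rfl)
    (tensorHom_id := fun _ _ => rfl)
    (tensorHom_comp_tensorHom := fun _ _ _ _ => tHom_comp _ _ _ _)
    (associator_naturality := fun a b c => associator_naturality a b c)
    (leftUnitor_naturality := fun g => leftUnitor_naturality g)
    (rightUnitor_naturality := fun g => rightUnitor_naturality g)
    (pentagon := fun W X Y Z => pentagon W X Y Z)
    (triangle := fun X Y => triangle X Y)

theorem braiding_naturality {X X' Y Y' : Zest f} (g : X.obj ⟶ X'.obj) (h : Y.obj ⟶ Y'.obj) :
    tHom g h ≫ (zBraidingIso f X'.deg Y'.deg X'.obj Y'.obj).hom =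
      (zBraidingIso f X.deg Y.deg X.obj Y.obj).hom ≫ tHom h g := by
  by_cases h1 : X.deg = X'.deg
  swap
  · rw [hom_eq_zero h1 g, tHom_zero_right, tHom_zero_left, zero_comp, comp_zero]
  by_cases h2 : Y.deg = Y'.deg
  swap
  · rw [hom_eq_zero h2 h, tHom_zero_right, tHom_zero_left, zero_comp, comp_zero]
  obtain ⟨⟨X, σ, hX⟩⟩ := X
  obtain ⟨⟨X', σ', hX'⟩⟩ := X'
  obtain ⟨⟨Y, τ, hY⟩⟩ := Y
  obtain ⟨⟨Y', τ', hY'⟩⟩ := Y'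
  dsimp only at h1 h2 g h
  subst h1 h2
  simp only [tHom, zAlphaMap_self, zBraidingIso, smulIso_hom, Linear.comp_smul, Linear.smul_comp,
    tensorIso_hom, tensorHom_comp_tensorHom, id_comp, comp_id, BraidedCategory.braiding_naturality]

/-- The factor `zB` is multiplicative in each degree unless all three degrees are odd, when ζ²
stands against 1. The cochain w makes up for it: i · 1 · i = ζ · i · ζ. -/
theorem hexagon_forward (X Y Z : Zest f) :
    (zAssocIso f X.deg Y.deg Z.deg X.obj Y.obj Z.obj).hom ≫
      (zBraidingIso f X.deg (xor Y.deg Z.deg) X.obj (zAlpha f Y.deg Z.deg ⊗ (Y.obj ⊗ Z.obj))).hom ≫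
      (zAssocIso f Y.deg Z.deg X.deg Y.obj Z.obj X.obj).hom =
    tHom (X := tObj X Y) (X' := tObj Y X) (zBraidingIso f X.deg Y.deg X.obj Y.obj).hom (𝟙 Z.obj) ≫
      (zAssocIso f Y.deg X.deg Z.deg Y.obj X.obj Z.obj).hom ≫
      tHom (Y := tObj X Z) (Y' := tObj Z X) (𝟙 Y.obj)
        (zBraidingIso f X.deg Z.deg X.obj Z.obj).hom := by
  obtain ⟨⟨X, σ, hX⟩⟩ := X
  obtain ⟨⟨Y, τ, hY⟩⟩ := Y
  obtain ⟨⟨Z, ρ, hZ⟩⟩ := Z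
  cases σ <;> cases τ <;> cases ρ <;>
  · dsimp only [tHom, tObj, zAssocIso, smulIso, crossAssocIso, zBraidingIso, tensorIso_hom]
    erw [zAlphaMap_self]
    try erw [zAlphaMap_self]
    refine crossAssoc_hexagon_smul _ _ _ _ _ _ _ _ _ _ _ _ ?_ ?_ _ _ _
    · have e := zB_mul_self
      simp [zW, zB] at e ⊢
      try linear_combination (-Complex.I) * e - Complex.I_mul_I
    · change HexagonCocycle _ _ _ _ _ _
      dsimp only [zCocycle, zSymm, zAlpha, Iso.refl_hom, Iso.trans_hom, Iso.symm_hom,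
        xor_false_false, xor_false_true, xor_true_false, xor_true_true]
      simp [HexagonCocycle]
      try monoidal

/-- If all three degrees are odd, the coefficient `f` passes the odd object `Z` with double braiding
`d = -1`, and the scalars agree as (-i) · 1 · (-i) · (-1) = ζ · (-i) · ζ. -/
theorem hexagon_reverse (X Y Z : Zest f) :
    (zAssocIso f X.deg Y.deg Z.deg X.obj Y.obj Z.obj).inv ≫
      (zBraidingIso f (xor X.deg Y.deg) Z.deg (zAlpha f X.deg Y.deg ⊗ (X.obj ⊗ Y.obj)) Z.obj).hom ≫
      (zAssocIso f Z.deg X.deg Y.deg Z.obj X.obj Y.obj).inv =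
    tHom (Y := tObj Y Z) (Y' := tObj Z Y) (𝟙 X.obj) (zBraidingIso f Y.deg Z.deg Y.obj Z.obj).hom ≫
      (zAssocIso f X.deg Z.deg Y.deg X.obj Z.obj Y.obj).inv ≫
      tHom (X := tObj X Z) (X' := tObj Z X) (zBraidingIso f X.deg Z.deg X.obj Z.obj).hom
        (𝟙 Y.obj) := by
  obtain ⟨⟨X, σ, hX⟩⟩ := X
  obtain ⟨⟨Y, τ, hY⟩⟩ := Y
  obtain ⟨⟨Z, ρ, hZ⟩⟩ := Z
  -- The scalar is kept abstract with its value recorded in `hd'`, so that one term serves all eight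
  -- cases of degrees.
  obtain ⟨d, hd, hd'⟩ : ∃ d : ℂ, doubleBraiding (zAlpha f σ τ) Z = d • 𝟙 _ ∧
      d = if σ && τ then pSign ρ else 1 := by
    refine ⟨_, ?_, rfl⟩
    cases σ <;> cases τ <;>
      first
      | exact doubleBraiding_swap (hasParity_iff.1 hZ)
      | exact (show doubleBraiding (𝟙_ C) Z = (1 : ℂ) • 𝟙 (𝟙_ C ⊗ Z) by simp [doubleBraiding])
  cases σ <;> cases τ <;> cases ρ <;>
  · dsimp only [tHom, tObj, zAssocIso, smulIso, crossAssocIso, zBraidingIso, tensorIso_hom]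
    erw [zAlphaMap_self]
    try erw [zAlphaMap_self]
    refine crossAssocInv_hexagon_smul _ _ _ _ _ _ _ _ _ _ _ _ d ?_ ?_ _ _ _ hd
    · have e := zB_mul_self
      simp [zW, zB, pSign, hd'] at e ⊢
      try linear_combination Complex.I * e + Complex.I_mul_I
    · change HexagonCocycle _ _ _ _ _ _
      dsimp only [zCocycle, zSymm, zAlpha, Iso.refl_hom, Iso.trans_hom, Iso.symm_hom, Iso.refl_inv, Iso.trans_inv, Iso.symm_inv,
        xor_false_false, xor_false_true, xor_true_false, xor_true_true]
      simp [HexagonCocycle]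
      try monoidal

instance : BraidedCategory (Zest f) where
  braiding X Y := mkIso (X := tObj X Y) (Y := tObj Y X) (zBraidingIso f X.deg Y.deg X.obj Y.obj)
  braiding_naturality_left g Z := braiding_naturality g (𝟙 Z.obj)
  braiding_naturality_right X _ _ g := braiding_naturality (𝟙 X.obj) g
  hexagon_forward := hexagon_forward
  hexagon_reverse := hexagon_reverse

instance : Preadditive (Zest f) where
  homGroup X Y := inferInstanceAs (AddCommGroup (X.obj ⟶ Y.obj))
  add_comp _ _ _ _ _ _ := Preadditive.add_comp (C := C) _ _ _ _ _ _
  comp_add _ _ _ _ _ _ := Preadditive.comp_add (C := C) _ _ _ _ _ _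

instance : Linear ℂ (Zest f) where
  homModule X Y := inferInstanceAs (Module ℂ (X.obj ⟶ Y.obj))
  smul_comp _ _ _ _ _ _ := Linear.smul_comp (C := C) _ _ _ _ _ _
  comp_smul _ _ _ _ _ _ := Linear.comp_smul (C := C) _ _ _ _ _ _

instance : MonoidalPreadditive (Zest f) where
  whiskerLeft_zero := tHom_zero_right _
  zero_whiskerRight := tHom_zero_left _
  whiskerLeft_add {X Y Z} g h := by
    change tHom (𝟙 X.obj) (HAdd.hAdd (α := Y.obj ⟶ Z.obj) g h) = HAdd.hAdd (α := (tObj X Y).obj ⟶ (tObj X Z).obj) (tHom (𝟙 X.obj) g) (tHom (𝟙 X.obj) h)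
    simp [tHom, MonoidalPreadditive.tensor_add]
  add_whiskerRight {X Y Z} g h := by
    change tHom (HAdd.hAdd (α := Y.obj ⟶ Z.obj) g h) (𝟙 X.obj) = HAdd.hAdd (α := (tObj Y X).obj ⟶ (tObj Z X).obj) (tHom g (𝟙 X.obj)) (tHom h (𝟙 X.obj))
    simp [tHom, MonoidalPreadditive.tensor_add, MonoidalPreadditive.add_tensor]

instance : MonoidalLinear ℂ (Zest f) where
  whiskerLeft_smul X {Y Z} r g := by
    change tHom (𝟙 X.obj) (HSMul.hSMul (β := Y.obj ⟶ Z.obj) r g) = HSMul.hSMul (β := (tObj X Y).obj ⟶ (tObj X Z).obj) r (tHom (𝟙 X.obj) g)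
    simp only [tHom, tensorHom_smul]
  smul_whiskerRight {r Y Z} g X := by
    change tHom (HSMul.hSMul (β := Y.obj ⟶ Z.obj) r g) (𝟙 X.obj) = HSMul.hSMul (β := (tObj Y X).obj ⟶ (tObj Z X).obj) r (tHom g (𝟙 X.obj))
    simp only [tHom, tensorHom_smul, smul_tensorHom]

end Zest

/-! ### Homogeneous objects with the original tensor product. -/

namespace Homog

variable (f : C)

instance : Preadditive (Homog C f) where
  homGroup X Y := inferInstanceAs (AddCommGroup (X.obj ⟶ Y.obj))
  add_comp _ _ _ _ _ _ := Preadditive.add_comp (C := C) _ _ _ _ _ _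
  comp_add _ _ _ _ _ _ := Preadditive.comp_add (C := C) _ _ _ _ _ _

instance : Linear ℂ (Homog C f) where
  homModule X Y := inferInstanceAs (Module ℂ (X.obj ⟶ Y.obj))
  smul_comp _ _ _ _ _ _ := Linear.smul_comp (C := C) _ _ _ _ _ _
  comp_smul _ _ _ _ _ _ := Linear.comp_smul (C := C) _ _ _ _ _ _

/-- Isomorphisms of the underlying objects. -/
@[simps]
def mkIso {X Y : Homog C f} (e : X.obj ≅ Y.obj) : X ≅ Y where
  hom := e.hom
  inv := e.inv
  hom_inv_id := e.hom_inv_id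
  inv_hom_id := e.inv_hom_id

instance : MonoidalCategoryStruct (Homog C f) where
  tensorObj X Y := ⟨X.obj ⊗ Y.obj, xor X.deg Y.deg, X.parity.tensor Y.parity⟩
  tensorHom g h := MonoidalCategoryStruct.tensorHom (C := C) g h
  whiskerLeft X _ _ g := MonoidalCategoryStruct.whiskerLeft (C := C) X.obj g
  whiskerRight g Y := MonoidalCategoryStruct.whiskerRight (C := C) g Y.obj
  tensorUnit := ⟨𝟙_ C, false, hasParity_unit f⟩
  associator X Y Z := mkIso f (α_ X.obj Y.obj Z.obj)
  leftUnitor X := mkIso f (λ_ X.obj)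
  rightUnitor X := mkIso f (ρ_ X.obj)

variable (C) in
/-- The functor that forgets the degree. -/
@[simps]
def forget : Homog C f ⥤ C where
  obj X := X.obj
  map g := g

instance : (forget C f).Faithful where
  map_injective h := h

instance : (forget C f).Full where
  map_surjective g := ⟨g, rfl⟩

instance : (forget C f).Additive where
  map_add := rfl

instance : (forget C f).Linear ℂ where
  map_smul _ _ := rfl

variable (C) in
/-- The forgetful functor induces the monoidal structure. -/
def forgetData : Monoidal.InducingFunctorData (forget C f) :=
    { μIso := fun X Y => Iso.refl (X.obj ⊗ Y.obj)
      εIso := Iso.refl (𝟙_ C)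
      whiskerLeft_eq := fun X _ _ g => by
        change MonoidalCategoryStruct.whiskerLeft (C := C) X.obj g = 𝟙 _ ≫ MonoidalCategoryStruct.whiskerLeft (C := C) X.obj g ≫ 𝟙 _
        simp
      whiskerRight_eq := fun g Y => by
        change MonoidalCategoryStruct.whiskerRight (C := C) g Y.obj = 𝟙 _ ≫ MonoidalCategoryStruct.whiskerRight (C := C) g Y.obj ≫ 𝟙 _
        simp
      tensorHom_eq := fun g h => by
        change MonoidalCategoryStruct.tensorHom (C := C) g h = 𝟙 _ ≫ MonoidalCategoryStruct.tensorHom (C := C) g h ≫ 𝟙 _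
        simp
      associator_eq := fun X Y Z => by
        change (α_ X.obj Y.obj Z.obj).hom = (𝟙 _ ≫ (𝟙 (X.obj ⊗ Y.obj) ⊗ₘ 𝟙 Z.obj)) ≫ (α_ X.obj Y.obj Z.obj).hom ≫ (𝟙 X.obj ⊗ₘ 𝟙 (Y.obj ⊗ Z.obj)) ≫ 𝟙 _
        simp
      leftUnitor_eq := fun X => by
        change (λ_ X.obj).hom = (𝟙 _ ≫ (𝟙 _ ⊗ₘ 𝟙 _)) ≫ (λ_ X.obj).hom
        simp
      rightUnitor_eq := fun X => by
        change (ρ_ X.obj).hom = (𝟙 _ ≫ (𝟙 _ ⊗ₘ 𝟙 _)) ≫ (ρ_ X.obj).hom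
        simp }

instance : MonoidalCategory (Homog C f) := Monoidal.induced (forget C f) (forgetData C f)

instance : (forget C f).Monoidal :=
  (Monoidal.fromInducedCoreMonoidal (forget C f) (forgetData C f)).toMonoidal

instance : BraidedCategory (Homog C f) where
  braiding X Y := mkIso (X := X ⊗ Y) (Y := Y ⊗ X) f (β_ X.obj Y.obj)
  braiding_naturality_left g Z := BraidedCategory.braiding_naturality_left (C := C) g Z.obj
  braiding_naturality_right X _ _ g := BraidedCategory.braiding_naturality_right (C := C) X.obj g
  hexagon_forward X Y Z := BraidedCategory.hexagon_forward X.obj Y.obj Z.obj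
  hexagon_reverse X Y Z := BraidedCategory.hexagon_reverse X.obj Y.obj Z.obj

instance : MonoidalPreadditive (Homog C f) where
  whiskerLeft_zero := MonoidalPreadditive.whiskerLeft_zero (C := C)
  zero_whiskerRight := MonoidalPreadditive.zero_whiskerRight (C := C)
  whiskerLeft_add := MonoidalPreadditive.whiskerLeft_add (C := C)
  add_whiskerRight := MonoidalPreadditive.add_whiskerRight (C := C)

instance : MonoidalLinear ℂ (Homog C f) where
  whiskerLeft_smul X _ _ := MonoidalLinear.whiskerLeft_smul (C := C) X.obj
  smul_whiskerRight r _ _ g X := MonoidalLinear.smul_whiskerRight (C := C) r g X.obj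

instance : (forget C f).Braided where
  braided X Y := by
    change 𝟙 _ ≫ (β_ X.obj Y.obj).hom = (β_ X.obj Y.obj).hom ≫ 𝟙 _
    simp

end Homog

end Graded

end

/-! ### Dual pairings, the trace without twist, and duals in the zesting. -/

section

open BraidedCategory
section Pairings

variable {C : Type u} [Category.{v} C] [MonoidalCategory C]

theorem evaluation_cancel {X Y Z : C} [ExactPairing X Y] {h h' : Z ⟶ Y}
    (e : h ▷ X ≫ ε_ X Y = h' ▷ X ≫ ε_ X Y) : h = h' := by
  let : HasRightDual X := ⟨Y⟩
  have := congrArg (tensorRightHomEquiv Z X Y (𝟙_ C)) e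
  erw [tensorRightHomEquiv_whiskerRight_comp_evaluation,
    tensorRightHomEquiv_whiskerRight_comp_evaluation] at this
  exact (cancel_mono _).1 this

/-- For a pairing that is nondegenerate, one of the two zigzag identities implies the other. -/
@[reducible]
def exactPairingOfInjective (X Y : C) (c : 𝟙_ C ⟶ X ⊗ Y) (e : Y ⊗ X ⟶ 𝟙_ C)
    (h : c ▷ X ≫ (α_ X Y X).hom ≫ X ◁ e = (λ_ X).hom ≫ (ρ_ X).inv)
    (inj : ∀ a b : Y ⟶ Y, a ▷ X ≫ e = b ▷ X ≫ e → a = b) : ExactPairing X Y where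
  coevaluation' := c
  evaluation' := e
  evaluation_coevaluation' := h
  coevaluation_evaluation' := by
    have h' : c ▷ X ⊗≫ X ◁ e = ⊗𝟙.hom := by
      convert! h <;> simp [monoidalComp]
    rw [← Iso.inv_comp_eq, ← cancel_mono (λ_ Y).hom]
    simp only [assoc, Iso.inv_hom_id]
    apply inj
    -- After contraction with `e` the missing zigzag contains two evaluations; exchanging them
    -- brings out the zigzag that is known.
    calc _ = 𝟙 _ ⊗≫ Y ◁ c ▷ X ⊗≫ (e ▷ (Y ⊗ X) ≫ 𝟙_ C ◁ e) ⊗≫ 𝟙 _ := by monoidal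
      _ = 𝟙 _ ⊗≫ Y ◁ (c ▷ X ⊗≫ X ◁ e) ⊗≫ e ⊗≫ 𝟙 _ := by rw [← whisker_exchange]; monoidal
      _ = _ := by rw [h']; monoidal

section

variable {D : Type u₂} [Category.{v₂} D] [MonoidalCategory D]

open Functor.LaxMonoidal Functor.OplaxMonoidal in
/-- Monoidal functors preserve duals. -/
@[reducible]
def mapExactPairing (F : C ⥤ D) [F.Monoidal] (X Y : C) [ExactPairing X Y] :
    ExactPairing (F.obj X) (F.obj Y) where
  coevaluation' := ε F ≫ F.map (η_ X Y) ≫ δ F X Y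
  evaluation' := μ F Y X ≫ F.map (ε_ X Y) ≫ η F
  coevaluation_evaluation' := by
    have := congrArg (fun t => F.obj Y ◁ ε F ≫ μ F Y (𝟙_ C) ≫ F.map t ≫ δ F (𝟙_ C) Y ≫ η F ▷ F.obj Y)
      (ExactPairing.coevaluation_evaluation X Y)
    simp only [Functor.map_comp, Functor.Monoidal.map_whiskerLeft, Functor.Monoidal.map_whiskerRight,
      Functor.Monoidal.map_associator_inv, Functor.Monoidal.map_associator, Functor.Monoidal.map_leftUnitor, Functor.Monoidal.map_leftUnitor_inv,
      Functor.Monoidal.map_rightUnitor, Functor.Monoidal.map_rightUnitor_inv, assoc, Functor.Monoidal.μ_δ_assoc, Functor.Monoidal.δ_μ_assoc, Functor.Monoidal.μ_δ, Functor.Monoidal.δ_μ] at this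
    simp only [← MonoidalCategory.whiskerLeft_comp_assoc, ← comp_whiskerRight_assoc, ← MonoidalCategory.whiskerLeft_comp, ← comp_whiskerRight, assoc, Functor.Monoidal.μ_δ_assoc, Functor.Monoidal.δ_μ_assoc, Functor.Monoidal.μ_δ, Functor.Monoidal.δ_μ, Functor.Monoidal.ε_η, whiskerLeft_id, id_whiskerRight, id_comp, comp_id] at this
    exact this
  evaluation_coevaluation' := by
    have := congrArg (fun t => ε F ▷ F.obj X ≫ μ F (𝟙_ C) X ≫ F.map t ≫ δ F X (𝟙_ C) ≫ F.obj X ◁ η F)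
      (ExactPairing.evaluation_coevaluation X Y)
    simp only [Functor.map_comp, Functor.Monoidal.map_whiskerLeft, Functor.Monoidal.map_whiskerRight,
      Functor.Monoidal.map_associator_inv, Functor.Monoidal.map_associator, Functor.Monoidal.map_leftUnitor, Functor.Monoidal.map_leftUnitor_inv,
      Functor.Monoidal.map_rightUnitor, Functor.Monoidal.map_rightUnitor_inv, assoc, Functor.Monoidal.μ_δ_assoc, Functor.Monoidal.δ_μ_assoc, Functor.Monoidal.μ_δ, Functor.Monoidal.δ_μ] at this
    simp only [← MonoidalCategory.whiskerLeft_comp_assoc, ← comp_whiskerRight_assoc, ← MonoidalCategory.whiskerLeft_comp, ← comp_whiskerRight, assoc, Functor.Monoidal.μ_δ_assoc, Functor.Monoidal.δ_μ_assoc, Functor.Monoidal.μ_δ, Functor.Monoidal.δ_μ, Functor.Monoidal.ε_η, whiskerLeft_id, id_whiskerRight, id_comp, comp_id] at this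
    exact this
end

variable [BraidedCategory C]

/-- The trace `ev ∘ c ∘ (g ⊗ id) ∘ coev` without a twist. -/
def pTrace (X Y : C) [ExactPairing X Y] (g : X ⟶ X) : 𝟙_ C ⟶ 𝟙_ C :=
  η_ X Y ≫ g ▷ Y ≫ (β_ X Y).hom ≫ ε_ X Y

/-- The duals `Y` and `Y'` of `X` are related by the mate of the identity of `X`, and this
comparison slides from the evaluation through the braiding to the coevaluation. Hence duals may be
chosen freely in trace computations. -/
theorem pTrace_eq (X Y Y' : C) [p : ExactPairing X Y] [p' : ExactPairing X Y'] (g : X ⟶ X) :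
    pTrace X Y g = pTrace X Y' g := by
  obtain ⟨t, h1, h2⟩ : ∃ t : Y ⟶ Y', η_ X Y ≫ X ◁ t = η_ X Y' ∧ t ▷ X ≫ ε_ X Y' = ε_ X Y := by
    refine ⟨@rightAdjointMate _ _ _ X X ⟨Y'⟩ ⟨Y⟩ (𝟙 X), ?_, ?_⟩
    · have := @coevaluation_comp_rightAdjointMate _ _ _ X X ⟨Y'⟩ ⟨Y⟩ (𝟙 X)
      simpa using this
    · have := @rightAdjointMate_comp_evaluation _ _ _ X X ⟨Y'⟩ ⟨Y⟩ (𝟙 X)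
      simpa using this
  rw [pTrace, pTrace, ← h1, ← h2, assoc, whisker_exchange_assoc, braiding_naturality_right_assoc]


open Functor.LaxMonoidal Functor.OplaxMonoidal in
-- No twist enters `pTrace`, so it is respected by every braided functor. This is the invariant by
-- which twists and dimensions are compared later.
theorem pTrace_map {D : Type u₂} [Category.{v₂} D] [MonoidalCategory D] [BraidedCategory D]
    (F : C ⥤ D) [F.Braided] (X Y : C) [ExactPairing X Y] (g : X ⟶ X) (Y' : D)
    [ExactPairing (F.obj X) Y'] :
    pTrace (F.obj X) Y' (F.map g) = ε F ≫ F.map (pTrace X Y g) ≫ η F := by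
  let := mapExactPairing F X Y
  rw [pTrace_eq (F.obj X) Y' (F.obj Y), pTrace, pTrace]
  change (ε F ≫ F.map (η_ X Y) ≫ δ F X Y) ≫ F.map g ▷ F.obj Y ≫ (β_ (F.obj X) (F.obj Y)).hom ≫
    (μ F Y X ≫ F.map (ε_ X Y) ≫ η F) = _
  simp [Functor.map_braiding, Functor.Monoidal.map_whiskerRight]

end Pairings

section ZestPairing

variable {C : Type u} [Category.{v} C] [Preadditive C] [Linear ℂ C] [MonoidalCategory C]
  [MonoidalPreadditive C] [MonoidalLinear ℂ C] [BraidedCategory C]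

/-- If `a ⊗ Y` is dual to `X` then `crossAssoc` satisfies a zigzag identity. -/
theorem crossAssoc_zigzag (a X Y : C) [ExactPairing X (a ⊗ Y)] :
    (𝟙 (𝟙_ C) ⊗ₘ ((η_ X (a ⊗ Y) ≫ (α_ X a Y).inv ≫ (β_ X a).hom ▷ Y ≫ (α_ a X Y).hom) ⊗ₘ 𝟙 X)) ≫
      crossAssoc (𝟙 (𝟙_ C ⊗ a)) X Y X ≫
      (𝟙 (𝟙_ C) ⊗ₘ (𝟙 X ⊗ₘ ((α_ a Y X).inv ≫ ε_ X (a ⊗ Y)))) ≫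
      (𝟙 (𝟙_ C) ⊗ₘ (ρ_ X).hom) ≫ (λ_ X).hom =
    (𝟙 (𝟙_ C) ⊗ₘ (λ_ X).hom) ≫ (λ_ X).hom := by
  simp only [crossAssoc_eq, MonoidalCategory.tensorHom_def]
  calc
    _ = 𝟙 _ ⊗≫ η_ X (a ⊗ Y) ▷ X ⊗≫ ((β_ X a).hom ≫ (β_ X a).inv) ▷ (Y ⊗ X) ⊗≫
        X ◁ ε_ X (a ⊗ Y) ⊗≫ 𝟙 _ := by monoidal
    _ = 𝟙 _ ⊗≫ (η_ X (a ⊗ Y) ▷ X ⊗≫ X ◁ ε_ X (a ⊗ Y)) ⊗≫ 𝟙 _ := by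
      rw [Iso.hom_inv_id]; monoidal
    _ = _ := by rw [ExactPairing.evaluation_coevaluation'']; monoidal

theorem crossAssoc_zigzag_smul (a X Y : C) [ExactPairing X (a ⊗ Y)] {w : ℂ} (hw : w ≠ 0) :
    (𝟙 (𝟙_ C) ⊗ₘ ((w⁻¹ • (η_ X (a ⊗ Y) ≫ (α_ X a Y).inv ≫ (β_ X a).hom ▷ Y ≫
        (α_ a X Y).hom)) ⊗ₘ 𝟙 X)) ≫
      (w • crossAssoc (𝟙 (𝟙_ C ⊗ a)) X Y X) ≫
      (𝟙 (𝟙_ C) ⊗ₘ (𝟙 X ⊗ₘ ((α_ a Y X).inv ≫ ε_ X (a ⊗ Y)))) ≫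
      (𝟙 (𝟙_ C) ⊗ₘ (ρ_ X).hom) ≫ (λ_ X).hom =
    (𝟙 (𝟙_ C) ⊗ₘ (λ_ X).hom) ≫ (λ_ X).hom := by
  rw [smul_tensorHom, tensorHom_smul, Linear.smul_comp, Linear.smul_comp, Linear.comp_smul,
    smul_smul, inv_mul_cancel₀ hw, one_smul, crossAssoc_zigzag]

/-- The crossing of `X` with `a` in the coevaluation and the braiding of `X` with `Y` compose to the
braiding of `X` with `a ⊗ Y`. So the zested trace is the old trace formed with the dual `a ⊗ Y`. -/
theorem crossAssoc_trace (a X Y : C) [ExactPairing X (a ⊗ Y)] (g : X ⟶ X) (w z : ℂ) :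
    (w • (η_ X (a ⊗ Y) ≫ (α_ X a Y).inv ≫ (β_ X a).hom ▷ Y ≫ (α_ a X Y).hom)) ≫
      (𝟙 a ⊗ₘ (g ⊗ₘ 𝟙 Y)) ≫ (z • (𝟙 a ⊗ₘ (β_ X Y).hom)) ≫ (α_ a Y X).inv ≫ ε_ X (a ⊗ Y) =
    (w * z) • pTrace X (a ⊗ Y) g := by
  have key : (α_ X a Y).inv ≫ (β_ X a).hom ▷ Y ≫ (α_ a X Y).hom ≫ a ◁ (g ▷ Y) ≫
      a ◁ (β_ X Y).hom ≫ (α_ a Y X).inv = g ▷ (a ⊗ Y) ≫ (β_ X (a ⊗ Y)).hom := by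
    rw [BraidedCategory.braiding_naturality_left, braiding_tensor_right_hom]
    calc
      _ = 𝟙 _ ⊗≫ (β_ X a).hom ▷ Y ⊗≫ a ◁ (g ▷ Y ≫ (β_ X Y).hom) ⊗≫ 𝟙 _ := by monoidal
      _ = _ := by rw [BraidedCategory.braiding_naturality_left]; monoidal
  simp only [id_tensorHom, tensorHom_id, Linear.smul_comp, Linear.comp_smul, smul_smul, assoc,
    reassoc_of% key, pTrace]
  rw [mul_comm]

/-- The evaluation maps `V ⊗ X` to the unit, which braids trivially with `f`. So the signs of `V`
and `X` are inverse to each other, hence equal because they square to 1. -/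
theorem HasParity.dual {f : C} {σ : Bool} {X : C} (hX : HasParity f σ X) (V : C)
    [ExactPairing X V] : HasParity f σ V := by
  rw [hasParity_iff] at *
  have hz : pSign σ * pSign σ = 1 := by cases σ <;> simp [pSign]
  generalize pSign σ = z at *
  have h1 : (β_ X f).inv = z • (β_ f X).hom := by
    rw [← cancel_epi (β_ X f).hom, Iso.hom_inv_id, Linear.comp_smul]
    change _ = z • doubleBraiding X f
    rw [hX, smul_smul, hz, one_smul]
  have h2 : (β_ V f).hom ▷ X ≫ (α_ f V X).hom ≫ f ◁ ε_ X V =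
      (α_ V f X).hom ≫ V ◁ (β_ X f).inv ≫ (α_ V X f).inv ≫ ε_ X V ▷ f ≫ (β_ (𝟙_ C) f).hom := by
    rw [BraidedCategory.braiding_naturality_left]
    simp
  have h3 : doubleBraiding (V ⊗ X) f ≫ ε_ X V ▷ f = ε_ X V ▷ f := by
    rw [← doubleBraiding_naturality_left]; simp [doubleBraiding]
  have h4 : doubleBraiding V f ▷ X ≫ (α_ V f X).hom ≫ V ◁ (β_ f X).hom ≫ (α_ V X f).inv ≫ ε_ X V ▷ f =
      (α_ V f X).hom ≫ V ◁ (β_ X f).inv ≫ (α_ V X f).inv ≫ ε_ X V ▷ f := by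
    rw [doubleBraiding_tensor] at h3
    simp only [assoc] at h3
    rw [← cancel_epi (α_ V f X).inv, ← cancel_epi (V ◁ (β_ X f).hom), ← cancel_epi (α_ V X f).hom, h3]
    simp
  rw [← cancel_mono (β_ V f).hom]
  -- By duality, morphisms `V ⊗ f ⟶ f ⊗ V` may be compared after contraction with `X`, where `h2`
  -- turns the braiding of `V` into the inverse braiding of `X`.
  apply (tensorRightHomEquiv (V ⊗ f) X V f).symm.injective
  change _ ▷ X ≫ (α_ f V X).hom ≫ f ◁ ε_ X V ≫ (ρ_ f).hom = _ ▷ X ≫ (α_ f V X).hom ≫ f ◁ ε_ X V ≫ (ρ_ f).hom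
  have h5 : ∀ h : V ⊗ f ⟶ V ⊗ f, (h ≫ (β_ V f).hom) ▷ X ≫ (α_ f V X).hom ≫ f ◁ ε_ X V ≫ (ρ_ f).hom =
    h ▷ X ≫ ((α_ V f X).hom ≫ V ◁ (β_ X f).inv ≫ (α_ V X f).inv ≫ ε_ X V ▷ f) ≫ (β_ (𝟙_ C) f).hom ≫ (ρ_ f).hom := by
    intro h
    rw [comp_whiskerRight, assoc, reassoc_of% h2]
    simp only [assoc]
  have h6 : (α_ V f X).hom ≫ V ◁ (β_ X f).inv ≫ (α_ V X f).inv ≫ ε_ X V ▷ f =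
      z • ((α_ V f X).hom ≫ V ◁ (β_ f X).hom ≫ (α_ V X f).inv ≫ ε_ X V ▷ f) := by
    rw [h1]; simp only [MonoidalLinear.whiskerLeft_smul, Linear.comp_smul, Linear.smul_comp]
  rw [h5, h5]
  conv_lhs => rw [h6]
  simp only [Linear.comp_smul, Linear.smul_comp, MonoidalLinear.smul_whiskerRight, id_whiskerRight,
    id_comp, assoc]
  rw [reassoc_of% h4]

namespace Zest

variable {f : C} [SelfFermionic f]

theorem whiskerLeft_zAlpha_injective (f : C) [SelfFermionic f] (σ τ : Bool) {X Y : C} {g h : X ⟶ Y}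
    (e : zAlpha f σ τ ◁ g = zAlpha f σ τ ◁ h) : g = h := by
  cases σ <;> cases τ <;> first | exact whiskerLeft_fermion_injective f e | simpa [zAlpha] using e

/-- Duals in the zested category. -/
@[reducible]
def exactPairing (σ : Bool) (X Y : C) (hX : HasParity f σ X) (hY : HasParity f σ Y)
    [ExactPairing X (zAlpha f σ σ ⊗ Y)] :
    ExactPairing (C := Zest f) ⟨⟨X, σ, hX⟩⟩ ⟨⟨Y, σ, hY⟩⟩ :=
  exactPairingOfInjective (C := Zest f) ⟨⟨X, σ, hX⟩⟩ ⟨⟨Y, σ, hY⟩⟩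
    -- The inverse of w cancels the scalar that the zested associator contributes to the zigzag
    -- identity.
    ((zW σ σ σ)⁻¹ • (η_ X (zAlpha f σ σ ⊗ Y) ≫ (α_ X (zAlpha f σ σ) Y).inv ≫ (β_ X (zAlpha f σ σ)).hom ▷ Y ≫
      (α_ (zAlpha f σ σ) X Y).hom) : 𝟙_ C ⟶ zAlpha f σ σ ⊗ (X ⊗ Y))
    ((α_ (zAlpha f σ σ) Y X).inv ≫ ε_ X (zAlpha f σ σ ⊗ Y) : zAlpha f σ σ ⊗ (Y ⊗ X) ⟶ 𝟙_ C)
    (by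
      rw [← cancel_mono (ρ_ _).hom, assoc, assoc, assoc, Iso.inv_hom_id, comp_id]
      cases σ <;> exact crossAssoc_zigzag_smul _ X Y (zW_ne_zero _ _ _))
    (by
      intro a b h
      change (zAlphaMap f σ σ σ σ ⊗ₘ (MonoidalCategoryStruct.tensorHom (C := C) a (𝟙 X))) ≫ _ = (zAlphaMap f σ σ σ σ ⊗ₘ (MonoidalCategoryStruct.tensorHom (C := C) b (𝟙 X))) ≫ _ at h
      rw [zAlphaMap_self] at h
      apply whiskerLeft_zAlpha_injective f σ σ
      apply evaluation_cancel (X := X) 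
      rw [← cancel_epi (α_ (zAlpha f σ σ) Y X).inv]
      simpa using h)

/-- The trace in the zested category. -/
theorem pTrace_eq_smul (σ : Bool) (X Y : C) (hX : HasParity f σ X) (hY : HasParity f σ Y)
    [ExactPairing X (zAlpha f σ σ ⊗ Y)] (g : X ⟶ X) :
    letI := exactPairing σ X Y hX hY
    pTrace (C := Zest f) ⟨⟨X, σ, hX⟩⟩ ⟨⟨Y, σ, hY⟩⟩ g = 
      ((zB σ σ)⁻¹ • pTrace X (zAlpha f σ σ ⊗ Y) g : 𝟙_ C ⟶ 𝟙_ C) := by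
  -- In odd degree this says i⁻¹ ζ = ζ⁻¹, which is ζ² = i. One factor comes from the coevaluation,
  -- the other from the braiding.
  have h : (zW σ σ σ)⁻¹ * zB σ σ = (zB σ σ)⁻¹ := by
    have e := zB_mul_self
    cases σ
    · simp [zW, zB]
    · have := zB_ne_zero true true
      rw [show zW true true true = Complex.I from rfl, ← e]
      field_simp
  rw [← h]
  refine Eq.trans ?_ (crossAssoc_trace (zAlpha f σ σ) X Y g _ _)
  cases σ <;> rfl

end Zest

end ZestPairing

end

/-! ### Rigidity and the twist on zested homogeneous objects. -/

section

open BraidedCategory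
section RibbonZest

variable {C : Type u} [Category.{v} C] [MonoidalCategory C] 

theorem eq_rightAdjointMate {X : C} [HasRightDual X] {g : X ⟶ X} {h : Xᘁ ⟶ Xᘁ}
    (e : h ▷ X ≫ ε_ X (Xᘁ) = Xᘁ ◁ g ≫ ε_ X (Xᘁ)) : h = gᘁ :=
  evaluation_cancel (e.trans (rightAdjointMate_comp_evaluation g).symm)

variable [BraidedCategory C]

section

variable [RigidCategory C] [RibbonStructure C]

open RibbonStructure

/-- The twist is compatible with every pairing. -/
theorem twist_evaluation (X V : C) [p : ExactPairing X V] :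
    (twist V).hom ▷ X ≫ ε_ X V = V ◁ (twist X).hom ≫ ε_ X V := by
  obtain ⟨t, ht⟩ : ∃ t : V ⟶ Xᘁ, t ▷ X ≫ ε_ X (Xᘁ) = ε_ X V := by
    refine ⟨@rightAdjointMate _ _ _ X X _ ⟨V⟩ (𝟙 X), ?_⟩
    have := @rightAdjointMate_comp_evaluation _ _ _ X X _ ⟨V⟩ (𝟙 X)
    simpa using this
  rw [← ht, ← comp_whiskerRight_assoc, ← twist_naturality, comp_whiskerRight_assoc, twist_dual,
    rightAdjointMate_comp_evaluation, ← whisker_exchange_assoc]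

/-- By the balancing equation and naturality the twist of the unit is idempotent, and it is
invertible. -/
theorem twist_unit : (twist (𝟙_ C)).hom = 𝟙 _ := by
  have h1 := twist_tensor (𝟙_ C) (𝟙_ C)
  have h2 := twist_naturality (λ_ (𝟙_ C)).hom
  rw [h1] at h2
  have h3 : (twist (𝟙_ C)).hom = (twist (𝟙_ C)).hom ≫ (twist (𝟙_ C)).hom := by
    rw [← cancel_epi (λ_ (𝟙_ C)).hom, h2]
    have e : (ρ_ (𝟙_ C)).inv ≫ (λ_ (𝟙_ C)).hom = 𝟙 _ := by rw [unitors_equal]; simp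
    simp [MonoidalCategory.tensorHom_def, ← unitors_equal, reassoc_of% e]
  rw [← cancel_epi (twist (𝟙_ C)).hom, ← h3, comp_id]

end

variable [Preadditive C] [Linear ℂ C] [MonoidalPreadditive C] [MonoidalLinear ℂ C]

section

variable [RigidCategory C] [RibbonStructure C]

open RibbonStructure

/-- The twist of a fermion. -/
class FermionicTwist (f : C) : Prop where
  twist_eq : (twist f).hom = -𝟙 f

/-- The balancing equation with θ_f = -1: for the coefficient `f` the sign -1 of the fermion is
multiplied by the sign of its double braiding with `Y`. -/
theorem twist_zAlpha_tensor (f : C) [FermionicTwist f] (σ τ ρ : Bool) {Y : C}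
    (hY : HasParity f ρ Y) : (twist (zAlpha f σ τ ⊗ Y)).hom =
      (if σ && τ then -pSign ρ else 1 : ℂ) • zAlpha f σ τ ◁ (twist Y).hom := by
  rw [twist_tensor]
  have h1 : (β_ f Y).hom ≫ (β_ Y f).hom = pSign ρ • 𝟙 _ :=
    doubleBraiding_swap (hasParity_iff.1 hY)
  cases σ <;> cases τ
  case true.true =>
    change ((twist f).hom ⊗ₘ _) ≫ (β_ f Y).hom ≫ (β_ Y f).hom = _ • f ◁ _
    rw [h1, FermionicTwist.twist_eq,
      show -𝟙 f = (-1 : ℂ) • 𝟙 f by simp]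
    simp only [smul_tensorHom, Linear.smul_comp, Linear.comp_smul, id_tensorHom, comp_id, smul_smul]
    refine Eq.trans ?_ (neg_smul _ _).symm
    simp
  all_goals
    change ((twist (𝟙_ C)).hom ⊗ₘ _) ≫ (β_ (𝟙_ C) Y).hom ≫ (β_ Y (𝟙_ C)).hom = (1 : ℂ) • 𝟙_ C ◁ _
    refine Eq.trans ?_ (one_smul ℂ _).symm
    rw [twist_unit]
    simp [MonoidalCategory.tensorHom_def]

end

namespace Zest

variable {f : C} [SelfFermionic f]

/-- The values of `α` are invertible of order two. -/
def zAlphaSquare (f : C) [SelfFermionic f] : ∀ σ τ : Bool, zAlpha f σ τ ⊗ zAlpha f σ τ ≅ 𝟙_ C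
  | true, true => (SelfFermionic.square (f := f)).some
  | true, false => λ_ (𝟙_ C)
  | false, true => λ_ (𝟙_ C)
  | false, false => λ_ (𝟙_ C)

theorem hasParity_zAlpha (f : C) [SelfFermionic f] (σ τ : Bool) :
    HasParity f false (zAlpha f σ τ) := by
  cases σ <;> cases τ <;>
    first
    | exact hasParity_unit f
    | exact SelfFermionic.doubleBraiding f

/-- The object dual to `X` for the zested tensor product. -/
def dual [RightRigidCategory C] (X : Zest f) : Zest f :=
  ⟨⟨zAlpha f X.deg X.deg ⊗ X.objᘁ, X.deg, by
    have := (hasParity_zAlpha f X.deg X.deg).tensor (X.parity.dual (X.objᘁ))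
    rwa [Bool.false_xor] at this⟩⟩

/-- The pairing in `C` that underlies the pairing between `X` and its dual. -/
@[reducible]
def dualPairing [RightRigidCategory C] (X : Zest f) :
    ExactPairing X.obj (zAlpha f X.deg X.deg ⊗ X.dual.obj) :=
  exactPairingCongrRight (Y' := X.objᘁ)
    ((α_ _ _ _).symm ≪≫ whiskerRightIso (zAlphaSquare f X.deg X.deg) _ ≪≫ λ_ _)

instance [RightRigidCategory C] : RightRigidCategory (Zest f) where
  rightDual X :=
    { rightDual := X.dual
      exact :=
        let := dualPairing X
        exactPairing X.deg X.obj X.dual.obj X.parity X.dual.parity }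

instance [RightRigidCategory C] : RigidCategory (Zest f) :=
  BraidedCategory.rigidCategoryOfRightRigidCategory

section

variable [RigidCategory C] [RibbonStructure C]

open RibbonStructure

theorem twist_dual_aux (a X Y : C) [ExactPairing X (a ⊗ Y)] (z : ℂ)
    (h : (twist (a ⊗ Y)).hom = a ◁ (twist Y).hom) :
    (𝟙 a ⊗ₘ ((z • (twist Y).hom) ⊗ₘ 𝟙 X)) ≫ (α_ a Y X).inv ≫ ε_ X (a ⊗ Y) =
      (𝟙 a ⊗ₘ (𝟙 Y ⊗ₘ (z • (twist X).hom))) ≫ (α_ a Y X).inv ≫ ε_ X (a ⊗ Y) := by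
  have := twist_evaluation X (a ⊗ Y)
  rw [h] at this
  have this' : a ◁ ((twist Y).hom ▷ X) ≫ (α_ a Y X).inv ≫ ε_ X (a ⊗ Y) =
    a ◁ (Y ◁ (twist X).hom) ≫ (α_ a Y X).inv ≫ ε_ X (a ⊗ Y) := by simpa using this
  simp only [smul_tensorHom, tensorHom_smul, Linear.smul_comp, id_tensorHom, tensorHom_id, this',
    MonoidalLinear.smul_whiskerRight, MonoidalLinear.whiskerLeft_smul]

/-- The scalar part of the balancing equation for the zested twist. For two odd degrees it reads -1
= ζ⁴: the sign on the left is the twist of the coefficient `f` tensored with an even object. -/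
theorem twist_scalar (σ τ : Bool) : zB (xor σ τ) (xor σ τ) *
    (if σ && τ then -pSign (xor σ τ) else 1) = zB σ σ * zB τ τ * zB σ τ * zB τ σ := by
  have e := zB_mul_self
  cases σ <;> cases τ <;> simp [zB, pSign] at e ⊢
  linear_combination (-(Complex.exp (Real.pi * Complex.I / 4) *
    Complex.exp (Real.pi * Complex.I / 4)) - Complex.I) * e - Complex.I_mul_I

instance [FermionicTwist f] : RibbonStructure (Zest f) where
  twist X := mkIso (smulIso _ (zB_ne_zero X.deg X.deg) (twist X.obj))
  twist_naturality {X Y} g := by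
    change (g : X.obj ⟶ Y.obj) ≫ (zB Y.deg Y.deg • (twist Y.obj).hom) = (zB X.deg X.deg • (twist X.obj).hom) ≫ g
    by_cases h : X.deg = Y.deg
    · have key : ∀ (A B : C) (g : A ⟶ B) (z : ℂ),
          g ≫ (z • (twist B).hom) = (z • (twist A).hom) ≫ g := by
        intro A B g z
        rw [Linear.comp_smul, Linear.smul_comp, twist_naturality]
      rw [h]
      exact key _ _ g _
    · rw [hom_eq_zero h g]; simp
  twist_tensor X Y := by
    obtain ⟨⟨X, σ, hX⟩⟩ := X
    obtain ⟨⟨Y, τ, hY⟩⟩ := Y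
    have h := twist_zAlpha_tensor f σ τ _ (hX.tensor hY)
    have key : ∀ (a : C) (z w w₁ w₂ w₃ w₄ : ℂ), (twist (a ⊗ X ⊗ Y)).hom = w • a ◁ (twist (X ⊗ Y)).hom → z * w = w₁ * w₂ * w₃ * w₄ →
      z • (twist (a ⊗ X ⊗ Y)).hom = (𝟙 a ⊗ₘ ((w₁ • (twist X).hom) ⊗ₘ (w₂ • (twist Y).hom))) ≫
        (w₃ • (𝟙 a ⊗ₘ (β_ X Y).hom)) ≫ (w₄ • (𝟙 a ⊗ₘ (β_ Y X).hom)) := by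
      intro a z w w₁ w₂ w₃ w₄ h1 h2
      rw [h1, twist_tensor]
      simp only [smul_tensorHom, tensorHom_smul, Linear.smul_comp, Linear.comp_smul, id_tensorHom, smul_smul, MonoidalCategory.whiskerLeft_comp, h2]
      congr 1; ring
    cases σ <;> cases τ
    · exact key _ _ _ _ _ _ _ h (twist_scalar false false)
    · exact key _ _ _ _ _ _ _ h (twist_scalar false true)
    · exact key _ _ _ _ _ _ _ h (twist_scalar true false)
    · exact key _ _ _ _ _ _ _ h (twist_scalar true true)
  twist_dual X := by
    apply eq_rightAdjointMate
    let := dualPairing X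
    have h := twist_zAlpha_tensor f X.deg X.deg X.deg X.dual.parity
    -- Tensoring an odd object with the fermion preserves its twist: the two signs -1 cancel.
    have h1 : (if X.deg && X.deg then -pSign X.deg else 1 : ℂ) = 1 := by
      cases X.deg <;> simp [pSign]
    rw [h1, one_smul] at h
    refine Eq.trans ?_ ((twist_dual_aux (zAlpha f X.deg X.deg) X.obj X.dual.obj (zB X.deg X.deg) h).trans ?_)
    · rw [← zAlphaMap_self]; rfl
    · rw [← zAlphaMap_self]; rfl

end

end Zest

end RibbonZest

/-! ### The unitary structure on zested homogeneous objects; the scalars w and ζ have modulus one.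
-/

section UnitaryZest

namespace UnitaryStructure

variable {C : Type u} [Category.{v} C] [Preadditive C] [Linear ℂ C] [MonoidalCategory C]
  [BraidedCategory C] [RigidCategory C] [RibbonStructure C] (U : UnitaryStructure C)

@[simp]
theorem dag_zero {X Y : C} : U.dag (0 : X ⟶ Y) = 0 := by
  simpa using U.dag_smul 0 (0 : X ⟶ Y)

@[simp]
theorem dag_id (X : C) : U.dag (𝟙 X) = 𝟙 X := by
  have := U.dag_comp (U.dag (𝟙 X)) (𝟙 X)
  rw [comp_id, U.dag_dag, comp_id] at this
  rw [← this]

theorem dag_inv {X Y : C} (e : X ≅ Y) (h : U.dag e.hom = e.inv) : U.dag e.inv = e.hom := by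
  rw [← h, U.dag_dag]

theorem dag_whiskerLeft (X : C) {Y Z : C} (g : Y ⟶ Z) : U.dag (X ◁ g) = X ◁ U.dag g := by
  simpa using U.dag_tensor (𝟙 X) g

theorem dag_whiskerRight {Y Z : C} (g : Y ⟶ Z) (X : C) : U.dag (g ▷ X) = U.dag g ▷ X := by
  simpa using U.dag_tensor g (𝟙 X)

end UnitaryStructure

variable {C : Type u} [Category.{v} C] [Preadditive C] [Linear ℂ C] [MonoidalCategory C]
  [MonoidalPreadditive C] [MonoidalLinear ℂ C] [BraidedCategory C] [RigidCategory C]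
  [RibbonStructure C] (U : UnitaryStructure C)

theorem dag_crossAssoc {A₁ A₂ B₁ B₂ : C} (φ : A₂ ⊗ A₁ ≅ B₂ ⊗ B₁) (hφ : U.dag φ.hom = φ.inv)
    (X Y Z : C) : U.dag (crossAssoc φ.hom X Y Z) = crossAssocInv φ.inv X Y Z := by
  simp only [crossAssoc, crossAssocInv, U.dag_comp, U.dag_whiskerLeft, U.dag_whiskerRight,
    U.dag_associator, U.dag_inv _ (U.dag_associator _ _ _), U.dag_inv _ (U.dag_braiding _ _), hφ, assoc]

variable (f : C) [SelfFermionic f] [FermionicTwist f]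

theorem conj_zW (σ τ ρ : Bool) : starRingEnd ℂ (zW σ τ ρ) = (zW σ τ ρ)⁻¹ := by
  rw [zW]; split_ifs <;> simp

theorem conj_zB (σ τ : Bool) : starRingEnd ℂ (zB σ τ) = (zB σ τ)⁻¹ := by
  rw [zB]
  split_ifs
  · rw [← Complex.exp_conj, ← Complex.exp_neg]
    congr 1
    simp [Complex.conj_ofReal, neg_div, map_ofNat]
  · simp

/-- The unitary structure of the zested category. -/
def zestUnitary : UnitaryStructure (Zest f) where
  dag {X Y} g := U.dag (X := X.obj) (Y := Y.obj) g
  dag_dag g := U.dag_dag _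
  dag_comp g h := U.dag_comp _ _
  dag_add g h := U.dag_add _ _
  dag_smul z g := U.dag_smul _ _
  dag_pos g h := U.dag_pos _ h
  dag_tensor {X Y X' Y'} g h := by
    change U.dag (Zest.tHom g h) = Zest.tHom (U.dag (X := X.obj) (Y := Y.obj) g) (U.dag (X := X'.obj) (Y := Y'.obj) h)
    rw [Zest.tHom, U.dag_tensor, U.dag_tensor, Zest.tHom]
    congr 1
    rw [zAlphaMap, zAlphaMap]
    by_cases h1 : X.deg = Y.deg
    · by_cases h2 : X'.deg = Y'.deg
      · have h3 : ∀ {A B : C} (e : A = B), U.dag (eqToHom e) = eqToHom e.symm := by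
          rintro A B rfl; simp
        rw [dif_pos ⟨h1, h2⟩, dif_pos ⟨h1.symm, h2.symm⟩, h3]
      · rw [dif_neg (by tauto), dif_neg (by tauto), U.dag_zero]
    · rw [dif_neg (by tauto), dif_neg (by tauto), U.dag_zero]
  dag_associator X Y Z := by
    have hφ : U.dag (zCocycle f X.deg Y.deg Z.deg).hom = (zCocycle f X.deg Y.deg Z.deg).inv := by
      obtain ⟨⟨X, σ, hX⟩⟩ := X
      obtain ⟨⟨Y, τ, hY⟩⟩ := Y
      obtain ⟨⟨Z, ρ, hZ⟩⟩ := Z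
      cases σ <;> cases τ <;> cases ρ
      case true.true.false =>
        change U.dag ((λ_ f).hom ≫ (ρ_ f).inv) = (ρ_ f).hom ≫ (λ_ f).inv
        rw [U.dag_comp, U.dag_inv _ (U.dag_rightUnitor _), U.dag_leftUnitor]
      case false.true.true =>
        change U.dag ((ρ_ f).hom ≫ (λ_ f).inv) = (λ_ f).hom ≫ (ρ_ f).inv
        rw [U.dag_comp, U.dag_inv _ (U.dag_leftUnitor _), U.dag_rightUnitor]
      all_goals exact U.dag_id _
    refine (U.dag_smul (zW X.deg Y.deg Z.deg) (crossAssoc _ _ _ _)).trans ?_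
    rw [dag_crossAssoc U _ hφ, conj_zW]
    rfl
  dag_leftUnitor X := by
    obtain ⟨⟨X, σ, hX⟩⟩ := X
    have h : ∀ (e : 𝟙_ C ≅ 𝟙_ C) , e = Iso.refl _ → U.dag ((e.hom ⊗ₘ (λ_ X).hom) ≫ (λ_ X).hom) = (λ_ X).inv ≫ (e.inv ⊗ₘ (λ_ X).inv) := by
      rintro e rfl
      rw [U.dag_comp, U.dag_tensor, U.dag_leftUnitor, Iso.refl_hom, U.dag_id, Iso.refl_inv]
    cases σ <;> exact h _ rfl
  dag_rightUnitor X := by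
    obtain ⟨⟨X, σ, hX⟩⟩ := X
    have h : ∀ (e : 𝟙_ C ≅ 𝟙_ C) , e = Iso.refl _ → U.dag ((e.hom ⊗ₘ (ρ_ X).hom) ≫ (λ_ X).hom) = (λ_ X).inv ≫ (e.inv ⊗ₘ (ρ_ X).inv) := by
      rintro e rfl
      rw [U.dag_comp, U.dag_tensor, U.dag_leftUnitor, U.dag_rightUnitor, Iso.refl_hom, U.dag_id, Iso.refl_inv]
    cases σ <;> exact h _ rfl
  dag_braiding X Y := by
    obtain ⟨⟨X, σ, hX⟩⟩ := X
    obtain ⟨⟨Y, τ, hY⟩⟩ := Y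
    have h : ∀ a : C, U.dag (zB σ τ • (𝟙 a ⊗ₘ (β_ X Y).hom)) = (zB σ τ)⁻¹ • (𝟙 a ⊗ₘ (β_ X Y).inv) := by
      intro a
      rw [U.dag_smul, U.dag_tensor, U.dag_id, U.dag_braiding, conj_zB]
    cases σ <;> cases τ <;> exact h _
  dag_twist X := by
    refine (U.dag_smul _ _).trans ?_
    rw [U.dag_twist, conj_zB]
    rfl

end UnitaryZest

end

/-! ### The additive envelope; coded index types keep it in the universe of the original category.
-/

section

open BraidedCategory
/-- Codes for finite index types, closed under products. -/
inductive Idx : Type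
  | one : Idx
  | fin (n : ℕ) : Idx
  | prod (a b : Idx) : Idx

/-- The finite type with a given code. -/
@[reducible]
def Idx.El : Idx → Type
  | one => Unit
  | fin n => Fin n
  | prod a b => a.El × b.El

instance Idx.fintype : ∀ a : Idx, Fintype a.El
  | one => inferInstanceAs (Fintype Unit)
  | fin n => inferInstanceAs (Fintype (Fin n))
  | prod a b =>
    let := Idx.fintype a
    let := Idx.fintype b
    inferInstanceAs (Fintype (a.El × b.El))

instance Idx.decidableEq : ∀ a : Idx, DecidableEq a.El
  | one => inferInstanceAs (DecidableEq Unit)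
  | fin n => inferInstanceAs (DecidableEq (Fin n))
  | prod a b =>
    let := Idx.decidableEq a
    let := Idx.decidableEq b
    inferInstanceAs (DecidableEq (a.El × b.El))

/-- Finite families of objects: the additive envelope, with coded index types. -/
structure Fam (G : Type u) where
  idx : Idx
  obj : idx.El → G

namespace Fam

section Basic

variable {G : Type u} [Category.{v} G] [Preadditive G]

instance : Category.{v} (Fam G) where
  Hom M N := ∀ i j, M.obj i ⟶ N.obj j
  id M i j := if h : i = j then eqToHom (by rw [h]) else 0
  comp F H i k := ∑ j, F i j ≫ H j k
  id_comp {M N} F := by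
    funext i k
    rw [Finset.sum_eq_single i]
    · simp
    · intro j _ h; exact (congrArg (· ≫ _) (dif_neg h.symm)).trans zero_comp
    · simp
  comp_id {M N} F := by
    funext i k
    rw [Finset.sum_eq_single k]
    · simp
    · intro j _ h; exact (congrArg (_ ≫ ·) (dif_neg h)).trans comp_zero
    · simp
  assoc F H K := by
    funext i l
    simp only [Preadditive.sum_comp, Preadditive.comp_sum, assoc]
    rw [Finset.sum_comm]

theorem hom_ext {M N : Fam G} {F H : M ⟶ N} (h : ∀ i j, F i j = H i j) : F = H :=
  funext fun i => funext fun j => h i j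

theorem comp_apply {M N P : Fam G} (F : M ⟶ N) (H : N ⟶ P) (i : M.idx.El) (k : P.idx.El) :
    (F ≫ H) i k = ∑ j, F i j ≫ H j k := rfl

theorem id_apply (M : Fam G) (i j : M.idx.El) :
    (𝟙 M : M ⟶ M) i j = if h : i = j then eqToHom (by rw [h]) else 0 := rfl

@[simp]
theorem id_apply_self (M : Fam G) (i : M.idx.El) : (𝟙 M : M ⟶ M) i i = 𝟙 _ := by
  rw [id_apply, dif_pos rfl, eqToHom_refl]

theorem id_apply_of_ne (M : Fam G) {i j : M.idx.El} (h : i ≠ j) : (𝟙 M : M ⟶ M) i j = 0 := by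
  rw [id_apply, dif_neg h]

instance : Preadditive (Fam G) where
  homGroup M N := inferInstanceAs (AddCommGroup (∀ i j, M.obj i ⟶ N.obj j))
  add_comp _ _ _ F F' H := hom_ext fun i k => by
    change ∑ j, (F i j + F' i j) ≫ H j k = ∑ j, F i j ≫ H j k + ∑ j, F' i j ≫ H j k
    simp [Finset.sum_add_distrib]
  comp_add _ _ _ F H H' := hom_ext fun i k => by
    change ∑ j, F i j ≫ (H j k + H' j k) = ∑ j, F i j ≫ H j k + ∑ j, F i j ≫ H' j k
    simp [Finset.sum_add_distrib]

theorem add_apply {M N : Fam G} (F H : M ⟶ N) (i : M.idx.El) (j : N.idx.El) :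
    (F + H) i j = F i j + H i j := rfl

instance [Linear ℂ G] : Linear ℂ (Fam G) where
  homModule M N := inferInstanceAs (Module ℂ (∀ i j, M.obj i ⟶ N.obj j))
  smul_comp _ _ _ z F H := hom_ext fun i k => by
    change ∑ j, (z • F i j) ≫ H j k = z • ∑ j, F i j ≫ H j k
    simp [Finset.smul_sum]
  comp_smul _ _ _ F z H := hom_ext fun i k => by
    change ∑ j, F i j ≫ (z • H j k) = z • ∑ j, F i j ≫ H j k
    simp [Finset.smul_sum]

theorem smul_apply [Linear ℂ G] {M N : Fam G} (z : ℂ) (F : M ⟶ N) (i : M.idx.El) (j : N.idx.El) :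
    (z • F) i j = z • F i j := rfl

/-- The morphism along a bijection of the index types. -/
def diag {M N : Fam G} (e : M.idx.El → N.idx.El) (g : ∀ i, M.obj i ⟶ N.obj (e i)) : M ⟶ N :=
  fun i j => if h : e i = j then g i ≫ eqToHom (by rw [h]) else 0

/-- The morphism backwards along a bijection of the index types. -/
def codiag {M N : Fam G} (e : M.idx.El → N.idx.El) (g : ∀ i, N.obj (e i) ⟶ M.obj i) : N ⟶ M :=
  fun j i => if h : e i = j then eqToHom (by rw [h]) ≫ g i else 0

section

variable {M N : Fam G} (e : M.idx.El → N.idx.El)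

theorem diag_apply_self (g : ∀ i, M.obj i ⟶ N.obj (e i)) (i : M.idx.El) :
    diag e g i (e i) = g i := by
  simp [diag]

theorem diag_apply_of_ne (g : ∀ i, M.obj i ⟶ N.obj (e i)) {i : M.idx.El} {j : N.idx.El}
    (h : e i ≠ j) : diag e g i j = 0 := by
  simp [diag, h]

theorem codiag_apply_self (g : ∀ i, N.obj (e i) ⟶ M.obj i) (i : M.idx.El) :
    codiag e g (e i) i = g i := by
  simp [codiag]

theorem codiag_apply_of_ne (g : ∀ i, N.obj (e i) ⟶ M.obj i) {i : M.idx.El} {j : N.idx.El}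
    (h : e i ≠ j) : codiag e g j i = 0 := by
  simp [codiag, h]

theorem diag_comp_apply (g : ∀ i, M.obj i ⟶ N.obj (e i)) {P : Fam G} (F : N ⟶ P) (i : M.idx.El)
    (k : P.idx.El) : (diag e g ≫ F) i k = g i ≫ F (e i) k := by
  rw [comp_apply, Finset.sum_eq_single (e i)]
  · rw [diag_apply_self]
  · intro j _ h; rw [diag_apply_of_ne _ _ h.symm, zero_comp]
  · simp

theorem comp_diag_apply (he : Function.Injective e) (g : ∀ i, M.obj i ⟶ N.obj (e i)) {P : Fam G} (F : P ⟶ M) (k : P.idx.El)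
    (i : M.idx.El) : (F ≫ diag e g) k (e i) = F k i ≫ g i := by
  rw [comp_apply, Finset.sum_eq_single i]
  · rw [diag_apply_self]
  · intro j _ h; rw [diag_apply_of_ne _ _ (he.ne h), comp_zero]
  · simp

theorem codiag_comp_apply (he : Function.Injective e) (g : ∀ i, N.obj (e i) ⟶ M.obj i) {P : Fam G} (F : M ⟶ P) (i : M.idx.El)
    (k : P.idx.El) : (codiag e g ≫ F) (e i) k = g i ≫ F i k := by
  rw [comp_apply, Finset.sum_eq_single i]
  · rw [codiag_apply_self]
  · intro j _ h; rw [codiag_apply_of_ne _ _ (he.ne h), zero_comp]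
  · simp

/-- The isomorphism along a bijection of the index types. -/
@[simps]
def diagIso (he : Function.Bijective e) (g : ∀ i, M.obj i ≅ N.obj (e i)) : M ≅ N where
  hom := diag e fun i => (g i).hom
  inv := codiag e fun i => (g i).inv
  hom_inv_id := hom_ext fun i j => by
    rw [diag_comp_apply]
    by_cases h : i = j
    · subst h; rw [codiag_apply_self]; simp
    · rw [codiag_apply_of_ne _ _ (he.1.ne (Ne.symm h)), id_apply_of_ne _ h, comp_zero]
  inv_hom_id := hom_ext fun i j => by
    obtain ⟨i, rfl⟩ := he.2 i
    rw [codiag_comp_apply _ he.1]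
    by_cases h : e i = j
    · subst h; rw [diag_apply_self]; simp
    · rw [diag_apply_of_ne _ _ h, id_apply_of_ne _ h, comp_zero]

/-- The structural isomorphisms of `Fam G` are generalized permutation matrices of this kind. With
`tHom_diag` and `diag_congr`, pentagon, triangle and hexagons reduce to those of `G`, entry by
entry. -/
theorem diag_comp_diag {P : Fam G} (e' : N.idx.El → P.idx.El) (g : ∀ i, M.obj i ⟶ N.obj (e i))
    (g' : ∀ i, N.obj i ⟶ P.obj (e' i)) :
    diag e g ≫ diag e' g' = diag (e' ∘ e) fun i => g i ≫ g' (e i) := by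
  refine hom_ext fun i k => ?_
  rw [diag_comp_apply]
  by_cases h : e' (e i) = k
  · subst h
    exact ((congrArg (g i ≫ ·) (diag_apply_self e' g' (e i)))).trans (diag_apply_self (e' ∘ e) (fun i => g i ≫ g' (e i)) i).symm
  · rw [diag_apply_of_ne _ _ h, diag_apply_of_ne _ _ (by exact h), comp_zero]

theorem id_eq_diag : 𝟙 M = diag (fun i => i) fun i => 𝟙 (M.obj i) := by
  refine hom_ext fun i j => ?_
  by_cases h : i = j
  · subst h; rw [id_apply_self]; exact (diag_apply_self (M := M) (N := M) (fun i => i) (fun i => 𝟙 (M.obj i)) i).symm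
  · rw [id_apply_of_ne _ h, diag_apply_of_ne _ _ (by exact h)]

theorem diag_congr {e e' : M.idx.El → N.idx.El} {g : ∀ i, M.obj i ⟶ N.obj (e i)}
    {g' : ∀ i, M.obj i ⟶ N.obj (e' i)}
    (h : ∀ i, ∃ h : e i = e' i, g i ≫ eqToHom (congrArg N.obj h) = g' i) :
    diag e g = diag e' g' := by
  obtain rfl : e = e' := funext fun i => (h i).1
  congr 1
  funext i
  obtain ⟨h1, h2⟩ := h i
  simpa using h2

end

end Basic

section Monoidal

variable {G : Type u} [Category.{v} G] [Preadditive G] [MonoidalCategory G]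
  [MonoidalPreadditive G]

/-- The tensor product of families. -/
abbrev tObj (M N : Fam G) : Fam G := ⟨.prod M.idx N.idx, fun p => M.obj p.1 ⊗ N.obj p.2⟩

/-- The tensor product of matrices. -/
def tHom {M M' N N' : Fam G} (F : M ⟶ M') (H : N ⟶ N') : tObj M N ⟶ tObj M' N' :=
  fun p q => F p.1 q.1 ⊗ₘ H p.2 q.2

theorem tHom_diag {M M' N N' : Fam G} (e : M.idx.El → M'.idx.El) (e' : N.idx.El → N'.idx.El)
    (g : ∀ i, M.obj i ⟶ M'.obj (e i)) (g' : ∀ i, N.obj i ⟶ N'.obj (e' i)) :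
    tHom (diag e g) (diag e' g') = diag (M := tObj M N) (N := tObj M' N') (fun p => (e p.1, e' p.2)) fun p => g p.1 ⊗ₘ g' p.2 := by
  refine hom_ext ?_
  rintro ⟨i, j⟩ ⟨i', j'⟩
  change diag e g i i' ⊗ₘ diag e' g' j j' = _
  by_cases h : e i = i'
  · by_cases h' : e' j = j'
    · subst h h'
      rw [diag_apply_self, diag_apply_self]
      exact (diag_apply_self (M := tObj M N) (N := tObj M' N') (fun p => (e p.1, e' p.2)) (fun p => g p.1 ⊗ₘ g' p.2) (i, j)).symm
    · rw [diag_apply_of_ne _ _ h']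
      refine (MonoidalPreadditive.tensor_zero _).trans (diag_apply_of_ne (M := tObj M N) (N := tObj M' N') (fun p => (e p.1, e' p.2)) (fun p => g p.1 ⊗ₘ g' p.2) (i := (i, j)) (j := (i', j')) ?_).symm
      exact fun h => h' (congrArg Prod.snd h)
  · rw [diag_apply_of_ne _ _ h]
    refine (MonoidalPreadditive.zero_tensor _).trans (diag_apply_of_ne (M := tObj M N) (N := tObj M' N') (fun p => (e p.1, e' p.2)) (fun p => g p.1 ⊗ₘ g' p.2) (i := (i, j)) (j := (i', j')) ?_).symm
    exact fun h' => h (congrArg Prod.fst h')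

theorem tHom_id (M N : Fam G) : tHom (𝟙 M) (𝟙 N) = 𝟙 (tObj M N) := by
  rw [id_eq_diag, id_eq_diag, id_eq_diag, tHom_diag]
  exact diag_congr fun i => ⟨rfl, (comp_id _).trans (id_tensorHom_id _ _)⟩

theorem tHom_comp {M M' M'' N N' N'' : Fam G} (F : M ⟶ M') (F' : M' ⟶ M'') (H : N ⟶ N')
    (H' : N' ⟶ N'') : tHom F H ≫ tHom F' H' = tHom (F ≫ F') (H ≫ H') := by
  refine hom_ext ?_
  rintro ⟨i, j⟩ ⟨i', j'⟩
  change ∑ p : M'.idx.El × N'.idx.El, (F i p.1 ⊗ₘ H j p.2) ≫ (F' p.1 i' ⊗ₘ H' p.2 j') =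
    (∑ k, F i k ≫ F' k i') ⊗ₘ (∑ k, H j k ≫ H' k j')
  rw [Fintype.sum_prod_type]
  simp only [sum_tensor, tensor_sum, tensorHom_comp_tensorHom]
  rw [Finset.sum_comm]

theorem prodAssoc_bijective (α β γ : Type) :
    Function.Bijective fun p : (α × β) × γ => (p.1.1, (p.1.2, p.2)) :=
  (Equiv.prodAssoc α β γ).bijective

theorem punitProd_bijective (α : Type) : Function.Bijective fun p : Unit × α => p.2 :=
  (Equiv.punitProd α).bijective

theorem prodPUnit_bijective (α : Type) : Function.Bijective fun p : α × Unit => p.1 :=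
  (Equiv.prodPUnit α).bijective

instance : MonoidalCategoryStruct (Fam G) where
  tensorObj := tObj
  tensorHom := tHom
  whiskerLeft M _ _ F := tHom (𝟙 M) F
  whiskerRight F M := tHom F (𝟙 M)
  tensorUnit := ⟨.one, fun _ => 𝟙_ G⟩
  associator M N P := diagIso (M := tObj (tObj M N) P) (N := tObj M (tObj N P)) (fun p => (p.1.1, (p.1.2, p.2))) (prodAssoc_bijective _ _ _) fun p => α_ (M.obj p.1.1) (N.obj p.1.2) (P.obj p.2)
  leftUnitor M := diagIso (M := tObj ⟨.one, fun _ => 𝟙_ G⟩ M) (N := M) (fun p => p.2) (punitProd_bijective _) fun p => λ_ (M.obj p.2)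
  rightUnitor M := diagIso (M := tObj M ⟨.one, fun _ => 𝟙_ G⟩) (N := M) (fun p => p.1) (prodPUnit_bijective _) fun p => ρ_ (M.obj p.1)

instance : MonoidalCategory (Fam G) :=
  MonoidalCategory.ofTensorHom
    (id_tensorHom_id := tHom_id)
    (id_tensorHom := fun _ _ _ _ => rfl)
    (tensorHom_id := fun _ _ => rfl)
    (tensorHom_comp_tensorHom := fun _ _ _ _ => tHom_comp _ _ _ _)
    (associator_naturality := fun F H K => by
      refine hom_ext ?_
      rintro ⟨⟨i, j⟩, k⟩ ⟨i', j', k'⟩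
      refine (comp_diag_apply (M := tObj (tObj _ _) _) (N := tObj _ (tObj _ _)) (fun p => (p.1.1, (p.1.2, p.2))) (prodAssoc_bijective _ _ _).1 _ _ _ ((i', j'), k')).trans
        (Eq.trans ?_ (diag_comp_apply (M := tObj (tObj _ _) _) (N := tObj _ (tObj _ _)) _ _ _ _ _).symm)
      exact associator_naturality _ _ _)
    (leftUnitor_naturality := fun F => by
      refine hom_ext ?_
      rintro ⟨⟨⟩, i⟩ j
      refine (comp_diag_apply (M := tObj ⟨.one, fun _ => 𝟙_ G⟩ _) (fun p => p.2) (punitProd_bijective _).1 _ _ _ (Unit.unit, j)).trans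
        (Eq.trans ?_ (diag_comp_apply (M := tObj ⟨.one, fun _ => 𝟙_ G⟩ _) _ _ _ _ _).symm)
      change ((𝟙 _ : (𝟙_ (Fam G)) ⟶ (𝟙_ (Fam G))) Unit.unit Unit.unit ⊗ₘ F i j) ≫ (λ_ _).hom = (λ_ _).hom ≫ F i j
      rw [id_apply_self]
      exact (congrArg (· ≫ (λ_ _).hom) (id_tensorHom (𝟙_ G) (F i j))).trans (leftUnitor_naturality _))
    (rightUnitor_naturality := fun F => by
      refine hom_ext ?_
      rintro ⟨i, ⟨⟩⟩ j
      refine (comp_diag_apply (M := tObj _ ⟨.one, fun _ => 𝟙_ G⟩) (fun p => p.1) (prodPUnit_bijective _).1 _ _ _ (j, Unit.unit)).trans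
        (Eq.trans ?_ (diag_comp_apply (M := tObj _ ⟨.one, fun _ => 𝟙_ G⟩) _ _ _ _ _).symm)
      change (F i j ⊗ₘ (𝟙 _ : (𝟙_ (Fam G)) ⟶ (𝟙_ (Fam G))) Unit.unit Unit.unit) ≫ (ρ_ _).hom = (ρ_ _).hom ≫ F i j
      rw [id_apply_self]
      exact (congrArg (· ≫ (ρ_ _).hom) (tensorHom_id (F i j) (𝟙_ G))).trans (rightUnitor_naturality _))
    (pentagon := fun M N P Q => by
      change tHom (diag _ _) (𝟙 _) ≫ diag _ _ ≫ tHom (𝟙 _) (diag _ _) = diag _ _ ≫ diag _ _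
      rw [id_eq_diag, id_eq_diag, tHom_diag, tHom_diag, diag_comp_diag, diag_comp_diag, diag_comp_diag]
      refine diag_congr ?_
      rintro ⟨⟨⟨i, j⟩, k⟩, l⟩
      refine ⟨rfl, (comp_id _).trans ?_⟩
      change ((α_ _ _ _).hom ⊗ₘ 𝟙 _) ≫ (α_ _ _ _).hom ≫ (𝟙 _ ⊗ₘ (α_ _ _ _).hom) = (α_ _ _ _).hom ≫ (α_ _ _ _).hom
      simp)
    (triangle := fun M N => by
      change diag _ _ ≫ tHom (𝟙 _) (diag _ _) = tHom (diag _ _) (𝟙 _)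
      rw [id_eq_diag, id_eq_diag, tHom_diag, tHom_diag, diag_comp_diag]
      refine diag_congr ?_
      rintro ⟨⟨i, ⟨⟩⟩, k⟩
      refine ⟨rfl, (comp_id _).trans ?_⟩
      change (α_ _ _ _).hom ≫ (𝟙 _ ⊗ₘ (λ_ _).hom) = ((ρ_ _).hom ⊗ₘ 𝟙 _)
      simp)

end Monoidal

end Fam

end

/-! ### Braiding, duals, twist and unitary structure on the additive envelope. -/

section

open BraidedCategory
namespace Fam

section Monoidal

variable {G : Type u} [Category.{v} G] [Preadditive G] [MonoidalCategory G]
  [MonoidalPreadditive G]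

instance : MonoidalPreadditive (Fam G) where
  whiskerLeft_zero := hom_ext fun i j => MonoidalPreadditive.tensor_zero _
  zero_whiskerRight := hom_ext fun i j => MonoidalPreadditive.zero_tensor _
  whiskerLeft_add F H := hom_ext fun i j => MonoidalPreadditive.tensor_add _ _ _
  add_whiskerRight F H := hom_ext fun i j => MonoidalPreadditive.add_tensor _ _ _

theorem prodComm_bijective (α β : Type) : Function.Bijective fun p : α × β => (p.2, p.1) :=
  (Equiv.prodComm α β).bijective

instance [Linear ℂ G] [MonoidalLinear ℂ G] : MonoidalLinear ℂ (Fam G) where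
  whiskerLeft_smul M N P z F := hom_ext fun i j => by
    change (𝟙 M : M ⟶ M) i.1 j.1 ⊗ₘ (z • F i.2 j.2) = z • ((𝟙 M : M ⟶ M) i.1 j.1 ⊗ₘ F i.2 j.2)
    simp [MonoidalCategory.tensorHom_def]
  smul_whiskerRight z M N F P := hom_ext fun i j => by
    change (z • F i.1 j.1) ⊗ₘ (𝟙 P : P ⟶ P) i.2 j.2 = z • (F i.1 j.1 ⊗ₘ (𝟙 P : P ⟶ P) i.2 j.2)
    simp [MonoidalCategory.tensorHom_def]

section

variable [BraidedCategory G]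

/-- Inverses are defined through `codiag`; in the form `diag` they become accessible to the calculus
used for the second hexagon. -/
theorem associator_inv_eq (M N P : Fam G) : (α_ M N P).inv =
    diag (M := tObj M (tObj N P)) (N := tObj (tObj M N) P) (fun q => ((q.1, q.2.1), q.2.2))
      fun q => (α_ (M.obj q.1) (N.obj q.2.1) (P.obj q.2.2)).inv := by
  rw [← cancel_epi (α_ M N P).hom, Iso.hom_inv_id]
  symm
  change diag (M := tObj (tObj M N) P) (N := tObj M (tObj N P)) _ _ ≫ diag _ _ = 𝟙 _
  rw [diag_comp_diag, id_eq_diag]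
  refine diag_congr ?_
  rintro ⟨⟨i, j⟩, k⟩
  exact ⟨rfl, (comp_id _).trans (Iso.hom_inv_id _)⟩

theorem braiding_naturality_aux {M M' N N' : Fam G} (F : M ⟶ M') (H : N ⟶ N') :
    tHom F H ≫ diag (M := tObj M' N') (N := tObj N' M') (fun p => (p.2, p.1)) (fun p => (β_ (M'.obj p.1) (N'.obj p.2)).hom) =
      diag (M := tObj M N) (N := tObj N M) (fun p => (p.2, p.1)) (fun p => (β_ (M.obj p.1) (N.obj p.2)).hom) ≫ tHom H F := by
  refine hom_ext ?_
  rintro ⟨i, j⟩ ⟨j', i'⟩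
  refine (comp_diag_apply (M := tObj M' N') (N := tObj N' M') (fun p => (p.2, p.1)) (prodComm_bijective _ _).1 _ _ _ (i', j')).trans
    (Eq.trans ?_ (diag_comp_apply (M := tObj M N) (N := tObj N M) _ _ _ _ _).symm)
  exact BraidedCategory.braiding_naturality _ _

instance : BraidedCategory (Fam G) where
  braiding M N := diagIso (M := tObj M N) (N := tObj N M) (fun p => (p.2, p.1))
    (prodComm_bijective _ _) fun p => β_ (M.obj p.1) (N.obj p.2)
  braiding_naturality_left F P := braiding_naturality_aux F (𝟙 P)
  braiding_naturality_right M _ _ F := braiding_naturality_aux (𝟙 M) F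
  hexagon_forward M N P := by
    change diag _ _ ≫ diag _ _ ≫ diag _ _ = tHom (diag _ _) (𝟙 _) ≫ diag _ _ ≫ tHom (𝟙 _) (diag _ _)
    rw [id_eq_diag, id_eq_diag, tHom_diag, tHom_diag, diag_comp_diag, diag_comp_diag, diag_comp_diag, diag_comp_diag]
    refine diag_congr ?_
    rintro ⟨⟨i, j⟩, k⟩
    refine ⟨rfl, (comp_id _).trans ?_⟩
    change (α_ _ _ _).hom ≫ (β_ _ _).hom ≫ (α_ _ _ _).hom = ((β_ _ _).hom ⊗ₘ 𝟙 _) ≫ (α_ _ _ _).hom ≫ (𝟙 _ ⊗ₘ (β_ _ _).hom)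
    rw [tensorHom_id, id_tensorHom]
    exact BraidedCategory.hexagon_forward _ _ _
  hexagon_reverse M N P := by
    rw [associator_inv_eq, associator_inv_eq, associator_inv_eq]
    change diag _ _ ≫ diag _ _ ≫ diag _ _ = tHom (𝟙 _) (diag _ _) ≫ diag _ _ ≫ tHom (diag _ _) (𝟙 _)
    rw [id_eq_diag, id_eq_diag, tHom_diag, tHom_diag, diag_comp_diag, diag_comp_diag, diag_comp_diag, diag_comp_diag]
    refine diag_congr ?_
    rintro ⟨i, j, k⟩
    refine ⟨rfl, (comp_id _).trans ?_⟩
    change (α_ _ _ _).inv ≫ (β_ _ _).hom ≫ (α_ _ _ _).inv = (𝟙 _ ⊗ₘ (β_ _ _).hom) ≫ (α_ _ _ _).inv ≫ ((β_ _ _).hom ⊗ₘ 𝟙 _)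
    rw [tensorHom_id, id_tensorHom]
    exact BraidedCategory.hexagon_reverse _ _ _

end

variable [RightRigidCategory G]

/-- The dual family. -/
abbrev dual (M : Fam G) : Fam G := ⟨M.idx, fun i => (M.obj i)ᘁ⟩

/-- The coevaluation of a family. -/
def coev (M : Fam G) : 𝟙_ (Fam G) ⟶ tObj M (dual M) := fun _ p =>
  if h : p.1 = p.2 then η_ (M.obj p.1) _ ≫ M.obj p.1 ◁ (eqToHom (by rw [h]) : (M.obj p.1)ᘁ ⟶ (M.obj p.2)ᘁ) else 0

/-- The evaluation of a family. -/
def ev (M : Fam G) : tObj (dual M) M ⟶ 𝟙_ (Fam G) := fun p _ =>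
  if h : p.1 = p.2 then (M.obj p.1)ᘁ ◁ (eqToHom (by rw [h]) : M.obj p.2 ⟶ M.obj p.1) ≫ ε_ (M.obj p.1) _ else 0

theorem coev_apply_self (M : Fam G) (u : Unit) (i : M.idx.El) : coev M u (i, i) = η_ (M.obj i) _ := by
  simp [coev]

theorem coev_apply_of_ne (M : Fam G) (u : Unit) {i j : M.idx.El} (h : i ≠ j) : coev M u (i, j) = 0 := by
  simp [coev, h]

theorem ev_apply_self (M : Fam G) (u : Unit) (i : M.idx.El) : ev M (i, i) u = ε_ (M.obj i) _ := by
  simp [ev]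

theorem ev_apply_of_ne (M : Fam G) (u : Unit) {i j : M.idx.El} (h : i ≠ j) : ev M (i, j) u = 0 := by
  simp [ev, h]

theorem coev_tHom_comp_apply (M N P : Fam G) (F : tObj (tObj M (dual M)) N ⟶ P) (u : Unit) (k : N.idx.El)
    (x : P.idx.El) : (tHom (coev M) (𝟙 N) ≫ F) (u, k) x = ∑ i, (η_ (M.obj i) _ ▷ N.obj k) ≫ F ((i, i), k) x := by
  change ∑ p : (M.idx.El × M.idx.El) × N.idx.El, (coev M u p.1 ⊗ₘ (𝟙 N : N ⟶ N) k p.2) ≫ F p x = _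
  rw [Fintype.sum_prod_type, Fintype.sum_prod_type]
  refine Finset.sum_congr rfl fun i _ => ?_
  rw [Finset.sum_eq_single i]
  · rw [Finset.sum_eq_single k]
    · rw [coev_apply_self, id_apply_self, tensorHom_id]
    · intro j _ h; rw [id_apply_of_ne _ h.symm, MonoidalPreadditive.tensor_zero, zero_comp]
    · simp
  · intro j _ h
    refine Finset.sum_eq_zero fun k' _ => ?_
    rw [coev_apply_of_ne _ _ h.symm, MonoidalPreadditive.zero_tensor, zero_comp]
  · simp

theorem tHom_ev_apply (M N : Fam G) (F : N ⟶ dual M) (j : N.idx.El) (i : M.idx.El) (u : Unit) :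
    (tHom F (𝟙 M) ≫ ev M) (j, i) u = F j i ▷ M.obj i ≫ ε_ (M.obj i) _ := by
  change ∑ p : M.idx.El × M.idx.El, (F j p.1 ⊗ₘ (𝟙 M : M ⟶ M) i p.2) ≫ ev M p u = _
  rw [Fintype.sum_prod_type, Finset.sum_eq_single i]
  · rw [Finset.sum_eq_single i]
    · rw [ev_apply_self, id_apply_self, tensorHom_id]
    · intro j _ h; rw [id_apply_of_ne _ h.symm, MonoidalPreadditive.tensor_zero, zero_comp]
    · simp
  · intro k _ h
    rw [Finset.sum_eq_single i]
    · rw [ev_apply_of_ne _ _ h, comp_zero]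
    · intro j _ h; rw [id_apply_of_ne _ h.symm, MonoidalPreadditive.tensor_zero, zero_comp]
    · simp
  · simp

instance : RightRigidCategory (Fam G) where
  rightDual M :=
    { rightDual := dual M
      exact := exactPairingOfInjective M (dual M) (coev M) (ev M)
        (by
          refine hom_ext ?_
          rintro ⟨u, i⟩ ⟨i', u'⟩
          refine (coev_tHom_comp_apply M M _ _ u i _).trans ?_
          have h1 : ∀ a : M.idx.El, (diag (M := tObj (tObj M (dual M)) M) (N := tObj M (tObj (dual M) M)) (fun p => (p.1.1, (p.1.2, p.2))) (fun p => (α_ (M.obj p.1.1) ((M.obj p.1.2)ᘁ) (M.obj p.2)).hom) ≫ tHom (𝟙 M) (ev M)) ((a, a), i) (i', u') =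
              (α_ (M.obj a) ((M.obj a)ᘁ) (M.obj i)).hom ≫ ((𝟙 M : M ⟶ M) a i' ⊗ₘ ev M (a, i) u') := fun a => diag_comp_apply (M := tObj (tObj M (dual M)) M) (N := tObj M (tObj (dual M) M)) _ _ _ _ _
          refine (Finset.sum_congr rfl fun a _ => congrArg _ (h1 a)).trans ?_
          refine Eq.trans ?_ (diag_comp_apply (M := tObj ⟨.one, fun _ => 𝟙_ G⟩ M) (N := M) (fun p => p.2) (fun p => (λ_ (M.obj p.2)).hom) (P := tObj M ⟨.one, fun _ => 𝟙_ G⟩) (ρ_ M).inv (u, i) (i', u')).symm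
          -- Off the diagonal the evaluation vanishes, so a single summand remains and the zigzag is
          -- that of `M.obj i`.
          rw [Finset.sum_eq_single i]
          · by_cases h : i = i'
            · subst h
              rw [id_apply_self, ev_apply_self]
              refine Eq.trans ?_ (congrArg _ (codiag_apply_self (M := tObj M ⟨.one, fun _ => 𝟙_ G⟩) (N := M) (fun p => p.1) (fun p => (ρ_ (M.obj p.1)).inv) (i, u')).symm)
              rw [id_tensorHom]
              exact ExactPairing.evaluation_coevaluation _ _
            · rw [id_apply_of_ne _ h, MonoidalPreadditive.zero_tensor, comp_zero, comp_zero]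
              refine Eq.trans comp_zero.symm (congrArg _ (codiag_apply_of_ne (M := tObj M ⟨.one, fun _ => 𝟙_ G⟩) (N := M) (fun p => p.1) (fun p => (ρ_ (M.obj p.1)).inv) (Ne.symm h)).symm)
          · intro a _ h
            rw [ev_apply_of_ne _ _ h, MonoidalPreadditive.tensor_zero, comp_zero, comp_zero]
          · simp)
        (fun F F' h => hom_ext fun i j => by
          apply evaluation_cancel (X := M.obj j)
          have := congrFun (congrFun h (i, j)) Unit.unit
          exact ((tHom_ev_apply M _ F i j Unit.unit).symm.trans this).trans (tHom_ev_apply M _ F' i j Unit.unit)) }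

section

variable [BraidedCategory G]

instance : RigidCategory (Fam G) := BraidedCategory.rigidCategoryOfRightRigidCategory

end

end Monoidal

section Ribbon

variable {G : Type u} [Category.{v} G] [Preadditive G] [MonoidalCategory G]
  [MonoidalPreadditive G] [BraidedCategory G] [RigidCategory G] [RibbonStructure G]

open RibbonStructure

instance : RibbonStructure (Fam G) where
  twist M := diagIso (fun i => i) Function.bijective_id fun i => twist (M.obj i)
  twist_naturality {M N} F := hom_ext fun i j =>
    (comp_diag_apply (M := N) (N := N) (fun i => i) Function.injective_id _ _ _ _).trans
      ((twist_naturality (F i j)).trans (diag_comp_apply (M := M) (N := M) (fun i => i) (fun i => (twist (M.obj i)).hom) F i j).symm)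
  twist_tensor M N := by
    change diag _ _ = tHom (diag _ _) (diag _ _) ≫ diag _ _ ≫ diag _ _
    rw [tHom_diag, diag_comp_diag, diag_comp_diag]
    refine diag_congr ?_
    rintro ⟨i, j⟩
    exact ⟨rfl, (comp_id _).trans (twist_tensor _ _)⟩
  twist_dual M := by
    apply eq_rightAdjointMate
    refine hom_ext ?_
    rintro ⟨j, i⟩ u
    refine (tHom_ev_apply M (dual M) _ j i u).trans ?_
    change _ = (tHom (𝟙 (dual M)) (diag (M := M) (N := M) (fun i => i) fun i => (twist (M.obj i)).hom) ≫ ev M) (j, i) u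
    rw [id_eq_diag, tHom_diag]
    refine Eq.trans ?_ (diag_comp_apply (M := tObj (dual M) M) (N := tObj (dual M) M) _ _ _ _ _).symm
    change diag (M := dual M) (N := dual M) (fun i => i) (fun i => (twist ((M.obj i)ᘁ)).hom) j i ▷ _ ≫ _ = (𝟙 _ ⊗ₘ (twist (M.obj i)).hom) ≫ ev M (j, i) u
    rw [id_tensorHom]
    by_cases h : j = i
    · subst h
      rw [ev_apply_self]
      refine Eq.trans ?_ (twist_evaluation _ _)
      congr 2
      exact diag_apply_self (M := dual M) (N := dual M) _ _ _
    · refine Eq.trans ?_ ((congrArg (_ ≫ ·) (ev_apply_of_ne M u h)).trans comp_zero).symm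
      refine Eq.trans (congrArg (fun t => t ▷ M.obj i ≫ ε_ _ _) (diag_apply_of_ne (M := dual M) (N := dual M) _ _ h)) ?_
      rw [MonoidalPreadditive.zero_whiskerRight, zero_comp]

variable [Linear ℂ G]

/-- Strong positivity of a unitary structure: a sum of positive morphisms vanishes only if all of
them do. -/
def _root_.FermionicZesting.UnitaryStructure.IsPositive (U : UnitaryStructure G) : Prop :=
  ∀ {ι : Type} [Fintype ι] {X : G} (Y : ι → G) (g : ∀ i, X ⟶ Y i),
    ∑ i, g i ≫ U.dag (g i) = 0 → ∀ i, g i = 0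

variable (U : UnitaryStructure G)

/-- The adjoint of a matrix. -/
def dag {M N : Fam G} (F : M ⟶ N) : N ⟶ M := fun j i => U.dag (F i j)

theorem dag_sum {X Y : G} {ι : Type} (s : Finset ι) (g : ι → (X ⟶ Y)) :
    U.dag (∑ i ∈ s, g i) = ∑ i ∈ s, U.dag (g i) := by
  classical
  induction s using Finset.induction_on with
  | empty => simp
  | insert a s h ih => rw [Finset.sum_insert h, Finset.sum_insert h, U.dag_add, ih]

theorem dag_diag {M N : Fam G} (e : M.idx.El → N.idx.El) (g : ∀ i, M.obj i ⟶ N.obj (e i)) :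
    dag U (diag e g) = codiag e fun i => U.dag (g i) := by
  refine hom_ext fun j i => ?_
  by_cases h : e i = j
  · subst h
    rw [codiag_apply_self]
    exact congrArg U.dag (diag_apply_self _ _ _)
  · rw [codiag_apply_of_ne _ _ h]
    exact (congrArg U.dag (diag_apply_of_ne _ _ h)).trans (U.dag_zero)

theorem dag_diagIso {M N : Fam G} (e : M.idx.El → N.idx.El) (he : Function.Bijective e) (g : ∀ i, M.obj i ≅ N.obj (e i))
    (h : ∀ i, U.dag (g i).hom = (g i).inv) : dag U (diagIso e he g).hom = (diagIso e he g).inv := by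
  refine (dag_diag U _ _).trans ?_
  exact congrArg (codiag e) (funext h)

/-- The unitary structure of the category of families. -/
def unitary (hU : U.IsPositive) : UnitaryStructure (Fam G) where
  dag := dag U
  dag_dag F := hom_ext fun i j => U.dag_dag _
  dag_comp F H := hom_ext fun i k => by
    change U.dag (∑ j, F k j ≫ H j i) = ∑ j, U.dag (H j i) ≫ U.dag (F k j)
    rw [dag_sum]
    simp only [U.dag_comp]
  dag_add F H := hom_ext fun i j => U.dag_add _ _
  dag_smul z F := hom_ext fun i j => U.dag_smul _ _
  dag_tensor F H := hom_ext fun i j => U.dag_tensor _ _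
  dag_associator M N P := dag_diagIso U _ _ _ fun i => U.dag_associator _ _ _
  dag_leftUnitor M := dag_diagIso U _ _ _ fun i => U.dag_leftUnitor _
  dag_rightUnitor M := dag_diagIso U _ _ _ fun i => U.dag_rightUnitor _
  dag_braiding M N := dag_diagIso U _ _ _ fun i => U.dag_braiding _ _
  dag_twist M := dag_diagIso U (M := M) (N := M) (fun i => i) Function.bijective_id
    (fun i => twist (M.obj i)) fun i => U.dag_twist (M.obj i)
  -- The entry (i, i) of F F† is the sum over j of F_ij F_ij†. Definiteness for single morphisms
  -- would not suffice here.
  dag_pos {M N} F h := hom_ext fun i j =>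
    hU (fun j => N.obj j) (fun j => F i j) (congrFun (congrFun h i) i) j

end Ribbon


end Fam

end

/-! ### Additive extension of functors to the envelope. -/

section

open BraidedCategory
namespace Fam

section Extend

variable {G : Type u} [Category.{v} G] [Preadditive G] {D : Type u₂} [Category.{v₂} D]
  [Preadditive D] [HasFiniteBiproducts D] (K : G ⥤ D) [K.Additive]

/-- The additive extension of a functor to families. -/
def extend : Fam G ⥤ D where
  obj M := ⨁ fun i => K.obj (M.obj i)
  map F := biproduct.matrix fun i j => K.map (F i j)
  map_id M := by
    refine biproduct.hom_ext' _ _ fun i => biproduct.hom_ext _ _ fun j => ?_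
    rw [assoc, biproduct.matrix_π, biproduct.ι_desc, comp_id, biproduct.ι_π]
    by_cases h : i = j
    · subst h; simp
    · rw [id_apply_of_ne _ h, dif_neg h, K.map_zero]
  map_comp F H := by
    refine biproduct.hom_ext' _ _ fun i => biproduct.hom_ext _ _ fun j => ?_
    simp only [assoc, biproduct.matrix_π, biproduct.ι_desc, biproduct.ι_matrix_assoc,
      biproduct.lift_desc, comp_apply, K.map_sum, K.map_comp]

/-- The inclusion of a summand. -/
def ι (M : Fam G) (i : M.idx.El) : K.obj (M.obj i) ⟶ (extend K).obj M :=
  biproduct.ι (fun i => K.obj (M.obj i)) i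

/-- The projection to a summand. -/
def π (M : Fam G) (i : M.idx.El) : (extend K).obj M ⟶ K.obj (M.obj i) :=
  biproduct.π (fun i => K.obj (M.obj i)) i

theorem ι_π_self (M : Fam G) (i : M.idx.El) : ι K M i ≫ π K M i = 𝟙 _ :=
  biproduct.ι_π_self _ i

theorem ι_π_self_assoc (M : Fam G) (i : M.idx.El) {Z : D} (h : K.obj (M.obj i) ⟶ Z) :
    ι K M i ≫ π K M i ≫ h = h := by
  rw [← assoc, ι_π_self, id_comp]

theorem ι_π_ne (M : Fam G) {i j : M.idx.El} (h : i ≠ j) : ι K M i ≫ π K M j = 0 :=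
  biproduct.ι_π_ne _ h

theorem ι_π_ne_assoc (M : Fam G) {i j : M.idx.El} (h : i ≠ j) {Z : D} (g : K.obj (M.obj j) ⟶ Z) :
    ι K M i ≫ π K M j ≫ g = 0 := by
  rw [← assoc, ι_π_ne _ _ h, zero_comp]

theorem total (M : Fam G) : ∑ i, π K M i ≫ ι K M i = 𝟙 _ := biproduct.total

variable {K}

theorem ι_ext {M : Fam G} {Z : D} {g h : (extend K).obj M ⟶ Z}
    (H : ∀ i, ι K M i ≫ g = ι K M i ≫ h) : g = h := biproduct.hom_ext' _ _ H

theorem π_ext {M : Fam G} {Z : D} {g h : Z ⟶ (extend K).obj M}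
    (H : ∀ i, g ≫ π K M i = h ≫ π K M i) : g = h := biproduct.hom_ext _ _ H

variable (K)

theorem ι_map_π {M N : Fam G} (F : M ⟶ N) (i : M.idx.El) (j : N.idx.El) :
    ι K M i ≫ (extend K).map F ≫ π K N j = K.map (F i j) := by
  change biproduct.ι _ i ≫ biproduct.matrix _ ≫ biproduct.π _ j = _
  rw [biproduct.matrix_π, biproduct.ι_desc]

theorem ι_map {M N : Fam G} (F : M ⟶ N) (i : M.idx.El) :
    ι K M i ≫ (extend K).map F = ∑ j, K.map (F i j) ≫ ι K N j := by
  rw [← comp_id ((extend K).map F), ← total, Preadditive.comp_sum, Preadditive.comp_sum]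
  simp only [← assoc]
  refine Finset.sum_congr rfl fun j _ => ?_
  rw [assoc (ι K M i), ι_map_π]

theorem ι_diag {M N : Fam G} (e : M.idx.El → N.idx.El) (g : ∀ i, M.obj i ⟶ N.obj (e i))
    (i : M.idx.El) : ι K M i ≫ (extend K).map (diag e g) = K.map (g i) ≫ ι K N (e i) := by
  rw [ι_map, Finset.sum_eq_single (e i)]
  · rw [diag_apply_self]
  · intro j _ h; rw [diag_apply_of_ne _ _ h.symm, K.map_zero, zero_comp]
  · simp

instance : (extend K).Additive where
  map_add {M N F H} := by
    refine ι_ext fun i => π_ext fun j => ?_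
    rw [Preadditive.comp_add, Preadditive.add_comp, assoc, assoc, assoc, ι_map_π, ι_map_π,
      ι_map_π, add_apply, K.map_add]

instance [Linear ℂ G] [Linear ℂ D] [K.Linear ℂ] : (extend K).Linear ℂ where
  map_smul {M N} F z := by
    refine ι_ext fun i => π_ext fun j => ?_
    rw [Linear.comp_smul, Linear.smul_comp, assoc, assoc, ι_map_π, ι_map_π, smul_apply,
      K.map_smul]

instance [K.Faithful] : (extend K).Faithful where
  map_injective {M N F H} h := hom_ext fun i j => K.map_injective (by
    rw [← ι_map_π, ← ι_map_π, h])

instance [K.Full] : (extend K).Full where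
  map_surjective {M N} F := ⟨fun i j => K.preimage (ι K M i ≫ F ≫ π K N j), by
    refine ι_ext fun i => π_ext fun j => ?_
    rw [assoc, ι_map_π, K.map_preimage, assoc]⟩

/-- Every object is a finite sum of objects in the image of `K`. -/
def _root_.FermionicZesting.IsDense {G : Type u} [Category.{v} G] {D : Type u₂} [Category.{v₂} D]
    [Preadditive D] [HasFiniteBiproducts D] (K : G ⥤ D) : Prop :=
  ∀ X : D, ∃ (n : ℕ) (S : Fin n → G), Nonempty ((⨁ fun i => K.obj (S i)) ≅ X)

variable {K} in
theorem extend_isEquivalence [K.Full] [K.Faithful] (h : IsDense K) :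
    (extend K).IsEquivalence where
  essSurj := ⟨fun X => by
    obtain ⟨n, S, e⟩ := h X
    exact ⟨⟨.fin n, S⟩, e⟩⟩

/-- The inclusion of one-element families. -/
@[simps]
def single (G : Type u) [Category.{v} G] [Preadditive G] : G ⥤ Fam G where
  obj X := ⟨.one, fun _ => X⟩
  map g := fun _ _ => g
  map_id X := hom_ext fun i j => (id_apply_self (⟨.one, fun _ => X⟩ : Fam G) i).symm
  map_comp g h := hom_ext fun i j => by
    change _ = ∑ j : Unit, g ≫ h
    simp

instance : (single G).Additive where
  map_add := rfl

instance [Linear ℂ G] : (single G).Linear ℂ where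
  map_smul _ _ := rfl

instance : (single G).Full where
  map_surjective F := ⟨F Unit.unit Unit.unit, rfl⟩

instance : (single G).Faithful where
  map_injective h := congrFun (congrFun h Unit.unit) Unit.unit

/-- The extension restricts to the given functor. -/
def singleExtend : single G ⋙ extend K ≅ K :=
  NatIso.ofComponents (fun X =>
    { hom := π K ((single G).obj X) Unit.unit
      inv := ι K ((single G).obj X) Unit.unit
      hom_inv_id := by
        have := total K ((single G).obj X)
        change ∑ i : Unit, _ = _ at this
        rw [Fintype.sum_unique] at this
        exact this
      inv_hom_id := ι_π_self K ((single G).obj X) Unit.unit }) (fun {X Y} g => by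
    refine ι_ext fun i => ?_
    refine (ι_map_π K ((single G).map g) i Unit.unit).trans ?_
    exact (ι_π_self_assoc K ((single G).obj X) i (K.map g)).symm)

variable [MonoidalCategory G] [MonoidalPreadditive G]

section

variable [MonoidalCategory D] [MonoidalPreadditive D]

theorem _root_.FermionicZesting.tensorHom_sum {X X' Y Y' : D} {J : Type} (s : Finset J) (g : X ⟶ X') (h : J → (Y ⟶ Y')) :
    g ⊗ₘ (∑ j ∈ s, h j) = ∑ j ∈ s, g ⊗ₘ h j := by
  simp only [MonoidalCategory.tensorHom_def, whiskerLeft_sum, Preadditive.comp_sum]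

theorem _root_.FermionicZesting.sum_tensorHom {X X' Y Y' : D} {J : Type} (s : Finset J) (g : X ⟶ X') (h : J → (Y ⟶ Y')) :
    (∑ j ∈ s, h j) ⊗ₘ g = ∑ j ∈ s, h j ⊗ₘ g := by
  simp only [MonoidalCategory.tensorHom_def, sum_whiskerRight, Preadditive.sum_comp]

variable {K} in
theorem whiskerLeft_ext {M : Fam G} {X Z : D} {g h : X ⊗ (extend K).obj M ⟶ Z}
    (H : ∀ i, X ◁ ι K M i ≫ g = X ◁ ι K M i ≫ h) : g = h := by
  have e : 𝟙 (X ⊗ (extend K).obj M) = ∑ i, X ◁ π K M i ≫ X ◁ ι K M i := by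
    simp only [← whiskerLeft_comp, ← whiskerLeft_sum, total, whiskerLeft_id]
  rw [← id_comp g, ← id_comp h, e]
  simp only [Preadditive.sum_comp, assoc, H]

variable {K} in
theorem whiskerRight_ext {M : Fam G} {X Z : D} {g h : (extend K).obj M ⊗ X ⟶ Z}
    (H : ∀ i, ι K M i ▷ X ≫ g = ι K M i ▷ X ≫ h) : g = h := by
  have e : 𝟙 ((extend K).obj M ⊗ X) = ∑ i, π K M i ▷ X ≫ ι K M i ▷ X := by
    simp only [← comp_whiskerRight, ← sum_whiskerRight, total, id_whiskerRight]
  rw [← id_comp g, ← id_comp h, e]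
  simp only [Preadditive.sum_comp, assoc, H]

variable {K} in
theorem tensor_ext {M N : Fam G} {Z : D}
    {g h : (extend K).obj M ⊗ (extend K).obj N ⟶ Z}
    (H : ∀ i j, (ι K M i ⊗ₘ ι K N j) ≫ g = (ι K M i ⊗ₘ ι K N j) ≫ h) :
    g = h := by
  refine whiskerRight_ext fun i => whiskerLeft_ext fun j => ?_
  have := H i j
  rwa [tensorHom_def', assoc, assoc] at this

variable {K} in
-- The form in which associativity of `extendμHom` is reduced to homogeneous summands: the identity
-- of a triple product is the sum of its projections onto tensor products of summands.
theorem tensor_ext₃ {M N P : Fam G} {Z : D}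
    {g h : ((extend K).obj M ⊗ (extend K).obj N) ⊗ (extend K).obj P ⟶ Z}
    (H : ∀ i j k, ((ι K M i ⊗ₘ ι K N j) ⊗ₘ ι K P k) ≫ g = ((ι K M i ⊗ₘ ι K N j) ⊗ₘ ι K P k) ≫ h) :
    g = h := by
  have e : 𝟙 (((extend K).obj M ⊗ (extend K).obj N) ⊗ (extend K).obj P) = ∑ i, ∑ j, ∑ k, ((π K M i ⊗ₘ π K N j) ⊗ₘ π K P k) ≫ ((ι K M i ⊗ₘ ι K N j) ⊗ₘ ι K P k) := by
    simp only [tensorHom_comp_tensorHom, ← tensorHom_sum, ← sum_tensorHom, total, id_tensorHom_id]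
  rw [← id_comp g, ← id_comp h, e]
  simp only [Preadditive.sum_comp, assoc, H]

variable [K.Monoidal]

open Functor.LaxMonoidal Functor.OplaxMonoidal

/-- The tensorator of the extension. -/
def extendμHom (M N : Fam G) : (extend K).obj M ⊗ (extend K).obj N ⟶ (extend K).obj (tObj M N) :=
  ∑ i, ∑ j, (π K M i ⊗ₘ π K N j) ≫ μ K _ _ ≫ ι K (tObj M N) (i, j)

theorem ι_extendμHom (M N : Fam G) (i : M.idx.El) (j : N.idx.El) :
    (ι K M i ⊗ₘ ι K N j) ≫ extendμHom K M N = μ K _ _ ≫ ι K (tObj M N) (i, j) := by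
  rw [extendμHom, Preadditive.comp_sum, Finset.sum_eq_single i]
  · rw [Preadditive.comp_sum, Finset.sum_eq_single j]
    · rw [tensorHom_comp_tensorHom_assoc, ι_π_self, ι_π_self, id_tensorHom_id, id_comp]
    · intro j' _ h
      rw [tensorHom_comp_tensorHom_assoc, ι_π_ne _ _ h.symm, MonoidalPreadditive.tensor_zero,
        zero_comp]
    · simp
  · intro i' _ h
    rw [Preadditive.comp_sum]
    refine Finset.sum_eq_zero fun j' _ => ?_
    rw [tensorHom_comp_tensorHom_assoc, ι_π_ne _ _ h.symm, MonoidalPreadditive.zero_tensor,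
        zero_comp]
  · simp

theorem ι_extendμHom_assoc (M N : Fam G) (i : M.idx.El) (j : N.idx.El) {Z : D}
    (h : (extend K).obj (tObj M N) ⟶ Z) :
    (ι K M i ⊗ₘ ι K N j) ≫ extendμHom K M N ≫ h = μ K _ _ ≫ ι K (tObj M N) (i, j) ≫ h := by
  rw [← assoc, ι_extendμHom, assoc]

/-- The tensorator of the extension. -/
def extendμ (M N : Fam G) : (extend K).obj M ⊗ (extend K).obj N ≅ (extend K).obj (M ⊗ N) where
  hom := extendμHom K M N
  inv := ∑ p : M.idx.El × N.idx.El, π K (tObj M N) p ≫ δ K _ _ ≫ (ι K M p.1 ⊗ₘ ι K N p.2)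
  hom_inv_id := by
    refine tensor_ext fun i j => ?_
    rw [ι_extendμHom_assoc, Preadditive.comp_sum, Preadditive.comp_sum,
      Finset.sum_eq_single (i, j)]
    · rw [ι_π_self_assoc, Functor.Monoidal.μ_δ_assoc, comp_id]
    · intro p _ h; rw [ι_π_ne_assoc _ _ h.symm, comp_zero]
    · simp
  inv_hom_id := by
    rw [Preadditive.sum_comp]
    refine Eq.trans (Finset.sum_congr rfl fun p _ => ?_) (total K (tObj M N))
    rw [assoc, assoc, ι_extendμHom, Functor.Monoidal.δ_μ_assoc]

theorem extendμ_natural {M M' N N' : Fam G} (F : M ⟶ M') (H : N ⟶ N') :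
    ((extend K).map F ⊗ₘ (extend K).map H) ≫ extendμHom K M' N' =
      extendμHom K M N ≫ (extend K).map (tHom F H) := by
  refine tensor_ext fun i j => ?_
  rw [tensorHom_comp_tensorHom_assoc, ι_extendμHom_assoc, ι_map, ι_map, ι_map, sum_tensorHom,
    Preadditive.comp_sum]
  refine Eq.trans ?_ (Fintype.sum_prod_type _).symm
  rw [Preadditive.sum_comp]
  refine Finset.sum_congr rfl fun k _ => ?_
  rw [tensorHom_sum, Preadditive.sum_comp]
  refine Finset.sum_congr rfl fun l _ => ?_
  rw [← tensorHom_comp_tensorHom, assoc, ι_extendμHom, μ_natural_assoc]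
  rfl

theorem extendμ_assoc (M N P : Fam G) :
    extendμHom K M N ▷ (extend K).obj P ≫ extendμHom K (tObj M N) P ≫ (extend K).map (α_ M N P).hom =
      (α_ _ _ _).hom ≫ (extend K).obj M ◁ extendμHom K N P ≫ extendμHom K M (tObj N P) := by
  refine tensor_ext₃ fun i j k => ?_
  rw [← tensorHom_id, ← id_tensorHom, tensorHom_comp_tensorHom_assoc, ι_extendμHom, comp_id,
    associator_naturality_assoc, tensorHom_comp_tensorHom_assoc, ι_extendμHom, comp_id]
  have e1 : μ K (M.obj i) (N.obj j) ≫ ι K (tObj M N) (i, j) ⊗ₘ ι K P k =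
    μ K _ _ ▷ _ ≫ (ι K (tObj M N) (i, j) ⊗ₘ ι K P k) := by
    rw [← tensorHom_id, tensorHom_comp_tensorHom, id_comp]
  have e2 : ι K M i ⊗ₘ μ K (N.obj j) (P.obj k) ≫ ι K (tObj N P) (j, k) =
    _ ◁ μ K _ _ ≫ (ι K M i ⊗ₘ ι K (tObj N P) (j, k)) := by
    rw [← id_tensorHom, tensorHom_comp_tensorHom, id_comp]
  rw [e1, e2, assoc, assoc, ι_extendμHom_assoc, ι_extendμHom]
  have e3 : ι K (tObj (tObj M N) P) ((i, j), k) ≫ (extend K).map (α_ M N P).hom =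
    K.map (α_ (M.obj i) (N.obj j) (P.obj k)).hom ≫ ι K (tObj M (tObj N P)) (i, (j, k)) :=
    ι_diag K (M := tObj (tObj M N) P) (N := tObj M (tObj N P)) _ _ ((i, j), k)
  rw [e3]
  exact associativity_assoc K _ _ _ _

/-- The inclusion of the summand of a one-element family. -/
def ι₁ (X : G) : K.obj X ⟶ (extend K).obj ((single G).obj X) := ι K ((single G).obj X) Unit.unit

theorem ι₁_extendμHom (X : G) (M : Fam G) (i : M.idx.El) :
    (ι₁ K X ⊗ₘ ι K M i) ≫ extendμHom K ((single G).obj X) M =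
      μ K _ _ ≫ ι K (tObj ((single G).obj X) M) (Unit.unit, i) :=
  ι_extendμHom K ((single G).obj X) M Unit.unit i

theorem ι_extendμHom_ι₁ (X : G) (M : Fam G) (i : M.idx.El) :
    (ι K M i ⊗ₘ ι₁ K X) ≫ extendμHom K M ((single G).obj X) =
      μ K _ _ ≫ ι K (tObj M ((single G).obj X)) (i, Unit.unit) :=
  ι_extendμHom K M ((single G).obj X) i Unit.unit

/-- The unit constraint of the extension. -/
def extendε : 𝟙_ D ≅ (extend K).obj ((single G).obj (𝟙_ G)) :=
  Functor.Monoidal.εIso K ≪≫ ((singleExtend K).app (𝟙_ G)).symm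

theorem extend_left_unit (M : Fam G) : (λ_ ((extend K).obj M)).hom =
    (ε K ≫ ι₁ K (𝟙_ G)) ▷ (extend K).obj M ≫
      extendμHom K ((single G).obj (𝟙_ G)) M ≫ (extend K).map (λ_ M).hom := by
  refine whiskerLeft_ext fun i => ?_
  rw [whisker_exchange_assoc, comp_whiskerRight, assoc, ← tensorHom_def_assoc, reassoc_of% (ι₁_extendμHom K (𝟙_ G) M i),
    leftUnitor_naturality, Functor.LaxMonoidal.left_unitality K, assoc, assoc]
  refine congrArg (_ ≫ ·) (Eq.trans ?_ (assoc _ _ _).symm)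
  refine congrArg (_ ≫ ·) ?_
  exact (ι_diag K (M := tObj ((single G).obj (𝟙_ G)) M) (N := M) (fun p => p.2) (fun p => (λ_ (M.obj p.2)).hom) (Unit.unit, i)).symm

theorem extend_right_unit (M : Fam G) : (ρ_ ((extend K).obj M)).hom =
    (extend K).obj M ◁ (ε K ≫ ι₁ K (𝟙_ G)) ≫
      extendμHom K M ((single G).obj (𝟙_ G)) ≫ (extend K).map (ρ_ M).hom := by
  refine whiskerRight_ext fun i => ?_
  rw [← whisker_exchange_assoc, whiskerLeft_comp, assoc, ← tensorHom_def'_assoc, reassoc_of% (ι_extendμHom_ι₁ K (𝟙_ G) M i),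
    rightUnitor_naturality, Functor.LaxMonoidal.right_unitality K, assoc, assoc]
  refine congrArg (_ ≫ ·) (Eq.trans ?_ (assoc _ _ _).symm)
  refine congrArg (_ ≫ ·) ?_
  exact (ι_diag K (M := tObj M ((single G).obj (𝟙_ G))) (N := M) (fun p => p.1) (fun p => (ρ_ (M.obj p.1)).hom) (i, Unit.unit)).symm

instance : (extend K).Monoidal := Functor.CoreMonoidal.toMonoidal
  { εIso := extendε K
    μIso := extendμ K
    μIso_hom_natural_left := fun {X Y} f X' => by
      have := extendμ_natural K f (𝟙 X')
      rw [(extend K).map_id, tensorHom_id] at this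
      exact this
    μIso_hom_natural_right := fun {X Y} X' f => by
      have := extendμ_natural K (𝟙 X') f
      rw [(extend K).map_id, id_tensorHom] at this
      exact this
    associativity := extendμ_assoc K
    left_unitality := extend_left_unit K
    right_unitality := extend_right_unit K }


end

/-- The extension of a braided functor is braided. -/
theorem extendμ_braiding [MonoidalCategory D] [MonoidalPreadditive D] [BraidedCategory G]
    [BraidedCategory D] [K.Braided] (M N : Fam G) :
    extendμHom K M N ≫ (extend K).map (β_ M N).hom = (β_ _ _).hom ≫ extendμHom K N M := by
  refine tensor_ext fun i j => ?_
  rw [ι_extendμHom_assoc, BraidedCategory.braiding_naturality_assoc, ι_extendμHom]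
  have h1 : ι K (tObj M N) (i, j) ≫ (extend K).map (β_ M N).hom =
    K.map (β_ (M.obj i) (N.obj j)).hom ≫ ι K (tObj N M) (j, i) :=
    ι_diag K (M := tObj M N) (N := tObj N M) (fun p => (p.2, p.1))
      (fun p => (β_ (M.obj p.1) (N.obj p.2)).hom) (i, j)
  rw [h1]
  exact (assoc _ _ _).symm.trans ((congrArg (· ≫ ι K (tObj N M) (j, i)) (Functor.LaxBraided.braided (F := K) (M.obj i) (N.obj j))).trans (assoc _ _ _))

instance [MonoidalCategory D] [MonoidalPreadditive D] [BraidedCategory G]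
    [BraidedCategory D] [K.Braided] : (extend K).Braided where
  braided M N := extendμ_braiding K M N

/-! ### The inclusion of one-element families as a braided functor. -/

theorem unit_bijective : Function.Bijective (fun _ : Unit × Unit => Unit.unit) :=
  ⟨fun _ _ _ => Subsingleton.elim _ _, fun _ => ⟨(Unit.unit, Unit.unit), rfl⟩⟩

/-- One-element families multiply. -/
def singleμ (X Y : G) : tObj ((single G).obj X) ((single G).obj Y) ≅ (single G).obj (X ⊗ Y) :=
  diagIso (M := tObj ((single G).obj X) ((single G).obj Y)) (N := (single G).obj (X ⊗ Y))
    (fun _ => Unit.unit) unit_bijective fun _ => Iso.refl _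

theorem singleμ_hom_apply (X Y : G) (p : Unit × Unit) (k : Unit) :
    (singleμ X Y).hom p k = 𝟙 (X ⊗ Y) :=
  diag_apply_self (M := tObj ((single G).obj X) ((single G).obj Y)) (N := (single G).obj (X ⊗ Y))
    (fun _ => Unit.unit) (fun _ => 𝟙 (X ⊗ Y)) p

theorem single_id_apply (X : G) (i j : Unit) :
    (𝟙 ((single G).obj X) : (single G).obj X ⟶ (single G).obj X) i j = 𝟙 X :=
  id_apply_self ((single G).obj X) i

theorem comp_apply_of_unique {M N P : Fam G} (F : M ⟶ N) (H : N ⟶ P) (i : M.idx.El) (k : P.idx.El)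
    (j : N.idx.El) (hj : ∀ j', j' = j) : (F ≫ H) i k = F i j ≫ H j k := by
  rw [comp_apply, Finset.sum_eq_single j]
  · intro j' _ h; exact absurd (hj j') h
  · simp

theorem singleμ_hom_comp_apply {X Y : G} {P : Fam G} (F : (single G).obj (X ⊗ Y) ⟶ P) (p : Unit × Unit) (k : P.idx.El) :
    ((singleμ X Y).hom ≫ F) p k = F Unit.unit k :=
  (diag_comp_apply (M := tObj ((single G).obj X) ((single G).obj Y)) (N := (single G).obj (X ⊗ Y))
    (fun _ => Unit.unit) (fun _ => 𝟙 (X ⊗ Y)) F p k).trans (id_comp _)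

theorem comp_singleμ_hom_apply {X Y : G} {P : Fam G} (F : P ⟶ tObj ((single G).obj X) ((single G).obj Y))
    (k : P.idx.El) (p : Unit) :
    (F ≫ (singleμ X Y).hom) k p = F k (Unit.unit, Unit.unit) :=
  (comp_diag_apply (M := tObj ((single G).obj X) ((single G).obj Y)) (N := (single G).obj (X ⊗ Y))
    (fun _ => Unit.unit) unit_bijective.1 (fun _ => 𝟙 (X ⊗ Y)) F k (Unit.unit, Unit.unit)).trans (comp_id _)

theorem tHom_id_single {M N : Fam G} (F : M ⟶ N) (Z : G) (i : M.idx.El) (j : N.idx.El) :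
    tHom F (𝟙 ((single G).obj Z)) (i, Unit.unit) (j, Unit.unit) = F i j ▷ Z :=
  (congrArg (F i j ⊗ₘ ·) (single_id_apply Z _ _)).trans (tensorHom_id _ _)

theorem single_id_tHom {M N : Fam G} (F : M ⟶ N) (Z : G) (i : M.idx.El) (j : N.idx.El) :
    tHom (𝟙 ((single G).obj Z)) F (Unit.unit, i) (Unit.unit, j) = Z ◁ F i j :=
  (congrArg (· ⊗ₘ F i j) (single_id_apply Z _ _)).trans (id_tensorHom _ _)

theorem tHom_singleμ_id (X Y Z : G) (p : (Unit × Unit) × Unit) (q : Unit × Unit) :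
    tHom (singleμ X Y).hom (𝟙 ((single G).obj Z)) p q = 𝟙 ((X ⊗ Y) ⊗ Z) :=
  (tHom_id_single (singleμ X Y).hom Z p.1 q.1).trans
    ((congrArg (· ▷ Z) (singleμ_hom_apply X Y _ _)).trans (id_whiskerRight _ _))

theorem tHom_id_singleμ (X Y Z : G) (p : Unit × (Unit × Unit)) (q : Unit × Unit) :
    tHom (𝟙 ((single G).obj X)) (singleμ Y Z).hom p q = 𝟙 (X ⊗ Y ⊗ Z) :=
  (single_id_tHom (singleμ Y Z).hom X p.2 q.2).trans
    ((congrArg (X ◁ ·) (singleμ_hom_apply Y Z _ _)).trans (MonoidalCategory.whiskerLeft_id _ _))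

instance : (single G).Monoidal := Functor.CoreMonoidal.toMonoidal
  { εIso := Iso.refl _
    μIso := singleμ
    μIso_hom_natural_left := fun {X Y} f X' => hom_ext fun p k => by
      have h1 := comp_singleμ_hom_apply (X := Y) (Y := X') ((single G).map f ▷ (single G).obj X') p k
      have h2 := singleμ_hom_comp_apply (X := X) (Y := X') ((single G).map (f ▷ X')) p k
      have h3 := tHom_id_single ((single G).map f) X' Unit.unit Unit.unit
      exact h1.trans (h3.trans h2.symm)
    μIso_hom_natural_right := fun {X Y} X' f => hom_ext fun p k => by
      have h1 := comp_singleμ_hom_apply (X := X') (Y := Y) ((single G).obj X' ◁ (single G).map f) p k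
      have h2 := singleμ_hom_comp_apply (X := X') (Y := X) ((single G).map (X' ◁ f)) p k
      have h3 := single_id_tHom ((single G).map f) X' Unit.unit Unit.unit
      exact h1.trans (h3.trans h2.symm)
    associativity := fun X Y Z => hom_ext fun p k => by
      have h1 := comp_apply_of_unique (M := tObj (tObj ((single G).obj X) ((single G).obj Y)) ((single G).obj Z))
        (N := tObj ((single G).obj (X ⊗ Y)) ((single G).obj Z)) (P := (single G).obj (X ⊗ Y ⊗ Z))
        ((singleμ X Y).hom ▷ (single G).obj Z) ((singleμ (X ⊗ Y) Z).hom ≫ (single G).map (α_ X Y Z).hom) p k (Unit.unit, Unit.unit) fun _ => rfl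
      have h2 := congrArg₂ (· ≫ ·) (tHom_singleμ_id X Y Z p (Unit.unit, Unit.unit))
        (singleμ_hom_comp_apply (X := X ⊗ Y) (Y := Z) ((single G).map (α_ X Y Z).hom) (Unit.unit, Unit.unit) k)
      have h3 := diag_comp_apply (M := tObj (tObj ((single G).obj X) ((single G).obj Y)) ((single G).obj Z))
        (N := tObj ((single G).obj X) (tObj ((single G).obj Y) ((single G).obj Z))) (P := (single G).obj (X ⊗ Y ⊗ Z))
        (fun p => (p.1.1, (p.1.2, p.2))) (fun p => (α_ X Y Z).hom) ((single G).obj X ◁ (singleμ Y Z).hom ≫ (singleμ X (Y ⊗ Z)).hom) p k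
      have h4 := congrArg ((α_ X Y Z).hom ≫ ·) ((comp_singleμ_hom_apply (X := X) (Y := Y ⊗ Z)
        ((single G).obj X ◁ (singleμ Y Z).hom) (Unit.unit, (Unit.unit, Unit.unit)) k).trans (tHom_id_singleμ X Y Z _ _))
      exact h1.trans (h2.trans ((id_comp _).trans (h3.trans (h4.trans (comp_id _))).symm))
    left_unitality := fun X => hom_ext fun p k => by
      have h1 := diag_apply_self (M := tObj ((single G).obj (𝟙_ G)) ((single G).obj X)) (N := (single G).obj X) (fun p => p.2) (fun p => (λ_ X).hom) p
      have h2 := comp_apply_of_unique (M := tObj ((single G).obj (𝟙_ G)) ((single G).obj X))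
        (N := tObj ((single G).obj (𝟙_ G)) ((single G).obj X)) (P := (single G).obj X)
        ((𝟙 ((single G).obj (𝟙_ G)) : (single G).obj (𝟙_ G) ⟶ (single G).obj (𝟙_ G)) ▷ (single G).obj X)
        ((singleμ (𝟙_ G) X).hom ≫ (single G).map (λ_ X).hom) p k (Unit.unit, Unit.unit) fun _ => rfl
      have h3 := congrArg₂ (· ≫ ·) ((tHom_id_single (𝟙 ((single G).obj (𝟙_ G))) X Unit.unit Unit.unit).trans
        ((congrArg (· ▷ X) (single_id_apply (𝟙_ G) _ _)).trans (id_whiskerRight _ _)))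
        (singleμ_hom_comp_apply (X := 𝟙_ G) (Y := X) ((single G).map (λ_ X).hom) p k)
      exact h1.trans (h2.trans (h3.trans (id_comp _))).symm
    right_unitality := fun X => hom_ext fun p k => by
      have h1 := diag_apply_self (M := tObj ((single G).obj X) ((single G).obj (𝟙_ G))) (N := (single G).obj X) (fun p => p.1) (fun p => (ρ_ X).hom) p
      have h2 := comp_apply_of_unique (M := tObj ((single G).obj X) ((single G).obj (𝟙_ G)))
        (N := tObj ((single G).obj X) ((single G).obj (𝟙_ G))) (P := (single G).obj X)
        ((single G).obj X ◁ (𝟙 ((single G).obj (𝟙_ G)) : (single G).obj (𝟙_ G) ⟶ (single G).obj (𝟙_ G)))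
        ((singleμ X (𝟙_ G)).hom ≫ (single G).map (ρ_ X).hom) p k (Unit.unit, Unit.unit) fun _ => rfl
      have h3 := congrArg₂ (· ≫ ·) ((single_id_tHom (𝟙 ((single G).obj (𝟙_ G))) X Unit.unit Unit.unit).trans
        ((congrArg (X ◁ ·) (single_id_apply (𝟙_ G) _ _)).trans (MonoidalCategory.whiskerLeft_id _ _)))
        (singleμ_hom_comp_apply (X := X) (Y := 𝟙_ G) ((single G).map (ρ_ X).hom) p k)
      exact h1.trans (h2.trans (h3.trans (id_comp _))).symm }

instance [BraidedCategory G] : (single G).Braided where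
  braided X Y := hom_ext fun p k => by
    have h1 := singleμ_hom_comp_apply (X := X) (Y := Y) ((single G).map (β_ X Y).hom) p k
    have h2 := comp_singleμ_hom_apply (X := Y) (Y := X) (β_ ((single G).obj X) ((single G).obj Y)).hom p k
    have h3 := diag_apply_self (M := tObj ((single G).obj X) ((single G).obj Y)) (N := tObj ((single G).obj Y) ((single G).obj X))
      (fun p => (p.2, p.1)) (fun p => (β_ X Y).hom) p
    exact h1.trans (h2.trans h3).symm

instance [MonoidalCategory D] [MonoidalPreadditive D] [K.Monoidal] : NatTrans.IsMonoidal (singleExtend K).hom where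
  unit := by
    have h : ι₁ K (𝟙_ G) ≫ (singleExtend K).hom.app (𝟙_ G) = 𝟙 _ := ι_π_self K _ _
    change ((Functor.LaxMonoidal.ε K ≫ ι₁ K (𝟙_ G)) ≫ (extend K).map (𝟙 _)) ≫ (singleExtend K).hom.app (𝟙_ G) = _
    rw [(extend K).map_id, comp_id, assoc, h, comp_id]
  tensor X Y := by
    change (extendμHom K ((single G).obj X) ((single G).obj Y) ≫ (extend K).map (singleμ X Y).hom) ≫ (singleExtend K).hom.app (X ⊗ Y) = ((singleExtend K).hom.app X ⊗ₘ (singleExtend K).hom.app Y) ≫ _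
    refine tensor_ext fun i j => ?_
    rw [tensorHom_comp_tensorHom_assoc, assoc, ι_extendμHom_assoc]
    have h1 : ι K ((single G).obj X) i ≫ (singleExtend K).hom.app X = 𝟙 _ := ι_π_self K _ _
    have h2 : ι K ((single G).obj Y) j ≫ (singleExtend K).hom.app Y = 𝟙 _ := ι_π_self K _ _
    have h3 : ι K (tObj ((single G).obj X) ((single G).obj Y)) (i, j) ≫ (extend K).map (singleμ X Y).hom ≫
        (singleExtend K).hom.app (X ⊗ Y) = 𝟙 _ :=
      (ι_map_π K (singleμ X Y).hom (i, j) Unit.unit).trans ((congrArg K.map (singleμ_hom_apply X Y _ _)).trans (K.map_id _))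
    have h4 := congrArg₂ (· ⊗ₘ ·) h1 h2
    refine ((congrArg (Functor.LaxMonoidal.μ K X Y ≫ ·) h3).trans (comp_id _)).trans (((congrArg (· ≫ Functor.LaxMonoidal.μ K X Y) h4).trans ?_).symm)
    exact (congrArg (· ≫ Functor.LaxMonoidal.μ K X Y) (id_tensorHom_id _ _)).trans (id_comp _)

end Extend

end Fam

end

/-! ### Traces are cyclic and multiplicative. -/

section

open BraidedCategory
section Trace

variable {C : Type u} [Category.{v} C] [MonoidalCategory C] [BraidedCategory C]

theorem evaluation_whiskerRight_comp {X Y : C} (h : Y ⟶ X) (X' Y' : C) [ExactPairing X X']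
    [ExactPairing Y Y'] : ∃ t : X' ⟶ Y', X' ◁ h ≫ ε_ X X' = t ▷ Y ≫ ε_ Y Y' ∧
      η_ X X' ≫ X ◁ t = η_ Y Y' ≫ h ▷ Y' := by
  refine ⟨@rightAdjointMate _ _ _ Y X ⟨Y'⟩ ⟨X'⟩ h, ?_, ?_⟩
  · exact (@rightAdjointMate_comp_evaluation _ _ _ Y X ⟨Y'⟩ ⟨X'⟩ h).symm
  · exact @coevaluation_comp_rightAdjointMate _ _ _ Y X ⟨Y'⟩ ⟨X'⟩ h

/-- The trace is cyclic. -/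
theorem pTrace_comm {X Y : C} (X' Y' : C) [ExactPairing X X'] [ExactPairing Y Y'] (g : X ⟶ Y)
    (h : Y ⟶ X) : pTrace X X' (g ≫ h) = pTrace Y Y' (h ≫ g) := by
  obtain ⟨t, h1, h2⟩ := evaluation_whiskerRight_comp h X' Y'
  rw [pTrace, pTrace, comp_whiskerRight, assoc, braiding_naturality_left_assoc, h1,
    ← braiding_naturality_right_assoc, ← whisker_exchange_assoc, reassoc_of% h2, comp_whiskerRight,
    assoc]

/-- Naturality of the braiding with respect to `e`: a strand that crosses both legs of a contraction
can be pulled off it. -/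
theorem braiding_evaluation_slide {X Y Y' : C} (e : Y ⊗ Y' ⟶ 𝟙_ C) :
    (β_ X Y).hom ▷ Y' ⊗≫ Y ◁ (β_ X Y').hom ⊗≫ e ▷ X =
      (α_ X Y Y').hom ≫ X ◁ e ≫ (ρ_ X).hom ≫ (λ_ X).inv := by
  have h := braiding_naturality_right X e
  rw [braiding_tensor_right_hom, braiding_tensorUnit_right] at h
  rw [h]
  monoidal

/-- The strands of `X` and `Y` are linked when `X ⊗ Y` is closed up by the braiding alone; the
inserted double braiding undoes the link and leaves two separate loops. In the quantum trace it is
the balancing equation that inserts it. -/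
theorem pTrace_tensor_doubleBraiding (X Y X' Y' : C) [ExactPairing X X'] [ExactPairing Y Y']
    (a : X ⟶ X) (b : Y ⟶ Y) :
    pTrace (X ⊗ Y) (Y' ⊗ X') ((a ⊗ₘ b) ≫ (β_ X Y).hom ≫ (β_ Y X).hom) =
      pTrace X X' a ≫ pTrace Y Y' b := by
  have key : ((β_ X Y).hom ≫ (β_ Y X).hom) ▷ (Y' ⊗ X') ≫ (β_ (X ⊗ Y) (Y' ⊗ X')).hom ≫
      (𝟙 _ ⊗≫ Y' ◁ (ε_ X X' ▷ Y) ⊗≫ ε_ Y Y') =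
      𝟙 _ ⊗≫ X ◁ ((β_ Y Y').hom ≫ ε_ Y Y') ▷ X' ⊗≫ (β_ X X').hom ≫ ε_ X X' := by
    rw [braiding_tensor_right_hom, braiding_tensor_left_hom X Y X']
    calc
      _ = (β_ X Y).hom ▷ (Y' ⊗ X') ⊗≫ ((β_ Y X).hom ▷ Y' ≫ (β_ (X ⊗ Y) Y').hom) ▷ X' ⊗≫
          Y' ◁ (X ◁ (β_ Y X').hom ⊗≫ ((β_ X X').hom ≫ ε_ X X') ▷ Y) ⊗≫ ε_ Y Y' := by monoidal
      _ = (β_ X Y).hom ▷ (Y' ⊗ X') ⊗≫ (β_ (Y ⊗ X) Y').hom ▷ X' ⊗≫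
          Y' ◁ ((β_ Y X).hom ▷ X' ⊗≫ X ◁ (β_ Y X').hom ⊗≫ ((β_ X X').hom ≫ ε_ X X') ▷ Y) ⊗≫ ε_ Y Y' := by
        rw [BraidedCategory.braiding_naturality_left]; monoidal
      _ = (β_ X Y).hom ▷ (Y' ⊗ X') ⊗≫ (Y ◁ (β_ X Y').hom) ▷ X' ⊗≫ ((β_ Y Y').hom ▷ (X ⊗ X') ≫
          (Y' ⊗ Y) ◁ ((β_ X X').hom ≫ ε_ X X')) ⊗≫ ε_ Y Y' := by
        rw [braiding_evaluation_slide, braiding_tensor_left_hom]; monoidal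
      _ = 𝟙 _ ⊗≫ ((β_ X Y).hom ▷ Y' ⊗≫ (Y ◁ (β_ X Y').hom) ⊗≫ ((β_ Y Y').hom ≫ ε_ Y Y') ▷ X) ▷ X' ⊗≫
          ((β_ X X').hom ≫ ε_ X X') := by
        have h := whisker_exchange (ε_ Y Y') ((β_ X X').hom ≫ ε_ X X')
        calc
          _ = (β_ X Y).hom ▷ (Y' ⊗ X') ⊗≫ (Y ◁ (β_ X Y').hom) ▷ X' ⊗≫ (β_ Y Y').hom ▷ (X ⊗ X') ⊗≫
              ((Y' ⊗ Y) ◁ ((β_ X X').hom ≫ ε_ X X') ≫ ε_ Y Y' ▷ 𝟙_ C) ⊗≫ 𝟙 _ := by monoidal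
          _ = _ := by rw [h]; monoidal
      _ = _ := by rw [braiding_evaluation_slide]; monoidal
  rw [pTrace]
  change (η_ X X' ⊗≫ (X ◁ η_ Y Y') ▷ X' ⊗≫ 𝟙 _) ≫ _ ▷ (Y' ⊗ X') ≫ _ ≫ (𝟙 _ ⊗≫ Y' ◁ (ε_ X X' ▷ Y) ⊗≫ ε_ Y Y') = _
  rw [comp_whiskerRight, assoc, key]
  simp only [MonoidalCategory.tensorHom_def]
  calc
    _ = η_ X X' ⊗≫ (X ◁ η_ Y Y') ▷ X' ⊗≫ (a ▷ (Y ⊗ Y') ≫ X ◁ (b ▷ Y' ≫ (β_ Y Y').hom ≫ ε_ Y Y')) ▷ X' ⊗≫ (β_ X X').hom ≫ ε_ X X' := by monoidal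
    _ = η_ X X' ⊗≫ (X ◁ pTrace Y Y' b) ▷ X' ⊗≫ a ▷ X' ⊗≫ (β_ X X').hom ≫ ε_ X X' := by
      rw [← whisker_exchange, pTrace]; monoidal
    _ = 𝟙 _ ⊗≫ (𝟙_ C ◁ pTrace X X' a ≫ pTrace Y Y' b ▷ 𝟙_ C) ⊗≫ 𝟙 _ := by
      -- An endomorphism of the unit passes through the strand `X` by naturality of the braiding.
      have h : X ◁ pTrace Y Y' b = (ρ_ X).hom ≫ (λ_ X).inv ≫ pTrace Y Y' b ▷ X ≫ (λ_ X).hom ≫ (ρ_ X).inv := by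
        have := braiding_naturality_right X (pTrace Y Y' b)
        rw [braiding_tensorUnit_right] at this
        rw [← cancel_mono (ρ_ X).hom, ← cancel_mono (λ_ X).inv]
        simpa using this
      calc
        _ = η_ X X' ⊗≫ (pTrace Y Y' b ▷ (X ⊗ X') ≫ 𝟙_ C ◁ (a ▷ X' ≫ (β_ X X').hom ≫ ε_ X X')) ⊗≫ 𝟙 _ := by
          rw [h]; monoidal
        _ = 𝟙 _ ⊗≫ (𝟙_ C ◁ η_ X X' ≫ pTrace Y Y' b ▷ (X ⊗ X')) ⊗≫ (a ▷ X' ≫ (β_ X X').hom ≫ ε_ X X') := by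
          monoidal
        _ = 𝟙 _ ⊗≫ (pTrace Y Y' b ▷ 𝟙_ C ≫ 𝟙_ C ◁ pTrace X X' a) ⊗≫ 𝟙 _ := by
          rw [whisker_exchange, pTrace, pTrace]; monoidal
        _ = _ := by rw [← whisker_exchange]
    _ = _ := by monoidal

end Trace

section QTrace

variable {C : Type u} [Category.{v} C] [MonoidalCategory C] [BraidedCategory C]
  [RigidCategory C] [RibbonStructure C]

open RibbonStructure

theorem qTrace_eq {X : C} (g : X ⟶ X) : qTrace g = pTrace X Xᘁ (g ≫ (twist X).hom) := rfl

theorem qTrace_comm {X Y : C} (g : X ⟶ Y) (h : Y ⟶ X) : qTrace (g ≫ h) = qTrace (h ≫ g) := by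
  rw [qTrace_eq, qTrace_eq, assoc, assoc, pTrace_comm (Y := Y) _ Yᘁ, assoc, twist_naturality]

/-- The quantum trace is multiplicative. -/
theorem qTrace_tensor {X Y : C} (g : X ⟶ X) (h : Y ⟶ Y) :
    qTrace (g ⊗ₘ h) = qTrace g ≫ qTrace h := by
  rw [qTrace_eq, pTrace_eq (X ⊗ Y) _ (Yᘁ ⊗ Xᘁ), twist_tensor, tensorHom_comp_tensorHom_assoc,
    pTrace_tensor_doubleBraiding]
  rfl

theorem qTrace_unit (g : 𝟙_ C ⟶ 𝟙_ C) : qTrace g = g := by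
  rw [qTrace_eq, pTrace_eq (𝟙_ C) _ (𝟙_ C), twist_unit, comp_id, pTrace]
  change (ρ_ _).inv ≫ g ▷ _ ≫ _ ≫ (ρ_ _).hom = _
  have e : (ρ_ (𝟙_ C)).inv ≫ (λ_ (𝟙_ C)).hom = 𝟙 _ := by rw [unitors_equal]; simp
  simp [braiding_tensorUnit_right, ← unitors_equal, e, reassoc_of% e]

theorem qTrace_conj {X Y : C} (e : X ≅ Y) (g : X ⟶ X) : qTrace (e.inv ≫ g ≫ e.hom) = qTrace g := by
  rw [qTrace_comm, assoc, e.hom_inv_id, comp_id]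

variable [Preadditive C] [MonoidalPreadditive C]

theorem qTrace_add {X : C} (g h : X ⟶ X) : qTrace (g + h) = qTrace g + qTrace h := by
  simp [qTrace]

theorem qTrace_zero {X : C} : qTrace (0 : X ⟶ X) = 0 := by
  simp [qTrace]

theorem qTrace_smul [Linear ℂ C] [MonoidalLinear ℂ C] {X : C} (z : ℂ) (g : X ⟶ X) : qTrace (z • g) = z • qTrace g := by
  simp [qTrace]

end QTrace

section Scalars

variable {C : Type u} [Category.{v} C] [Preadditive C] [Linear ℂ C]

theorem endScalar_smul_id {X : C} (h : 𝟙 X ≠ 0) (z : ℂ) : endScalar (z • 𝟙 X) = z := by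
  have h' : ∃ w : ℂ, z • 𝟙 X = w • 𝟙 X := ⟨z, rfl⟩
  rw [endScalar, dif_pos h']
  exact (smul_left_injective ℂ h h'.choose_spec).symm

end Scalars

end

/-! ### Labels, scalars and decompositions in unitary ribbon fusion categories. -/

section

open BraidedCategory
section

variable {C : Type u} [Category.{v} C] [HasZeroMorphisms C]

/-- The label of a simple object. -/
def Label.mk (X : C) (hX : Simple X) : Label C := Quotient.mk _ ⟨X, hX⟩

theorem Label.rep_simple (i : Label C) : Simple i.rep := (Quotient.out i).2

theorem Label.mk_eq {X Y : C} (hX : Simple X) (hY : Simple Y) :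
    Label.mk X hX = Label.mk Y hY ↔ Nonempty (X ≅ Y) := Quotient.eq (r := simpleSetoid C)

@[simp]
theorem Label.mk_rep (i : Label C) : Label.mk i.rep i.rep_simple = i := Quotient.out_eq i

theorem Label.rep_iso (X : C) (hX : Simple X) : Nonempty ((Label.mk X hX).rep ≅ X) :=
  (Label.mk_eq (Label.rep_simple _) hX).1 (Label.mk_rep _)

end

namespace URFC

open RibbonStructure

variable {C : URFC.{u, v}}

instance (X Y : C) : FiniteDimensional ℂ (X ⟶ Y) := C.hom_finite X Y

theorem eq_endScalar_smul {X : C} (hX : Simple X) (g : X ⟶ X) : g = endScalar g • 𝟙 X := by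
  obtain ⟨c, rfl⟩ := endomorphism_simple_eq_smul_id ℂ g
  rw [endScalar_smul_id (id_nonzero X)]

/-- The quantum trace as a number. -/
def tr {X : C} (g : X ⟶ X) : ℂ := endScalar (qTrace g)

theorem qTrace_eq_tr {X : C} (g : X ⟶ X) : qTrace g = tr g • 𝟙 _ :=
  eq_endScalar_smul C.unit_simple _

theorem unit_id_ne_zero : 𝟙 (𝟙_ C.Obj) ≠ 0 := by
  have := C.unit_simple
  exact id_nonzero _

theorem tr_eq {X : C} {g : X ⟶ X} {z : ℂ} (h : qTrace g = z • 𝟙 _) : tr g = z := by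
  rw [tr, h, endScalar_smul_id unit_id_ne_zero]

theorem qDim_eq_tr (X : C) : qDim X = tr (𝟙 X) := rfl

theorem sEntry_eq_tr (X Y : C) : sEntry X Y = tr (doubleBraiding X Y) := rfl

theorem tr_comm {X Y : C} (g : X ⟶ Y) (h : Y ⟶ X) : tr (g ≫ h) = tr (h ≫ g) := by
  rw [tr, qTrace_comm, tr]

theorem tr_conj {X Y : C} (e : X ≅ Y) (g : X ⟶ X) : tr (e.inv ≫ g ≫ e.hom) = tr g := by
  rw [tr, qTrace_conj, tr]

theorem tr_add {X : C} (g h : X ⟶ X) : tr (g + h) = tr g + tr h :=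
  tr_eq (by rw [qTrace_add, qTrace_eq_tr g, qTrace_eq_tr h, add_smul])

theorem tr_smul {X : C} (z : ℂ) (g : X ⟶ X) : tr (z • g) = z * tr g :=
  tr_eq (by rw [qTrace_smul, qTrace_eq_tr g, mul_smul])

theorem tr_zero {X : C} : tr (0 : X ⟶ X) = 0 := tr_eq (by rw [qTrace_zero, zero_smul])

theorem tr_sum {X : C} {ι : Type*} (s : Finset ι) (g : ι → (X ⟶ X)) :
    tr (∑ i ∈ s, g i) = ∑ i ∈ s, tr (g i) :=
  map_sum (⟨⟨fun g => tr g, tr_zero⟩, tr_add⟩ : (X ⟶ X) →+ ℂ) g s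

theorem tr_tensor {X Y : C} (g : X ⟶ X) (h : Y ⟶ Y) : tr (g ⊗ₘ h) = tr g * tr h :=
  tr_eq (by rw [qTrace_tensor, qTrace_eq_tr g, qTrace_eq_tr h]; simp [smul_smul, mul_comm])

theorem qDim_of_iso {X Y : C} (e : X ≅ Y) : qDim X = qDim Y := by
  rw [qDim_eq_tr, qDim_eq_tr, ← tr_conj e]; simp

theorem qDim_tensor (X Y : C) : qDim (X ⊗ Y) = qDim X * qDim Y := by
  rw [qDim_eq_tr, ← id_tensorHom_id, tr_tensor]; rfl

theorem qDim_unit : qDim (𝟙_ C.Obj) = 1 := by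
  rw [qDim_eq_tr]; exact tr_eq (by rw [qTrace_unit, one_smul])

theorem qDim_ne_zero {X : C} (hX : Simple X) : qDim X ≠ 0 := by
  obtain ⟨r, h, h'⟩ := C.qDim_pos X hX
  rw [h']; exact_mod_cast h.ne'

theorem twist_eq {X : C} (hX : Simple X) : (twist X).hom = twistScalar X • 𝟙 X :=
  eq_endScalar_smul hX _

theorem twistScalar_eq {X : C} (hX : Simple X) {z : ℂ} (h : (twist X).hom = z • 𝟙 X) :
    twistScalar X = z := by
  rw [twistScalar, h, endScalar_smul_id (id_nonzero X)]

theorem twistScalar_of_iso {X Y : C} (hX : Simple X) (e : X ≅ Y) :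
    twistScalar X = twistScalar Y := by
  have hY : Simple Y := Simple.of_iso e.symm
  refine twistScalar_eq hX ?_
  rw [← cancel_mono e.hom, ← twist_naturality, twist_eq hY]
  simp

/-- The twist is unitary, so θ times its conjugate is 1. -/
theorem norm_twistScalar {X : C} (hX : Simple X) : ‖twistScalar X‖ = 1 := by
  obtain ⟨U⟩ := C.unitary
  have h := U.dag_twist X
  have h2 := (twist X).hom_inv_id
  rw [← h, twist_eq hX, U.dag_smul, U.dag_id, Linear.smul_comp, Linear.comp_smul, smul_smul,
    comp_id] at h2
  have h3 : twistScalar X * starRingEnd ℂ (twistScalar X) = 1 :=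
    smul_left_injective ℂ (id_nonzero X) (h2.trans (one_smul ℂ _).symm)
  have h4 : ‖twistScalar X‖ ^ 2 = 1 := by
    have := congrArg norm h3
    simpa [sq] using this
  nlinarith [norm_nonneg (twistScalar X)]

theorem twistScalar_ne_zero {X : C} (hX : Simple X) : twistScalar X ≠ 0 := by
  have := norm_twistScalar hX
  intro h; rw [h] at this; simp at this

theorem doubleBraiding_of_iso {X X' Y Y' : C} (e : X ≅ X') (e' : Y ≅ Y') :
    doubleBraiding X' Y' = (e ⊗ᵢ e').inv ≫ doubleBraiding X Y ≫ (e ⊗ᵢ e').hom := by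
  rw [Iso.eq_inv_comp, doubleBraiding, doubleBraiding]
  simp

theorem sEntry_of_iso {X X' Y Y' : C} (e : X ≅ X') (e' : Y ≅ Y') : sEntry X Y = sEntry X' Y' := by
  rw [sEntry_eq_tr, sEntry_eq_tr, doubleBraiding_of_iso e e', tr_conj]

theorem exists_decomposition (X : C) : ∃ (n : ℕ) (S : Fin n → C) (p : ∀ i, X ⟶ S i)
    (q : ∀ i, S i ⟶ X), (∀ i, Simple (S i)) ∧ (∀ i, q i ≫ p i = 𝟙 _) ∧
      (∀ i j, i ≠ j → q i ≫ p j = 0) ∧ ∑ i, p i ≫ q i = 𝟙 X := by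
  have := Abelian.hasFiniteBiproducts (C := C.Obj)
  obtain ⟨n, S, hS, ⟨e⟩⟩ := C.semisimple X
  refine ⟨n, S, fun i => e.hom ≫ biproduct.π S i, fun i => biproduct.ι S i ≫ e.inv, hS, ?_, ?_, ?_⟩
  · intro i; simp
  · intro i j h; simp [biproduct.ι_π_ne _ h]
  · have : ∑ i, (e.hom ≫ biproduct.π S i) ≫ biproduct.ι S i ≫ e.inv =
        e.hom ≫ (∑ i, biproduct.π S i ≫ biproduct.ι S i) ≫ e.inv := by
      simp only [Preadditive.sum_comp, Preadditive.comp_sum, assoc]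
    rw [this, biproduct.total]
    simp

/-- Morphisms are determined by their composites with morphisms from simple objects. -/
theorem simple_hom_ext {X Y : C} {g h : X ⟶ Y}
    (H : ∀ (S : C) (_ : Simple S) (k : S ⟶ X), k ≫ g = k ≫ h) : g = h := by
  obtain ⟨n, S, p, q, hS, -, -, h1⟩ := exists_decomposition X
  rw [← id_comp g, ← id_comp h, ← h1]
  simp only [Preadditive.sum_comp, assoc, H _ (hS _)]

section Decomposition

variable {X : C} {n : ℕ} {S : Fin n → C} {p : ∀ i, X ⟶ S i} {q : ∀ i, S i ⟶ X}

theorem tr_eq_sum (h1 : ∑ i, p i ≫ q i = 𝟙 X) (g : X ⟶ X) : tr g = ∑ i, tr (q i ≫ g ≫ p i) := by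
  conv_lhs => rw [← id_comp g, ← h1, Preadditive.sum_comp, tr_sum]
  refine Finset.sum_congr rfl fun i _ => ?_
  rw [assoc, tr_comm, assoc]

theorem qDim_eq_sum (hp : ∀ i, q i ≫ p i = 𝟙 _) (h1 : ∑ i, p i ≫ q i = 𝟙 X) :
    qDim X = ∑ i, qDim (S i) := by
  rw [qDim_eq_tr, tr_eq_sum h1]
  simp [hp, qDim_eq_tr]

theorem tr_twist_eq_sum (hS : ∀ i, Simple (S i)) (hp : ∀ i, q i ≫ p i = 𝟙 _)
    (h1 : ∑ i, p i ≫ q i = 𝟙 X) :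
    tr (twist X).hom = ∑ i, twistScalar (S i) * qDim (S i) := by
  rw [tr_eq_sum h1]
  refine Finset.sum_congr rfl fun i _ => ?_
  rw [← twist_naturality, reassoc_of% (hp i), twist_eq (hS i), tr_smul]
  rfl

variable (hp : ∀ i, q i ≫ p i = 𝟙 _) (hpq : ∀ i j, i ≠ j → q i ≫ p j = 0)
  (h1 : ∑ i, p i ≫ q i = 𝟙 X)

/-- Morphisms into a direct sum. -/
def homToEquiv (hp : ∀ i, q i ≫ p i = 𝟙 _) (hpq : ∀ i j, i ≠ j → q i ≫ p j = 0)
    (h1 : ∑ i, p i ≫ q i = 𝟙 X) (Y : C) : (Y ⟶ X) ≃ₗ[ℂ] (∀ i, Y ⟶ S i) where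
  toFun g i := g ≫ p i
  map_add' g h := by ext i; simp
  map_smul' z g := by ext i; simp
  invFun h := ∑ i, h i ≫ q i
  left_inv g := by simp only [assoc, ← Preadditive.comp_sum, h1, comp_id]
  right_inv h := by
    ext i
    change (∑ i, h i ≫ q i) ≫ p i = h i
    rw [Preadditive.sum_comp, Finset.sum_eq_single i]
    · rw [assoc, hp, comp_id]
    · intro j _ hj; rw [assoc, hpq _ _ hj, comp_zero]
    · simp

/-- Morphisms out of a direct sum. -/
def homFromEquiv (hp : ∀ i, q i ≫ p i = 𝟙 _) (hpq : ∀ i j, i ≠ j → q i ≫ p j = 0)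
    (h1 : ∑ i, p i ≫ q i = 𝟙 X) (Y : C) : (X ⟶ Y) ≃ₗ[ℂ] (∀ i, S i ⟶ Y) where
  toFun g i := q i ≫ g
  map_add' g h := by ext i; simp
  map_smul' z g := by ext i; simp
  invFun h := ∑ i, p i ≫ h i
  left_inv g := by simp only [← assoc, ← Preadditive.sum_comp, h1, id_comp]
  right_inv h := by
    ext i
    change q i ≫ (∑ i, p i ≫ h i) = h i
    rw [Preadditive.comp_sum, Finset.sum_eq_single i]
    · rw [← assoc, hp, id_comp]
    · intro j _ hj; rw [← assoc, hpq _ _ hj.symm, zero_comp]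
    · simp

end Decomposition

open Module in
-- By semisimplicity both numbers are the multiplicity of `Y` in `X`.
theorem finrank_hom_comm {Y : C} (hY : Simple Y) (X : C) :
    finrank ℂ (Y ⟶ X) = finrank ℂ (X ⟶ Y) := by
  obtain ⟨n, S, p, q, hS, hp, hpq, h1⟩ := exists_decomposition X
  rw [(homToEquiv hp hpq h1 Y).finrank_eq, (homFromEquiv hp hpq h1 Y).finrank_eq,
    finrank_pi_fintype, finrank_pi_fintype]
  refine Finset.sum_congr rfl fun i _ => ?_
  have := hS i
  classical
  rw [finrank_hom_simple_simple, finrank_hom_simple_simple]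
  exact if_congr ⟨fun ⟨e⟩ => ⟨e.symm⟩, fun ⟨e⟩ => ⟨e.symm⟩⟩ rfl rfl

open Module in
-- The dimension of the space of morphisms from a label to `X` counts the summands with that label.
-- This trades sums over fusion multiplicities for sums over a decomposition, where traces can be
-- evaluated.
theorem sum_finrank_mul [Fintype (Label C.Obj)] {X : C} {n : ℕ} {S : Fin n → C}
    {p : ∀ i, X ⟶ S i} {q : ∀ i, S i ⟶ X} (hS : ∀ i, Simple (S i))
    (hp : ∀ i, q i ≫ p i = 𝟙 _) (hpq : ∀ i j, i ≠ j → q i ≫ p j = 0)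
    (h1 : ∑ i, p i ≫ q i = 𝟙 X) (F : C → ℂ)
    (hF : ∀ {Y Z : C}, Simple Y → (Y ≅ Z) → F Y = F Z) :
    ∑ l : Label C.Obj, (finrank ℂ (l.rep ⟶ X) : ℂ) * F l.rep = ∑ i, F (S i) := by
  classical
  have e : ∀ l : Label C.Obj, (finrank ℂ (l.rep ⟶ X) : ℂ) * F l.rep =
      ∑ i, if l = Label.mk (S i) (hS i) then F (S i) else 0 := by
    intro l
    rw [(homToEquiv hp hpq h1 l.rep).finrank_eq, finrank_pi_fintype, Nat.cast_sum, Finset.sum_mul]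
    refine Finset.sum_congr rfl fun i _ => ?_
    have := hS i
    have := l.rep_simple
    rw [finrank_hom_simple_simple, ← Label.mk_eq l.rep_simple (hS i), Label.mk_rep]
    split_ifs with h
    · obtain ⟨e⟩ := Label.rep_iso (S i) (hS i)
      rw [h, hF (Label.rep_simple _) e]; simp
    · simp
  simp only [e]
  rw [Finset.sum_comm]
  simp

end URFC

end

/-! ### Fermions, and the nonvanishing of the central charge. -/

section

open BraidedCategory
/-- The partial trace of the self-braiding of `X`. -/
theorem partialTrace_braiding {C : Type u} [Category.{v} C] [MonoidalCategory C]
    [BraidedCategory C] (X X' : C) [ExactPairing X X'] :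
    X ◁ η_ X X' ≫ (α_ X X X').inv ≫ (β_ X X).hom ▷ X' ≫ (α_ X X X').hom ≫
      X ◁ ((β_ X X').hom ≫ ε_ X X') = 𝟙 (X ⊗ 𝟙_ C) := by
  have h := braiding_naturality_right X (η_ X X')
  rw [braiding_tensor_right_hom, braiding_tensorUnit_right] at h
  rw [MonoidalCategory.whiskerLeft_comp]
  have h2 := congrArg (· ≫ (α_ _ _ _).hom ≫ X ◁ ε_ X X') h
  simp only [assoc, Iso.inv_hom_id_assoc] at h2
  rw [h2, ExactPairing.evaluation_coevaluation]
  simp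

/-- Tensoring with an object of order two is an equivalence. -/
theorem tensorLeft_isEquivalence {C : Type u} [Category.{v} C] [MonoidalCategory C] {f : C}
    (e : f ⊗ f ≅ 𝟙_ C) : (tensorLeft f).IsEquivalence :=
  let i : tensorLeft f ⋙ tensorLeft f ≅ 𝟭 C :=
    (tensorLeftTensor f f).symm ≪≫ (tensoringLeft C).mapIso e ≪≫ leftUnitorNatIso C
  (CategoryTheory.Equivalence.mk (tensorLeft f) (tensorLeft f) i.symm i).isEquivalence_functor

namespace URFC

open RibbonStructure

variable {C : URFC.{u, v}} {f : C}

/-- As `f ⊗ f` is simple, its braiding is a scalar s, and balancing on `f ⊗ f ≅ 𝟙` gives s² = 1. The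
partial trace of the self-braiding is the identity; with θ_f = -1 this says -s d_f = 1. Positivity
of d_f leaves only s = -1 and d_f = 1. -/
theorem IsFermion.braiding_and_dim (hf : IsFermion f) :
    (β_ f f).hom = -𝟙 (f ⊗ f) ∧ qDim f = 1 := by
  obtain ⟨hs, ⟨e⟩, hθ⟩ := hf
  have h1 : Simple (f ⊗ f) := by have := C.unit_simple; exact Simple.of_iso e
  set s := endScalar (β_ f f).hom with hs'
  have hβ : (β_ f f).hom = s • 𝟙 (f ⊗ f) := eq_endScalar_smul h1 _
  have hss : s * s = 1 := by
    have h2 : (twist (f ⊗ f)).hom = 𝟙 _ := by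
      rw [← cancel_mono e.hom, ← twist_naturality, twist_unit]; simp
    rw [twist_tensor, hθ, hβ] at h2
    have h3 : (-𝟙 f) ⊗ₘ (-𝟙 f) = 𝟙 (f ⊗ f) := by
      rw [← neg_one_smul ℂ (𝟙 f)]
      simp only [smul_tensorHom, tensorHom_smul, id_tensorHom_id, smul_smul]
      norm_num
    rw [h3] at h2
    simp only [id_comp, Linear.comp_smul, comp_id, smul_smul] at h2
    exact smul_left_injective ℂ (id_nonzero _) (h2.trans (one_smul ℂ _).symm)
  have hp : η_ f fᘁ ≫ (β_ f fᘁ).hom ≫ ε_ f fᘁ = (-qDim f) • 𝟙 _ := by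
    have h2 := qTrace_eq_tr (𝟙 f)
    rw [qTrace, hθ, id_comp, ← neg_one_smul ℂ (𝟙 f), MonoidalLinear.smul_whiskerRight,
      id_whiskerRight, Linear.smul_comp, Linear.comp_smul, id_comp] at h2
    rw [neg_smul, qDim_eq_tr, ← h2, neg_one_smul, neg_neg]
  have h4 := partialTrace_braiding f fᘁ
  rw [hβ] at h4
  simp only [MonoidalLinear.smul_whiskerRight, id_whiskerRight, Linear.comp_smul, Linear.smul_comp,
    id_comp, Iso.inv_hom_id_assoc, ← MonoidalCategory.whiskerLeft_comp, hp,
    MonoidalLinear.whiskerLeft_smul, MonoidalCategory.whiskerLeft_id, smul_smul] at h4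
  have h5 : Simple (f ⊗ 𝟙_ C.Obj) := Simple.of_iso (ρ_ f)
  have h6 : s * -qDim f = 1 :=
    smul_left_injective ℂ (id_nonzero _) (h4.trans (one_smul ℂ _).symm)
  obtain ⟨r, hr, hr'⟩ := C.qDim_pos f hs
  rcases mul_self_eq_one_iff.1 hss with h | h
  · rw [h, hr'] at h6
    have : -r = 1 := by exact_mod_cast (one_mul _).symm.trans h6
    linarith
  · rw [h] at h6 hβ
    exact ⟨by rw [hβ]; simp, by linear_combination h6⟩

theorem IsFermion.selfFermionic (hf : IsFermion f) : SelfFermionic f :=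
  ⟨hf.2.1, hf.braiding_and_dim.1⟩

theorem IsFermion.fermionicTwist (hf : IsFermion f) : FermionicTwist f := ⟨hf.2.2⟩

theorem IsFermion.simple_tensor (hf : IsFermion f) {X : C} (hX : Simple X) : Simple (f ⊗ X) := by
  have := tensorLeft_isEquivalence hf.2.1.some
  exact simple_obj (tensorLeft f) X

theorem doubleBraiding_tensor_left (Z X Y : C) {z : ℂ} (h : doubleBraiding Z Y = z • 𝟙 _) :
    doubleBraiding (Z ⊗ X) Y = z • ((α_ Z X Y).hom ≫ Z ◁ doubleBraiding X Y ≫ (α_ Z X Y).inv) := by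
  rw [doubleBraiding_tensor, h]
  simp [doubleBraiding]

/-- `X ⊗ f` is simple, so the double braiding is a scalar. Its square is the double braiding of `X`
with `f ⊗ f ≅ 𝟙`, which is trivial. -/
theorem IsFermion.exists_hasParity (hf : IsFermion f) {X : C} (hX : Simple X) :
    ∃ σ, HasParity f σ X := by
  have := hf.selfFermionic
  have hs : Simple (X ⊗ f) := by have := hf.simple_tensor hX; exact Simple.of_iso (β_ X f)
  have h1 := eq_endScalar_smul hs (doubleBraiding X f)
  set s := endScalar (doubleBraiding X f)
  have h2 := doubleBraiding_swap h1
  have hss : s * s = 1 := by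
    have hs' : Simple ((f ⊗ f) ⊗ X) :=
      have := hf.simple_tensor (hf.simple_tensor hX)
      Simple.of_iso (α_ f f X)
    have h3 := doubleBraiding_tensor_left f f X h2
    rw [h2] at h3
    have h4 := doubleBraiding_naturality_left hf.2.1.some.hom X
    rw [h3] at h4
    have h5 : doubleBraiding (𝟙_ C.Obj) X = 𝟙 _ := by simp [doubleBraiding]
    have h6 : (s * s) • 𝟙 ((f ⊗ f) ⊗ X) = 𝟙 _ := by
      rw [← cancel_mono (hf.2.1.some.hom ▷ X), ← smul_smul, id_comp]
      simpa [h5] using h4.symm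
    exact smul_left_injective ℂ (id_nonzero _) (h6.trans (one_smul ℂ _).symm)
  rcases mul_self_eq_one_iff.1 hss with h | h
  · exact ⟨false, by rw [hasParity_iff, h1, h]; simp [pSign]⟩
  · exact ⟨true, by rw [hasParity_iff, h1, h]; simp [pSign]⟩

theorem twistScalar_fermion_tensor (hf : IsFermion f) {X : C} (hX : Simple X) {σ : Bool}
    (h : HasParity f σ X) : twistScalar (f ⊗ X) = -pSign σ * twistScalar X := by
  refine twistScalar_eq (hf.simple_tensor hX) ?_
  rw [hasParity_iff] at h
  have h2 := doubleBraiding_swap h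
  rw [doubleBraiding] at h2
  rw [twist_tensor, h2, hf.2.2, twist_eq hX, ← neg_one_smul ℂ (𝟙 f)]
  simp only [smul_tensorHom, tensorHom_smul, id_tensorHom_id, Linear.comp_smul, comp_id, smul_smul]
  congr 1
  ring

theorem qDim_fermion_tensor (hf : IsFermion f) (X : C) : qDim (f ⊗ X) = qDim X := by
  rw [qDim_tensor, hf.braiding_and_dim.2, one_mul]

theorem sEntry_fermion_tensor (hf : IsFermion f) (X : C) {Y : C} {τ : Bool}
    (h : HasParity f τ Y) : sEntry (f ⊗ X) Y = pSign τ * sEntry X Y := by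
  rw [hasParity_iff] at h
  rw [sEntry_eq_tr, doubleBraiding_tensor_left f X Y (doubleBraiding_swap h), tr_smul]
  have := tr_conj (α_ f X Y).symm (f ◁ doubleBraiding X Y)
  simp only [Iso.symm_hom, Iso.symm_inv] at this
  rw [this, ← id_tensorHom, tr_tensor, ← qDim_eq_tr, hf.braiding_and_dim.2, one_mul, sEntry_eq_tr]


/-- Tensoring with a fermion permutes the labels. -/
def IsFermion.perm (hf : IsFermion f) : Equiv.Perm (Label C.Obj) :=
  Function.Involutive.toPerm (fun l => Label.mk (f ⊗ l.rep) (hf.simple_tensor l.rep_simple)) fun l => by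
    conv_rhs => rw [← l.mk_rep]
    rw [Label.mk_eq]
    obtain ⟨e⟩ := Label.rep_iso (f ⊗ l.rep) (hf.simple_tensor l.rep_simple)
    exact ⟨whiskerLeftIso f e ≪≫ (α_ _ _ _).symm ≪≫ whiskerRightIso hf.2.1.some _ ≪≫ λ_ _⟩

theorem IsFermion.perm_rep (hf : IsFermion f) (l : Label C.Obj) :
    Nonempty ((hf.perm l).rep ≅ f ⊗ l.rep) := Label.rep_iso _ (hf.simple_tensor l.rep_simple)

/-- The degree of a label. -/
def IsFermion.deg (hf : IsFermion f) (l : Label C.Obj) : Bool :=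
  (hf.exists_hasParity l.rep_simple).choose

theorem IsFermion.hasParity_deg (hf : IsFermion f) (l : Label C.Obj) :
    HasParity f (hf.deg l) l.rep := (hf.exists_hasParity l.rep_simple).choose_spec

theorem IsFermion.hasParity_unique (hf : IsFermion f) {X : C} (hX : Simple X) {σ τ : Bool}
    (h : HasParity f σ X) (h' : HasParity f τ X) : σ = τ := by
  by_contra hne
  have := hf.selfFermionic
  exact id_nonzero X (h.hom_eq_zero h' hne (𝟙 X))

theorem IsFermion.deg_perm (hf : IsFermion f) (l : Label C.Obj) : hf.deg (hf.perm l) = hf.deg l := by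
  have := hf.selfFermionic
  obtain ⟨e⟩ := hf.perm_rep l
  refine hf.hasParity_unique (Label.rep_simple _) (hf.hasParity_deg _) ?_
  have h : HasParity f (xor false (hf.deg l)) (f ⊗ l.rep) :=
    HasParity.tensor (SelfFermionic.doubleBraiding f) (hf.hasParity_deg l)
  rw [Bool.false_xor] at h
  exact h.of_iso e.symm

instance : Fintype (Label C.Obj) := Fintype.ofFinite _

/-- The even labels do not contribute to the central charge. -/
theorem IsFermion.sum_even_eq_zero (hf : IsFermion f) :
    ∑ l : Label C.Obj, (if hf.deg l then 0 else twistScalar l.rep * qDim l.rep ^ 2) = 0 := by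
  have h : ∑ l : Label C.Obj, (if hf.deg l then 0 else twistScalar l.rep * qDim l.rep ^ 2) =
      -∑ l : Label C.Obj, (if hf.deg l then 0 else twistScalar l.rep * qDim l.rep ^ 2) := by
    -- Tensoring with the fermion permutes the even labels, preserves their dimensions and negates
    -- their twists, so the sum is its own negative.
    conv_lhs => rw [← Equiv.sum_comp hf.perm]
    rw [← Finset.sum_neg_distrib]
    refine Finset.sum_congr rfl fun l _ => ?_
    obtain ⟨e⟩ := hf.perm_rep l
    rw [hf.deg_perm, twistScalar_of_iso (Label.rep_simple _) e, qDim_of_iso e,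
      twistScalar_fermion_tensor hf l.rep_simple (hf.hasParity_deg l), qDim_fermion_tensor hf]
    cases hf.deg l <;> simp [pSign]
  linear_combination (1 / 2 : ℂ) * h

/-- The twisted `S`-matrix sums in terms of multiplicities. -/
theorem sEntry_eq_sum {X Y : C} (hX : Simple X) (hY : Simple Y) :
    sEntry X Y = (twistScalar X)⁻¹ * (twistScalar Y)⁻¹ *
      ∑ l : Label C.Obj, (Module.finrank ℂ (l.rep ⟶ X ⊗ Y) : ℂ) * (twistScalar l.rep * qDim l.rep) := by
  obtain ⟨n, S, p, q, hS, hp, hpq, h1⟩ := exists_decomposition (X ⊗ Y)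
  -- The balancing equation identifies the trace of the twist of `X ⊗ Y` with θ_X θ_Y times the
  -- trace of the double braiding.
  rw [sum_finrank_mul hS hp hpq h1 (fun Z => twistScalar Z * qDim Z)
    fun h e => by rw [twistScalar_of_iso h e, qDim_of_iso e], ← tr_twist_eq_sum hS hp h1,
    twist_tensor, twist_eq hX, twist_eq hY]
  simp only [smul_tensorHom, tensorHom_smul, id_tensorHom_id, Linear.smul_comp, id_comp, tr_smul]
  have := twistScalar_ne_zero hX
  have := twistScalar_ne_zero hY
  rw [sEntry_eq_tr, doubleBraiding]
  field_simp

theorem sum_finrank_mul_qDim (X : C) :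
    ∑ l : Label C.Obj, (Module.finrank ℂ (l.rep ⟶ X) : ℂ) * qDim l.rep = qDim X := by
  obtain ⟨n, S, p, q, hS, hp, hpq, h1⟩ := exists_decomposition X
  rw [sum_finrank_mul hS hp hpq h1 (fun Z => qDim Z) fun h e => qDim_of_iso e, qDim_eq_sum hp h1]

theorem finrank_tensorRight (Z X Y : C) : Module.finrank ℂ (Z ⟶ X ⊗ Y) =
    Module.finrank ℂ ((Z ⊗ (ᘁY)) ⟶ X) := by
  let e : ((Z ⊗ (ᘁY)) ⟶ X) ≃ₗ[ℂ] (Z ⟶ X ⊗ Y) :=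
    { tensorRightHomEquiv Z (ᘁY) Y X with
      map_add' := fun g h => by simp [tensorRightHomEquiv]
      map_smul' := fun z g => by simp [tensorRightHomEquiv] }
  exact e.finrank_eq.symm

/-- Expanding the S-matrix by multiplicities cancels the twist of `l`. Duality moves `Y` to the
other side, the sum over `l` becomes a dimension, and the Gauss sum splits off. -/
theorem sum_twist_mul_sEntry {Y : C} (hY : Simple Y) :
    ∑ l : Label C.Obj, (twistScalar l.rep * qDim l.rep) * sEntry l.rep Y =
      (twistScalar Y)⁻¹ * qDim (ᘁY) * ∑ l : Label C.Obj, twistScalar l.rep * qDim l.rep ^ 2 := by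
  have h1 : ∀ l : Label C.Obj, (twistScalar l.rep * qDim l.rep) * sEntry l.rep Y =
      ∑ m : Label C.Obj, (twistScalar Y)⁻¹ * (twistScalar m.rep * qDim m.rep) *
        ((Module.finrank ℂ (l.rep ⟶ m.rep ⊗ (ᘁY)) : ℂ) * qDim l.rep) := by
    intro l
    rw [sEntry_eq_sum l.rep_simple hY, Finset.mul_sum, Finset.mul_sum]
    refine Finset.sum_congr rfl fun m _ => ?_
    rw [finrank_tensorRight, finrank_hom_comm l.rep_simple]
    have := twistScalar_ne_zero l.rep_simple
    field_simp
  simp only [h1]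
  rw [Finset.sum_comm, Finset.mul_sum]
  refine Finset.sum_congr rfl fun m _ => ?_
  rw [← Finset.mul_sum, sum_finrank_mul_qDim, qDim_tensor]
  ring

theorem dim_eq_sum : C.dim = ∑ l : Label C.Obj, qDim l.rep ^ 2 := finsum_eq_sum_of_fintype _

/-- The central charge of a modular category is not zero. -/
theorem IsModular.centralCharge_ne_zero (hC : C.IsModular) : C.centralCharge ≠ 0 := by
  classical
  rw [centralCharge, finsum_eq_sum_of_fintype]
  refine div_ne_zero ?_ ?_
  · intro h0
    apply hC
    -- If the Gauss sum vanished, the vector of the numbers θ d, which has no zero entry, would lie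
    -- in the left kernel of the S-matrix.
    have : ∃ v : Label C.Obj → ℂ, v ≠ 0 ∧ Matrix.vecMul v C.sMatrix = 0 := by
      refine ⟨fun l => twistScalar l.rep * qDim l.rep, ?_, ?_⟩
      · intro h
        have := congrFun h (Label.mk (𝟙_ C.Obj) C.unit_simple)
        exact mul_ne_zero (twistScalar_ne_zero (Label.rep_simple _)) (qDim_ne_zero (Label.rep_simple _)) this
      · funext m
        have := sum_twist_mul_sEntry m.rep_simple
        rw [h0, mul_zero] at this
        exact this
    convert Matrix.exists_vecMul_eq_zero_iff.1 this
  · have h : 0 < C.dim.re := by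
      rw [dim_eq_sum, Complex.re_sum]
      have h1 : ∀ l : Label C.Obj, 0 < (qDim l.rep ^ 2).re := fun l => by
        obtain ⟨r, hr, h⟩ := C.qDim_pos l.rep l.rep_simple
        rw [h]
        have : ((r : ℂ) ^ 2).re = r ^ 2 := by exact_mod_cast Complex.ofReal_re _
        rw [this]; positivity
      exact Finset.sum_pos (fun l _ => h1 l) ⟨Label.mk (𝟙_ C.Obj) C.unit_simple, Finset.mem_univ _⟩
    exact_mod_cast (Real.sqrt_pos.2 h).ne'

end URFC

end

/-! ### The effect of zesting on twists, dimensions, S-matrix, central charge and modularity. -/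

section

open BraidedCategory
open RibbonStructure

section

variable {C : Type u} [Category.{v} C] [Preadditive C] [Linear ℂ C]
    [MonoidalCategory C] [MonoidalPreadditive C] [MonoidalLinear ℂ C] [BraidedCategory C]
    [RigidCategory C] {f : C} [SelfFermionic f]

theorem Zest.pTrace_rightDual (X : Zest f) (g : X.obj ⟶ X.obj) :
    pTrace (C := Zest f) X Xᘁ g = ((zB X.deg X.deg)⁻¹ • pTrace X.obj X.objᘁ g : 𝟙_ C ⟶ 𝟙_ C) := by
  let := Zest.dualPairing X
  rw [pTrace_eq X.obj X.objᘁ (zAlpha f X.deg X.deg ⊗ X.dual.obj)]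
  exact Zest.pTrace_eq_smul X.deg X.obj X.dual.obj X.parity X.dual.parity g

/-- The factor ζ⁻¹ of the trace without twist and the factor ζ of the twist cancel in odd degree.
This is why dimensions stay positive under zesting. -/
theorem Zest.qTrace_eq [RibbonStructure C] [FermionicTwist f]
    (X : Zest f) (g : X.obj ⟶ X.obj) :
    qTrace (C := Zest f) (X := X) g = (qTrace g : 𝟙_ C ⟶ 𝟙_ C) := by
  have h : ∀ z : ℂ, z ≠ 0 → z⁻¹ • pTrace X.obj X.objᘁ (g ≫ (z • (twist X.obj).hom)) = qTrace g := by
    intro z hz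
    rw [Linear.comp_smul, FermionicZesting.qTrace_eq, pTrace, pTrace]
    simp [smul_smul, hz]
  exact (Zest.pTrace_rightDual X (g ≫ (zB X.deg X.deg • (twist X.obj).hom))).trans (h _ (zB_ne_zero _ _))

end

theorem zB_mul_comm (σ τ : Bool) : zB σ τ * zB τ σ = if σ && τ then Complex.I else 1 := by
  cases σ <;> cases τ <;> simp [zB]
  exact zB_mul_self

theorem norm_zB (σ τ : Bool) : ‖zB σ τ‖ = 1 := by
  rw [zB]
  split_ifs
  · rw [Complex.norm_exp]; simp
  · simp

namespace URFC

theorem exists_pTrace_eq {C : URFC.{u, v}} {X : C} (hX : Simple X) :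
    ∃ p : ℂ, pTrace X Xᘁ (𝟙 X) = p • 𝟙 _ ∧ qDim X = twistScalar X * p := by
  refine ⟨endScalar (pTrace X Xᘁ (𝟙 X)), eq_endScalar_smul C.unit_simple _, ?_⟩
  rw [qDim_eq_tr]
  refine tr_eq ?_
  rw [qTrace_eq, id_comp, twist_eq hX, mul_smul, ← eq_endScalar_smul C.unit_simple]
  simp [pTrace]

/-- Let p be the trace without twist of the identity. Then d = θ p with |θ| = 1 and d > 0, so d =
|p|, and p determines θ as well. Hence a relation between the values of p, with a factor of modulus
one, yields the relations between twists and between dimensions, without any hypothesis that twists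
correspond. -/
theorem twist_compare {C : URFC.{u, v}} {D : URFC.{u₂, v₂}} {X : C} {Y : D} (hX : Simple X)
    (hY : Simple Y) {z : ℂ} (hz : ‖z‖ = 1)
    (h : ∀ p : ℂ, pTrace X Xᘁ (𝟙 X) = p • 𝟙 _ → pTrace Y Yᘁ (𝟙 Y) = (z⁻¹ * p) • 𝟙 _) :
    twistScalar Y = z * twistScalar X ∧ qDim Y = qDim X := by
  obtain ⟨p, hp, hX1⟩ := exists_pTrace_eq hX
  obtain ⟨p', hp', hY1⟩ := exists_pTrace_eq hY
  have e : p' = z⁻¹ * p :=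
    smul_left_injective ℂ unit_id_ne_zero (hp'.symm.trans (h p hp))
  obtain ⟨r, hr, hr'⟩ := C.qDim_pos X hX
  obtain ⟨s, hs, hs'⟩ := D.qDim_pos Y hY
  have hz0 : z ≠ 0 := by rintro rfl; simp at hz
  have hθ := twistScalar_ne_zero hX
  have key : twistScalar Y * (r : ℂ) = z * twistScalar X * s := by
    rw [← hr', ← hs', hX1, hY1, e]; field_simp
  have hrs : r = s := by
    have := congrArg norm key
    rw [norm_mul, norm_mul, norm_mul, norm_twistScalar hX, norm_twistScalar hY, hz] at this
    simpa [abs_of_pos hr, abs_of_pos hs] using this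
  subst hrs
  have hr0 : (r : ℂ) ≠ 0 := by exact_mod_cast hr.ne'
  exact ⟨mul_right_cancel₀ hr0 key, by rw [hs', hr']⟩

/-- Braided functors preserve fermions. -/
theorem IsFermion.map {B : URFC.{u₁, v₁}} {C : URFC.{u, v}} (F : B.Obj ⥤ C.Obj) [F.Braided]
    [F.Additive] [F.Linear ℂ] {f : B} (hf : IsFermion f) : IsFermion (F.obj f) := by
  have e : F.obj f ⊗ F.obj f ≅ 𝟙_ C.Obj :=
    Functor.Monoidal.μIso F f f ≪≫ F.mapIso hf.2.1.some ≪≫ (Functor.Monoidal.εIso F).symm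
  have hs : Simple (F.obj f) := by
    have := tensorLeft_isEquivalence e
    have := C.unit_simple
    have h : Simple ((tensorLeft (F.obj f)).obj (𝟙_ C.Obj)) := simple_obj _ _
    exact @Simple.of_iso _ _ _ _ _ h (ρ_ (F.obj f)).symm
  refine ⟨hs, ⟨e⟩, ?_⟩
  have h := twist_compare (X := f) (Y := F.obj f) (z := 1) hf.1 hs (by simp) fun p hp => by
    have := pTrace_map F f fᘁ (𝟙 f) (F.obj f)ᘁ
    rw [F.map_id, hp, F.map_smul, F.map_id] at this
    rw [this]; simp
  rw [twist_eq hs, h.1, one_mul, twistScalar_eq hf.1 (z := -1) (by rw [hf.2.2]; simp)]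
  simp

section Compare

variable {C : URFC.{u, v}} {D : URFC.{u₂, v₂}} {f : C} [SelfFermionic f] [FermionicTwist f]
  (K : Zest f ⥤ D.Obj) [K.Braided] [K.Additive] [K.Linear ℂ]

theorem twist_obj_of_simple (X : Zest f) (hX : Simple X.obj) (hK : Simple (K.obj X)) :
    twistScalar (K.obj X) = zB X.deg X.deg * twistScalar X.obj ∧
      qDim (K.obj X) = qDim X.obj := by
  refine twist_compare hX hK (norm_zB _ _) fun p hp => ?_
  have h1 := pTrace_map K X Xᘁ (𝟙 X) (K.obj X)ᘁ
  have h2 : pTrace X Xᘁ (𝟙 X) = ((zB X.deg X.deg)⁻¹ * p) • 𝟙 (𝟙_ (Zest f)) :=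
    (Zest.pTrace_rightDual X (𝟙 X.obj)).trans (by rw [hp, smul_smul]; rfl)
  rw [K.map_id, h2, K.map_smul, K.map_id] at h1
  rw [h1]; simp

variable (hf : IsFermion f) (hK : ∀ X : Zest f, Simple X.obj → Simple (K.obj X))
include hf hK

/-- For simple objects this is the comparison of scalars. The general case follows by naturality of
both twists, since every object decomposes into homogeneous simple ones. -/
theorem twist_obj (X : Zest f) : (twist (K.obj X)).hom = K.map (twist X).hom := by
  have h0 : ∀ X : Zest f, Simple X.obj → (twist (K.obj X)).hom = K.map (twist X).hom := by
    intro X hX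
    have h2 : (twist X).hom = (zB X.deg X.deg * twistScalar X.obj) • 𝟙 X := by
      change zB X.deg X.deg • (twist X.obj).hom = _
      rw [twist_eq hX, smul_smul]; rfl
    rw [twist_eq (hK X hX), (twist_obj_of_simple K X hX (hK X hX)).1, h2, K.map_smul, K.map_id]
  obtain ⟨n, S, p, q, hS, hp, hpq, h1⟩ := exists_decomposition X.obj
  choose σ hσ using fun i => hf.exists_hasParity (hS i)
  let P : ∀ i, X ⟶ (⟨⟨S i, σ i, hσ i⟩⟩ : Zest f) := p
  let Q : ∀ i, (⟨⟨S i, σ i, hσ i⟩⟩ : Zest f) ⟶ X := q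
  have h2 : ∑ i, P i ≫ Q i = 𝟙 X := h1
  have h3 : 𝟙 (K.obj X) = ∑ i, K.map (P i) ≫ K.map (Q i) := by
    rw [← K.map_id, ← h2, K.map_sum]; simp only [K.map_comp]
  rw [← id_comp (twist (K.obj X)).hom, ← id_comp (twist X).hom, h3, ← h2, Preadditive.sum_comp,
    Preadditive.sum_comp, K.map_sum]
  refine Finset.sum_congr rfl fun i _ => ?_
  rw [assoc, assoc, twist_naturality, twist_naturality, h0 _ (hS i), K.map_comp, K.map_comp]

theorem qTrace_obj (X : Zest f) (g : X ⟶ X) : tr (K.map g) = tr (X := X.obj) g := by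
  have h1 := pTrace_map K X Xᘁ (g ≫ (twist X).hom) (K.obj X)ᘁ
  have h2 : pTrace X Xᘁ (g ≫ (twist X).hom) = tr (X := X.obj) g • 𝟙 (𝟙_ (Zest f)) :=
    (Zest.qTrace_eq X g).trans (qTrace_eq_tr (X := X.obj) g)
  refine tr_eq ?_
  rw [qTrace_eq, twist_obj K hf hK, ← K.map_comp, h1, h2, K.map_smul, K.map_id]
  simp

/-- The double braiding in the zesting is the identity on the coefficient α(σ,τ), which has
dimension 1, tensored with the old double braiding; the scalar is ζ² = i for two odd objects. -/
theorem sEntry_obj (X Y : Zest f) : sEntry (K.obj X) (K.obj Y) =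
    (if X.deg && Y.deg then Complex.I else 1) * sEntry X.obj Y.obj := by
  have h1 : doubleBraiding (K.obj X) (K.obj Y) =
      (Functor.Monoidal.μIso K X Y).symm.inv ≫ K.map (doubleBraiding X Y) ≫
        (Functor.Monoidal.μIso K X Y).symm.hom := by
    simp [doubleBraiding, Functor.map_braiding]
  rw [sEntry_eq_tr, h1, tr_conj, qTrace_obj K hf hK]
  have h2 : ∀ (σ τ : Bool) (X Y : C) (hX : HasParity f σ X) (hY : HasParity f τ Y),
      tr (X := zAlpha f σ τ ⊗ (X ⊗ Y)) ((show (⟨⟨X, σ, hX⟩⟩ : Zest f) ⊗ (⟨⟨Y, τ, hY⟩⟩ : Zest f) ⟶ _ ⊗ _ from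
        doubleBraiding (⟨⟨X, σ, hX⟩⟩ : Zest f) (⟨⟨Y, τ, hY⟩⟩ : Zest f)) :
        zAlpha f σ τ ⊗ (X ⊗ Y) ⟶ zAlpha f σ τ ⊗ (X ⊗ Y)) =
      (if σ && τ then Complex.I else 1) * sEntry X Y := by
    intro σ τ X Y hX hY
    have key : ∀ (a : C) (z w : ℂ), qDim a = 1 →
        tr ((z • (𝟙 a ⊗ₘ (β_ X Y).hom)) ≫ (w • (𝟙 a ⊗ₘ (β_ Y X).hom))) = z * w * sEntry X Y := by
      intro a z w ha
      rw [Linear.smul_comp, Linear.comp_smul, smul_smul, tr_smul, tensorHom_comp_tensorHom,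
        id_comp, tr_tensor, ← qDim_eq_tr, ha, one_mul, sEntry_eq_tr, doubleBraiding]
    rw [← zB_mul_comm]
    cases σ <;> cases τ
    · exact key _ _ _ qDim_unit
    · exact key _ _ _ qDim_unit
    · exact key _ _ _ qDim_unit
    · exact key _ _ _ hf.braiding_and_dim.2
  exact h2 X.deg Y.deg X.obj Y.obj X.parity Y.parity

end Compare

/-- The numerical data of a zesting. -/
structure IsZestFunctor {C : URFC.{u, v}} {D : URFC.{u₂, v₂}} (f : C) (Φ : C.Obj ⥤ D.Obj) : Prop where
  isEquivalence : Φ.IsEquivalence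
  twist : ∀ (σ : Bool) (X : C), Simple X → HasParity f σ X →
    twistScalar (Φ.obj X) = zB σ σ * twistScalar X
  qDim : ∀ X : C, Simple X → qDim (Φ.obj X) = qDim X
  sEntry : ∀ (σ τ : Bool) (X Y : C), Simple X → Simple Y → HasParity f σ X → HasParity f τ Y →
    sEntry (Φ.obj X) (Φ.obj Y) = (if σ && τ then Complex.I else 1) * sEntry X Y

/-- An equivalence induces a bijection of labels. -/
def labelEquiv {C : URFC.{u, v}} {D : URFC.{u₂, v₂}} (Φ : C.Obj ⥤ D.Obj) [Φ.IsEquivalence] :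
    Label C.Obj ≃ Label D.Obj :=
  Equiv.ofBijective (fun l => Label.mk (Φ.obj l.rep) (by have := l.rep_simple; exact simple_obj _ _))
    ⟨fun l m h => by
      obtain ⟨e⟩ := (Label.mk_eq _ _).1 h
      rw [← l.mk_rep, ← m.mk_rep, Label.mk_eq]
      exact ⟨Φ.preimageIso e⟩,
    fun m => by
      have hs : Simple (Φ.objPreimage m.rep) := by
        have := m.rep_simple
        have h : Simple (Φ.obj (Φ.objPreimage m.rep)) := Simple.of_iso (Φ.objObjPreimageIso m.rep)
        exact (simple_obj_iff Φ _).1 h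
      refine ⟨Label.mk _ hs, ?_⟩
      conv_rhs => rw [← m.mk_rep]
      rw [Label.mk_eq]
      obtain ⟨e⟩ := Label.rep_iso _ hs
      exact ⟨Φ.mapIso e ≪≫ Φ.objObjPreimageIso _⟩⟩

theorem labelEquiv_rep {C : URFC.{u, v}} {D : URFC.{u₂, v₂}} (Φ : C.Obj ⥤ D.Obj)
    [Φ.IsEquivalence] (l : Label C.Obj) : Nonempty ((labelEquiv Φ l).rep ≅ Φ.obj l.rep) :=
  Label.rep_iso _ _

namespace IsZestFunctor

variable {C : URFC.{u, v}} {D : URFC.{u₂, v₂}} {f : C} {Φ : C.Obj ⥤ D.Obj}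
  (hf : IsFermion f) (h : IsZestFunctor f Φ)
include h

theorem dim_eq : D.dim = C.dim := by
  have := h.isEquivalence
  rw [dim_eq_sum, dim_eq_sum, ← Equiv.sum_comp (labelEquiv Φ)]
  refine Finset.sum_congr rfl fun l _ => ?_
  obtain ⟨e⟩ := labelEquiv_rep Φ l
  rw [qDim_of_iso e, h.qDim _ l.rep_simple]

include hf

/-- Zesting scales only the odd part of the Gauss sum by ζ; since the even part is zero, it scales
the whole sum. -/
theorem centralCharge_eq : D.centralCharge = Complex.exp (Real.pi * Complex.I / 4) * C.centralCharge := by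
  have := h.isEquivalence
  rw [centralCharge, centralCharge, h.dim_eq, ← mul_div_assoc, finsum_eq_sum_of_fintype,
    finsum_eq_sum_of_fintype, ← Equiv.sum_comp (labelEquiv Φ)]
  congr 1
  have e := hf.sum_even_eq_zero
  -- Each new term is ζ times the old one plus a correction supported on even labels; the
  -- corrections sum to zero.
  have h1 : ∀ l : Label C.Obj, twistScalar (labelEquiv Φ l).rep * FermionicZesting.qDim (labelEquiv Φ l).rep ^ 2 =
      Complex.exp (Real.pi * Complex.I / 4) * (twistScalar l.rep * FermionicZesting.qDim l.rep ^ 2) +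
      (1 - Complex.exp (Real.pi * Complex.I / 4)) * (if hf.deg l then 0 else twistScalar l.rep * FermionicZesting.qDim l.rep ^ 2) := by
    intro l
    obtain ⟨e⟩ := labelEquiv_rep Φ l
    rw [twistScalar_of_iso (Label.rep_simple _) e, qDim_of_iso e, h.qDim _ l.rep_simple,
      h.twist _ _ l.rep_simple (hf.hasParity_deg l)]
    cases hf.deg l <;> simp [zB] <;> ring
  simp only [h1]
  rw [Finset.sum_add_distrib, ← Finset.mul_sum, ← Finset.mul_sum, e, mul_zero, add_zero]

/-- For a vector in the kernel of the new S-matrix, let a and b be the contributions of the even and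
the odd columns of the old matrix. Replacing a row label l by f ⊗ l fixes a and negates b. The
vanishing of a + b, or of a + i b in odd rows, for both labels forces a = b = 0, so the vector lies
in the kernel of the old S-matrix. -/
theorem isModular (hC : C.IsModular) : D.IsModular := by
  classical
  have := h.isEquivalence
  intro h0
  have h0' : D.sMatrix.det = 0 := by convert h0
  obtain ⟨v, hv, hv0⟩ := Matrix.exists_mulVec_eq_zero_iff.2 h0'
  let w : Label C.Obj → ℂ := fun l => v (labelEquiv Φ l)
  have h1 : ∀ l : Label C.Obj, ∑ m : Label C.Obj, (if hf.deg l && hf.deg m then Complex.I else 1) *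
      FermionicZesting.sEntry l.rep m.rep * w m = 0 := by
    intro l
    have h2 := congrFun hv0 (labelEquiv Φ l)
    have h3 : ∑ m : Label D.Obj, FermionicZesting.sEntry (labelEquiv Φ l).rep m.rep * v m = 0 := h2
    rw [← Equiv.sum_comp (labelEquiv Φ)] at h3
    rw [← h3]
    refine Finset.sum_congr rfl fun m _ => ?_
    obtain ⟨e⟩ := labelEquiv_rep Φ l
    obtain ⟨e'⟩ := labelEquiv_rep Φ m
    rw [sEntry_of_iso e e', h.sEntry _ _ _ _ l.rep_simple m.rep_simple (hf.hasParity_deg l) (hf.hasParity_deg m)]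
  let a : Label C.Obj → ℂ := fun l => ∑ m : Label C.Obj, if hf.deg m then 0 else FermionicZesting.sEntry l.rep m.rep * w m
  let b : Label C.Obj → ℂ := fun l => ∑ m : Label C.Obj, if hf.deg m then FermionicZesting.sEntry l.rep m.rep * w m else 0
  have hab : ∀ l, a l + (if hf.deg l then Complex.I else 1) * b l = 0 := by
    intro l
    rw [← h1 l, Finset.mul_sum, ← Finset.sum_add_distrib]
    refine Finset.sum_congr rfl fun m _ => ?_
    cases hf.deg l <;> cases hf.deg m <;> simp [mul_assoc]
  have hs : ∀ l m : Label C.Obj, FermionicZesting.sEntry (hf.perm l).rep m.rep =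
      pSign (hf.deg m) * FermionicZesting.sEntry l.rep m.rep := by
    intro l m
    obtain ⟨e⟩ := hf.perm_rep l
    rw [sEntry_of_iso e (Iso.refl _), sEntry_fermion_tensor hf _ (hf.hasParity_deg m)]
  have ha : ∀ l, a (hf.perm l) = a l := fun l => Finset.sum_congr rfl fun m _ => by
    rw [hs]; cases hf.deg m <;> simp [pSign]
  have hb : ∀ l, b (hf.perm l) = - b l := fun l => by
    rw [← Finset.sum_neg_distrib]
    refine Finset.sum_congr rfl fun m _ => ?_
    rw [hs]; cases hf.deg m <;> simp [pSign]
  have h4 : ∀ l, a l = 0 ∧ b l = 0 := by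
    intro l
    have h5 := hab l
    have h6 := hab (hf.perm l)
    rw [hf.deg_perm, ha, hb] at h6
    have h7 : a l = 0 := by linear_combination (1 / 2 : ℂ) * h5 + (1 / 2 : ℂ) * h6
    rw [h7, zero_add] at h5
    refine ⟨h7, (mul_eq_zero.1 h5).resolve_left ?_⟩
    split_ifs <;> simp
  apply hC
  have : ∃ w : Label C.Obj → ℂ, w ≠ 0 ∧ C.sMatrix.mulVec w = 0 := by
    refine ⟨w, ?_, ?_⟩
    · intro hw
      apply hv
      funext m
      have := congrFun hw ((labelEquiv Φ).symm m)
      simpa [w] using this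
    · funext l
      change ∑ m : Label C.Obj, FermionicZesting.sEntry l.rep m.rep * w m = 0
      have h5 := h4 l
      have h6 : a l + b l = 0 := by rw [h5.1, h5.2, add_zero]
      rw [← h6, ← Finset.sum_add_distrib]
      refine Finset.sum_congr rfl fun m _ => ?_
      cases hf.deg m <;> simp
  convert Matrix.exists_mulVec_eq_zero_iff.1 this

end IsZestFunctor

end URFC

end

/-! ### Correcting the signs of a unitary structure so that it is positive on sums. -/

section

open BraidedCategory
open RibbonStructure

namespace URFC

variable {C : URFC.{u, v}} (U : UnitaryStructure C.Obj)

section Norm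

/-- The hermitian form on the morphisms from a simple object, on the diagonal. -/
def nrm {S X : C} (g : S ⟶ X) : ℝ := (endScalar (g ≫ U.dag g)).re

variable {S X : C}

theorem comp_dag (hS : Simple S) (g : S ⟶ X) : g ≫ U.dag g = (nrm U g : ℂ) • 𝟙 S := by
  have h := eq_endScalar_smul hS (g ≫ U.dag g)
  have h2 := congrArg U.dag h
  rw [U.dag_comp, U.dag_dag, U.dag_smul, U.dag_id] at h2
  have h3 := smul_left_injective ℂ (id_nonzero S) (h.symm.trans h2)
  have h4 : ((endScalar (g ≫ U.dag g)).re : ℂ) = endScalar (g ≫ U.dag g) :=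
    Complex.conj_eq_iff_re.1 h3.symm
  rw [nrm, h4]; exact h

theorem nrm_eq (hS : Simple S) {g : S ⟶ X} {z : ℝ} (h : g ≫ U.dag g = (z : ℂ) • 𝟙 S) :
    nrm U g = z := by
  rw [nrm, h, endScalar_smul_id (id_nonzero S), Complex.ofReal_re]

theorem nrm_id (hS : Simple S) : nrm U (𝟙 S) = 1 := nrm_eq U hS (by simp [U.dag_id])

theorem nrm_ne_zero (hS : Simple S) {g : S ⟶ X} (hg : g ≠ 0) : nrm U g ≠ 0 := by
  intro h
  refine hg (U.dag_pos g ?_)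
  rw [comp_dag U hS, h]; simp

theorem ne_zero_of_nrm (hS : Simple S) {g : S ⟶ X} (hg : nrm U g ≠ 0) : g ≠ 0 := by
  rintro rfl
  exact hg (nrm_eq U hS (by simp))

theorem nrm_comp {T : C} (hT : Simple T) (hS : Simple S) (u : T ⟶ S) (g : S ⟶ X) :
    nrm U (u ≫ g) = nrm U u * nrm U g := by
  refine nrm_eq U hT ?_
  rw [U.dag_comp, assoc, ← assoc g, comp_dag U hS]
  simp only [Linear.smul_comp, Linear.comp_smul, id_comp, comp_dag U hT, smul_smul]
  push_cast
  ring_nf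

theorem nrm_tensor {A B Y : C} (hS : Simple S) (hA : Simple A) (hB : Simple B) (g : S ⟶ A ⊗ B)
    (u : A ⟶ X) (v : B ⟶ Y) : nrm U (g ≫ (u ⊗ₘ v)) = nrm U g * nrm U u * nrm U v := by
  refine nrm_eq U hS ?_
  rw [U.dag_comp, U.dag_tensor, assoc, tensorHom_comp_tensorHom_assoc, comp_dag U hA,
    comp_dag U hB]
  simp only [smul_tensorHom, tensorHom_smul, id_tensorHom_id, Linear.smul_comp, Linear.comp_smul,
    id_comp, comp_dag U hS, smul_smul]
  push_cast
  ring_nf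

theorem nrm_comp_iso (hS : Simple S) {Y : C} (g : S ⟶ X) (e : X ≅ Y) (he : U.dag e.hom = e.inv) :
    nrm U (g ≫ e.hom) = nrm U g := by
  refine nrm_eq U hS ?_
  rw [U.dag_comp, he, assoc, e.hom_inv_id_assoc, comp_dag U hS]

/-- The form is definite. -/
theorem nrm_mul_pos (hS : Simple S) {g h : S ⟶ X} (hg : g ≠ 0) (hh : h ≠ 0) :
    0 < nrm U g * nrm U h := by
  by_contra hlt
  have hlt' : nrm U g * nrm U h < 0 := lt_of_le_of_ne (not_lt.1 hlt)
    (mul_ne_zero (nrm_ne_zero U hS hg) (nrm_ne_zero U hS hh))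
  set z := endScalar (g ≫ U.dag h) with hz
  have h1 : g ≫ U.dag h = z • 𝟙 S := eq_endScalar_smul hS _
  have h2 : h ≫ U.dag g = starRingEnd ℂ z • 𝟙 S := by
    have := congrArg U.dag h1
    rwa [U.dag_comp, U.dag_dag, U.dag_smul, U.dag_id] at this
  -- If the two norms had opposite signs, this quadratic polynomial in t would have a real zero.
  -- Then g + t h = 0, so the norm of g would be t² times that of h, and the signs would agree after
  -- all.
  have key : ∀ t : ℝ, nrm U (g + (t : ℂ) • h) =
      nrm U h * (t * t) + (2 * z.re) * t + nrm U g := by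
    intro t
    refine nrm_eq U hS ?_
    rw [U.dag_add, U.dag_smul, Complex.conj_ofReal]
    simp only [Preadditive.add_comp, Preadditive.comp_add, Linear.smul_comp, Linear.comp_smul, h1,
      h2, comp_dag U hS, smul_smul, ← add_smul]
    congr 1
    have := Complex.add_conj z
    push_cast at this ⊢
    linear_combination (t : ℂ) * this
  have hd : 0 ≤ discrim (nrm U h) (2 * z.re) (nrm U g) := by
    rw [discrim]; nlinarith [sq_nonneg (2 * z.re)]
  obtain ⟨t, ht⟩ := exists_quadratic_eq_zero (nrm_ne_zero U hS hh)
    ⟨Real.sqrt _, (Real.mul_self_sqrt hd).symm⟩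
  have h3 : g + (t : ℂ) • h = 0 := by
    by_contra hne
    exact nrm_ne_zero U hS hne (by rw [key, ← ht])
  have h4 : nrm U g = t * t * nrm U h := by
    refine nrm_eq U hS ?_
    rw [eq_neg_of_add_eq_zero_left h3, ← neg_smul, U.dag_smul]
    simp only [Linear.smul_comp, Linear.comp_smul, comp_dag U hS, smul_smul, map_neg,
      Complex.conj_ofReal]
    push_cast
    ring_nf
  rw [h4] at hlt'
  nlinarith [mul_self_nonneg (t * nrm U h)]

end Norm

section Sign

/-- The sum of all simple objects. -/
def allSimples (C : URFC.{u, v}) : C :=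
  have := Abelian.hasFiniteBiproducts (C := C.Obj)
  ⨁ fun l : Label C.Obj => l.rep

theorem exists_ne_zero_allSimples {S : C} (hS : Simple S) : ∃ k : S ⟶ allSimples C, k ≠ 0 := by
  have := Abelian.hasFiniteBiproducts (C := C.Obj)
  obtain ⟨e⟩ := Label.rep_iso S hS
  refine ⟨e.inv ≫ biproduct.ι (fun l : Label C.Obj => l.rep) _, fun h => ?_⟩
  have h2 : (e.inv ≫ biproduct.ι (fun l : Label C.Obj => l.rep) (Label.mk S hS)) ≫
      biproduct.π (fun l : Label C.Obj => l.rep) (Label.mk S hS) ≫ e.hom = 0 ≫ _ := congrArg (· ≫ _) h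
  rw [zero_comp, assoc, biproduct.ι_π_self_assoc, e.inv_hom_id] at h2
  exact id_nonzero S h2

open Classical in
/-- The sign of the form on morphisms from `S` to `X`, relative to the sum of all simple objects. -/
def sgn (X S : C) : ℝ :=
  if ∃ (g : S ⟶ X) (k : S ⟶ allSimples C), nrm U g * nrm U k < 0 then -1 else 1

theorem sgn_eq (X S : C) : sgn U X S = 1 ∨ sgn U X S = -1 := by
  rw [sgn]; split_ifs <;> simp

theorem sgn_mul_self (X S : C) : sgn U X S * sgn U X S = 1 := by
  rcases sgn_eq U X S with h | h <;> rw [h] <;> norm_num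

theorem sgn_mul_pos {X S : C} (hS : Simple S) {g : S ⟶ X} {k : S ⟶ allSimples C} (hg : g ≠ 0)
    (hk : k ≠ 0) : 0 < sgn U X S * (nrm U g * nrm U k) := by
  rw [sgn]
  split_ifs with h
  · obtain ⟨g', k', h'⟩ := h
    have hg' : g' ≠ 0 := ne_zero_of_nrm U hS (by intro h0; rw [h0] at h'; simp at h')
    have hk' : k' ≠ 0 := ne_zero_of_nrm U hS (by intro h0; rw [h0] at h'; simp at h')
    have h1 := nrm_mul_pos U hS hg hg'
    have h2 := nrm_mul_pos U hS hk hk'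
    by_contra h3
    have h4 : 0 ≤ nrm U g * nrm U k := by linarith
    have h5 := mul_pos h1 h2
    have h6 : nrm U g * nrm U g' * (nrm U k * nrm U k') = (nrm U g * nrm U k) * (nrm U g' * nrm U k') := by ring
    rw [h6] at h5
    linarith [mul_nonpos_of_nonneg_of_nonpos h4 h'.le]
  · have h1 : nrm U g * nrm U k ≠ 0 := mul_ne_zero (nrm_ne_zero U hS hg) (nrm_ne_zero U hS hk)
    rw [one_mul]
    by_contra h2
    exact h ⟨g, k, lt_of_le_of_ne (not_lt.1 h2) h1⟩

theorem eq_of_sign {r s a : ℝ} (hr : r = 1 ∨ r = -1) (hs : s = 1 ∨ s = -1) (h : 0 < r * s * (a * a)) :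
    r = s := by
  have ha := mul_self_nonneg a
  rcases hr with rfl | rfl <;> rcases hs with rfl | rfl <;> norm_num at h ⊢ <;> nlinarith

/-- Signs are compared through arbitrary nonzero morphisms: as the form is definite, it is enough
that the product of the four norms is a square. -/
theorem sgn_congr {X Y S T : C} (hS : Simple S) (hT : Simple T) {g : S ⟶ X} {h : T ⟶ Y}
    (hg : g ≠ 0) (hh : h ≠ 0) {k : S ⟶ allSimples C} {l : T ⟶ allSimples C} (hk : k ≠ 0)
    (hl : l ≠ 0) {a : ℝ} (e : nrm U g * nrm U k * (nrm U h * nrm U l) = a * a) :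
    sgn U X S = sgn U Y T := by
  refine eq_of_sign (a := a) (sgn_eq U X S) (sgn_eq U Y T) ?_
  have h1 := mul_pos (sgn_mul_pos U hS hg hk) (sgn_mul_pos U hT hh hl)
  rw [← e]
  refine lt_of_lt_of_eq h1 ?_
  ring

theorem sgn_of_iso {X S T : C} (hS : Simple S) (hT : Simple T) (e : T ≅ S) {g : S ⟶ X}
    (hg : g ≠ 0) : sgn U X T = sgn U X S := by
  obtain ⟨k, hk⟩ := exists_ne_zero_allSimples hS
  have h1 : ∀ {Y : C} {h : S ⟶ Y}, h ≠ 0 → e.hom ≫ h ≠ 0 := fun h h0 => h ((cancel_epi e.hom).1 (by rw [h0, comp_zero]))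
  refine sgn_congr U hT hS (h1 hg) hg (h1 hk) hk (a := nrm U e.hom * nrm U g * nrm U k) ?_
  rw [nrm_comp U hT hS, nrm_comp U hT hS]
  ring

theorem sgn_unitary_iso {X Y S : C} (hS : Simple S) (e : X ≅ Y) (he : U.dag e.hom = e.inv)
    {g : S ⟶ X} (hg : g ≠ 0) : sgn U Y S = sgn U X S := by
  obtain ⟨k, hk⟩ := exists_ne_zero_allSimples hS
  have h1 : g ≫ e.hom ≠ 0 := fun h0 => hg ((cancel_mono e.hom).1 (by rw [h0, zero_comp]))
  refine sgn_congr U hS hS h1 hg hk hk (a := nrm U g * nrm U k) ?_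
  rw [nrm_comp_iso U hS g e he]

/-- The same `g` leads from `S` into `X ⊗ Y` and into the product of the reference objects; by
`nrm_tensor` its norm occurs in both and drops out of the comparison of signs. -/
theorem sgn_tensor_aux {X Y S A B : C} (hS : Simple S) (hA : Simple A) (hB : Simple B)
    {g : S ⟶ A ⊗ B} {u : A ⟶ X} {v : B ⟶ Y} (hg : g ≠ 0) (hu : u ≠ 0) (hv : v ≠ 0) :
    sgn U (X ⊗ Y) S = sgn U X A * sgn U Y B * sgn U (allSimples C ⊗ allSimples C) S := by
  obtain ⟨k, hk⟩ := exists_ne_zero_allSimples hS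
  obtain ⟨a, ha⟩ := exists_ne_zero_allSimples hA
  obtain ⟨b, hb⟩ := exists_ne_zero_allSimples hB
  have h0 : ∀ {X Y : C} {u : A ⟶ X} {v : B ⟶ Y}, u ≠ 0 → v ≠ 0 → g ≫ (u ⊗ₘ v) ≠ 0 := by
    intro X Y u v hu hv
    refine ne_zero_of_nrm U hS ?_
    rw [nrm_tensor U hS hA hB]
    exact mul_ne_zero (mul_ne_zero (nrm_ne_zero U hS hg) (nrm_ne_zero U hA hu)) (nrm_ne_zero U hB hv)
  have h1 := sgn_mul_pos U hS (h0 hu hv) hk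
  have h2 := sgn_mul_pos U hS (h0 ha hb) hk
  have h3 := sgn_mul_pos U hA hu ha
  have h4 := sgn_mul_pos U hB hv hb
  rw [nrm_tensor U hS hA hB] at h1 h2
  have h5 := mul_pos (mul_pos h1 h2) (mul_pos h3 h4)
  refine eq_of_sign (a := nrm U g * nrm U k * (nrm U u * nrm U a) * (nrm U v * nrm U b)) (sgn_eq U _ _) ?_ ?_
  · rcases sgn_eq U X A with h | h <;> rcases sgn_eq U Y B with h' | h' <;>
      rcases sgn_eq U (allSimples C ⊗ allSimples C) S with h'' | h'' <;> rw [h, h', h''] <;> norm_num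
  · refine lt_of_lt_of_eq h5 ?_
    ring

/-- The last factor in `sgn_tensor_aux` does not depend on `S`: applying that lemma to the unitary
left unitor of `S` evaluates it. The sign is thus multiplicative up to a constant, which `nsgn`
removes. -/
theorem sgn_tensor {X Y S A B : C} (hS : Simple S) (hA : Simple A) (hB : Simple B)
    {g : S ⟶ A ⊗ B} {u : A ⟶ X} {v : B ⟶ Y} (hg : g ≠ 0) (hu : u ≠ 0) (hv : v ≠ 0) :
    sgn U (X ⊗ Y) S = sgn U X A * sgn U Y B * sgn U (𝟙_ C.Obj) (𝟙_ C.Obj) := by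
  have h1 : sgn U (allSimples C ⊗ allSimples C) S = sgn U (𝟙_ C.Obj) (𝟙_ C.Obj) := by
    have h2 := sgn_tensor_aux U hS C.unit_simple hS (g := (λ_ S).inv) (u := 𝟙 _) (v := 𝟙 S)
      (fun h => id_nonzero S (by rw [← (λ_ S).inv_hom_id, h, zero_comp])) unit_id_ne_zero
      (id_nonzero S)
    have h3 := sgn_unitary_iso U hS (λ_ S).symm (U.dag_inv _ (U.dag_leftUnitor S)) (id_nonzero S)
    rw [h3] at h2
    have h4 := sgn_mul_self U S S
    have h5 := sgn_mul_self U (𝟙_ C.Obj) (𝟙_ C.Obj)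
    linear_combination (-sgn U (𝟙_ C.Obj) (𝟙_ C.Obj) * sgn U S S) * h2 + (sgn U (𝟙_ C.Obj) (𝟙_ C.Obj)) * h4
      - (sgn U (allSimples C ⊗ allSimples C) S * sgn U S S * sgn U S S) * h5
      - (sgn U (allSimples C ⊗ allSimples C) S) * h4
  rw [sgn_tensor_aux U hS hA hB hg hu hv, h1]

/-- The sign, normalized to be multiplicative. -/
def nsgn (X S : C) : ℝ := sgn U X S * sgn U (𝟙_ C.Obj) (𝟙_ C.Obj)

theorem nsgn_mul_self (X S : C) : nsgn U X S * nsgn U X S = 1 := by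
  have h1 := sgn_mul_self U X S
  have h2 := sgn_mul_self U (𝟙_ C.Obj) (𝟙_ C.Obj)
  rw [nsgn]
  linear_combination (sgn U (𝟙_ C.Obj) (𝟙_ C.Obj)) ^ 2 * h1 + h2

theorem nsgn_tensor {X Y S A B : C} (hS : Simple S) (hA : Simple A) (hB : Simple B)
    {g : S ⟶ A ⊗ B} {u : A ⟶ X} {v : B ⟶ Y} (hg : g ≠ 0) (hu : u ≠ 0) (hv : v ≠ 0) :
    nsgn U (X ⊗ Y) S = nsgn U X A * nsgn U Y B := by
  rw [nsgn, sgn_tensor U hS hA hB hg hu hv, nsgn, nsgn]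
  ring

theorem nsgn_nonneg (Y S : C) (hS : Simple S) (h : S ⟶ Y) :
    0 ≤ nsgn U Y S * nsgn U S S * nrm U h ∧ (nsgn U Y S * nsgn U S S * nrm U h = 0 → h = 0) := by
  by_cases hh : h = 0
  · have h0 : nrm U h = 0 := nrm_eq U hS (by rw [hh]; simp)
    rw [h0]; simp [hh]
  obtain ⟨k, hk⟩ := exists_ne_zero_allSimples hS
  have h1 := mul_pos (sgn_mul_pos U hS hh hk) (sgn_mul_pos U hS (id_nonzero S) hk)
  rw [nrm_id U hS] at h1
  have h2 := sgn_mul_self U (𝟙_ C.Obj) (𝟙_ C.Obj)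
  have h3 : 0 < nsgn U Y S * nsgn U S S * nrm U h := by
    have h4 : 0 < nrm U k * nrm U k := mul_self_pos.2 (nrm_ne_zero U hS hk)
    refine (mul_pos_iff_of_pos_right h4).1 ?_
    rw [nsgn, nsgn]
    refine lt_of_lt_of_eq h1 ?_
    linear_combination - (sgn U Y S * sgn U S S * nrm U h * (nrm U k * nrm U k)) * h2
  exact ⟨h3.le, fun h => absurd h h3.ne'⟩

/-- The sign depends only on the isomorphism class of `S`, so it can be imposed on each summand of a
decomposition into simple objects. -/
theorem exists_signOp (X : C) : ∃ e : X ⟶ X, ∀ (S : C) (_ : Simple S) (g : S ⟶ X),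
    g ≫ e = (nsgn U X S : ℂ) • g := by
  obtain ⟨n, S, p, q, hS, hp, hpq, h1⟩ := exists_decomposition X
  refine ⟨∑ i, (nsgn U X (S i) : ℂ) • (p i ≫ q i), fun T hT g => ?_⟩
  rw [Preadditive.comp_sum]
  conv_rhs => rw [← comp_id g, ← h1, Preadditive.comp_sum, Finset.smul_sum]
  refine Finset.sum_congr rfl fun i _ => ?_
  rw [Linear.comp_smul]
  by_cases h : g ≫ p i = 0
  · rw [← assoc, h]; simp
  · have := hS i
    have := isIso_of_hom_simple h
    have hq : q i ≠ 0 := fun h0 => id_nonzero (S i) (by rw [← hp, h0, zero_comp])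
    rw [nsgn, nsgn, sgn_of_iso U (hS i) hT (asIso (g ≫ p i)) hq]

/-- The operator that corrects the signs. -/
def signOp (X : C) : X ⟶ X := (exists_signOp U X).choose

variable {U} in
theorem comp_signOp {X S : C} (hS : Simple S) (g : S ⟶ X) :
    g ≫ signOp U X = (nsgn U X S : ℂ) • g := (exists_signOp U X).choose_spec S hS g

theorem signOp_mul_self (X : C) : signOp U X ≫ signOp U X = 𝟙 X := by
  refine simple_hom_ext fun S hS g => ?_
  rw [← assoc, comp_signOp hS, comp_signOp hS, smul_smul, ← Complex.ofReal_mul,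
    nsgn_mul_self]
  simp

/-- Tested on simple objects, the adjoint acts by the same real sign: the difference is orthogonal
to all morphisms, in particular to itself, and † is definite. -/
theorem dag_signOp (X : C) : U.dag (signOp U X) = signOp U X := by
  refine simple_hom_ext fun S hS g => ?_
  rw [comp_signOp hS, ← sub_eq_zero]
  refine U.dag_pos _ ?_
  have h : ∀ h : S ⟶ X, (g ≫ U.dag (signOp U X) - (nsgn U X S : ℂ) • g) ≫ U.dag h = 0 := by
    intro h
    rw [Preadditive.sub_comp, assoc, ← U.dag_comp, comp_signOp hS, U.dag_smul, Complex.conj_ofReal,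
      Linear.comp_smul, Linear.smul_comp, sub_self]
  exact h _

theorem signOp_unitary {X Y : C} (e : X ≅ Y) (he : U.dag e.hom = e.inv) :
    e.hom ≫ signOp U Y = signOp U X ≫ e.hom := by
  refine simple_hom_ext fun S hS g => ?_
  rw [← assoc, ← assoc, comp_signOp hS, comp_signOp hS]
  by_cases hg : g = 0
  · simp [hg]
  · rw [nsgn, nsgn, sgn_unitary_iso U hS e he hg, Linear.smul_comp]

theorem signOp_tensor (X Y : C) : signOp U (X ⊗ Y) = signOp U X ⊗ₘ signOp U Y := by
  obtain ⟨n, A, p, q, hA, hp, hpq, h1⟩ := exists_decomposition X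
  obtain ⟨m, B, p', q', hB, hp', hpq', h1'⟩ := exists_decomposition Y
  have := Abelian.hasFiniteBiproducts (C := C.Obj)
  have hid : 𝟙 (X ⊗ Y) = ∑ i, ∑ j, (p i ⊗ₘ p' j) ≫ (q i ⊗ₘ q' j) := by
    rw [← id_tensorHom_id, ← h1, ← h1', sum_tensorHom]
    refine Finset.sum_congr rfl fun i _ => ?_
    rw [tensorHom_sum]
    simp only [tensorHom_comp_tensorHom]
  refine simple_hom_ext fun S hS g => ?_
  rw [comp_signOp hS]
  conv_lhs => rw [← comp_id g, hid]
  conv_rhs => rw [← id_comp (signOp U X ⊗ₘ signOp U Y), hid]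
  simp only [Preadditive.comp_sum, Preadditive.sum_comp, Finset.smul_sum, assoc,
    tensorHom_comp_tensorHom, comp_signOp (hA _), comp_signOp (hB _), smul_tensorHom, tensorHom_smul,
    Linear.comp_smul, smul_smul]
  refine Finset.sum_congr rfl fun i _ => Finset.sum_congr rfl fun j _ => ?_
  rw [← tensorHom_comp_tensorHom]
  by_cases h : g ≫ (p i ⊗ₘ p' j) = 0
  · rw [← assoc, h]; simp
  · have hq : q i ≠ 0 := fun h0 => have := hA i; id_nonzero (A i) (by rw [← hp, h0, zero_comp])
    have hq' : q' j ≠ 0 := fun h0 => have := hB j; id_nonzero (B j) (by rw [← hp', h0, zero_comp])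
    rw [nsgn_tensor U hS (hA i) (hB j) h hq hq']
    push_cast
    ring_nf

end Sign

theorem dag_normalized_unitary {X Y : C} (e : X ≅ Y) (he : U.dag e.hom = e.inv) :
    signOp U Y ≫ U.dag e.hom ≫ signOp U X = e.inv := by
  have h := signOp_unitary U e he
  rw [he, ← cancel_epi e.hom, reassoc_of% h, e.hom_inv_id_assoc, signOp_mul_self, e.hom_inv_id]

theorem normalized_comp_dag {S Y : C} (hS : Simple S) (h : S ⟶ Y) :
    h ≫ signOp U Y ≫ U.dag h ≫ signOp U S = ((nsgn U Y S * nsgn U S S * nrm U h : ℝ) : ℂ) • 𝟙 S := by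
  have e1 : signOp U S = (nsgn U S S : ℂ) • 𝟙 S := by
    rw [← id_comp (signOp U S), comp_signOp hS]
  rw [← assoc h, comp_signOp hS, e1]
  simp only [Linear.smul_comp, Linear.comp_smul, comp_id, comp_dag U hS, smul_smul]
  push_cast
  ring_nf

/-- Precomposition with a morphism from a simple object `S` turns the hypothesis into a vanishing
sum of nonnegative multiples of the identity of `S`. -/
theorem eq_zero_of_sum_normalized {ι : Type} [Fintype ι] {X : C} (Y : ι → C) (g : ∀ i, X ⟶ Y i)
    (h : ∑ i, g i ≫ signOp U (Y i) ≫ U.dag (g i) ≫ signOp U X = 0) (i : ι) : g i = 0 := by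
  refine simple_hom_ext fun S hS k => ?_
  rw [comp_zero]
  have h1 : ∀ j, (k ≫ g j) ≫ signOp U (Y j) ≫ U.dag (k ≫ g j) ≫ signOp U S =
      k ≫ (g j ≫ signOp U (Y j) ≫ U.dag (g j) ≫ signOp U X) ≫ (signOp U X ≫ U.dag k ≫ signOp U S) := by
    intro j
    have e := signOp_mul_self U X
    simp only [U.dag_comp, assoc, reassoc_of% e]
  have h2 : ∑ j, (k ≫ g j) ≫ signOp U (Y j) ≫ U.dag (k ≫ g j) ≫ signOp U S = 0 := by
    simp only [h1]
    rw [← Preadditive.comp_sum, ← Preadditive.sum_comp, h, zero_comp, comp_zero]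
  simp only [normalized_comp_dag U hS] at h2
  rw [← Finset.sum_smul] at h2
  have h3 := (smul_eq_zero.1 h2).resolve_right (id_nonzero S)
  have h4 : ∑ j, nsgn U (Y j) S * nsgn U S S * nrm U (k ≫ g j) = 0 := by exact_mod_cast h3
  have h5 := (Finset.sum_eq_zero_iff_of_nonneg fun j _ => (nsgn_nonneg U (Y j) S hS (k ≫ g j)).1).1 h4 i
    (Finset.mem_univ i)
  exact (nsgn_nonneg U (Y i) S hS (k ≫ g i)).2 h5

/-- The corrected unitary structure. -/
def normalized : UnitaryStructure C.Obj where
  dag {X Y} g := signOp U Y ≫ U.dag g ≫ signOp U X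
  dag_dag g := by
    simp only [U.dag_comp, U.dag_dag, dag_signOp, assoc, signOp_mul_self, comp_id]
    rw [← assoc, signOp_mul_self, id_comp]
  dag_comp {X Y Z} g h := by
    have e := signOp_mul_self U Y
    simp only [U.dag_comp, assoc, reassoc_of% e]
  dag_add g h := by simp [U.dag_add]
  dag_smul z g := by simp [U.dag_smul]
  dag_tensor g h := by simp only [U.dag_tensor, signOp_tensor, tensorHom_comp_tensorHom]
  dag_associator X Y Z := dag_normalized_unitary U _ (U.dag_associator X Y Z)
  dag_leftUnitor X := dag_normalized_unitary U _ (U.dag_leftUnitor X)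
  dag_rightUnitor X := dag_normalized_unitary U _ (U.dag_rightUnitor X)
  dag_braiding X Y := dag_normalized_unitary U _ (U.dag_braiding X Y)
  dag_twist X := dag_normalized_unitary U _ (U.dag_twist X)
  dag_pos {X Y} g h := by
    exact eq_zero_of_sum_normalized U (ι := Unit) (fun _ => Y) (fun _ => g) (by simpa using h) ()

/-- Every unitary ribbon fusion category has a unitary structure that is positive on sums. -/
theorem exists_isPositive (C : URFC.{u, v}) : ∃ U : UnitaryStructure C.Obj, U.IsPositive := by
  obtain ⟨U⟩ := C.unitary
  exact ⟨normalized U, fun Y g h => eq_zero_of_sum_normalized U Y g h⟩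

end URFC

end

/-! ### The zested category is a unitary ribbon fusion category. -/

section

open BraidedCategory
open RibbonStructure

/-- The functor from the zested category that forgets the degree. -/
@[simps]
def Zest.forget {C : Type u} [Category.{v} C] [Preadditive C] [Linear ℂ C] [MonoidalCategory C]
    [MonoidalPreadditive C] [MonoidalLinear ℂ C] [BraidedCategory C] (f : C) [SelfFermionic f] : Zest f ⥤ C where
  obj X := X.obj
  map g := g

section

variable {C : Type u} [Category.{v} C] [Preadditive C] [Linear ℂ C] [MonoidalCategory C]
    [MonoidalPreadditive C] [MonoidalLinear ℂ C] [BraidedCategory C] (f : C) [SelfFermionic f]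

instance : (Zest.forget f).Faithful where
  map_injective h := h

instance : (Zest.forget f).Full where
  map_surjective g := ⟨g, rfl⟩

instance : (Zest.forget f).Additive where
  map_add := rfl

instance : (Zest.forget f).Linear ℂ where
  map_smul _ _ := rfl

end

namespace URFC

variable {C : URFC.{u, v}} {f : C}

attribute [local instance] Abelian.hasFiniteBiproducts

theorem isDense_of_homogeneous {G : Type u₂} [Category.{v₂} G] (hf : IsFermion f) (K : G ⥤ C.Obj)
    (h : ∀ (σ : Bool) (X : C), Simple X → HasParity f σ X → ∃ Y : G, Nonempty (K.obj Y ≅ X)) :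
    IsDense K := by
  intro X
  obtain ⟨n, S, hS, ⟨e⟩⟩ := C.semisimple X
  have h' : ∀ i, ∃ Y : G, Nonempty (K.obj Y ≅ S i) := fun i => by
    obtain ⟨σ, hσ⟩ := hf.exists_hasParity (hS i)
    exact h σ _ (hS i) hσ
  choose T hT using h'
  exact ⟨n, T, ⟨biproduct.mapIso (fun i => (hT i).some) ≪≫ e.symm⟩⟩

theorem IsFermion.zestForget_isDense [SelfFermionic f] (hf : IsFermion f) : IsDense (Zest.forget f) :=
  isDense_of_homogeneous hf _ fun σ X _ hX => ⟨⟨⟨X, σ, hX⟩⟩, ⟨Iso.refl _⟩⟩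

theorem IsFermion.homogForget_isDense [SelfFermionic f] (hf : IsFermion f) :
    IsDense (Homog.forget C.Obj f) :=
  isDense_of_homogeneous hf _ fun σ X _ hX => ⟨⟨X, σ, hX⟩, ⟨Iso.refl _⟩⟩

section

variable [SelfFermionic f]

/-- Sums of homogeneous objects are all objects. -/
abbrev zestSum (f : C) [SelfFermionic f] : Fam (Zest f) ⥤ C.Obj := Fam.extend (Zest.forget f)

theorem IsFermion.zestSum_isEquivalence (hf : IsFermion f) : (zestSum f).IsEquivalence :=
  Fam.extend_isEquivalence hf.zestForget_isDense

@[reducible]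
def IsFermion.zestAbelian (hf : IsFermion f) : Abelian (Fam (Zest f)) :=
  have := hf.zestSum_isEquivalence
  have : HasFiniteProducts (Fam (Zest f)) :=
    ⟨fun n => Adjunction.hasLimitsOfShape_of_equivalence (zestSum f)⟩
  abelianOfEquivalence (zestSum f)

/-- The sum of one object. -/
def zestSumSingle (X : Zest f) : (zestSum f).obj ((Fam.single _).obj X) ≅ X.obj :=
  (Fam.singleExtend (Zest.forget f)).app X

theorem IsFermion.exists_single (hf : IsFermion f) (M : Fam (Zest f)) (hM : Simple ((zestSum f).obj M)) :
    ∃ X : Zest f, Simple X.obj ∧ Nonempty ((Fam.single _).obj X ≅ M) := by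
  have := hf.zestSum_isEquivalence
  obtain ⟨σ, hσ⟩ := hf.exists_hasParity hM
  exact ⟨⟨⟨(zestSum f).obj M, σ, hσ⟩⟩, hM, ⟨(zestSum f).preimageIso (zestSumSingle _)⟩⟩

variable [FermionicTwist f]

theorem qTrace_single (X : Zest f) (g : X.obj ⟶ X.obj) :
    qTrace ((Fam.single (Zest f)).map (X := X) (Y := X) g) = tr g • 𝟙 (𝟙_ (Fam (Zest f))) := by
  have h0 : (twist ((Fam.single (Zest f)).obj X)).hom = (Fam.single (Zest f)).map (twist X).hom := by
    exact Fam.hom_ext fun i j => Fam.diag_apply_self (M := (Fam.single (Zest f)).obj X)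
      (N := (Fam.single (Zest f)).obj X) (fun i => i) (fun i => (twist X).hom) i
  have h1 := pTrace_map (Fam.single (Zest f)) X Xᘁ ((g : X ⟶ X) ≫ (twist X).hom) ((Fam.single (Zest f)).obj X)ᘁ
  have h2 : pTrace X Xᘁ (g ≫ (twist X).hom) = tr (X := X.obj) g • 𝟙 (𝟙_ (Zest f)) :=
    (Zest.qTrace_eq X g).trans (qTrace_eq_tr (X := X.obj) g)
  rw [qTrace_eq, h0, ← Functor.map_comp, h1, h2, Functor.map_smul,
    CategoryTheory.Functor.map_id]
  simp

theorem IsFermion.fam_unit_simple (hf : IsFermion f) : Simple (𝟙_ (Fam (Zest f))) := by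
  have := hf.zestSum_isEquivalence
  have h : Simple ((zestSum f).obj ((Fam.single _).obj (𝟙_ (Zest f)))) := by
    have := C.unit_simple
    exact Simple.of_iso (zestSumSingle (𝟙_ (Zest f)))
  exact (simple_obj_iff (zestSum f) _).1 h

/-- The zesting of a unitary ribbon fusion category by a fermion. -/
def zested (C : URFC.{u, v}) (f : C) [SelfFermionic f] [FermionicTwist f] (hf : IsFermion f) : URFC.{u, v} :=
  letI := hf.zestAbelian
  { Obj := Fam (Zest f)
    hom_finite := fun M N => by
      have (X Y : Zest f) : FiniteDimensional ℂ (X ⟶ Y) := C.hom_finite X.obj Y.obj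
      exact inferInstanceAs (FiniteDimensional ℂ (∀ i j, M.obj i ⟶ N.obj j))
    unit_simple := hf.fam_unit_simple
    semisimple := fun M => by
      have := hf.zestSum_isEquivalence
      obtain ⟨n, S, hS, ⟨e⟩⟩ := C.semisimple ((zestSum f).obj M)
      choose σ hσ using fun i => hf.exists_hasParity (hS i)
      refine ⟨n, fun i => (Fam.single _).obj (⟨⟨S i, σ i, hσ i⟩⟩ : Zest f), fun i => ?_, ⟨?_⟩⟩
      · have h : Simple ((zestSum f).obj ((Fam.single _).obj (⟨⟨S i, σ i, hσ i⟩⟩ : Zest f))) := by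
          have := hS i
          exact Simple.of_iso (zestSumSingle (⟨⟨S i, σ i, hσ i⟩⟩ : Zest f))
        exact (simple_obj_iff (zestSum f) _).1 h
      · refine (zestSum f).preimageIso (e ≪≫ ?_)
        refine biproduct.mapIso (fun i => (zestSumSingle (⟨⟨S i, σ i, hσ i⟩⟩ : Zest f)).symm) ≪≫ ?_
        exact ((zestSum f).mapBiproduct _).symm
    finite_label := by
      have := hf.zestSum_isEquivalence
      refine Finite.of_injective (β := Label C.Obj) (fun l => Label.mk ((zestSum f).obj l.rep)
        (by have := l.rep_simple; exact simple_obj _ _)) fun l m h => ?_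
      obtain ⟨e⟩ := (Label.mk_eq _ _).1 h
      rw [← l.mk_rep, ← m.mk_rep, Label.mk_eq]
      exact ⟨(zestSum f).preimageIso e⟩
    qDim_pos := fun M hM => by
      have := hf.zestSum_isEquivalence
      have hM' : Simple ((zestSum f).obj M) := simple_obj _ _
      obtain ⟨X, hX, ⟨e⟩⟩ := hf.exists_single M hM'
      obtain ⟨r, hr, hr'⟩ := C.qDim_pos X.obj hX
      refine ⟨r, hr, ?_⟩
      have h0 := hf.fam_unit_simple
      have h1 : qTrace (𝟙 M) = tr (𝟙 X.obj) • 𝟙 (𝟙_ (Fam (Zest f))) := by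
        rw [← qTrace_single X (𝟙 X.obj), ← qTrace_conj e]
        exact congrArg qTrace (((congrArg (e.inv ≫ ·) ((congrArg (· ≫ e.hom)
          ((Fam.single (Zest f)).map_id X)).trans (id_comp _))).trans e.inv_hom_id).symm)
      rw [← hr', qDim, h1, endScalar_smul_id (id_nonzero _), qDim_eq_tr]
    unitary := by
      -- Morphisms between families are matrices, so a unitary structure that is positive on sums is
      -- required.
      obtain ⟨U, hU⟩ := C.exists_isPositive
      exact ⟨Fam.unitary (zestUnitary U f) fun Y g h => hU (fun i => (Y i).obj) g h⟩ }

end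

end URFC

end

/-! ### The inclusion of even objects, and the zested modular closure. -/

section

open BraidedCategory
section EvenLift

variable {C : Type u} [Category.{v} C] [Preadditive C] [Linear ℂ C] [MonoidalCategory C]
    [MonoidalPreadditive C] [MonoidalLinear ℂ C] [BraidedCategory C] {f : C} [SelfFermionic f]
    {B : Type u₁} [Category.{v₁} B] (F : B ⥤ C) (h : ∀ b, HasParity f false (F.obj b))

/-- A functor with values in even objects, as a functor to the zested category. -/
@[simps]
def evenLift : B ⥤ Zest f where
  obj b := ⟨⟨F.obj b, false, h b⟩⟩
  map g := F.map g
  map_id b := F.map_id b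
  map_comp a b := F.map_comp a b

instance [F.Full] : (evenLift F h).Full where
  map_surjective g := F.map_surjective g

instance [F.Faithful] : (evenLift F h).Faithful where
  map_injective e := F.map_injective e

instance [Preadditive B] [F.Additive] : (evenLift F h).Additive where
  map_add := F.map_add

instance [Preadditive B] [Linear ℂ B] [F.Linear ℂ] : (evenLift F h).Linear ℂ where
  map_smul g r := F.map_smul r g

variable [MonoidalCategory B] [F.Monoidal]

open Functor.LaxMonoidal Functor.Monoidal

/-- The tensorator of `evenLift`. -/
def evenLiftμ (b b' : B) : (evenLift F h).obj b ⊗ (evenLift F h).obj b' ≅ (evenLift F h).obj (b ⊗ b') :=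
  Zest.mkIso (X := Zest.tObj ((evenLift F h).obj b) ((evenLift F h).obj b')) (Y := (evenLift F h).obj (b ⊗ b'))
    ((λ_ (F.obj b ⊗ F.obj b')) ≪≫ μIso F b b')

instance : (evenLift F h).Monoidal :=
  Functor.CoreMonoidal.toMonoidal
    { εIso := Zest.mkIso (X := 𝟙_ (Zest f)) (Y := (evenLift F h).obj (𝟙_ B)) (εIso F)
      μIso := evenLiftμ F h
      μIso_hom_natural_left := by
        intro X Y g Z
        change (𝟙 (𝟙_ C) ⊗ₘ (F.map g ⊗ₘ 𝟙 (F.obj Z))) ≫ (λ_ _).hom ≫ μ F Y Z = ((λ_ _).hom ≫ μ F X Z) ≫ F.map (g ▷ Z)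
        simp
      μIso_hom_natural_right := by
        intro X Y Z g
        change (𝟙 (𝟙_ C) ⊗ₘ (𝟙 (F.obj Z) ⊗ₘ F.map g)) ≫ (λ_ _).hom ≫ μ F Z Y = ((λ_ _).hom ≫ μ F Z X) ≫ F.map (Z ◁ g)
        simp
      associativity := by
        intro X Y Z
        change (𝟙 (𝟙_ C) ⊗ₘ (((λ_ _).hom ≫ μ F X Y) ⊗ₘ 𝟙 (F.obj Z))) ≫ ((λ_ _).hom ≫ μ F (X ⊗ Y) Z) ≫ F.map (α_ X Y Z).hom =
          (zW false false false • crossAssoc (𝟙 (𝟙_ C ⊗ 𝟙_ C)) (F.obj X) (F.obj Y) (F.obj Z)) ≫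
          (𝟙 (𝟙_ C) ⊗ₘ (𝟙 (F.obj X) ⊗ₘ ((λ_ _).hom ≫ μ F Y Z))) ≫ ((λ_ _).hom ≫ μ F X (Y ⊗ Z))
        have e := Functor.LaxMonoidal.associativity F X Y Z
        rw [zW, if_neg (by decide), one_smul, crossAssoc_eq, braiding_inv_tensorUnit_right]
        simp only [MonoidalCategory.tensorHom_def, assoc, comp_whiskerRight, id_whiskerRight, id_comp,
          MonoidalCategory.whiskerLeft_comp, MonoidalCategory.whiskerLeft_id]
        calc
          _ = 𝟙 _ ⊗≫ (μ F X Y ▷ F.obj Z ≫ μ F (X ⊗ Y) Z ≫ F.map (α_ X Y Z).hom) := by monoidal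
          _ = _ := by rw [e]; monoidal
      left_unitality := by
        intro X
        change (𝟙 (𝟙_ C) ⊗ₘ (λ_ (F.obj X)).hom) ≫ (λ_ _).hom = (𝟙 (𝟙_ C) ⊗ₘ (ε F ⊗ₘ 𝟙 (F.obj X))) ≫ ((λ_ _).hom ≫ μ F _ _) ≫ F.map (λ_ X).hom
        simp
      right_unitality := by
        intro X
        change (𝟙 (𝟙_ C) ⊗ₘ (ρ_ (F.obj X)).hom) ≫ (λ_ _).hom = (𝟙 (𝟙_ C) ⊗ₘ (𝟙 (F.obj X) ⊗ₘ ε F)) ≫ ((λ_ _).hom ≫ μ F _ _) ≫ F.map (ρ_ X).hom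
        simp }

end EvenLift

instance {C : Type u} [Category.{v} C] [Preadditive C] [Linear ℂ C] [MonoidalCategory C]
    [MonoidalPreadditive C] [MonoidalLinear ℂ C] [BraidedCategory C] {f : C} [SelfFermionic f]
    {B : Type u₁} [Category.{v₁} B] [MonoidalCategory B] [BraidedCategory B] (F : B ⥤ C) [F.Braided]
    (h : ∀ b, HasParity f false (F.obj b)) : (evenLift F h).Braided where
  braided X Y := by
    change ((λ_ _).hom ≫ Functor.LaxMonoidal.μ F X Y) ≫ F.map (β_ X Y).hom =
      (zB false false • (𝟙 (𝟙_ C) ⊗ₘ (β_ (F.obj X) (F.obj Y)).hom)) ≫ (λ_ _).hom ≫ Functor.LaxMonoidal.μ F Y X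
    rw [zB, if_neg (by decide), one_smul, assoc, Functor.LaxBraided.braided]
    simp

namespace URFC

variable {C : URFC.{u, v}} {f : C} 

/-- The tensor structure sits on `K`, whereas `Φ` is only a linear equivalence. Isomorphisms of
values are enough, as twists, dimensions and S-matrix entries are invariant under them. -/
theorem isZestFunctor_of_iso {D : URFC.{u₂, v₂}} [SelfFermionic f] [FermionicTwist f] (hf : IsFermion f)
    (K : Zest f ⥤ D.Obj) [K.Braided] [K.Additive] [K.Linear ℂ] (Φ : C.Obj ⥤ D.Obj) [Φ.IsEquivalence]
    (e : ∀ X : Zest f, Nonempty (K.obj X ≅ Φ.obj X.obj)) : IsZestFunctor f Φ := by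
  have hK : ∀ X : Zest f, Simple X.obj → Simple (K.obj X) := fun X hX => by
    have : Simple (Φ.obj X.obj) := simple_obj _ _
    exact Simple.of_iso (e X).some
  refine ⟨inferInstance, fun σ X hX hσ => ?_, fun X hX => ?_, fun σ τ X Y hX hY hσ hτ => ?_⟩
  · obtain ⟨e'⟩ := e ⟨⟨X, σ, hσ⟩⟩
    rw [← twistScalar_of_iso (hK ⟨⟨X, σ, hσ⟩⟩ hX) e']
    exact (twist_obj_of_simple K ⟨⟨X, σ, hσ⟩⟩ hX (hK ⟨⟨X, σ, hσ⟩⟩ hX)).1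
  · obtain ⟨σ, hσ⟩ := hf.exists_hasParity hX
    obtain ⟨e'⟩ := e ⟨⟨X, σ, hσ⟩⟩
    rw [← qDim_of_iso e']
    exact (twist_obj_of_simple K ⟨⟨X, σ, hσ⟩⟩ hX (hK ⟨⟨X, σ, hσ⟩⟩ hX)).2
  · obtain ⟨e1⟩ := e ⟨⟨X, σ, hσ⟩⟩
    obtain ⟨e2⟩ := e ⟨⟨Y, τ, hτ⟩⟩
    rw [← sEntry_of_iso e1 e2]
    exact sEntry_obj K hf hK ⟨⟨X, σ, hσ⟩⟩ ⟨⟨Y, τ, hτ⟩⟩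

section

variable [SelfFermionic f] [FermionicTwist f] (hf : IsFermion f)

/-- Homogeneous objects in the zesting. -/
def zestedSingle : Zest f ⥤ (zested C f hf).Obj := Fam.single (Zest f)

instance : (zestedSingle hf).Full := inferInstanceAs (Fam.single (Zest f)).Full
instance : (zestedSingle hf).Faithful := inferInstanceAs (Fam.single (Zest f)).Faithful
instance : (zestedSingle hf).Additive := inferInstanceAs (Fam.single (Zest f)).Additive
instance : (zestedSingle hf).Linear ℂ := inferInstanceAs ((Fam.single (Zest f)).Linear ℂ)
instance : (zestedSingle hf).Braided := inferInstanceAs (Fam.single (Zest f)).Braided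

/-- The zesting as a linear category. -/
def zestedEquiv : (zested C f hf).Obj ≌ C.Obj :=
  have := hf.zestSum_isEquivalence
  (zestSum f).asEquivalence

instance : (zestedEquiv hf).functor.Additive := inferInstanceAs (zestSum f).Additive
instance : (zestedEquiv hf).functor.Linear ℂ := inferInstanceAs ((zestSum f).Linear ℂ)

/-- The underlying object of a homogeneous object in the zesting. -/
def zestedSingleIso : zestedSingle hf ⋙ (zestedEquiv hf).functor ≅ Zest.forget f :=
  have := Abelian.hasFiniteBiproducts (C := C.Obj)
  Fam.singleExtend (Zest.forget f)

theorem isZestFunctor_zestedEquiv_inverse : IsZestFunctor f (zestedEquiv hf).inverse :=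
  isZestFunctor_of_iso hf (zestedSingle hf) _ fun X =>
    ⟨(zestedEquiv hf).unitIso.app _ ≪≫ (zestedEquiv hf).inverse.mapIso ((zestedSingleIso hf).app X)⟩

end

end URFC

namespace ModularClosure

open URFC

variable {B : URFC.{u₁, v₁}} {f : B} (hf : B.IsSuperModular f) (C : ModularClosure.{u₁, v₁, u₂, v₂} B)
include hf

theorem isFermion : IsFermion (C.ι.obj f) := hf.1.map C.ι

theorem selfFermionic : SelfFermionic (C.ι.obj f) := (C.isFermion hf).selfFermionic

theorem fermionicTwist : FermionicTwist (C.ι.obj f) := (C.isFermion hf).fermionicTwist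

theorem hasParity_ι (b : B) : HasParity (C.ι.obj f) false (C.ι.obj b) := by
  have h1 : doubleBraiding b f = 𝟙 _ := by
    have := doubleBraiding_swap (z := 1) ((hf.2.1 b).trans (one_smul _ _).symm)
    rwa [one_smul] at this
  have h2 : doubleBraiding (C.ι.obj b) (C.ι.obj f) = (Functor.Monoidal.μIso C.ι b f).hom ≫
      C.ι.map (doubleBraiding b f) ≫ (Functor.Monoidal.μIso C.ι b f).inv := by
    simp [doubleBraiding, Functor.map_braiding]
  change doubleBraiding _ _ = _
  rw [h2, h1]
  simp

/-- The zesting of a modular closure. -/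
def zest : ModularClosure.{u₁, v₁, u₂, v₂} B :=
  have := C.selfFermionic hf
  have := C.fermionicTwist hf
  { cat := zested C.cat (C.ι.obj f) (C.isFermion hf)
    modular := (isZestFunctor_zestedEquiv_inverse (C.isFermion hf)).isModular (C.isFermion hf) C.modular
    ι := evenLift C.ι (C.hasParity_ι hf) ⋙ zestedSingle (C.isFermion hf)
    dim_eq := (isZestFunctor_zestedEquiv_inverse (C.isFermion hf)).dim_eq.trans C.dim_eq }

end ModularClosure

end

/-! ### From braided functors on the zested homogeneous objects to zestings. -/

section

open BraidedCategory
section Transport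

open Functor.LaxMonoidal Functor.Monoidal

variable {G : Type u} [Category.{v} G] [MonoidalCategory G] {D : Type u₂} [Category.{v₂} D]
  [MonoidalCategory D] (K : G ⥤ D) [K.Monoidal] {a : G → D} (i : ∀ X, K.obj X ≅ a X)

/-- The tensorator of a functor, transported along isomorphisms of objects. -/
@[simps!]
def transportμ (X Y : G) : a X ⊗ a Y ≅ a (X ⊗ Y) :=
  ((i X).symm ⊗ᵢ (i Y).symm) ≪≫ μIso K X Y ≪≫ i (X ⊗ Y)

/-- A zesting records its tensorator on the objects `Φ.obj X`, while the braided functor at hand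
takes only isomorphic values. This lemma and the next four carry naturality, associativity, units
and braiding along these isomorphisms. -/
theorem transportμ_natural {X X' Y Y' : G} (g : X ⟶ X') (h : Y ⟶ Y') :
    (((i X).inv ≫ K.map g ≫ (i X').hom) ⊗ₘ ((i Y).inv ≫ K.map h ≫ (i Y').hom)) ≫
        (transportμ K i X' Y').hom =
      (transportμ K i X Y).hom ≫ (i _).inv ≫ K.map (g ⊗ₘ h) ≫ (i _).hom := by
  simp [tensorHom_comp_tensorHom_assoc, ← μ_natural_assoc]

theorem transportμ_associativity (X Y Z : G) :
    (transportμ K i X Y).hom ▷ a Z ≫ (transportμ K i (X ⊗ Y) Z).hom ≫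
        (i _).inv ≫ K.map (α_ X Y Z).hom ≫ (i _).hom =
      (α_ (a X) (a Y) (a Z)).hom ≫ a X ◁ (transportμ K i Y Z).hom ≫
        (transportμ K i X (Y ⊗ Z)).hom := by
  have e := associativity K X Y Z
  have h1 : (transportμ K i X Y).hom ▷ a Z ≫ ((i (X ⊗ Y)).inv ⊗ₘ (i Z).inv) =
      (((i X).inv ⊗ₘ (i Y).inv) ⊗ₘ (i Z).inv) ≫ μ K X Y ▷ K.obj Z := by
    rw [← tensorHom_id, ← tensorHom_id, tensorHom_comp_tensorHom, tensorHom_comp_tensorHom]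
    simp
  have h2 : a X ◁ (transportμ K i Y Z).hom ≫ ((i X).inv ⊗ₘ (i (Y ⊗ Z)).inv) =
      ((i X).inv ⊗ₘ ((i Y).inv ⊗ₘ (i Z).inv)) ≫ K.obj X ◁ μ K Y Z := by
    rw [← id_tensorHom, ← id_tensorHom, tensorHom_comp_tensorHom, tensorHom_comp_tensorHom]
    simp
  rw [transportμ_hom K i (X ⊗ Y) Z, transportμ_hom K i X (Y ⊗ Z)]
  simp only [assoc, Iso.hom_inv_id_assoc]
  rw [reassoc_of% h1, reassoc_of% h2, reassoc_of% e, associator_naturality_assoc]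

theorem transportμ_left (X : G) : (ε K ≫ (i (𝟙_ G)).hom) ▷ a X ≫ (transportμ K i (𝟙_ G) X).hom ≫
    (i _).inv ≫ K.map (λ_ X).hom ≫ (i _).hom = (λ_ (a X)).hom := by
  have h1 : (ε K ≫ (i (𝟙_ G)).hom) ▷ a X ≫ ((i (𝟙_ G)).inv ⊗ₘ (i X).inv) =
      𝟙_ D ◁ (i X).inv ≫ ε K ▷ K.obj X := by
    rw [← tensorHom_id, ← tensorHom_id, ← id_tensorHom, tensorHom_comp_tensorHom, tensorHom_comp_tensorHom]
    simp
  rw [transportμ_hom]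
  simp only [assoc, Iso.hom_inv_id_assoc]
  rw [reassoc_of% h1, ← left_unitality_assoc, leftUnitor_naturality_assoc]
  simp

theorem transportμ_right (X : G) : a X ◁ (ε K ≫ (i (𝟙_ G)).hom) ≫ (transportμ K i X (𝟙_ G)).hom ≫
    (i _).inv ≫ K.map (ρ_ X).hom ≫ (i _).hom = (ρ_ (a X)).hom := by
  have h1 : a X ◁ (ε K ≫ (i (𝟙_ G)).hom) ≫ ((i X).inv ⊗ₘ (i (𝟙_ G)).inv) =
      (i X).inv ▷ 𝟙_ D ≫ K.obj X ◁ ε K := by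
    rw [← tensorHom_id, ← id_tensorHom, ← id_tensorHom, tensorHom_comp_tensorHom, tensorHom_comp_tensorHom]
    simp
  rw [transportμ_hom]
  simp only [assoc, Iso.hom_inv_id_assoc]
  rw [reassoc_of% h1, ← right_unitality_assoc, rightUnitor_naturality_assoc]
  simp

theorem transportμ_braiding {G : Type u} [Category.{v} G] [MonoidalCategory G] [BraidedCategory G]
    {D : Type u₂} [Category.{v₂} D] [MonoidalCategory D] [BraidedCategory D] (K : G ⥤ D) [K.Braided]
    {a : G → D} (i : ∀ X, K.obj X ≅ a X) (X Y : G) :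
    (β_ (a X) (a Y)).hom ≫ (transportμ K i Y X).hom =
      (transportμ K i X Y).hom ≫ (i _).inv ≫ K.map (β_ X Y).hom ≫ (i _).hom := by
  simp [Functor.LaxBraided.braided_assoc]

end Transport

namespace Zest

variable {C : Type u} [Category.{v} C] [Preadditive C] [Linear ℂ C] [MonoidalCategory C]
    [MonoidalPreadditive C] [MonoidalLinear ℂ C] [BraidedCategory C] {f : C} [SelfFermionic f]

/-- A homogeneous object. -/
@[reducible]
def of {σ : Bool} {X : C} (h : HasParity f σ X) : Zest f := ⟨⟨X, σ, h⟩⟩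

end Zest

open URFC ModularClosure

section

variable {B : URFC.{u₁, v₁}} {f : B} (hf : B.IsSuperModular f)
  {C D : ModularClosure.{u₁, v₁, u₂, v₂} B} [SelfFermionic (C.ι.obj f)]

open Functor.LaxMonoidal

/-- A braided functor on the zested category, that is given by an equivalence on the underlying
objects, exhibits a zesting. -/
def Zesting.ofFunctor (Φ : C.cat.Obj ⥤ D.cat.Obj) (h1 : Φ.IsEquivalence) (h2 : Φ.Additive)
    (h3 : Φ.Linear ℂ) (K : Zest (C.ι.obj f) ⥤ D.cat.Obj) [K.Braided]
    (i : K ≅ Zest.forget (C.ι.obj f) ⋙ Φ)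
    (κ : evenLift C.ι (C.hasParity_ι hf) ⋙ K ≅ D.ι) (hκ : NatTrans.IsMonoidal κ.hom) :
    Zesting f C D :=
  have e : ∀ {X Y : Zest (C.ι.obj f)} (g : X ⟶ Y), (i.app X).inv ≫ K.map g ≫ (i.app Y).hom =
      Φ.map ((Zest.forget (C.ι.obj f)).map g) := fun g => by simp
  {
  Φ := Φ
  equivalence := h1
  additive := h2
  linear := h3
  J σ τ X Y hX hY := transportμ K (fun X => i.app X) (Zest.of hX) (Zest.of hY)
  J_natural σ τ X X' Y Y' g h hX hX' hY hY' := by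
    have := transportμ_natural K (fun X => i.app X) (X := Zest.of hX) (X' := Zest.of hX') (Y := Zest.of hY)
      (Y' := Zest.of hY') g h
    rw [e, e, e] at this
    refine this.trans ?_
    congr 2
    exact (congrArg (· ⊗ₘ (g ⊗ₘ h)) (zAlphaMap_self _ _ _)).trans (id_tensorHom _ _)
  J_assoc σ τ ρ X Y Z hX hY hZ hXY hYZ := by
    have := transportμ_associativity K (fun X => i.app X) (Zest.of hX) (Zest.of hY) (Zest.of hZ)
    rw [e] at this
    exact this
  unit := Functor.Monoidal.εIso K ≪≫ i.app (𝟙_ (Zest (C.ι.obj f)))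
  J_leftUnit τ X h1 hX := by
    have := transportμ_left K (fun X => i.app X) (Zest.of hX)
    rw [e] at this
    exact this
  J_rightUnit σ X h1 hX := by
    have := transportμ_right K (fun X => i.app X) (Zest.of hX)
    rw [e] at this
    exact this
  J_braiding σ τ X Y hX hY := by
    have := transportμ_braiding K (fun X => i.app X) (Zest.of hX) (Zest.of hY)
    rw [e] at this
    exact this
  incl := Functor.isoWhiskerLeft (evenLift C.ι (C.hasParity_ι hf)) i.symm ≪≫ κ
  incl_unit := by
    have h1 := hκ.unit
    let E := evenLift C.ι (C.hasParity_ι hf)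
    change (ε K ≫ i.hom.app (𝟙_ _)) ≫ (Zest.forget (C.ι.obj f) ⋙ Φ).map (ε E) ≫ i.inv.app (E.obj _) ≫ κ.hom.app _ = _
    rw [assoc, ← i.hom.naturality_assoc, i.hom_inv_id_app_assoc]
    simpa using h1
  incl_tensor b b' hb hb' := by
    have h1 := hκ.tensor b b'
    let E := evenLift C.ι (C.hasParity_ι hf)
    change ((i.inv.app (E.obj b) ⊗ₘ i.inv.app (E.obj b')) ≫ μ K (E.obj b) (E.obj b') ≫ i.hom.app _) ≫
      (Zest.forget (C.ι.obj f) ⋙ Φ).map (μ E b b') ≫ i.inv.app (E.obj (b ⊗ b')) ≫ κ.hom.app _ =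
      ((i.inv.app (E.obj b) ≫ κ.hom.app _) ⊗ₘ (i.inv.app (E.obj b') ≫ κ.hom.app _)) ≫ _
    rw [← tensorHom_comp_tensorHom, assoc, assoc, assoc, ← i.hom.naturality_assoc,
      i.hom_inv_id_app_assoc, ← h1, Functor.LaxMonoidal.comp_μ, assoc] }

end

end

/-! ### From zestings to braided functors; existence and uniqueness of the zesting. -/

section

open BraidedCategory
open URFC ModularClosure

section

variable {B : URFC.{u₁, v₁}} {f : B} (hf : B.IsSuperModular f)
  {C D : ModularClosure.{u₁, v₁, u₂, v₂} B}

open Functor.LaxMonoidal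

instance isMonoidal_refl_hom {A : Type u₁} [Category.{v₁} A] [MonoidalCategory A] {E : Type u₂} [Category.{v₂} E]
    [MonoidalCategory E] (F : A ⥤ E) [F.Monoidal] : NatTrans.IsMonoidal (Iso.refl F).hom :=
  inferInstanceAs (NatTrans.IsMonoidal (𝟙 F))

/-- Homogeneous objects in the zesting, through the linear equivalence. -/
def _root_.FermionicZesting.URFC.zestedSingleIsoInverse {C : URFC.{u, v}} {f : C} [SelfFermionic f]
    [FermionicTwist f] (hC : IsFermion f) :
    zestedSingle hC ≅ Zest.forget f ⋙ (zestedEquiv hC).inverse :=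
  (zestedSingle hC).rightUnitor.symm ≪≫ Functor.isoWhiskerLeft _ (zestedEquiv hC).unitIso ≪≫
    (Functor.associator _ _ _).symm ≪≫ Functor.isoWhiskerRight (zestedSingleIso hC) _

theorem ModularClosure.nonempty_zesting_zest (C : ModularClosure.{u₁, v₁, u₂, v₂} B) :
    Nonempty (Zesting f C (C.zest hf)) := by
  have := C.selfFermionic hf
  have := C.fermionicTwist hf
  let hC := C.isFermion hf
  have h1 : (zestedEquiv hC).inverse.IsEquivalence := inferInstance
  have h2 : (zestedEquiv hC).inverse.Additive := inferInstance
  have h3 : (zestedEquiv hC).inverse.Linear ℂ := inferInstance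
  let h4 : (zestedSingle hC).Braided := inferInstance
  exact ⟨@Zesting.ofFunctor _ _ hf C (C.zest hf) _ (zestedEquiv hC).inverse h1 h2 h3
    (zestedSingle hC) h4 (zestedSingleIsoInverse hC) (Iso.refl _) (isMonoidal_refl_hom (evenLift C.ι (C.hasParity_ι hf) ⋙ zestedSingle hC))⟩

namespace Zesting

variable (Z : Zesting f C D)

section

variable [SelfFermionic (C.ι.obj f)]

/-- The functor on the zested category given by a zesting. -/
@[simps!]
def functor : Zest (C.ι.obj f) ⥤ D.cat.Obj := Zest.forget (C.ι.obj f) ⋙ Z.Φ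

instance : Z.functor.Full := have := Z.equivalence; inferInstanceAs (_ ⋙ Z.Φ).Full
instance : Z.functor.Faithful := have := Z.equivalence; inferInstanceAs (_ ⋙ Z.Φ).Faithful
instance : Z.functor.Additive := have := Z.additive; inferInstanceAs (_ ⋙ Z.Φ).Additive
instance : Z.functor.Linear ℂ := have := Z.linear; inferInstanceAs ((_ ⋙ Z.Φ).Linear ℂ)

def functorμ (X Y : Zest (C.ι.obj f)) : Z.functor.obj X ⊗ Z.functor.obj Y ≅ Z.functor.obj (X ⊗ Y) :=
  Z.J X.deg Y.deg X.obj Y.obj X.parity Y.parity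

/-- The field `J_natural` covers morphisms that preserve the degree; all others are zero. -/
theorem functorμ_natural {X X' Y Y' : Zest (C.ι.obj f)} (g : X ⟶ X') (h : Y ⟶ Y') :
    (Z.functor.map g ⊗ₘ Z.functor.map h) ≫ (Z.functorμ X' Y').hom =
      (Z.functorμ X Y).hom ≫ Z.functor.map (g ⊗ₘ h) := by
  by_cases h1 : X.deg = X'.deg
  swap
  · have : g = 0 := Zest.hom_eq_zero h1 g
    subst this
    rw [CategoryTheory.Functor.map_zero]
    simp only [MonoidalPreadditive.tensor_zero, MonoidalPreadditive.zero_tensor, CategoryTheory.Functor.map_zero, zero_comp, comp_zero]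
  by_cases h2 : Y.deg = Y'.deg
  swap
  · have : h = 0 := Zest.hom_eq_zero h2 h
    subst this
    rw [CategoryTheory.Functor.map_zero]
    simp only [MonoidalPreadditive.tensor_zero, MonoidalPreadditive.zero_tensor, CategoryTheory.Functor.map_zero, zero_comp, comp_zero]
  obtain ⟨⟨X, σ, hX⟩⟩ := X
  obtain ⟨⟨X', σ', hX'⟩⟩ := X'
  obtain ⟨⟨Y, τ, hY⟩⟩ := Y
  obtain ⟨⟨Y', τ', hY'⟩⟩ := Y'
  dsimp only at h1 h2
  subst h1 h2
  refine (Z.J_natural σ τ g h hX hX' hY hY').trans ?_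
  refine congrArg (fun t => _ ≫ Z.Φ.map t) ?_
  exact ((congrArg (· ⊗ₘ (MonoidalCategoryStruct.tensorHom (C := C.cat.Obj) g h)) (zAlphaMap_self _ _ _)).trans (id_tensorHom _ _)).symm

instance : Z.functor.Monoidal :=
  Functor.CoreMonoidal.toMonoidal
    { εIso := Z.unit
      μIso := Z.functorμ
      μIso_hom_natural_left := by
        intro X Y g X'
        have := Z.functorμ_natural g (𝟙 X')
        rwa [CategoryTheory.Functor.map_id, tensorHom_id, tensorHom_id] at this
      μIso_hom_natural_right := by
        intro X Y X' g
        have := Z.functorμ_natural (𝟙 X') g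
        rwa [CategoryTheory.Functor.map_id, id_tensorHom, id_tensorHom] at this
      associativity := fun X Y W => Z.J_assoc X.deg Y.deg W.deg X.obj Y.obj W.obj X.parity Y.parity
          W.parity (X ⊗ Y).parity (Y ⊗ W).parity
      left_unitality := fun X => (Z.J_leftUnit X.deg X.obj (hasParity_unit _) X.parity).symm
      right_unitality := fun X => (Z.J_rightUnit X.deg X.obj (hasParity_unit _) X.parity).symm }

instance : Z.functor.Braided where
  braided X Y := (Z.J_braiding X.deg Y.deg X.obj Y.obj X.parity Y.parity).symm

/-- The compatibility with the inclusions of `B`. -/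
def functorIncl (h : ∀ b, HasParity (C.ι.obj f) false (C.ι.obj b)) : evenLift C.ι h ⋙ Z.functor ≅ D.ι :=
  NatIso.ofComponents (fun b => Z.incl.app b) fun g => Z.incl.hom.naturality g

instance (h : ∀ b, HasParity (C.ι.obj f) false (C.ι.obj b)) : NatTrans.IsMonoidal (Z.functorIncl h).hom where
  unit := (assoc _ _ _).trans Z.incl_unit
  tensor b b' := by
    refine Eq.trans ?_ (Z.incl_tensor b b' (h b) (h b'))
    exact assoc _ _ _

end

include hf in
theorem isZestFunctor : IsZestFunctor (C.ι.obj f) Z.Φ := by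
  have := C.selfFermionic hf
  have := C.fermionicTwist hf
  have := Z.equivalence
  exact isZestFunctor_of_iso (C.isFermion hf) Z.functor Z.Φ fun X => ⟨Iso.refl _⟩

end Zesting

/-- The zesting of a modular closure is unique. -/
theorem ModularClosure.zest_equivalent (Z : Zesting f C D) : (C.zest hf).Equivalent D := by
  have := C.selfFermionic hf
  have := C.fermionicTwist hf
  have := Abelian.hasFiniteBiproducts (C := D.cat.Obj)
  let hC := C.isFermion hf
  -- Every object of `D` is the image under `Φ` of a sum of homogeneous objects, so the additive
  -- extension of the functor is an equivalence.
  have hd : IsDense Z.functor := by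
    have := Z.equivalence
    intro X
    obtain ⟨n, S, ⟨e⟩⟩ := hC.zestForget_isDense (Z.Φ.objPreimage X)
    have := Abelian.hasFiniteBiproducts (C := C.cat.Obj)
    have := Z.additive
    exact ⟨n, S, ⟨(Z.Φ.mapBiproduct fun i => (Zest.forget (C.ι.obj f)).obj (S i)).symm ≪≫ Z.Φ.mapIso e ≪≫ Z.Φ.objObjPreimageIso X⟩⟩
  let E := evenLift C.ι (C.hasParity_ι hf)
  let κ : (E ⋙ Fam.single _) ⋙ Fam.extend Z.functor ≅ D.ι :=
    Functor.associator _ _ _ ≪≫ Functor.isoWhiskerLeft E (Fam.singleExtend Z.functor) ≪≫ Z.functorIncl (C.hasParity_ι hf)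
  have h1 : NatTrans.IsMonoidal κ.hom := by
    simp only [κ, Iso.trans_hom, Functor.isoWhiskerLeft_hom]
    infer_instance
  exact ⟨Fam.extend Z.functor, (inferInstance : (Fam.extend Z.functor).Braided), κ,
    Fam.extend_isEquivalence hd, (inferInstance : (Fam.extend Z.functor).Additive),
    (inferInstance : (Fam.extend Z.functor).Linear ℂ), h1⟩

end

end

/-! ### The central charge as an invariant of modular closures. -/

section

open BraidedCategory
namespace URFC

/-- The equivalence is not assumed to respect twists; this follows from `twist_compare` with factor
1. -/
theorem centralCharge_eq_of_isEquivalence {C : URFC.{u, v}} {D : URFC.{u₂, v₂}} (F : C.Obj ⥤ D.Obj)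
    [F.Braided] [F.IsEquivalence] [F.Additive] [F.Linear ℂ] : D.centralCharge = C.centralCharge := by
  have key : ∀ X : C, Simple X → twistScalar (F.obj X) = twistScalar X ∧ qDim (F.obj X) = qDim X := by
    intro X hX
    have h := twist_compare (X := X) (Y := F.obj X) (z := 1) hX (simple_obj F X) (by simp) fun p hp => by
      have := pTrace_map F X Xᘁ (𝟙 X) (F.obj X)ᘁ
      rw [F.map_id, hp, F.map_smul, F.map_id] at this
      rw [this]; simp
    simpa using h
  have h1 : ∀ l : Label C.Obj, twistScalar (labelEquiv F l).rep = twistScalar l.rep ∧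
      qDim (labelEquiv F l).rep = qDim l.rep := fun l => by
    obtain ⟨e⟩ := labelEquiv_rep F l
    rw [twistScalar_of_iso (Label.rep_simple _) e, qDim_of_iso e]
    exact key _ l.rep_simple
  have h2 : D.dim = C.dim := by
    rw [dim_eq_sum, dim_eq_sum, ← Equiv.sum_comp (labelEquiv F)]
    exact Finset.sum_congr rfl fun l _ => by rw [(h1 l).2]
  rw [centralCharge, centralCharge, h2, finsum_eq_sum_of_fintype, finsum_eq_sum_of_fintype,
    ← Equiv.sum_comp (labelEquiv F)]
  congr 1
  exact Finset.sum_congr rfl fun l _ => by rw [(h1 l).1, (h1 l).2]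

end URFC

namespace ModularClosure

open URFC

variable {B : URFC.{u₁, v₁}} {f : B} {C D : ModularClosure.{u₁, v₁, u₂, v₂} B}

theorem Equivalent.centralCharge_eq (h : C.Equivalent D) : D.cat.centralCharge = C.cat.centralCharge := by
  obtain ⟨F, h1, κ, h2, h3, h4, h5⟩ := h
  exact centralCharge_eq_of_isEquivalence F

theorem centralCharge_zesting (hf : B.IsSuperModular f) (Z : Zesting f C D) :
    D.cat.centralCharge = Complex.exp (Real.pi * Complex.I / 4) * C.cat.centralCharge :=
  (Z.isZestFunctor hf).centralCharge_eq (C.isFermion hf)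

theorem exp_pow_eq_one_iff (n : ℕ) : Complex.exp (Real.pi * Complex.I / 4) ^ n = 1 ↔ 8 ∣ n := by
  have h : Complex.exp (Real.pi * Complex.I / 4) = Complex.exp (2 * Real.pi * Complex.I / (8 : ℕ)) := by
    congr 1; push_cast; ring
  rw [h]
  exact (Complex.isPrimitiveRoot_exp 8 (by norm_num)).pow_eq_one_iff_dvd n

/-- Equivalence would give ξ = ζ ξ with ξ ≠ 0, but ζ ≠ 1. -/
theorem not_equivalent_of_zesting (hf : B.IsSuperModular f) (Z : Zesting f C D) : ¬ C.Equivalent D := by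
  intro h
  have h1 := h.centralCharge_eq
  rw [centralCharge_zesting hf Z] at h1
  have h2 := mul_right_cancel₀ (C.modular.centralCharge_ne_zero) (h1.trans (one_mul _).symm)
  have := (exp_pow_eq_one_iff 1).1 (by rw [pow_one, h2])
  omega

theorem zesting_data (hf : B.IsSuperModular f) (C D : ModularClosure.{u₁, v₁, u₂, v₂} B)
    (Z : Zesting f C D) :
      (∀ X : C.cat.Obj, Simple X → ∃ σ, HasParity (C.ι.obj f) σ X) ∧
      (∀ (σ τ : Bool) (X Y : C.cat.Obj), Simple X → Simple Y →
        HasParity (C.ι.obj f) σ X → HasParity (C.ι.obj f) τ Y →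
        sEntry (Z.Φ.obj X) (Z.Φ.obj Y) =
          (if σ && τ then Complex.I else 1) * sEntry X Y) ∧
      (∀ (σ : Bool) (X : C.cat.Obj), Simple X → HasParity (C.ι.obj f) σ X →
        twistScalar (Z.Φ.obj X) =
          (if σ then Complex.exp (Real.pi * Complex.I / 4) else 1) *
            twistScalar X) ∧
      D.cat.centralCharge =
        Complex.exp (Real.pi * Complex.I / 4) * C.cat.centralCharge := by
  refine ⟨fun X hX => (C.isFermion hf).exists_hasParity hX, fun σ τ X Y hX hY hσ hτ =>
    (Z.isZestFunctor hf).sEntry σ τ X Y hX hY hσ hτ, fun σ X hX hσ => ?_, centralCharge_zesting hf Z⟩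
  rw [(Z.isZestFunctor hf).twist σ X hX hσ, zB, Bool.and_self]

end ModularClosure

end

/-! ### Braided functors induce functors of zested categories. -/

section

open BraidedCategory
section

variable {C : Type u} [Category.{v} C] [MonoidalCategory C] [BraidedCategory C]

theorem crossAssoc_naturality_coeff {A₁ A₂ B₁ B₂ A₁' A₂' B₁' B₂' : C} (φ : A₂ ⊗ A₁ ⟶ B₂ ⊗ B₁)
    (φ' : A₂' ⊗ A₁' ⟶ B₂' ⊗ B₁') (a₁ : A₁' ⟶ A₁) (a₂ : A₂' ⟶ A₂) (b₁ : B₁' ⟶ B₁) (b₂ : B₂' ⟶ B₂)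
    (h : (a₂ ⊗ₘ a₁) ≫ φ = φ' ≫ (b₂ ⊗ₘ b₁)) (X Y Z : C) :
    (a₂ ⊗ₘ ((a₁ ⊗ₘ 𝟙 (X ⊗ Y)) ⊗ₘ 𝟙 Z)) ≫ crossAssoc φ X Y Z =
      crossAssoc φ' X Y Z ≫ (b₂ ⊗ₘ (𝟙 X ⊗ₘ (b₁ ⊗ₘ 𝟙 (Y ⊗ Z)))) := by
  rw [crossAssoc_eq, crossAssoc_eq]
  simp only [tensorHom_id, id_tensorHom]
  calc
    _ = 𝟙 _ ⊗≫ ((a₂ ⊗ₘ a₁) ≫ φ) ▷ (X ⊗ Y ⊗ Z) ⊗≫ B₂ ◁ (β_ X B₁).inv ▷ (Y ⊗ Z) ⊗≫ 𝟙 _ := by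
      simp only [MonoidalCategory.tensorHom_def]; monoidal
    _ = 𝟙 _ ⊗≫ φ' ▷ (X ⊗ Y ⊗ Z) ⊗≫ b₂ ▷ (B₁' ⊗ X ⊗ Y ⊗ Z) ⊗≫ B₂ ◁ (b₁ ▷ X ≫ (β_ X B₁).inv) ▷ (Y ⊗ Z) ⊗≫ 𝟙 _ := by
      rw [h]; simp only [MonoidalCategory.tensorHom_def]; monoidal
    _ = 𝟙 _ ⊗≫ φ' ▷ (X ⊗ Y ⊗ Z) ⊗≫ (b₂ ▷ (B₁' ⊗ X) ≫ B₂ ◁ (β_ X B₁').inv) ▷ (Y ⊗ Z) ⊗≫ B₂ ◁ (X ◁ b₁) ▷ (Y ⊗ Z) ⊗≫ 𝟙 _ := by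
      rw [braiding_inv_naturality_left]; monoidal
    _ = _ := by
      rw [← whisker_exchange]; simp only [MonoidalCategory.tensorHom_def]; monoidal

variable {D : Type u₂} [Category.{v₂} D] [MonoidalCategory D] [BraidedCategory D] (F : C ⥤ D) [F.Braided]

open Functor.LaxMonoidal Functor.OplaxMonoidal

theorem map_braiding_inv (X Y : C) : F.map (β_ X Y).inv = δ F Y X ≫ (β_ (F.obj X) (F.obj Y)).inv ≫ μ F X Y := by
  rw [← cancel_epi (F.map (β_ X Y).hom), ← F.map_comp, Iso.hom_inv_id, F.map_id, Functor.map_braiding]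
  simp

theorem map_crossAssoc {A₁ A₂ B₁ B₂ : C} (φ : A₂ ⊗ A₁ ⟶ B₂ ⊗ B₁) (X Y Z : C) :
    (𝟙 (F.obj A₂) ⊗ₘ (((𝟙 (F.obj A₁) ⊗ₘ μ F X Y) ≫ μ F A₁ (X ⊗ Y)) ⊗ₘ 𝟙 (F.obj Z))) ≫
        F.obj A₂ ◁ μ F (A₁ ⊗ (X ⊗ Y)) Z ≫ μ F A₂ _ ≫ F.map (crossAssoc φ X Y Z) =
      crossAssoc (μ F A₂ A₁ ≫ F.map φ ≫ δ F B₂ B₁) (F.obj X) (F.obj Y) (F.obj Z) ≫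
        (𝟙 (F.obj B₂) ⊗ₘ (𝟙 (F.obj X) ⊗ₘ ((𝟙 (F.obj B₁) ⊗ₘ μ F Y Z) ≫ μ F B₁ (Y ⊗ Z)))) ≫
        F.obj B₂ ◁ μ F X _ ≫ μ F B₂ _ := by
  simp only [crossAssoc, Functor.Monoidal.map_associator, Functor.Monoidal.map_associator_inv, map_braiding_inv,
    Functor.map_comp, Functor.Monoidal.map_whiskerLeft, Functor.Monoidal.map_whiskerRight, id_tensorHom, tensorHom_id,
    MonoidalCategory.whiskerLeft_comp, comp_whiskerRight, assoc, Functor.Monoidal.μ_δ_assoc,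
    Functor.Monoidal.whiskerLeft_μ_δ_assoc, Functor.Monoidal.whiskerRight_μ_δ_assoc, Functor.Monoidal.δ_μ_assoc]
  have h1 : ∀ (X Y : C) (T S : D), T ◁ μ F X Y ▷ S ≫ T ◁ δ F X Y ▷ S = 𝟙 _ := fun X Y T S => by
    rw [← MonoidalCategory.whiskerLeft_comp, ← comp_whiskerRight]; simp
  have h2 : ∀ (X Y : C) (T S : D), T ◁ S ◁ μ F X Y ≫ T ◁ S ◁ δ F X Y = 𝟙 _ := fun X Y T S => by
    rw [← MonoidalCategory.whiskerLeft_comp, ← MonoidalCategory.whiskerLeft_comp]; simp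
  rw [reassoc_of% h1, reassoc_of% h2, reassoc_of% h1, reassoc_of% h1]
  generalize hψ : μ F A₂ A₁ ≫ F.map φ ≫ δ F B₂ B₁ = ψ
  have hm : μ F X Y ≫ δ F X Y = 𝟙 _ := Functor.Monoidal.μ_δ F X Y
  have hm' : μ F X (Y ⊗ Z) ≫ δ F X (Y ⊗ Z) = 𝟙 _ := Functor.Monoidal.μ_δ F X _
  calc
    _ = 𝟙 _ ⊗≫ F.obj A₂ ◁ F.obj A₁ ◁ (μ F X Y ≫ δ F X Y) ▷ F.obj Z ⊗≫
          ((F.obj A₂ ⊗ F.obj A₁) ◁ (F.obj X ◁ μ F Y Z ≫ μ F X (Y ⊗ Z)) ≫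
          (μ F A₂ A₁ ≫ F.map φ ≫ δ F B₂ B₁) ▷ F.obj (X ⊗ Y ⊗ Z)) ⊗≫
          F.obj B₂ ◁ F.obj B₁ ◁ δ F X (Y ⊗ Z) ⊗≫
          F.obj B₂ ◁ (β_ (F.obj X) (F.obj B₁)).inv ▷ F.obj (Y ⊗ Z) ⊗≫
          F.obj B₂ ◁ F.obj X ◁ μ F B₁ (Y ⊗ Z) ≫
          F.obj B₂ ◁ μ F X (B₁ ⊗ Y ⊗ Z) ≫ μ F B₂ (X ⊗ B₁ ⊗ Y ⊗ Z) := by monoidal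
    _ = 𝟙 _ ⊗≫ ψ ▷ (F.obj X ⊗ F.obj Y ⊗ F.obj Z) ⊗≫
          F.obj B₂ ◁ F.obj B₁ ◁ F.obj X ◁ μ F Y Z ⊗≫ F.obj B₂ ◁ F.obj B₁ ◁ (μ F X (Y ⊗ Z) ≫ δ F X (Y ⊗ Z)) ⊗≫
          F.obj B₂ ◁ (β_ (F.obj X) (F.obj B₁)).inv ▷ F.obj (Y ⊗ Z) ⊗≫
          F.obj B₂ ◁ F.obj X ◁ μ F B₁ (Y ⊗ Z) ≫
          F.obj B₂ ◁ μ F X (B₁ ⊗ Y ⊗ Z) ≫ μ F B₂ (X ⊗ B₁ ⊗ Y ⊗ Z) := by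
      rw [hm, hψ, whisker_exchange]; monoidal
    _ = 𝟙 _ ⊗≫ ψ ▷ (F.obj X ⊗ F.obj Y ⊗ F.obj Z) ⊗≫
          F.obj B₂ ◁ ((F.obj B₁ ⊗ F.obj X) ◁ μ F Y Z ≫ (β_ (F.obj X) (F.obj B₁)).inv ▷ F.obj (Y ⊗ Z)) ⊗≫
          F.obj B₂ ◁ F.obj X ◁ μ F B₁ (Y ⊗ Z) ≫
          F.obj B₂ ◁ μ F X (B₁ ⊗ Y ⊗ Z) ≫ μ F B₂ (X ⊗ B₁ ⊗ Y ⊗ Z) := by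
      rw [hm']; monoidal
    _ = _ := by
      rw [whisker_exchange, ← hψ]; monoidal

/-- A braided functor sends the values of α to isomorphic objects only: the unit by its unit
constraint, the fermion by a chosen isomorphism. The maps `a₁`, `a₂`, `b₁`, `b₂` absorb these
comparisons. -/
theorem map_crossAssoc_coeff {A₁ A₂ B₁ B₂ : C} (φ : A₂ ⊗ A₁ ⟶ B₂ ⊗ B₁) {A₁' A₂' B₁' B₂' : D}
    (φ' : A₂' ⊗ A₁' ⟶ B₂' ⊗ B₁') (a₁ : A₁' ⟶ F.obj A₁) (a₂ : A₂' ⟶ F.obj A₂) (b₁ : B₁' ⟶ F.obj B₁)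
    (b₂ : B₂' ⟶ F.obj B₂)
    (h : (a₂ ⊗ₘ a₁) ≫ μ F A₂ A₁ ≫ F.map φ = φ' ≫ (b₂ ⊗ₘ b₁) ≫ μ F B₂ B₁) (X Y Z : C) :
    (𝟙 A₂' ⊗ₘ (((a₁ ⊗ₘ μ F X Y) ≫ μ F A₁ (X ⊗ Y)) ⊗ₘ 𝟙 (F.obj Z))) ≫
        ((a₂ ⊗ₘ μ F (A₁ ⊗ (X ⊗ Y)) Z) ≫ μ F A₂ _) ≫ F.map (crossAssoc φ X Y Z) =
      crossAssoc φ' (F.obj X) (F.obj Y) (F.obj Z) ≫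
        (𝟙 B₂' ⊗ₘ (𝟙 (F.obj X) ⊗ₘ ((b₁ ⊗ₘ μ F Y Z) ≫ μ F B₁ (Y ⊗ Z)))) ≫
        (b₂ ⊗ₘ μ F X _) ≫ μ F B₂ _ := by
  have h' : (a₂ ⊗ₘ a₁) ≫ μ F A₂ A₁ ≫ F.map φ ≫ δ F B₂ B₁ = φ' ≫ (b₂ ⊗ₘ b₁) := by
    rw [reassoc_of% h]; simp
  have e1 : (𝟙 A₂' ⊗ₘ (((a₁ ⊗ₘ μ F X Y) ≫ μ F A₁ (X ⊗ Y)) ⊗ₘ 𝟙 (F.obj Z))) ≫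
        (a₂ ⊗ₘ μ F (A₁ ⊗ (X ⊗ Y)) Z) = (a₂ ⊗ₘ ((a₁ ⊗ₘ 𝟙 (F.obj X ⊗ F.obj Y)) ⊗ₘ 𝟙 (F.obj Z))) ≫
        (𝟙 (F.obj A₂) ⊗ₘ (((𝟙 (F.obj A₁) ⊗ₘ μ F X Y) ≫ μ F A₁ (X ⊗ Y)) ⊗ₘ 𝟙 (F.obj Z))) ≫
        F.obj A₂ ◁ μ F (A₁ ⊗ (X ⊗ Y)) Z := by
    rw [← id_tensorHom, tensorHom_comp_tensorHom, tensorHom_comp_tensorHom, tensorHom_comp_tensorHom,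
      tensorHom_comp_tensorHom_assoc, tensorHom_comp_tensorHom_assoc]
    simp
  have e2 : (𝟙 B₂' ⊗ₘ (𝟙 (F.obj X) ⊗ₘ ((b₁ ⊗ₘ μ F Y Z) ≫ μ F B₁ (Y ⊗ Z)))) ≫ (b₂ ⊗ₘ μ F X _) =
      (b₂ ⊗ₘ (𝟙 (F.obj X) ⊗ₘ (b₁ ⊗ₘ 𝟙 (F.obj Y ⊗ F.obj Z)))) ≫
        (𝟙 (F.obj B₂) ⊗ₘ (𝟙 (F.obj X) ⊗ₘ ((𝟙 (F.obj B₁) ⊗ₘ μ F Y Z) ≫ μ F B₁ (Y ⊗ Z)))) ≫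
        F.obj B₂ ◁ μ F X _ := by
    rw [← id_tensorHom (F.obj B₂) (μ F X _), tensorHom_comp_tensorHom, tensorHom_comp_tensorHom, tensorHom_comp_tensorHom,
      tensorHom_comp_tensorHom_assoc, tensorHom_comp_tensorHom_assoc]
    simp
  have e3 := crossAssoc_naturality_coeff _ _ a₁ a₂ b₁ b₂ h' (F.obj X) (F.obj Y) (F.obj Z)
  rw [assoc, reassoc_of% e1, map_crossAssoc, reassoc_of% e3, reassoc_of% e2]

end

section

variable {C : Type u} [Category.{v} C] [Preadditive C] [Linear ℂ C] [MonoidalCategory C]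
    [MonoidalPreadditive C] [MonoidalLinear ℂ C] [BraidedCategory C]
    {D : Type u₂} [Category.{v₂} D] [Preadditive D] [Linear ℂ D] [MonoidalCategory D]
    [MonoidalPreadditive D] [MonoidalLinear ℂ D] [BraidedCategory D] (F : C ⥤ D) [F.Braided]
    [F.Additive] [F.Linear ℂ] {f : C} {g : D} (e : F.obj f ≅ g)

open Functor.LaxMonoidal

include e in
/-- Braided functors preserve parities. -/
theorem HasParity.map {σ : Bool} {X : C} (h : HasParity f σ X) : HasParity g σ (F.obj X) := by
  rw [hasParity_iff] at *
  have h1 : doubleBraiding (F.obj X) (F.obj f) = (Functor.Monoidal.μIso F X f).hom ≫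
      F.map (doubleBraiding X f) ≫ (Functor.Monoidal.μIso F X f).inv := by
    simp [doubleBraiding, Functor.map_braiding]
  rw [h, F.map_smul, F.map_id] at h1
  rw [← cancel_epi (F.obj X ◁ e.hom)]
  have h2 : F.obj X ◁ e.hom ≫ doubleBraiding (F.obj X) g = doubleBraiding (F.obj X) (F.obj f) ≫ F.obj X ◁ e.hom := by
    simp [doubleBraiding]
  rw [h2, h1]
  simp

/-- The comparison of the values of `α`. -/
def zAlphaIso : ∀ σ τ : Bool, zAlpha g σ τ ≅ F.obj (zAlpha f σ τ)
  | true, true => e.symm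
  | true, false => Functor.Monoidal.εIso F
  | false, true => Functor.Monoidal.εIso F
  | false, false => Functor.Monoidal.εIso F

/-- In six cases the cocycle map is an identity. The other two, with unitors of `f` on both sides,
follow from the unitality of `F`. -/
theorem zAlphaIso_zCocycle (σ τ ρ : Bool) :
    ((zAlphaIso F e (xor σ τ) ρ).hom ⊗ₘ (zAlphaIso F e σ τ).hom) ≫ μ F _ _ ≫ F.map (zCocycle f σ τ ρ).hom =
      (zCocycle g σ τ ρ).hom ≫ ((zAlphaIso F e σ (xor τ ρ)).hom ⊗ₘ (zAlphaIso F e τ ρ).hom) ≫ μ F _ _ := by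
  have h1 : (ε F ⊗ₘ e.inv) ≫ μ F _ _ ≫ F.map ((λ_ f) ≪≫ (ρ_ f).symm).hom =
      ((λ_ g) ≪≫ (ρ_ g).symm).hom ≫ (e.inv ⊗ₘ ε F) ≫ μ F _ _ := by
    have e1 := left_unitality F f
    have e2 := right_unitality F f
    rw [← cancel_mono (F.map (ρ_ f).hom), assoc, assoc, assoc, assoc, ← F.map_comp, Iso.trans_hom, Iso.symm_hom, assoc,
      Iso.inv_hom_id, comp_id, Iso.trans_hom, Iso.symm_hom]
    rw [show (ε F ⊗ₘ e.inv) = 𝟙_ D ◁ e.inv ≫ ε F ▷ _ by simp [MonoidalCategory.tensorHom_def'],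
      show (e.inv ⊗ₘ ε F) = e.inv ▷ 𝟙_ D ≫ _ ◁ ε F by simp [MonoidalCategory.tensorHom_def]]
    simp only [assoc, ← e1, ← e2]
    simp
  have h2 : (e.inv ⊗ₘ ε F) ≫ μ F _ _ ≫ F.map ((ρ_ f) ≪≫ (λ_ f).symm).hom =
      ((ρ_ g) ≪≫ (λ_ g).symm).hom ≫ (ε F ⊗ₘ e.inv) ≫ μ F _ _ := by
    have e1 := left_unitality F f
    have e2 := right_unitality F f
    rw [← cancel_mono (F.map (λ_ f).hom), assoc, assoc, assoc, assoc, ← F.map_comp, Iso.trans_hom, Iso.symm_hom, assoc,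
      Iso.inv_hom_id, comp_id, Iso.trans_hom, Iso.symm_hom]
    rw [show (ε F ⊗ₘ e.inv) = 𝟙_ D ◁ e.inv ≫ ε F ▷ _ by simp [MonoidalCategory.tensorHom_def'],
      show (e.inv ⊗ₘ ε F) = e.inv ▷ 𝟙_ D ≫ _ ◁ ε F by simp [MonoidalCategory.tensorHom_def]]
    simp only [assoc, ← e1, ← e2]
    simp
  have h3 : ∀ {P Q : C} {P' Q' : D} (a : P' ⟶ F.obj P) (b : Q' ⟶ F.obj Q),
      (a ⊗ₘ b) ≫ μ F P Q ≫ F.map (𝟙 (P ⊗ Q)) = 𝟙 (P' ⊗ Q') ≫ (a ⊗ₘ b) ≫ μ F P Q := by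
    intros; simp
  cases σ <;> cases τ <;> cases ρ
  · exact h3 _ _
  · exact h3 _ _
  · exact h3 _ _
  · exact h2
  · exact h3 _ _
  · exact h3 _ _
  · exact h1
  · exact h3 _ _

variable [SelfFermionic f] [SelfFermionic g]

namespace Zest

/-- A braided functor that preserves the fermions induces a functor of the zested categories. -/
@[simps]
def map : Zest f ⥤ Zest g where
  obj X := ⟨⟨F.obj X.obj, X.deg, X.parity.map F e⟩⟩
  map h := F.map h
  map_id X := F.map_id X.obj
  map_comp h h' := F.map_comp _ _

instance [F.Full] : (map F e).Full where
  map_surjective g := F.map_surjective g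

instance [F.Faithful] : (map F e).Faithful where
  map_injective e := F.map_injective e

instance : (map F e).Additive where
  map_add := F.map_add

instance : (map F e).Linear ℂ where
  map_smul k r := F.map_smul r k

/-- The tensorator of `Zest.map`. -/
def mapμ (X Y : Zest f) : (map F e).obj X ⊗ (map F e).obj Y ≅ (map F e).obj (X ⊗ Y) :=
  mkIso (X := tObj ((map F e).obj X) ((map F e).obj Y)) (Y := (map F e).obj (tObj X Y))
    ((zAlphaIso F e X.deg Y.deg ⊗ᵢ Functor.Monoidal.μIso F X.obj Y.obj) ≪≫ Functor.Monoidal.μIso F _ _)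

theorem mapμ_natural {X X' Y Y' : Zest f} (h : X ⟶ X') (k : Y ⟶ Y') :
    ((map F e).map h ⊗ₘ (map F e).map k) ≫ (mapμ F e X' Y').hom =
      (mapμ F e X Y).hom ≫ (map F e).map (h ⊗ₘ k) := by
  by_cases h1 : X.deg = X'.deg
  swap
  · have : h = 0 := Zest.hom_eq_zero h1 h
    subst this
    rw [CategoryTheory.Functor.map_zero]
    simp only [MonoidalPreadditive.tensor_zero, MonoidalPreadditive.zero_tensor, CategoryTheory.Functor.map_zero, zero_comp, comp_zero]
  by_cases h2 : Y.deg = Y'.deg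
  swap
  · have : k = 0 := Zest.hom_eq_zero h2 k
    subst this
    rw [CategoryTheory.Functor.map_zero]
    simp only [MonoidalPreadditive.tensor_zero, MonoidalPreadditive.zero_tensor, CategoryTheory.Functor.map_zero, zero_comp, comp_zero]
  obtain ⟨⟨X, σ, hX⟩⟩ := X
  obtain ⟨⟨X', σ', hX'⟩⟩ := X'
  obtain ⟨⟨Y, τ, hY⟩⟩ := Y
  obtain ⟨⟨Y', τ', hY'⟩⟩ := Y'
  dsimp only at h1 h2
  subst h1 h2
  have key : ∀ {A : C} {A' : D} (a : A' ⟶ F.obj A) {X X' Y Y' : C} (h : X ⟶ X') (k : Y ⟶ Y'),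
      (𝟙 A' ⊗ₘ (F.map h ⊗ₘ F.map k)) ≫ (a ⊗ₘ μ F X' Y') ≫ μ F A _ =
      ((a ⊗ₘ μ F X Y) ≫ μ F A _) ≫ F.map (𝟙 A ⊗ₘ (h ⊗ₘ k)) := by
    intro A A' a X X' Y Y' h k
    rw [assoc, ← μ_natural, F.map_id, tensorHom_comp_tensorHom_assoc, tensorHom_comp_tensorHom_assoc, ← μ_natural]
    simp
  have := key (zAlphaIso F e σ τ).hom h k
  rw [← zAlphaMap_self, ← zAlphaMap_self] at this
  exact this

instance : (map F e).Monoidal :=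
  Functor.CoreMonoidal.toMonoidal
    { εIso := mkIso (X := 𝟙_ (Zest g)) (Y := (map F e).obj (𝟙_ (Zest f))) (Functor.Monoidal.εIso F)
      μIso := mapμ F e
      μIso_hom_natural_left := by
        intro X Y g X'
        have := mapμ_natural F e g (𝟙 X')
        rwa [CategoryTheory.Functor.map_id, tensorHom_id, tensorHom_id] at this
      μIso_hom_natural_right := by
        intro X Y X' g
        have := mapμ_natural F e (𝟙 X') g
        rwa [CategoryTheory.Functor.map_id, id_tensorHom, id_tensorHom] at this
      associativity := by
        intro X Y Z
        have h := map_crossAssoc_coeff F _ _ _ _ _ _ (zAlphaIso_zCocycle F e X.deg Y.deg Z.deg) X.obj Y.obj Z.obj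
        have h' : (𝟙 _ ⊗ₘ (((((zAlphaIso F e X.deg Y.deg).hom ⊗ₘ μ F X.obj Y.obj) ≫ μ F _ _)) ⊗ₘ 𝟙 (F.obj Z.obj))) ≫
            (((zAlphaIso F e (xor X.deg Y.deg) Z.deg).hom ⊗ₘ μ F _ Z.obj) ≫ μ F _ _) ≫
            F.map (zW X.deg Y.deg Z.deg • crossAssoc (zCocycle f X.deg Y.deg Z.deg).hom X.obj Y.obj Z.obj) =
          (zW X.deg Y.deg Z.deg • crossAssoc (zCocycle g X.deg Y.deg Z.deg).hom (F.obj X.obj) (F.obj Y.obj) (F.obj Z.obj)) ≫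
            (𝟙 _ ⊗ₘ (𝟙 (F.obj X.obj) ⊗ₘ (((zAlphaIso F e Y.deg Z.deg).hom ⊗ₘ μ F Y.obj Z.obj) ≫ μ F _ _))) ≫
            (((zAlphaIso F e X.deg (xor Y.deg Z.deg)).hom ⊗ₘ μ F X.obj _) ≫ μ F _ _) := by
          rw [F.map_smul, Linear.comp_smul, Linear.comp_smul, Linear.smul_comp, h]
        rw [← zAlphaMap_self, ← zAlphaMap_self] at h'
        exact h'
      left_unitality := by
        intro X
        have key : ((𝟙 (𝟙_ D) ⊗ₘ (λ_ (F.obj X.obj)).hom) ≫ (λ_ _).hom : 𝟙_ D ⊗ (𝟙_ D ⊗ F.obj X.obj) ⟶ F.obj X.obj) =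
            (𝟙 _ ⊗ₘ (ε F ⊗ₘ 𝟙 _)) ≫ ((ε F ⊗ₘ μ F _ _) ≫ μ F _ _) ≫ F.map ((𝟙 (𝟙_ C) ⊗ₘ (λ_ X.obj).hom) ≫ (λ_ X.obj).hom) := by
          have e1 := left_unitality F X.obj
          rw [assoc, F.map_comp, ← μ_natural_assoc, F.map_id, tensorHom_comp_tensorHom_assoc,
            tensorHom_comp_tensorHom_assoc, comp_id, id_comp, tensorHom_id, assoc, ← e1,
            MonoidalCategory.tensorHom_def' (ε F), assoc, ← e1, id_tensorHom]
        obtain ⟨⟨X, σ, hX⟩⟩ := X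
        cases σ <;> exact key
      right_unitality := by
        intro X
        have key : ((𝟙 (𝟙_ D) ⊗ₘ (ρ_ (F.obj X.obj)).hom) ≫ (λ_ _).hom : 𝟙_ D ⊗ (F.obj X.obj ⊗ 𝟙_ D) ⟶ F.obj X.obj) =
            (𝟙 _ ⊗ₘ (𝟙 _ ⊗ₘ ε F)) ≫ ((ε F ⊗ₘ μ F _ _) ≫ μ F _ _) ≫ F.map ((𝟙 (𝟙_ C) ⊗ₘ (ρ_ X.obj).hom) ≫ (λ_ X.obj).hom) := by
          have e1 := left_unitality F X.obj
          have e2 := right_unitality F X.obj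
          rw [assoc, F.map_comp, ← μ_natural_assoc, F.map_id, tensorHom_comp_tensorHom_assoc,
            tensorHom_comp_tensorHom_assoc, comp_id, id_comp, id_tensorHom (F.obj X.obj), assoc, ← e2,
            MonoidalCategory.tensorHom_def' (ε F), assoc, ← e1, id_tensorHom]
        obtain ⟨⟨X, σ, hX⟩⟩ := X
        cases σ <;> exact key }

instance : (map F e).Braided where
  braided X Y := by
    have h0 : ∀ σ τ : Bool, (zAlphaIso F e σ τ).hom ≫ F.map (zSymm f σ τ).hom = (zSymm g σ τ).hom ≫ (zAlphaIso F e τ σ).hom := by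
      have h3 : ∀ {P : C} {P' : D} (a : P' ⟶ F.obj P), a ≫ F.map (𝟙 P) = 𝟙 P' ≫ a := by
        intros; simp
      intro σ τ
      cases σ <;> cases τ <;> exact h3 _
    have h1 : (((zAlphaIso F e X.deg Y.deg).hom ⊗ₘ μ F X.obj Y.obj) ≫ μ F _ _) ≫
        F.map (zB X.deg Y.deg • ((zSymm f X.deg Y.deg).hom ⊗ₘ (β_ X.obj Y.obj).hom)) =
        (zB X.deg Y.deg • ((zSymm g X.deg Y.deg).hom ⊗ₘ (β_ (F.obj X.obj) (F.obj Y.obj)).hom)) ≫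
        (((zAlphaIso F e Y.deg X.deg).hom ⊗ₘ μ F Y.obj X.obj) ≫ μ F _ _) := by
      rw [F.map_smul, Linear.comp_smul, Linear.smul_comp, assoc, ← μ_natural, tensorHom_comp_tensorHom_assoc,
        tensorHom_comp_tensorHom_assoc, h0, Functor.LaxBraided.braided]
    exact h1

end Zest

end

end

/-! ### Zesting on equivalence classes of modular closures. -/

section

open BraidedCategory
section

variable {C : Type u} [Category.{v} C] [Preadditive C] [Linear ℂ C] [MonoidalCategory C]
    [MonoidalPreadditive C] [MonoidalLinear ℂ C] [BraidedCategory C]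
    {D : Type u₂} [Category.{v₂} D] [Preadditive D] [Linear ℂ D] [MonoidalCategory D]
    [MonoidalPreadditive D] [MonoidalLinear ℂ D] [BraidedCategory D] (F : C ⥤ D) [F.Braided]
    [F.Additive] [F.Linear ℂ] {f : C} {g : D} (e : F.obj f ≅ g) [SelfFermionic f] [SelfFermionic g]
    {B : Type u₁} [Category.{v₁} B] [MonoidalCategory B] (I : B ⥤ C) [I.Monoidal] (I' : B ⥤ D) [I'.Monoidal]
    (κ : I ⋙ F ≅ I') [hκ : NatTrans.IsMonoidal κ.hom]
    (h : ∀ b, HasParity f false (I.obj b)) (h' : ∀ b, HasParity g false (I'.obj b))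

open Functor.LaxMonoidal

/-- `Zest.map` on the even objects. -/
def evenLiftMapIso : evenLift I h ⋙ Zest.map F e ≅ evenLift I' h' :=
  NatIso.ofComponents (fun b => Zest.mkIso (X := (evenLift I h ⋙ Zest.map F e).obj b) (Y := (evenLift I' h').obj b) (κ.app b))
    fun g => κ.hom.naturality g

instance : NatTrans.IsMonoidal (evenLiftMapIso F e I I' κ h h').hom where
  unit := by
    have h1 := hκ.unit
    rw [comp_ε] at h1
    exact h1
  tensor b b' := by
    have h1 := hκ.tensor b b'
    rw [comp_μ] at h1
    have h2 : (((ε F ⊗ₘ μ F (I.obj b) (I.obj b')) ≫ μ F (𝟙_ C) (I.obj b ⊗ I.obj b')) ≫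
        F.map ((λ_ _).hom ≫ μ I b b')) ≫ κ.hom.app (b ⊗ b') =
        (𝟙 (𝟙_ D) ⊗ₘ (κ.hom.app b ⊗ₘ κ.hom.app b')) ≫ (λ_ _).hom ≫ μ I' b b' := by
      have e1 := left_unitality F (I.obj b ⊗ I.obj b')
      rw [F.map_comp, MonoidalCategory.tensorHom_def' (ε F)]
      simp only [assoc]
      rw [← reassoc_of% e1,
        leftUnitor_naturality_assoc, id_tensorHom, leftUnitor_naturality_assoc, ← h1]
      simp
    exact h2

end

open URFC ModularClosure

namespace ModularClosure

variable {B : URFC.{u₁, v₁}} {f : B} (hf : B.IsSuperModular f)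
  {C D : ModularClosure.{u₁, v₁, u₂, v₂} B}

/-- Zesting is compatible with equivalence. -/
theorem Equivalent.zest (h : C.Equivalent D) : (C.zest hf).Equivalent (D.zest hf) := by
  obtain ⟨F, h1, κ, h2, h3, h4, h5⟩ := h
  have := C.selfFermionic hf
  have := D.selfFermionic hf
  have := D.fermionicTwist hf
  let hD := D.isFermion hf
  -- Through this functor the zesting of `D` is also a zesting of `C`, so the claim reduces to
  -- uniqueness.
  let K : Zest (C.ι.obj f) ⥤ (zested D.cat (D.ι.obj f) hD).Obj := Zest.map F (κ.app f) ⋙ zestedSingle hD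
  let Φ : C.cat.Obj ⥤ (zested D.cat (D.ι.obj f) hD).Obj := F ⋙ (zestedEquiv hD).inverse
  have e1 : Φ.IsEquivalence := inferInstance
  have e2 : Φ.Additive := inferInstance
  have e3 : Φ.Linear ℂ := inferInstance
  let e4 : K.Braided := inferInstance
  let i : K ≅ Zest.forget (C.ι.obj f) ⋙ Φ :=
    Functor.isoWhiskerLeft (Zest.map F (κ.app f)) (zestedSingleIsoInverse hD)
  let κ' : evenLift C.ι (C.hasParity_ι hf) ⋙ K ≅ evenLift D.ι (D.hasParity_ι hf) ⋙ zestedSingle hD :=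
    (Functor.associator _ _ _).symm ≪≫ Functor.isoWhiskerRight (evenLiftMapIso F (κ.app f) C.ι D.ι κ (C.hasParity_ι hf) (D.hasParity_ι hf)) (zestedSingle hD)
  have hκ' : NatTrans.IsMonoidal κ'.hom := by
    simp only [κ', K, Iso.trans_hom, Iso.symm_hom, Functor.isoWhiskerRight_hom]
    infer_instance
  exact zest_equivalent hf (@Zesting.ofFunctor _ _ hf C (D.zest hf) _ Φ e1 e2 e3 K e4 i κ' hκ')

/-- Zesting, on equivalence classes. -/
def zestClass : Classes.{u₁, v₁, u₂, v₂} B → Classes.{u₁, v₁, u₂, v₂} B :=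
  Quotient.map (fun C => C.zest hf) fun _ _ h => Equivalent.zest hf h

theorem zestClass_toClass (Z : Zesting f C D) : zestClass hf C.toClass = D.toClass :=
  Quotient.sound (zest_equivalent hf Z)

end ModularClosure

end

/-! ### Contracting the coefficients of an iterated zesting. -/

section

open BraidedCategory
section

variable {C : Type u} [Category.{v} C] [MonoidalCategory C] [BraidedCategory C]

/-- The contraction `1 ⊗ (A ⊗ (A' ⊗ V)) ⟶ V` given by a morphism `A ⊗ A' ⟶ 1`. -/
def contract {A A' : C} (t : A ⊗ A' ⟶ 𝟙_ C) (V : C) : 𝟙_ C ⊗ (A ⊗ (A' ⊗ V)) ⟶ V :=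
  (λ_ _).hom ≫ (α_ A A' V).inv ≫ t ▷ V ≫ (λ_ V).hom

/-- The associator of an iterated zesting, for general objects in place of the values of `α`. -/
def doubleAssoc {A₁ A₂ B₁ B₂ A₁' A₂' B₁' B₂' : C} (φ' : A₂' ⊗ A₁' ⟶ B₂' ⊗ B₁')
    (φ : 𝟙_ C ⊗ (A₂ ⊗ A₁) ⟶ 𝟙_ C ⊗ (B₂ ⊗ B₁)) (ψ₁ : A₂' ⊗ 𝟙_ C ⟶ 𝟙_ C ⊗ A₂')
    (ψ₂ : 𝟙_ C ⊗ 𝟙_ C ⟶ 𝟙_ C ⊗ 𝟙_ C) (ψ₃ : 𝟙_ C ⊗ 𝟙_ C ⟶ 𝟙_ C ⊗ 𝟙_ C) (ψ₄ : 𝟙_ C ⊗ B₂' ⟶ B₂' ⊗ 𝟙_ C)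
    (ψ₅ : B₂' ⊗ 𝟙_ C ⟶ B₂' ⊗ 𝟙_ C) (X Y Z : C) :
    𝟙_ C ⊗ (A₂ ⊗ (A₂' ⊗ ((𝟙_ C ⊗ (A₁ ⊗ (A₁' ⊗ (X ⊗ Y)))) ⊗ Z))) ⟶
      𝟙_ C ⊗ (B₂ ⊗ (B₂' ⊗ (X ⊗ (𝟙_ C ⊗ (B₁ ⊗ (B₁' ⊗ (Y ⊗ Z))))))) :=
  (𝟙 (𝟙_ C) ⊗ₘ (𝟙 A₂ ⊗ₘ (crossAssoc ψ₁ A₁ (A₁' ⊗ (X ⊗ Y)) Z ≫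
    (𝟙 (𝟙_ C) ⊗ₘ (𝟙 A₁ ⊗ₘ crossAssoc φ' X Y Z))))) ≫
  crossAssocInv ψ₂ A₂ A₁ (B₂' ⊗ (X ⊗ (B₁' ⊗ (Y ⊗ Z)))) ≫
  (𝟙 (𝟙_ C) ⊗ₘ (φ ⊗ₘ 𝟙 _)) ≫
  crossAssoc ψ₃ B₂ B₁ (B₂' ⊗ (X ⊗ (B₁' ⊗ (Y ⊗ Z)))) ≫
  (𝟙 (𝟙_ C) ⊗ₘ (𝟙 B₂ ⊗ₘ (crossAssocInv ψ₄ B₁ X (B₁' ⊗ (Y ⊗ Z)) ≫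
    (𝟙 B₂' ⊗ₘ ((𝟙 (𝟙_ C) ⊗ₘ (β_ X B₁).inv) ⊗ₘ 𝟙 _)) ≫
    crossAssoc ψ₅ X B₁ (B₁' ⊗ (Y ⊗ Z)))))

/-- With the unit coefficients removed, there remain the two cocycle maps, the crossings of `X` with
`B₁` and `B₁'`, and two crossings of coefficients of the inner with those of the outer zesting. -/
theorem doubleAssoc_eq {A₁ A₂ B₁ B₂ A₁' A₂' B₁' B₂' : C} (φ' : A₂' ⊗ A₁' ⟶ B₂' ⊗ B₁')
    (φ : 𝟙_ C ⊗ (A₂ ⊗ A₁) ⟶ 𝟙_ C ⊗ (B₂ ⊗ B₁)) (X Y Z : C) :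
    doubleAssoc φ' φ ((ρ_ A₂').hom ≫ (λ_ A₂').inv) (𝟙 _) (𝟙 _) ((λ_ B₂').hom ≫ (ρ_ B₂').inv) (𝟙 _) X Y Z =
      𝟙 _ ⊗≫ A₂ ◁ (β_ A₁ A₂').inv ▷ (A₁' ⊗ X ⊗ Y ⊗ Z) ⊗≫ (A₂ ⊗ A₁) ◁ φ' ▷ (X ⊗ Y ⊗ Z) ⊗≫
      ((A₂ ⊗ A₁) ⊗ B₂') ◁ (β_ X B₁').inv ▷ (Y ⊗ Z) ⊗≫
      ((λ_ _).inv ≫ φ ≫ (λ_ _).hom) ▷ (B₂' ⊗ X ⊗ B₁' ⊗ Y ⊗ Z) ⊗≫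
      B₂ ◁ (β_ B₁ B₂').hom ▷ (X ⊗ B₁' ⊗ Y ⊗ Z) ⊗≫
      (B₂ ⊗ B₂') ◁ (β_ X B₁).inv ▷ (B₁' ⊗ Y ⊗ Z) ⊗≫ 𝟙 _ := by
  simp only [doubleAssoc, crossAssoc_eq, crossAssocInv_eq, id_tensorHom, tensorHom_id,
    braiding_inv_tensorUnit_right, braiding_tensorUnit_right]
  monoidal

theorem braiding_inv_comp_contract (X : C) {A A' : C} (t : A ⊗ A' ⟶ 𝟙_ C) :
    A ◁ (β_ X A').inv ⊗≫ (β_ X A).inv ▷ A' ⊗≫ X ◁ t = (α_ A A' X).inv ≫ t ▷ X ≫ (λ_ X).hom ≫ (ρ_ X).inv := by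
  have e := braiding_inv_naturality_left t X
  rw [braiding_inv_tensorUnit_right, braiding_tensor_right_inv] at e
  calc
    _ = (α_ A A' X).inv ≫ ((α_ _ _ _).hom ≫ A ◁ (β_ X A').inv ≫ (α_ _ _ _).inv ≫ (β_ X A).inv ▷ A' ≫ (α_ _ _ _).hom) ≫ X ◁ t := by
      monoidal
    _ = _ := by rw [← e]

/-- An iterated zesting becomes the original tensor product if the values of `α` are contracted. -/
theorem doubleAssoc_contract {A₁ A₂ B₁ B₂ A₁' A₂' B₁' B₂' : C} (φ' : A₂' ⊗ A₁' ⟶ B₂' ⊗ B₁')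
    (φ : 𝟙_ C ⊗ (A₂ ⊗ A₁) ⟶ 𝟙_ C ⊗ (B₂ ⊗ B₁)) (s₁ : A₁ ⊗ A₁' ⟶ 𝟙_ C) (s₂ : A₂ ⊗ A₂' ⟶ 𝟙_ C)
    (u₁ : B₁ ⊗ B₁' ⟶ 𝟙_ C) (u₂ : B₂ ⊗ B₂' ⟶ 𝟙_ C)
    (h : 𝟙 _ ⊗≫ A₂ ◁ (β_ A₁ A₂').inv ▷ A₁' ⊗≫ (A₂ ⊗ A₁) ◁ φ' ⊗≫
      ((λ_ _).inv ≫ φ ≫ (λ_ _).hom) ▷ (B₂' ⊗ B₁') ⊗≫ B₂ ◁ (β_ B₁ B₂').hom ▷ B₁' ⊗≫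
      u₂ ▷ (B₁ ⊗ B₁') ⊗≫ u₁ = (α_ A₂ A₂' (A₁ ⊗ A₁')).inv ≫ s₂ ▷ (A₁ ⊗ A₁') ⊗≫ s₁) (X Y Z : C) :
    doubleAssoc φ' φ ((ρ_ A₂').hom ≫ (λ_ A₂').inv) (𝟙 _) (𝟙 _) ((λ_ B₂').hom ≫ (ρ_ B₂').inv) (𝟙 _) X Y Z ≫
        (𝟙 _ ⊗ₘ (𝟙 B₂ ⊗ₘ (𝟙 B₂' ⊗ₘ (𝟙 X ⊗ₘ contract u₁ (Y ⊗ Z))))) ≫ contract u₂ (X ⊗ (Y ⊗ Z)) =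
      (𝟙 _ ⊗ₘ (𝟙 A₂ ⊗ₘ (𝟙 A₂' ⊗ₘ (contract s₁ (X ⊗ Y) ⊗ₘ 𝟙 Z)))) ≫ contract s₂ ((X ⊗ Y) ⊗ Z) ≫ (α_ X Y Z).hom := by
  rw [doubleAssoc_eq]
  simp only [id_tensorHom, tensorHom_id, contract]
  generalize hφ : (λ_ (A₂ ⊗ A₁)).inv ≫ φ ≫ (λ_ (B₂ ⊗ B₁)).hom = φ₀ at h ⊢
  calc
    _ = 𝟙 _ ⊗≫ A₂ ◁ (β_ A₁ A₂').inv ▷ (A₁' ⊗ X ⊗ Y ⊗ Z) ⊗≫ (A₂ ⊗ A₁) ◁ φ' ▷ (X ⊗ Y ⊗ Z) ⊗≫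
      (((A₂ ⊗ A₁) ◁ (B₂' ◁ (β_ X B₁').inv) ≫ φ₀ ▷ _) ▷ (Y ⊗ Z)) ⊗≫
      B₂ ◁ (β_ B₁ B₂').hom ▷ (X ⊗ B₁' ⊗ Y ⊗ Z) ⊗≫
      (B₂ ⊗ B₂') ◁ (β_ X B₁).inv ▷ (B₁' ⊗ Y ⊗ Z) ⊗≫
      ((B₂ ⊗ B₂') ◁ (X ◁ u₁) ≫ u₂ ▷ _) ▷ (Y ⊗ Z) ⊗≫ 𝟙 _ := by monoidal
    _ = 𝟙 _ ⊗≫ A₂ ◁ (β_ A₁ A₂').inv ▷ (A₁' ⊗ X ⊗ Y ⊗ Z) ⊗≫ (A₂ ⊗ A₁) ◁ φ' ▷ (X ⊗ Y ⊗ Z) ⊗≫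
      φ₀ ▷ (B₂' ⊗ B₁' ⊗ X ⊗ Y ⊗ Z) ⊗≫ B₂ ◁ ((B₁ ⊗ B₂') ◁ (β_ X B₁').inv ≫ (β_ B₁ B₂').hom ▷ _) ▷ (Y ⊗ Z) ⊗≫
      ((B₂ ⊗ B₂') ◁ (β_ X B₁).inv ≫ u₂ ▷ _) ▷ (B₁' ⊗ Y ⊗ Z) ⊗≫
      X ◁ u₁ ▷ (Y ⊗ Z) ⊗≫ 𝟙 _ := by rw [whisker_exchange, whisker_exchange]; monoidal
    _ = 𝟙 _ ⊗≫ A₂ ◁ (β_ A₁ A₂').inv ▷ (A₁' ⊗ X ⊗ Y ⊗ Z) ⊗≫ (A₂ ⊗ A₁) ◁ φ' ▷ (X ⊗ Y ⊗ Z) ⊗≫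
      φ₀ ▷ (B₂' ⊗ B₁' ⊗ X ⊗ Y ⊗ Z) ⊗≫ B₂ ◁ (β_ B₁ B₂').hom ▷ (B₁' ⊗ X ⊗ Y ⊗ Z) ⊗≫
      ((B₂ ⊗ B₂') ◁ (B₁ ◁ (β_ X B₁').inv) ≫ u₂ ▷ _) ▷ (Y ⊗ Z) ⊗≫ (β_ X B₁).inv ▷ (B₁' ⊗ Y ⊗ Z) ⊗≫
      X ◁ u₁ ▷ (Y ⊗ Z) ⊗≫ 𝟙 _ := by rw [whisker_exchange, whisker_exchange]; monoidal
    _ = 𝟙 _ ⊗≫ A₂ ◁ (β_ A₁ A₂').inv ▷ (A₁' ⊗ X ⊗ Y ⊗ Z) ⊗≫ (A₂ ⊗ A₁) ◁ φ' ▷ (X ⊗ Y ⊗ Z) ⊗≫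
      φ₀ ▷ (B₂' ⊗ B₁' ⊗ X ⊗ Y ⊗ Z) ⊗≫ B₂ ◁ (β_ B₁ B₂').hom ▷ (B₁' ⊗ X ⊗ Y ⊗ Z) ⊗≫
      u₂ ▷ (B₁ ⊗ B₁' ⊗ X ⊗ Y ⊗ Z) ⊗≫ (B₁ ◁ (β_ X B₁').inv ⊗≫ (β_ X B₁).inv ▷ B₁' ⊗≫
      X ◁ u₁) ▷ (Y ⊗ Z) ⊗≫ 𝟙 _ := by rw [whisker_exchange]; monoidal
    _ = 𝟙 _ ⊗≫ (𝟙 (A₂ ⊗ (A₂' ⊗ (A₁ ⊗ A₁'))) ⊗≫ A₂ ◁ (β_ A₁ A₂').inv ▷ A₁' ⊗≫ (A₂ ⊗ A₁) ◁ φ' ⊗≫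
      φ₀ ▷ (B₂' ⊗ B₁') ⊗≫ B₂ ◁ (β_ B₁ B₂').hom ▷ B₁' ⊗≫
      u₂ ▷ (B₁ ⊗ B₁') ⊗≫ u₁) ▷ (X ⊗ Y ⊗ Z) ⊗≫ 𝟙 _ := by
      -- The crossings of `X` now stand directly before the contraction of `B₁ ⊗ B₁'`, from which
      -- `X` can be pulled off. What is left concerns coefficients only and is settled by `h`.
      rw [braiding_inv_comp_contract]; monoidal
    _ = 𝟙 _ ⊗≫ ((α_ A₂ A₂' (A₁ ⊗ A₁')).inv ≫ s₂ ▷ (A₁ ⊗ A₁') ⊗≫ s₁) ▷ (X ⊗ Y ⊗ Z) ⊗≫ 𝟙 _ := by rw [h]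
    _ = 𝟙 _ ⊗≫ (s₂ ▷ (A₁ ⊗ A₁') ≫ 𝟙_ C ◁ s₁) ▷ (X ⊗ Y ⊗ Z) ⊗≫ 𝟙 _ := by monoidal
    _ = _ := by rw [← whisker_exchange]; monoidal

end

end

/-! ### The second power of the zesting, up to scalars. -/

section

open BraidedCategory
section

variable {C : Type u} [Category.{v} C] [Preadditive C] [Linear ℂ C] [MonoidalCategory C]
  [MonoidalPreadditive C] [MonoidalLinear ℂ C] [BraidedCategory C]

theorem smul_doubleAssoc {A₁ A₂ B₁ B₂ A₁' A₂' B₁' B₂' : C} (φ' : A₂' ⊗ A₁' ⟶ B₂' ⊗ B₁')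
    (φ : 𝟙_ C ⊗ (A₂ ⊗ A₁) ⟶ 𝟙_ C ⊗ (B₂ ⊗ B₁)) (ψ₁ : A₂' ⊗ 𝟙_ C ⟶ 𝟙_ C ⊗ A₂')
    (ψ₂ : 𝟙_ C ⊗ 𝟙_ C ⟶ 𝟙_ C ⊗ 𝟙_ C) (ψ₃ : 𝟙_ C ⊗ 𝟙_ C ⟶ 𝟙_ C ⊗ 𝟙_ C) (ψ₄ : 𝟙_ C ⊗ B₂' ⟶ B₂' ⊗ 𝟙_ C)
    (ψ₅ : B₂' ⊗ 𝟙_ C ⟶ B₂' ⊗ 𝟙_ C) (w₀ w₁ w₂ w₃ w₄ w₅ w₆ w₇ : ℂ) (X Y Z : C) :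
  w₀ • ((𝟙 (𝟙_ C) ⊗ₘ (𝟙 A₂ ⊗ₘ ((w₁ • crossAssoc ψ₁ A₁ (A₁' ⊗ (X ⊗ Y)) Z) ≫
    (𝟙 (𝟙_ C) ⊗ₘ (𝟙 A₁ ⊗ₘ (w₂ • crossAssoc φ' X Y Z)))))) ≫
  (w₃ • crossAssocInv ψ₂ A₂ A₁ (B₂' ⊗ (X ⊗ (B₁' ⊗ (Y ⊗ Z))))) ≫
  (𝟙 (𝟙_ C) ⊗ₘ (φ ⊗ₘ 𝟙 _)) ≫
  (w₄ • crossAssoc ψ₃ B₂ B₁ (B₂' ⊗ (X ⊗ (B₁' ⊗ (Y ⊗ Z))))) ≫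
  (𝟙 (𝟙_ C) ⊗ₘ (𝟙 B₂ ⊗ₘ ((w₅ • crossAssocInv ψ₄ B₁ X (B₁' ⊗ (Y ⊗ Z))) ≫
    (𝟙 B₂' ⊗ₘ ((w₆ • (𝟙 (𝟙_ C) ⊗ₘ (β_ X B₁).inv)) ⊗ₘ 𝟙 _)) ≫
    (w₇ • crossAssoc ψ₅ X B₁ (B₁' ⊗ (Y ⊗ Z))))))) =
  (w₀ * w₁ * w₂ * w₃ * w₄ * w₅ * w₆ * w₇) • doubleAssoc φ' φ ψ₁ ψ₂ ψ₃ ψ₄ ψ₅ X Y Z := by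
  simp only [doubleAssoc, Linear.smul_comp, Linear.comp_smul, tensorHom_smul, smul_tensorHom, smul_smul]
  congr 1
  ring

/-- The hypothesis on the values of `α` under which contraction turns an iterated zesting into the
original tensor product. -/
def ContractCocycle {A₁ A₂ B₁ B₂ A₁' A₂' B₁' B₂' : C} (φ' : A₂' ⊗ A₁' ⟶ B₂' ⊗ B₁')
    (φ : 𝟙_ C ⊗ (A₂ ⊗ A₁) ⟶ 𝟙_ C ⊗ (B₂ ⊗ B₁)) (s₁ : A₁ ⊗ A₁' ⟶ 𝟙_ C) (s₂ : A₂ ⊗ A₂' ⟶ 𝟙_ C)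
    (u₁ : B₁ ⊗ B₁' ⟶ 𝟙_ C) (u₂ : B₂ ⊗ B₂' ⟶ 𝟙_ C) : Prop :=
  𝟙 _ ⊗≫ A₂ ◁ (β_ A₁ A₂').inv ▷ A₁' ⊗≫ (A₂ ⊗ A₁) ◁ φ' ⊗≫
      ((λ_ _).inv ≫ φ ≫ (λ_ _).hom) ▷ (B₂' ⊗ B₁') ⊗≫ B₂ ◁ (β_ B₁ B₂').hom ▷ B₁' ⊗≫
      u₂ ▷ (B₁ ⊗ B₁') ⊗≫ u₁ = (α_ A₂ A₂' (A₁ ⊗ A₁')).inv ≫ s₂ ▷ (A₁ ⊗ A₁') ⊗≫ s₁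

/-- All scalars and unit maps are independent variables fixed by equations, so that the associator
of the twice zested category matches the left-hand side by unfolding, in each case of degrees. -/
theorem smul_doubleAssoc_contract {A₁ A₂ B₁ B₂ A₁' A₂' B₁' B₂' : C} (φ' : A₂' ⊗ A₁' ⟶ B₂' ⊗ B₁')
    (φ : 𝟙_ C ⊗ (A₂ ⊗ A₁) ⟶ 𝟙_ C ⊗ (B₂ ⊗ B₁)) (s₁ : A₁ ⊗ A₁' ⟶ 𝟙_ C) (s₂ : A₂ ⊗ A₂' ⟶ 𝟙_ C)
    (u₁ : B₁ ⊗ B₁' ⟶ 𝟙_ C) (u₂ : B₂ ⊗ B₂' ⟶ 𝟙_ C) (ψ₁ : A₂' ⊗ 𝟙_ C ⟶ 𝟙_ C ⊗ A₂')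
    (ψ₂ : 𝟙_ C ⊗ 𝟙_ C ⟶ 𝟙_ C ⊗ 𝟙_ C) (ψ₃ : 𝟙_ C ⊗ 𝟙_ C ⟶ 𝟙_ C ⊗ 𝟙_ C) (ψ₄ : 𝟙_ C ⊗ B₂' ⟶ B₂' ⊗ 𝟙_ C)
    (ψ₅ : B₂' ⊗ 𝟙_ C ⟶ B₂' ⊗ 𝟙_ C) (w₀ w₁ w₂ w₃ w₄ w₅ w₆ w₇ s : ℂ) (X Y Z : C)
    (h₁ : ψ₁ = (ρ_ A₂').hom ≫ (λ_ A₂').inv) (h₂ : ψ₂ = 𝟙 _) (h₃ : ψ₃ = 𝟙 _)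
    (h₄ : ψ₄ = (λ_ B₂').hom ≫ (ρ_ B₂').inv) (h₅ : ψ₅ = 𝟙 _)
    (hs : w₀ * w₁ * w₂ * w₃ * w₄ * w₅ * w₆ * w₇ = s)
    (h : ContractCocycle φ' φ s₁ s₂ u₁ u₂) :
  (w₀ • ((𝟙 (𝟙_ C) ⊗ₘ (𝟙 A₂ ⊗ₘ ((w₁ • crossAssoc ψ₁ A₁ (A₁' ⊗ (X ⊗ Y)) Z) ≫
    (𝟙 (𝟙_ C) ⊗ₘ (𝟙 A₁ ⊗ₘ (w₂ • crossAssoc φ' X Y Z)))))) ≫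
  (w₃ • crossAssocInv ψ₂ A₂ A₁ (B₂' ⊗ (X ⊗ (B₁' ⊗ (Y ⊗ Z))))) ≫
  (𝟙 (𝟙_ C) ⊗ₘ (φ ⊗ₘ 𝟙 _)) ≫
  (w₄ • crossAssoc ψ₃ B₂ B₁ (B₂' ⊗ (X ⊗ (B₁' ⊗ (Y ⊗ Z))))) ≫
  (𝟙 (𝟙_ C) ⊗ₘ (𝟙 B₂ ⊗ₘ ((w₅ • crossAssocInv ψ₄ B₁ X (B₁' ⊗ (Y ⊗ Z))) ≫
    (𝟙 B₂' ⊗ₘ ((w₆ • (𝟙 (𝟙_ C) ⊗ₘ (β_ X B₁).inv)) ⊗ₘ 𝟙 _)) ≫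
    (w₇ • crossAssoc ψ₅ X B₁ (B₁' ⊗ (Y ⊗ Z)))))))) ≫
        (𝟙 _ ⊗ₘ (𝟙 B₂ ⊗ₘ (𝟙 B₂' ⊗ₘ (𝟙 X ⊗ₘ contract u₁ (Y ⊗ Z))))) ≫ contract u₂ (X ⊗ (Y ⊗ Z)) =
      s • ((𝟙 _ ⊗ₘ (𝟙 A₂ ⊗ₘ (𝟙 A₂' ⊗ₘ (contract s₁ (X ⊗ Y) ⊗ₘ 𝟙 Z)))) ≫ contract s₂ ((X ⊗ Y) ⊗ Z) ≫ (α_ X Y Z).hom) := by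
  subst h₁ h₂ h₃ h₄ h₅ hs
  rw [smul_doubleAssoc, Linear.smul_comp, doubleAssoc_contract φ' φ s₁ s₂ u₁ u₂ h]

variable (f : C) [SelfFermionic f]

/-- The fermion in the zested category. -/
@[reducible]
def zestFermion : Zest f := ⟨⟨f, false, SelfFermionic.doubleBraiding f⟩⟩

instance : SelfFermionic (zestFermion f) where
  square := ⟨Zest.mkIso (X := Zest.tObj (zestFermion f) (zestFermion f)) (Y := 𝟙_ (Zest f))
    ((λ_ _) ≪≫ (SelfFermionic.square (f := f)).some)⟩
  braiding := by
    have h : zB false false • (𝟙 (𝟙_ C) ⊗ₘ (β_ f f).hom) = -𝟙 (𝟙_ C ⊗ (f ⊗ f)) := by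
      rw [zB, if_neg (by decide), one_smul, SelfFermionic.braiding, ← neg_one_smul ℂ, tensorHom_smul,
        id_tensorHom_id, neg_one_smul]
    exact h

variable {f}

/-- The fermion is even, so the zested braiding with it carries no power of ζ, and zesting does not
change parities. -/
theorem hasParity_zest {σ τ : Bool} {X : C} (h : HasParity f σ X) (h' : HasParity f τ X) :
    HasParity (zestFermion f) σ (⟨⟨X, τ, h'⟩⟩ : Zest f) := by
  rw [hasParity_iff] at h ⊢
  have h1 : (zB τ false • (𝟙 (𝟙_ C) ⊗ₘ (β_ X f).hom)) ≫ (zB false τ • (𝟙 (𝟙_ C) ⊗ₘ (β_ f X).hom)) =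
      pSign σ • 𝟙 (𝟙_ C ⊗ (X ⊗ f)) := by
    rw [zB, if_neg (by simp), one_smul, zB, if_neg (by simp), one_smul, tensorHom_comp_tensorHom, id_comp]
    change 𝟙 _ ⊗ₘ doubleBraiding X f = _
    rw [h, tensorHom_smul, id_tensorHom_id]
  cases τ <;> exact h1

/-- Homogeneous objects in the twice zested category. -/
def doubleZest (f : C) [SelfFermionic f] : Homog C f ⥤ Zest (zestFermion f) where
  obj X := ⟨⟨⟨⟨X.obj, X.deg, X.parity⟩⟩, X.deg, hasParity_zest X.parity X.parity⟩⟩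
  map g := g

/-- `contract` as an isomorphism. -/
def contractIso {A A' : C} (t : A ⊗ A' ≅ 𝟙_ C) (V : C) : 𝟙_ C ⊗ (A ⊗ (A' ⊗ V)) ≅ V :=
  (λ_ _) ≪≫ (α_ A A' V).symm ≪≫ whiskerRightIso t V ≪≫ (λ_ V)

/-- The square of the fermion. -/
def squareIso (f : C) [SelfFermionic f] : f ⊗ f ≅ 𝟙_ C := (SelfFermionic.square (f := f)).some

/-- Lift an isomorphism to the twice zested category. -/
abbrev zestMkIso₂ {X Y : Zest (zestFermion f)} (e : X.obj.obj ≅ Y.obj.obj) : X ≅ Y := 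
  Zest.mkIso (Zest.mkIso e)

/-- The comparison of the twice zested tensor product with the original one. -/
def doubleZestμ : ∀ X Y : Homog C f, (doubleZest f).obj X ⊗ (doubleZest f).obj Y ≅ (doubleZest f).obj (X ⊗ Y)
  | ⟨X, true, hX⟩, ⟨Y, true, hY⟩ => zestMkIso₂ (contractIso (squareIso f) (X ⊗ Y))
  | ⟨X, true, hX⟩, ⟨Y, false, hY⟩ => zestMkIso₂ (contractIso (λ_ (𝟙_ C)) (X ⊗ Y))
  | ⟨X, false, hX⟩, ⟨Y, true, hY⟩ => zestMkIso₂ (contractIso (λ_ (𝟙_ C)) (X ⊗ Y))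
  | ⟨X, false, hX⟩, ⟨Y, false, hY⟩ => zestMkIso₂ (contractIso (λ_ (𝟙_ C)) (X ⊗ Y))

/-- The scalar by which the associator of the second power of the zesting is changed. -/
def degSign (σ τ ρ : Bool) : ℂ := if σ && τ && ρ then -1 else 1
/-- The scalar by which the braiding of the second power of the zesting is changed. -/
def degI (σ τ : Bool) : ℂ := if σ && τ then Complex.I else 1

/-- This and the next three lemmas treat the possible positions of the pair of fermions. There is at
most one such pair, so every crossing between coefficients involves the unit and no sign arises. -/
theorem contractCocycle_right {A A' : C} (t : A ⊗ A' ⟶ 𝟙_ C) :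
    ContractCocycle (𝟙 (A' ⊗ 𝟙_ C)) (𝟙 (𝟙_ C ⊗ (A ⊗ 𝟙_ C))) (λ_ (𝟙_ C)).hom t (λ_ (𝟙_ C)).hom t := by
  simp only [ContractCocycle, braiding_inv_tensorUnit_left, braiding_tensorUnit_left]
  monoidal

theorem contractCocycle_left {A A' : C} (t : A ⊗ A' ⟶ 𝟙_ C) :
    ContractCocycle (𝟙 (𝟙_ C ⊗ A')) (𝟙 (𝟙_ C ⊗ (𝟙_ C ⊗ A))) t (λ_ (𝟙_ C)).hom t (λ_ (𝟙_ C)).hom := by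
  simp only [ContractCocycle, braiding_inv_tensorUnit_right, braiding_tensorUnit_right]
  monoidal

theorem contractCocycle_left_right {A A' : C} (t : A ⊗ A' ⟶ 𝟙_ C) :
    ContractCocycle ((λ_ A').hom ≫ (ρ_ A').inv) (((𝟙 (𝟙_ C) ⊗ₘ (λ_ A).hom) ≫ (λ_ A).hom) ≫
      (λ_ A).inv ≫ (𝟙 (𝟙_ C) ⊗ₘ (ρ_ A).inv)) t (λ_ (𝟙_ C)).hom (λ_ (𝟙_ C)).hom t := by
  rw [ContractCocycle]; simp [braiding_inv_tensorUnit_right, braiding_tensorUnit_left]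
  monoidal

theorem contractCocycle_right_left {A A' : C} (t : A ⊗ A' ⟶ 𝟙_ C) :
    ContractCocycle ((ρ_ A').hom ≫ (λ_ A').inv) (((𝟙 (𝟙_ C) ⊗ₘ (ρ_ A).hom) ≫ (λ_ A).hom) ≫
      (λ_ A).inv ≫ (𝟙 (𝟙_ C) ⊗ₘ (λ_ A).inv)) (λ_ (𝟙_ C)).hom t t (λ_ (𝟙_ C)).hom := by
  simp only [ContractCocycle, braiding_inv_tensorUnit_left, braiding_tensorUnit_right]
  monoidal

theorem id_eq_rightUnitor_comp : 𝟙 (𝟙_ C ⊗ 𝟙_ C) = (ρ_ (𝟙_ C)).hom ≫ (λ_ (𝟙_ C)).inv := by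
  rw [← unitors_equal, Iso.hom_inv_id]

theorem id_eq_leftUnitor_comp : 𝟙 (𝟙_ C ⊗ 𝟙_ C) = (λ_ (𝟙_ C)).hom ≫ (ρ_ (𝟙_ C)).inv := by
  rw [unitors_equal, Iso.hom_inv_id]

/-- Only the factors w(σ,τ,ρ) of the two zestings can differ from 1, because each of the others has
an even argument. In odd degrees they give i² = -1. -/
theorem degSign_eq (σ τ ρ a b c a' b' c' : Bool) :
    zW σ τ ρ * zW false a b * zW σ τ ρ * (zW false false c)⁻¹ * zW false false a' * (zW false b' c')⁻¹ *
      (zB σ false)⁻¹ * zW σ false a = degSign σ τ ρ := by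
  cases σ <;> cases τ <;> cases ρ <;> simp [zW, zB, degSign]

set_option maxHeartbeats 2000000 in
theorem doubleZest_associativity (X Y Z : Homog C f) :
    (α_ ((doubleZest f).obj X) ((doubleZest f).obj Y) ((doubleZest f).obj Z)).hom ≫
      (doubleZest f).obj X ◁ (doubleZestμ Y Z).hom ≫ (doubleZestμ X (Y ⊗ Z)).hom =
    degSign X.deg Y.deg Z.deg • ((doubleZestμ X Y).hom ▷ (doubleZest f).obj Z ≫ (doubleZestμ (X ⊗ Y) Z).hom ≫
      (doubleZest f).map (α_ X Y Z).hom) := by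
  obtain ⟨X, σ, hX⟩ := X
  obtain ⟨Y, τ, hY⟩ := Y
  obtain ⟨Z, ρ, hZ⟩ := Z
  cases σ <;> cases τ <;> cases ρ <;>
  · refine smul_doubleAssoc_contract _ _ _ _ _ _ _ _ _ _ _ _ _ _ _ _ _ _ _ _ X Y Z ?_ ?_ ?_ ?_ ?_ ?_ ?_
    · first | exact id_eq_rightUnitor_comp | rfl
    · rfl
    · rfl
    · first | exact id_eq_leftUnitor_comp | rfl
    · rfl
    · exact degSign_eq _ _ _ _ _ _ _ _ _
    · first
      | exact contractCocycle_right _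
      | exact contractCocycle_left _
      | exact contractCocycle_left_right _
      | exact contractCocycle_right_left _

end

end

/-! ### Functors that are braided up to powers of the scalars (-1)^{στρ} and i^{στ}. -/

section

open BraidedCategory
section

variable {C : Type u} [Category.{v} C] [Preadditive C] [Linear ℂ C] [MonoidalCategory C]
  [MonoidalPreadditive C] [MonoidalLinear ℂ C] [BraidedCategory C] 

/-- A functor from a category with degrees in `ℤ/2` that is braided monoidal up to the scalars of the
`2 * k`-th power of the zesting. -/
structure TwistedBraided {S : Type u₁} [Category.{v₁} S] [MonoidalCategory S] [BraidedCategory S] 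
    (deg : S → Bool) (k : ℕ) (K : S ⥤ C) where
  ε : 𝟙_ C ≅ K.obj (𝟙_ S)
  μ (X Y : S) : K.obj X ⊗ K.obj Y ≅ K.obj (X ⊗ Y)
  natural_left {X Y : S} (g : X ⟶ Y) (Z : S) :
    K.map g ▷ K.obj Z ≫ (μ Y Z).hom = (μ X Z).hom ≫ K.map (g ▷ Z)
  natural_right {X Y : S} (Z : S) (g : X ⟶ Y) :
    K.obj Z ◁ K.map g ≫ (μ Z Y).hom = (μ Z X).hom ≫ K.map (Z ◁ g)
  associativity (X Y Z : S) :
    (α_ (K.obj X) (K.obj Y) (K.obj Z)).hom ≫ K.obj X ◁ (μ Y Z).hom ≫ (μ X (Y ⊗ Z)).hom =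
      degSign (deg X) (deg Y) (deg Z) ^ k •
        ((μ X Y).hom ▷ K.obj Z ≫ (μ (X ⊗ Y) Z).hom ≫ K.map (α_ X Y Z).hom)
  left_unitality (X : S) : (λ_ (K.obj X)).hom = ε.hom ▷ K.obj X ≫ (μ (𝟙_ S) X).hom ≫ K.map (λ_ X).hom
  right_unitality (X : S) : (ρ_ (K.obj X)).hom = K.obj X ◁ ε.hom ≫ (μ X (𝟙_ S)).hom ≫ K.map (ρ_ X).hom
  braided (X Y : S) : (β_ (K.obj X) (K.obj Y)).hom ≫ (μ Y X).hom =
    degI (deg X) (deg Y) ^ k • ((μ X Y).hom ≫ K.map (β_ X Y).hom)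

variable {f : C} [SelfFermionic f]

instance : (doubleZest f).Additive where
  map_add := rfl

instance : (doubleZest f).Linear ℂ where
  map_smul _ _ := rfl

instance : (doubleZest f).Full where
  map_surjective g := ⟨g, rfl⟩

instance : (doubleZest f).Faithful where
  map_injective h := h

theorem Homog.hom_eq_zero {X Y : Homog C f} (h : X.deg ≠ Y.deg) (g : X ⟶ Y) : g = 0 :=
  X.parity.hom_eq_zero Y.parity h g

theorem contract_naturality {A A' X Y : C} (t : A ⊗ A' ⟶ 𝟙_ C) (g : X ⟶ Y) :
    (𝟙 (𝟙_ C) ⊗ₘ (𝟙 A ⊗ₘ (𝟙 A' ⊗ₘ g))) ≫ contract t Y = contract t X ≫ g := by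
  simp only [contract, id_tensorHom]
  calc
    _ = 𝟙 _ ⊗≫ ((A ⊗ A') ◁ g ≫ t ▷ Y) ⊗≫ 𝟙 _ := by monoidal
    _ = _ := by rw [whisker_exchange]; monoidal

theorem contract_naturality_smul {A A' X Y : C} (t : A ⊗ A' ⟶ 𝟙_ C) (g : X ⟶ Y) (w w' s : ℂ) (h : w * w' = s):
    (w • (𝟙 (𝟙_ C) ⊗ₘ (𝟙 A ⊗ₘ (w' • (𝟙 A' ⊗ₘ g))))) ≫ contract t Y = s • (contract t X ≫ g) := by
  subst h
  rw [tensorHom_smul, tensorHom_smul, smul_smul, Linear.smul_comp, contract_naturality]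

theorem doubleZest_natural_left {X Y : Homog C f} (g : X ⟶ Y) (Z : Homog C f) :
    (doubleZest f).map g ▷ (doubleZest f).obj Z ≫ (doubleZestμ Y Z).hom =
      (doubleZestμ X Z).hom ≫ (doubleZest f).map (g ▷ Z) := by
  by_cases h : X.deg = Y.deg
  swap
  · rw [Homog.hom_eq_zero h g]; simp
  obtain ⟨X, σ, hX⟩ := X
  obtain ⟨Y, σ', hY⟩ := Y
  obtain ⟨Z, τ, hZ⟩ := Z
  dsimp only at h
  subst h
  have := fun (A A' : C) (t : A ⊗ A' ⟶ 𝟙_ C) => contract_naturality t ((show X ⟶ Y from g) ⊗ₘ 𝟙 Z)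
  have e : ((show X ⟶ Y from g) ⊗ₘ 𝟙 Z) = ((show X ⟶ Y from g) ▷ Z) := tensorHom_id _ _
  have e' := fun (A A' : C) (t : A ⊗ A' ⟶ 𝟙_ C) => (this A A' t).trans (congrArg (_ ≫ ·) e)
  cases σ <;> cases τ <;> exact e' _ _ _

theorem doubleZest_natural_right {X Y : Homog C f} (Z : Homog C f) (g : X ⟶ Y) :
    (doubleZest f).obj Z ◁ (doubleZest f).map g ≫ (doubleZestμ Z Y).hom =
      (doubleZestμ Z X).hom ≫ (doubleZest f).map (Z ◁ g) := by
  by_cases h : X.deg = Y.deg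
  swap
  · rw [Homog.hom_eq_zero h g]; simp
  obtain ⟨X, σ, hX⟩ := X
  obtain ⟨Y, σ', hY⟩ := Y
  obtain ⟨Z, τ, hZ⟩ := Z
  dsimp only at h
  subst h
  have := fun (A A' : C) (t : A ⊗ A' ⟶ 𝟙_ C) => contract_naturality t (𝟙 Z ⊗ₘ (show X ⟶ Y from g))
  have e : (𝟙 Z ⊗ₘ (show X ⟶ Y from g)) = (Z ◁ (show X ⟶ Y from g)) := id_tensorHom _ _
  have e' := fun (A A' : C) (t : A ⊗ A' ⟶ 𝟙_ C) => (this A A' t).trans (congrArg (_ ≫ ·) e)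
  cases σ <;> cases τ <;> exact e' _ _ _

theorem doubleZest_braided (X Y : Homog C f) :
    (β_ ((doubleZest f).obj X) ((doubleZest f).obj Y)).hom ≫ (doubleZestμ Y X).hom =
      degI X.deg Y.deg • ((doubleZestμ X Y).hom ≫ (doubleZest f).map (β_ X Y).hom) := by
  obtain ⟨X, σ, hX⟩ := X
  obtain ⟨Y, τ, hY⟩ := Y
  have h : zB σ τ * zB σ τ = degI σ τ := by
    have := zB_mul_self
    cases σ <;> cases τ <;> simp [degI, this] <;> simp [zB]
  cases σ <;> cases τ <;> exact contract_naturality_smul _ (β_ X Y).hom _ _ _ h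

/-- The comparison of the unit objects. -/
def doubleZestε : 𝟙_ (Zest (zestFermion f)) ≅ (doubleZest f).obj (𝟙_ _) :=
  zestMkIso₂ (X := 𝟙_ _) (Iso.refl (𝟙_ C))

theorem doubleZest_left_unitality (X : Homog C f) : (λ_ ((doubleZest f).obj X)).hom =
    doubleZestε.hom ▷ (doubleZest f).obj X ≫ (doubleZestμ (𝟙_ _) X).hom ≫ (doubleZest f).map (λ_ X).hom := by
  obtain ⟨X, σ, hX⟩ := X
  have h : (𝟙 (𝟙_ C) ⊗ₘ (𝟙 (𝟙_ C) ⊗ₘ ((𝟙 (𝟙_ C) ⊗ₘ (λ_ X).hom) ≫ (λ_ X).hom))) ≫ ((𝟙 (𝟙_ C) ⊗ₘ (λ_ X).hom) ≫ (λ_ X).hom) =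
      (𝟙 (𝟙_ C) ⊗ₘ (𝟙 (𝟙_ C) ⊗ₘ (𝟙 (𝟙_ C) ⊗ₘ (𝟙 (𝟙_ C) ⊗ₘ 𝟙 X)))) ≫ contract (λ_ (𝟙_ C)).hom (𝟙_ C ⊗ X) ≫ (λ_ X).hom := by
    rw [contract]; monoidal
  cases σ <;> exact h

theorem doubleZest_right_unitality (X : Homog C f) : (ρ_ ((doubleZest f).obj X)).hom =
    (doubleZest f).obj X ◁ doubleZestε.hom ≫ (doubleZestμ X (𝟙_ _)).hom ≫ (doubleZest f).map (ρ_ X).hom := by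
  obtain ⟨X, σ, hX⟩ := X
  have h : (𝟙 (𝟙_ C) ⊗ₘ (𝟙 (𝟙_ C) ⊗ₘ ((𝟙 (𝟙_ C) ⊗ₘ (ρ_ X).hom) ≫ (λ_ X).hom))) ≫ ((𝟙 (𝟙_ C) ⊗ₘ (λ_ X).hom) ≫ (λ_ X).hom) =
      (𝟙 (𝟙_ C) ⊗ₘ (𝟙 (𝟙_ C) ⊗ₘ (𝟙 (𝟙_ C) ⊗ₘ (𝟙 X ⊗ₘ 𝟙 (𝟙_ C))))) ≫ contract (λ_ (𝟙_ C)).hom (X ⊗ 𝟙_ C) ≫ (ρ_ X).hom := by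
    rw [contract]; monoidal
  cases σ <;> exact h

/-- The second power of the zesting. -/
def doubleZestTwisted (f : C) [SelfFermionic f] : TwistedBraided (S := Homog C f) Homog.deg 1 (doubleZest f) where
  ε := doubleZestε
  μ := doubleZestμ
  natural_left := doubleZest_natural_left
  natural_right := doubleZest_natural_right
  associativity X Y Z := by rw [pow_one]; exact doubleZest_associativity X Y Z
  left_unitality := doubleZest_left_unitality
  right_unitality := doubleZest_right_unitality
  braided X Y := by rw [pow_one]; exact doubleZest_braided X Y

end

end

/-! ### Composition of twisted functors, and their compatibility with the inclusions of the
super-modular category. -/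

section

open BraidedCategory
open Functor.LaxMonoidal Functor.Monoidal

section

variable {S : Type u₁} [Category.{v₁} S] [MonoidalCategory S] [BraidedCategory S]
  {C : Type u} [Category.{v} C] [Preadditive C] [Linear ℂ C] [MonoidalCategory C]
  [MonoidalPreadditive C] [MonoidalLinear ℂ C] [BraidedCategory C]
  {D : Type u₂} [Category.{v₂} D] [Preadditive D] [Linear ℂ D] [MonoidalCategory D]
  [MonoidalPreadditive D] [MonoidalLinear ℂ D] [BraidedCategory D]

namespace TwistedBraided

/-- A braided functor is twisted by trivial scalars. -/
@[simps]
def ofBraided (deg : S → Bool) (K : S ⥤ C) [K.Braided] : TwistedBraided deg 0 K where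
  ε := εIso K
  μ := μIso K
  natural_left g Z := by simp
  natural_right Z g := by simp
  associativity X Y Z := by
    have := Functor.LaxMonoidal.associativity K X Y Z
    simp only [pow_zero, one_smul, μIso_hom]
    exact this.symm
  left_unitality X := Functor.LaxMonoidal.left_unitality K X
  right_unitality X := Functor.LaxMonoidal.right_unitality K X
  braided X Y := by
    rw [pow_zero, one_smul]
    exact (Functor.LaxBraided.braided (F := K) X Y).symm

/-- The composition of twisted functors. -/
@[simps]
def comp {deg : S → Bool} {deg' : C → Bool} {j k : ℕ} {K : S ⥤ C} {L : C ⥤ D} [L.Linear ℂ]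
    (T : TwistedBraided deg j K) (T' : TwistedBraided deg' k L) (h : ∀ X, deg' (K.obj X) = deg X) :
    TwistedBraided deg (j + k) (K ⋙ L) where
  ε := T'.ε ≪≫ L.mapIso T.ε
  μ X Y := T'.μ _ _ ≪≫ L.mapIso (T.μ X Y)
  natural_left g Z := by
    have h1 := T'.natural_left (K.map g) (K.obj Z)
    have h2 := congrArg (fun t => L.map t) (T.natural_left g Z)
    simp only [L.map_comp] at h2
    simp only [Functor.comp_obj, Functor.comp_map, Iso.trans_hom, Functor.mapIso_hom, assoc, reassoc_of% h1, h2]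
  natural_right Z g := by
    have h1 := T'.natural_right (K.obj Z) (K.map g)
    have h2 := congrArg (fun t => L.map t) (T.natural_right Z g)
    simp only [L.map_comp] at h2
    simp only [Functor.comp_obj, Functor.comp_map, Iso.trans_hom, Functor.mapIso_hom, assoc, reassoc_of% h1, h2]
  associativity X Y Z := by
    have h1 := T'.associativity (K.obj X) (K.obj Y) (K.obj Z)
    have h2 := T.associativity X Y Z
    have h3 := T'.natural_right (K.obj X) (T.μ Y Z).hom
    have h4 := T'.natural_left (T.μ X Y).hom (K.obj Z)
    have h5 := congrArg (fun t => L.map t) h2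
    simp only [L.map_comp, L.map_smul, h] at h1 h5
    simp only [Functor.comp_obj, Iso.trans_hom, Functor.mapIso_hom, MonoidalCategory.whiskerLeft_comp, assoc,
      comp_whiskerRight, Functor.comp_map, reassoc_of% h3, reassoc_of% h4]
    have h6 := congrArg (· ≫ L.map (K.obj X ◁ (T.μ Y Z).hom) ≫ L.map (T.μ X (Y ⊗ Z)).hom) h1
    simp only [assoc] at h6
    -- The scalars of both functors are evaluated at the same degrees, so the exponents add.
    rw [h6, pow_add, mul_comm, mul_smul]
    simp only [Linear.smul_comp, Linear.comp_smul, assoc, h5]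
  left_unitality X := by
    have h1 := T'.left_unitality (K.obj X)
    have h2 := T'.natural_left T.ε.hom (K.obj X)
    simp only [Functor.comp_obj, Iso.trans_hom, Functor.mapIso_hom, comp_whiskerRight, assoc, Functor.comp_map,
      reassoc_of% h2, h1, ← L.map_comp, ← T.left_unitality]
  right_unitality X := by
    have h1 := T'.right_unitality (K.obj X)
    have h2 := T'.natural_right (K.obj X) T.ε.hom
    simp only [Functor.comp_obj, Iso.trans_hom, Functor.mapIso_hom, MonoidalCategory.whiskerLeft_comp, assoc,
      Functor.comp_map, reassoc_of% h2, h1, ← L.map_comp, ← T.right_unitality]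
  braided X Y := by
    have h1 := T'.braided (K.obj X) (K.obj Y)
    have h2 := T.braided X Y
    have h5 := congrArg (fun t => L.map t) h2
    simp only [L.map_comp, L.map_smul, h] at h1 h5
    simp only [Functor.comp_obj, Iso.trans_hom, Functor.mapIso_hom, assoc, Functor.comp_map, reassoc_of% h1]
    rw [pow_add, mul_comm, mul_smul]
    simp only [Linear.smul_comp, Linear.comp_smul, assoc, h5]

/-- A twisted functor with trivial scalars is monoidal. -/
@[reducible]
def monoidal {deg : S → Bool} {k : ℕ} {K : S ⥤ C} (T : TwistedBraided deg k K)
    (h : ∀ X Y Z, degSign (deg X) (deg Y) (deg Z) ^ k = 1) : K.Monoidal :=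
  Functor.CoreMonoidal.toMonoidal
    { εIso := T.ε
      μIso := T.μ
      μIso_hom_natural_left := T.natural_left
      μIso_hom_natural_right := T.natural_right
      associativity X Y Z := by
        have := T.associativity X Y Z
        rw [h, one_smul] at this
        exact this.symm
      left_unitality := T.left_unitality
      right_unitality := T.right_unitality }

/-- A twisted functor with trivial scalars is braided. -/
@[reducible]
def toBraided {deg : S → Bool} {k : ℕ} {K : S ⥤ C} (T : TwistedBraided deg k K)
    (h : ∀ X Y Z, degSign (deg X) (deg Y) (deg Z) ^ k = 1) (h' : ∀ X Y, degI (deg X) (deg Y) ^ k = 1) : K.Braided :=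
  letI := T.monoidal h
  { braided X Y := by
      have := T.braided X Y
      rw [h', one_smul] at this
      exact this.symm }

variable {B : Type u₃} [Category.{v₃} B] [MonoidalCategory B]

/-- The compatibility of a natural isomorphism with the structure of a twisted functor. -/
structure Compat {deg : S → Bool} {k : ℕ} {K : S ⥤ C} (T : TwistedBraided deg k K) {I : B ⥤ S} [I.Monoidal]
    {I' : B ⥤ C} [I'.Monoidal] (κ : I ⋙ K ≅ I') : Prop where
  unit : T.ε.hom ≫ K.map (Functor.LaxMonoidal.ε I) ≫ κ.hom.app (𝟙_ B) = Functor.LaxMonoidal.ε I'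
  tensor (b b' : B) : (T.μ (I.obj b) (I.obj b')).hom ≫ K.map (Functor.LaxMonoidal.μ I b b') ≫ κ.hom.app (b ⊗ b') =
    (κ.hom.app b ⊗ₘ κ.hom.app b') ≫ Functor.LaxMonoidal.μ I' b b'

theorem Compat.ofBraided (deg : S → Bool) (K : S ⥤ C) [K.Braided] {I : B ⥤ S} [I.Monoidal]
    {I' : B ⥤ C} [I'.Monoidal] (κ : I ⋙ K ≅ I') [h : NatTrans.IsMonoidal κ.hom] :
    (ofBraided deg K).Compat κ where
  unit := by
    have := h.unit
    rw [Functor.LaxMonoidal.comp_ε] at this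
    simpa using this
  tensor b b' := by
    have := h.tensor b b'
    rw [Functor.LaxMonoidal.comp_μ] at this
    simpa using this

theorem Compat.comp {deg : S → Bool} {deg' : C → Bool} {j k : ℕ} {K : S ⥤ C} {L : C ⥤ D} [L.Linear ℂ]
    {T : TwistedBraided deg j K} {T' : TwistedBraided deg' k L} (h : ∀ X, deg' (K.obj X) = deg X)
    {I : B ⥤ S} [I.Monoidal] {I' : B ⥤ C} [I'.Monoidal] {I'' : B ⥤ D} [I''.Monoidal] {κ : I ⋙ K ≅ I'}
    {κ' : I' ⋙ L ≅ I''} (hκ : T.Compat κ) (hκ' : T'.Compat κ') :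
    (T.comp T' h).Compat ((Functor.associator I K L).symm ≪≫ Functor.isoWhiskerRight κ L ≪≫ κ') where
  unit := by
    have h1 := hκ.unit
    have h2 := hκ'.unit
    rw [← h1] at h2
    simpa using h2
  tensor b b' := by
    have h1 := hκ.tensor b b'
    have h2 := hκ'.tensor b b'
    have h3 := congrArg (fun t => L.map t) h1
    simp only [L.map_comp] at h3
    have h4 : (L.map (κ.hom.app b) ⊗ₘ L.map (κ.hom.app b')) ≫ (T'.μ _ _).hom =
      (T'.μ _ _).hom ≫ L.map (κ.hom.app b ⊗ₘ κ.hom.app b') := by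
      rw [MonoidalCategory.tensorHom_def, MonoidalCategory.tensorHom_def, assoc, T'.natural_right,
        L.map_comp, ← assoc, ← assoc]
      congr 1
      exact T'.natural_left _ _
    have h5 : ((L.map (κ.hom.app b) ≫ κ'.hom.app b) ⊗ₘ (L.map (κ.hom.app b') ≫ κ'.hom.app b')) =
      (L.map (κ.hom.app b) ⊗ₘ L.map (κ.hom.app b')) ≫ (κ'.hom.app b ⊗ₘ κ'.hom.app b') :=
      (tensorHom_comp_tensorHom _ _ _ _).symm
    simp only [Iso.trans_hom, Functor.mapIso_hom, assoc, Functor.comp_map, NatTrans.comp_app,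
      Iso.symm_hom, Functor.associator_inv_app, Functor.isoWhiskerRight_hom, Functor.whiskerRight_app, id_comp,
      Functor.comp_obj]
    rw [h5, assoc, ← h2, reassoc_of% h4]
    simp only [comp_μ, Iso.trans_hom, Functor.mapIso_hom, assoc]
    rw [← reassoc_of% h3]

theorem Compat.isMonoidal {deg : S → Bool} {k : ℕ} {K : S ⥤ C} (T : TwistedBraided deg k K)
    (h : ∀ X Y Z, degSign (deg X) (deg Y) (deg Z) ^ k = 1) {I : B ⥤ S} [I.Monoidal]
    {I' : B ⥤ C} [I'.Monoidal] {κ : I ⋙ K ≅ I'} (hκ : T.Compat κ) :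
    letI := T.monoidal h
    NatTrans.IsMonoidal κ.hom :=
  letI := T.monoidal h
  { unit := by
      rw [Functor.LaxMonoidal.comp_ε, assoc]
      exact hκ.unit
    tensor b b' := by
      rw [Functor.LaxMonoidal.comp_μ, assoc]
      exact hκ.tensor b b' }

end TwistedBraided

end

section

variable {S : Type u₁} [Category.{v₁} S] {C : Type u} [Category.{v} C] [Preadditive C] {f : C}
  [Linear ℂ C] [MonoidalCategory C] [MonoidalPreadditive C] [MonoidalLinear ℂ C] [BraidedCategory C]

/-- Lift a functor to homogeneous objects. -/
@[simps]
def homogLift (F : S ⥤ C) (deg : S → Bool) (h : ∀ X, HasParity f (deg X) (F.obj X)) : S ⥤ Homog C f where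
  obj X := ⟨F.obj X, deg X, h X⟩
  map g := F.map g
  map_id X := F.map_id X
  map_comp g g' := F.map_comp g g'

variable (F : S ⥤ C) (deg : S → Bool) (h : ∀ X, HasParity f (deg X) (F.obj X))

instance [F.Full] : (homogLift F deg h).Full where
  map_surjective g := F.map_surjective g

instance [F.Faithful] : (homogLift F deg h).Faithful where
  map_injective e := F.map_injective e

instance [Preadditive S] [F.Additive] : (homogLift F deg h).Additive where
  map_add := F.map_add

instance [Preadditive S] [Linear ℂ S] [F.Linear ℂ] : (homogLift F deg h).Linear ℂ where
  map_smul g r := F.map_smul r g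

variable [MonoidalCategory S] [BraidedCategory S] 

/-- Lift a twisted functor to homogeneous objects. -/
def TwistedBraided.lift {F : S ⥤ C} {deg : S → Bool} {deg' : S → Bool} {k : ℕ} (T : TwistedBraided deg k F)
    (h : ∀ X, HasParity f (deg' X) (F.obj X)) : TwistedBraided deg k (homogLift F deg' h) where
  ε := Homog.mkIso f (X := 𝟙_ (Homog C f)) (Y := (homogLift F deg' h).obj (𝟙_ S)) T.ε
  μ X Y := Homog.mkIso f (X := (homogLift F deg' h).obj X ⊗ (homogLift F deg' h).obj Y)
    (Y := (homogLift F deg' h).obj (X ⊗ Y)) (T.μ X Y)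
  natural_left := T.natural_left
  natural_right := T.natural_right
  associativity := T.associativity
  left_unitality := T.left_unitality
  right_unitality := T.right_unitality
  braided := T.braided

end

section

variable {B : Type u₁} [Category.{v₁} B] [MonoidalCategory B] {C : Type u} [Category.{v} C] [Preadditive C]
  [Linear ℂ C] [MonoidalCategory C] [MonoidalPreadditive C] [MonoidalLinear ℂ C] [BraidedCategory C] {f : C}

/-- Lift a functor with values in even objects to homogeneous objects. -/
abbrev homogEven (F : B ⥤ C) (h : ∀ b, HasParity f false (F.obj b)) : B ⥤ Homog C f :=
  homogLift F (fun _ => false) h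

instance (F : B ⥤ C) [F.Monoidal] (h : ∀ b, HasParity f false (F.obj b)) : (homogEven F h).Monoidal :=
  Functor.CoreMonoidal.toMonoidal
    { εIso := Homog.mkIso f (X := 𝟙_ (Homog C f)) (Y := (homogEven F h).obj (𝟙_ B)) (εIso F)
      μIso X Y := Homog.mkIso f (X := (homogEven F h).obj X ⊗ (homogEven F h).obj Y)
        (Y := (homogEven F h).obj (X ⊗ Y)) (μIso F X Y)
      μIso_hom_natural_left g Z := Functor.LaxMonoidal.μ_natural_left F g Z
      μIso_hom_natural_right Z g := Functor.LaxMonoidal.μ_natural_right F Z g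
      associativity X Y Z := Functor.LaxMonoidal.associativity F X Y Z
      left_unitality X := Functor.LaxMonoidal.left_unitality F X
      right_unitality X := Functor.LaxMonoidal.right_unitality F X }

instance [BraidedCategory B] (F : B ⥤ C) [F.Braided] (h : ∀ b, HasParity f false (F.obj b)) : (homogEven F h).Braided where
  braided X Y := Functor.LaxBraided.braided (F := F) X Y

/-- Forgetting the degree of a lift. -/
def homogEvenForget (F : B ⥤ C) (h : ∀ b, HasParity f false (F.obj b)) : homogEven F h ⋙ Homog.forget C f ≅ F :=
  NatIso.ofComponents (fun b => Iso.refl (F.obj b)) fun g => by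
    change F.map g ≫ 𝟙 _ = 𝟙 _ ≫ F.map g
    simp

instance (F : B ⥤ C) [F.Monoidal] (h : ∀ b, HasParity f false (F.obj b)) :
    NatTrans.IsMonoidal (homogEvenForget F h).hom where
  unit := by
    change (𝟙 _ ≫ Functor.LaxMonoidal.ε F) ≫ 𝟙 _ = Functor.LaxMonoidal.ε F
    simp
  tensor b b' := by
    change (𝟙 _ ≫ Functor.LaxMonoidal.μ F b b') ≫ 𝟙 _ = (𝟙 (F.obj b) ⊗ₘ 𝟙 (F.obj b')) ≫ Functor.LaxMonoidal.μ F b b'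
    simp

variable {S : Type u₂} [Category.{v₂} S] [MonoidalCategory S] [BraidedCategory S]

/-- Lift a natural isomorphism to homogeneous objects. -/
def homogLiftIso {I : B ⥤ S} {K : S ⥤ C} {I' : B ⥤ C} (κ : I ⋙ K ≅ I') {deg : S → Bool}
    (h : ∀ X, HasParity f (deg X) (K.obj X)) (h' : ∀ b, HasParity f false (I'.obj b)) :
    I ⋙ homogLift K deg h ≅ homogEven I' h' :=
  NatIso.ofComponents (fun b => Homog.mkIso f (X := (homogLift K deg h).obj (I.obj b)) (Y := (homogEven I' h').obj b)
    (κ.app b)) fun g => κ.hom.naturality g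

theorem TwistedBraided.Compat.lift {I : B ⥤ S} [I.Monoidal] {K : S ⥤ C} {I' : B ⥤ C} [I'.Monoidal] {κ : I ⋙ K ≅ I'}
    {deg deg' : S → Bool} {k : ℕ} {T : TwistedBraided deg k K} (hκ : T.Compat κ)
    (h : ∀ X, HasParity f (deg' X) (K.obj X)) (h' : ∀ b, HasParity f false (I'.obj b)) :
    (T.lift h).Compat (homogLiftIso κ h h') where
  unit := hκ.unit
  tensor := hκ.tensor

variable [SelfFermionic f]

theorem hasParity_evenLift (F : B ⥤ C) (h : ∀ b, HasParity f false (F.obj b)) (b : B) :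
    HasParity (zestFermion f) false ((evenLift F h).obj b) :=
  hasParity_zest (h b) (h b)

/-- Even objects in the second power of the zesting. -/
def homogEvenDoubleZest (F : B ⥤ C) (h : ∀ b, HasParity f false (F.obj b)) :
    homogEven F h ⋙ doubleZest f ≅ evenLift (evenLift F h) (hasParity_evenLift F h) :=
  Iso.refl _

theorem homogEvenDoubleZest_compat (F : B ⥤ C) [F.Monoidal] (h : ∀ b, HasParity f false (F.obj b)) :
    (doubleZestTwisted f).Compat (homogEvenDoubleZest F h) where
  unit := by
    have e : 𝟙 (𝟙_ C) ≫ Functor.LaxMonoidal.ε F ≫ 𝟙 _ = Functor.LaxMonoidal.ε F := by simp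
    exact e
  tensor b b' := by
    have e : contract (λ_ (𝟙_ C)).hom (F.obj b ⊗ F.obj b') ≫ Functor.LaxMonoidal.μ F b b' ≫ 𝟙 _ =
        (𝟙 (𝟙_ C) ⊗ₘ (𝟙 (𝟙_ C) ⊗ₘ (𝟙 (𝟙_ C) ⊗ₘ (𝟙 (F.obj b) ⊗ₘ 𝟙 (F.obj b'))))) ≫
          ((𝟙 (𝟙_ C) ⊗ₘ (λ_ (𝟙_ C ⊗ (F.obj b ⊗ F.obj b'))).hom) ≫ (λ_ _).hom) ≫ (λ_ _).hom ≫
            Functor.LaxMonoidal.μ F b b' := by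
      simp only [contract]
      rw [comp_id]
      monoidal
    exact e

end

end

/-! ### The eighth power of the zesting is trivial. -/

section

open BraidedCategory
open URFC

theorem URFC.exists_zestedSingle {C : URFC.{u, v}} {f : C} [SelfFermionic f] [FermionicTwist f] (hf : IsFermion f)
    (M : (zested C f hf).Obj) (hM : Simple M) : ∃ X : Zest f, Simple X.obj ∧ Nonempty ((zestedSingle hf).obj X ≅ M) :=
  hf.exists_single M (simple_obj (zestedEquiv hf).functor M)

namespace ModularClosure

variable {B : URFC.{u₁, v₁}} {f : B} (hf : B.IsSuperModular f)

/-- `E` is the `2 * k`-th power of the zesting of `C`, on homogeneous objects. -/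
def TwistedEquivalent (k : ℕ) (C E : ModularClosure.{u₁, v₁, u₂, v₂} B) : Prop :=
  ∃ (K : Homog C.cat.Obj (C.ι.obj f) ⥤ Homog E.cat.Obj (E.ι.obj f)) (T : TwistedBraided Homog.deg k K)
    (κ : homogEven C.ι (C.hasParity_ι hf) ⋙ K ≅ homogEven E.ι (E.hasParity_ι hf)),
    T.Compat κ ∧ K.Full ∧ K.Faithful ∧ K.Additive ∧ K.Linear ℂ ∧ (∀ X, (K.obj X).deg = X.deg) ∧
    ∀ Y : Homog E.cat.Obj (E.ι.obj f), Simple Y.obj → ∃ X, Simple X.obj ∧ Nonempty (K.obj X ≅ Y)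

variable {hf} {C D E : ModularClosure.{u₁, v₁, u₂, v₂} B}

theorem TwistedEquivalent.trans {j k : ℕ} (h : TwistedEquivalent hf j C D) (h' : TwistedEquivalent hf k D E) :
    TwistedEquivalent hf (j + k) C E := by
  obtain ⟨K, T, κ, hκ, h1, h2, h3, h4, h5, h6⟩ := h
  obtain ⟨L, T', κ', hκ', h1', h2', h3', h4', h5', h6'⟩ := h'
  refine ⟨K ⋙ L, T.comp T' h5, _, hκ.comp h5 hκ', inferInstance, inferInstance, inferInstance, inferInstance,
    fun X => (h5' _).trans (h5 X), fun Y hY => ?_⟩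
  obtain ⟨X, hX, ⟨e⟩⟩ := h6' Y hY
  obtain ⟨W, hW, ⟨e'⟩⟩ := h6 X hX
  exact ⟨W, hW, ⟨L.mapIso e' ≪≫ e⟩⟩

theorem degSign_pow_four (σ τ ρ : Bool) : degSign σ τ ρ ^ 4 = 1 := by
  unfold degSign; split_ifs <;> norm_num

theorem degI_pow_four (σ τ : Bool) : degI σ τ ^ 4 = 1 := by
  unfold degI; split_ifs <;> simp

/-- The eighth power of the zesting is trivial. -/
theorem TwistedEquivalent.equivalent (h : TwistedEquivalent hf 4 C E) : C.Equivalent E := by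
  have := C.selfFermionic hf
  have := E.selfFermionic hf
  have := Abelian.hasFiniteBiproducts (C := C.cat.Obj)
  have := Abelian.hasFiniteBiproducts (C := E.cat.Obj)
  obtain ⟨K, T, κ, hκ, h1, h2, h3, h4, h5, h6⟩ := h
  -- Since (-1)⁴ = i⁴ = 1, no scalars remain and the functor is genuinely braided.
  let b : K.Braided := T.toBraided (fun _ _ _ => degSign_pow_four _ _ _) (fun _ _ => degI_pow_four _ _)
  have hκ' : NatTrans.IsMonoidal κ.hom := hκ.isMonoidal T (fun _ _ _ => degSign_pow_four _ _ _)
  let I := homogEven C.ι (C.hasParity_ι hf)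
  let J : Homog C.cat.Obj (C.ι.obj f) ⥤ C.cat.Obj := Homog.forget C.cat.Obj (C.ι.obj f)
  let L : Homog C.cat.Obj (C.ι.obj f) ⥤ E.cat.Obj := K ⋙ Homog.forget E.cat.Obj (E.ι.obj f)
  have hJ : (Fam.extend J).IsEquivalence := Fam.extend_isEquivalence (C.isFermion hf).homogForget_isDense
  have hL : (Fam.extend L).IsEquivalence := by
    refine Fam.extend_isEquivalence (isDense_of_homogeneous (E.isFermion hf) _ fun σ X hX hσ => ?_)
    obtain ⟨W, hW, ⟨e⟩⟩ := h6 ⟨X, σ, hσ⟩ hX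
    exact ⟨W, ⟨(Homog.forget E.cat.Obj (E.ι.obj f)).mapIso e⟩⟩
  -- Sums of homogeneous objects form a category equivalent to both `C` and `E`. The equivalence
  -- sought goes back along the first and forward along the second; the isomorphisms below follow
  -- the inclusion of `B` along the way.
  let e := (Fam.extend J).asEquivalence
  let b1 : e.functor.Braided := (inferInstance : (Fam.extend J).Braided)
  have a1 : e.functor.Additive := (inferInstance : (Fam.extend J).Additive)
  have l1 : e.functor.Linear ℂ := (inferInstance : (Fam.extend J).Linear ℂ)
  obtain ⟨b2, hm⟩ := exists_braided_inverse e
  let κ₀ : C.ι ≅ (I ⋙ Fam.single _) ⋙ Fam.extend J :=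
    (homogEvenForget C.ι (C.hasParity_ι hf)).symm ≪≫ Functor.isoWhiskerLeft I (Fam.singleExtend J).symm ≪≫
      (Functor.associator _ _ _).symm
  have h0 : NatTrans.IsMonoidal κ₀.hom := by
    simp only [κ₀, J, Iso.trans_hom, Iso.symm_hom, Functor.isoWhiskerLeft_hom]
    infer_instance
  let κ₁ : C.ι ≅ (I ⋙ Fam.single _) ⋙ e.functor := κ₀
  have h7 : NatTrans.IsMonoidal κ₁.hom := h0
  let κ₂ : (I ⋙ Fam.single _) ⋙ Fam.extend L ≅ E.ι :=
    Functor.associator _ _ _ ≪≫ Functor.isoWhiskerLeft I (Fam.singleExtend L) ≪≫ (Functor.associator _ _ _).symm ≪≫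
      Functor.isoWhiskerRight κ _ ≪≫ homogEvenForget E.ι (E.hasParity_ι hf)
  have h8 : NatTrans.IsMonoidal κ₂.hom := by
    simp only [κ₂, L, Iso.trans_hom, Iso.symm_hom, Functor.isoWhiskerLeft_hom, Functor.isoWhiskerRight_hom]
    infer_instance
  let κ₃ : C.ι ⋙ e.inverse ≅ I ⋙ Fam.single _ :=
    Functor.isoWhiskerRight κ₁ e.inverse ≪≫ Functor.associator _ _ _ ≪≫
      Functor.isoWhiskerLeft (I ⋙ Fam.single _) e.unitIso.symm ≪≫ Functor.rightUnitor _
  have h9 : NatTrans.IsMonoidal κ₃.hom := by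
    simp only [κ₃, Iso.trans_hom, Iso.symm_hom, Functor.isoWhiskerLeft_hom, Functor.isoWhiskerRight_hom]
    infer_instance
  let κ₄ : C.ι ⋙ (e.inverse ⋙ Fam.extend L) ≅ E.ι :=
    (Functor.associator _ _ _).symm ≪≫ Functor.isoWhiskerRight κ₃ (Fam.extend L) ≪≫ κ₂
  have h10 : NatTrans.IsMonoidal κ₄.hom := by
    simp only [κ₄, Iso.trans_hom, Iso.symm_hom, Functor.isoWhiskerRight_hom]
    infer_instance
  exact ⟨e.inverse ⋙ Fam.extend L, inferInstance, κ₄, inferInstance, inferInstance, inferInstance, h10⟩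

variable (hf C)

/-- The second zesting starts from sums of objects of the first. One-element families identify its
homogeneous objects with those of the purely homogeneous iteration `Zest (zestFermion f₀)`, to which
`doubleZestTwisted` applies. -/
theorem twistedEquivalent_zest_zest : TwistedEquivalent hf 1 C ((C.zest hf).zest hf) := by
  have := C.selfFermionic hf
  have := C.fermionicTwist hf
  have := (C.zest hf).selfFermionic hf
  have := (C.zest hf).fermionicTwist hf
  let f₀ := C.ι.obj f
  let hC := C.isFermion hf
  let h0 := C.hasParity_ι hf
  let F₁ : Zest f₀ ⥤ (C.zest hf).cat.Obj := zestedSingle hC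
  let b₁ : F₁.Braided := (inferInstance : (zestedSingle hC).Braided)
  have : F₁.Additive := (inferInstance : (zestedSingle hC).Additive)
  have : F₁.Linear ℂ := (inferInstance : (zestedSingle hC).Linear ℂ)
  have : F₁.Full := (inferInstance : (zestedSingle hC).Full)
  have : F₁.Faithful := (inferInstance : (zestedSingle hC).Faithful)
  let e : F₁.obj (zestFermion f₀) ≅ (C.zest hf).ι.obj f := Iso.refl _
  let F₂ : Zest ((C.zest hf).ι.obj f) ⥤ ((C.zest hf).zest hf).cat.Obj := zestedSingle ((C.zest hf).isFermion hf)
  let b₂ : F₂.Braided := (inferInstance : (zestedSingle ((C.zest hf).isFermion hf)).Braided)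
  have : F₂.Additive := (inferInstance : (zestedSingle ((C.zest hf).isFermion hf)).Additive)
  have : F₂.Linear ℂ := (inferInstance : (zestedSingle ((C.zest hf).isFermion hf)).Linear ℂ)
  have : F₂.Full := (inferInstance : (zestedSingle ((C.zest hf).isFermion hf)).Full)
  have : F₂.Faithful := (inferInstance : (zestedSingle ((C.zest hf).isFermion hf)).Faithful)
  let G : Zest (zestFermion f₀) ⥤ ((C.zest hf).zest hf).cat.Obj := Zest.map F₁ e ⋙ F₂
  let I : B.Obj ⥤ (C.zest hf).cat.Obj := evenLift C.ι h0 ⋙ F₁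
  let κ₁ : evenLift C.ι h0 ⋙ F₁ ≅ (C.zest hf).ι := Iso.refl _
  have hκ₁ : NatTrans.IsMonoidal κ₁.hom := isMonoidal_refl_hom (evenLift C.ι h0 ⋙ F₁)
  let κ₂ : evenLift (C.zest hf).ι ((C.zest hf).hasParity_ι hf) ⋙ F₂ ≅ ((C.zest hf).zest hf).ι := Iso.refl _
  have hκ₂ : NatTrans.IsMonoidal κ₂.hom :=
    isMonoidal_refl_hom (evenLift (C.zest hf).ι ((C.zest hf).hasParity_ι hf) ⋙ F₂)
  let κ' : evenLift (evenLift C.ι h0) (hasParity_evenLift C.ι h0) ⋙ G ≅ ((C.zest hf).zest hf).ι :=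
    (Functor.associator _ _ _).symm ≪≫ Functor.isoWhiskerRight (evenLiftMapIso F₁ e (evenLift C.ι h0)
      (C.zest hf).ι κ₁ (hasParity_evenLift C.ι h0) ((C.zest hf).hasParity_ι hf)) F₂ ≪≫ κ₂
  have hκ' : NatTrans.IsMonoidal κ'.hom := by
    simp only [κ', G, Iso.trans_hom, Iso.symm_hom, Functor.isoWhiskerRight_hom]
    infer_instance
  have hp : ∀ X : Homog C.cat.Obj f₀, HasParity (((C.zest hf).zest hf).ι.obj f) X.deg
      ((doubleZest f₀ ⋙ G).obj X) := fun X =>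
    HasParity.map G (Iso.refl (G.obj (zestFermion (zestFermion f₀))))
      (hasParity_zest (hasParity_zest X.parity X.parity) (hasParity_zest X.parity X.parity))
  let T₁ := TwistedBraided.ofBraided (fun X : Zest (zestFermion f₀) => X.deg) G
  have hc := (homogEvenDoubleZest_compat C.ι h0).comp (fun _ => rfl)
    (TwistedBraided.Compat.ofBraided (fun X : Zest (zestFermion f₀) => X.deg) G κ')
  have hl := hc.lift hp (((C.zest hf).zest hf).hasParity_ι hf)
  refine ⟨_, _, _, hl, inferInstance, inferInstance, inferInstance, inferInstance, fun _ => rfl, fun Y hY => ?_⟩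
  -- A simple object is homogeneous, hence isomorphic to a one-element family, at both levels of the
  -- iteration.
  obtain ⟨X₁, hX₁, ⟨e₁⟩⟩ := exists_zestedSingle ((C.zest hf).isFermion hf) Y.obj hY
  obtain ⟨X₂, hX₂, ⟨e₂⟩⟩ := exists_zestedSingle hC X₁.obj hX₁
  exact ⟨⟨X₂.obj, X₂.deg, X₂.parity⟩, hX₂, ⟨Homog.mkIso _ (F₂.mapIso (Zest.mkIso e₂) ≪≫ e₁)⟩⟩

end ModularClosure

end

/-! ### The free action of ℤ/8. -/

section

open BraidedCategory
open URFC

namespace ModularClosure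

variable {B : URFC.{u₁, v₁}} {f : B} (hf : B.IsSuperModular f)

theorem zestClass_iterate_toClass (n : ℕ) (C : ModularClosure.{u₁, v₁, u₂, v₂} B) :
    (zestClass hf)^[n] C.toClass = ((fun D : ModularClosure.{u₁, v₁, u₂, v₂} B => D.zest hf)^[n] C).toClass := by
  induction n generalizing C with
  | zero => rfl
  | succ n ih => exact ih (C.zest hf)

theorem centralCharge_zest_iterate (n : ℕ) (C : ModularClosure.{u₁, v₁, u₂, v₂} B) :
    ((fun D : ModularClosure.{u₁, v₁, u₂, v₂} B => D.zest hf)^[n] C).cat.centralCharge =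
      Complex.exp (Real.pi * Complex.I / 4) ^ n * C.cat.centralCharge := by
  induction n with
  | zero => simp
  | succ n ih =>
    obtain ⟨Z⟩ := nonempty_zesting_zest hf ((fun D : ModularClosure.{u₁, v₁, u₂, v₂} B => D.zest hf)^[n] C)
    rw [Function.iterate_succ_apply', centralCharge_zesting hf Z, ih, pow_succ']
    ring

theorem zestClass_iterate_eight (c : Classes.{u₁, v₁, u₂, v₂} B) : (zestClass hf)^[8] c = c := by
  induction c using Quotient.ind with
  | _ C =>
    -- Four squares of the zesting, with exponents 1 + 1 + 1 + 1 = 4.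
    have h := (((twistedEquivalent_zest_zest hf C).trans (twistedEquivalent_zest_zest hf _)).trans
      (twistedEquivalent_zest_zest hf _)).trans (twistedEquivalent_zest_zest hf _)
    exact (zestClass_iterate_toClass hf 8 C).trans (Quotient.sound h.equivalent.symm)

/-- The n-th iterate multiplies the nonzero number ξ by ζ^n, and ζ is a primitive eighth root of
unity. -/
theorem dvd_of_zestClass_iterate_eq {n : ℕ} {c : Classes.{u₁, v₁, u₂, v₂} B} (h : (zestClass hf)^[n] c = c) :
    8 ∣ n := by
  induction c using Quotient.ind with
  | _ C =>
    have h1 : Equivalent _ _ := Quotient.exact ((zestClass_iterate_toClass hf n C).symm.trans h)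
    have h2 := h1.centralCharge_eq
    rw [centralCharge_zest_iterate] at h2
    exact (exp_pow_eq_one_iff n).1 (mul_right_cancel₀ C.modular.centralCharge_ne_zero (h2.symm.trans (one_mul _).symm))

/-- The action of `ℤ/8` on the equivalence classes of modular closures by zesting. -/
@[reducible]
def zestAction : AddAction (ZMod 8) (Classes.{u₁, v₁, u₂, v₂} B) where
  vadd k c := (zestClass hf)^[k.val] c
  zero_vadd _ := rfl
  add_vadd k l c := by
    change (zestClass hf)^[(k + l).val] c = (zestClass hf)^[k.val] ((zestClass hf)^[l.val] c)
    rw [ZMod.val_add, ← Function.iterate_add_apply]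
    exact Function.IsPeriodicPt.iterate_mod_apply (zestClass_iterate_eight hf c) _

theorem zestAction_free (k : ZMod 8) (c : Classes.{u₁, v₁, u₂, v₂} B)
    (h : (zestAction hf).toVAdd.vadd k c = c) : k = 0 := by
  have h1 := dvd_of_zestClass_iterate_eq hf (n := k.val) h
  rw [← ZMod.natCast_zmod_val k]
  exact (ZMod.natCast_eq_zero_iff _ _).2 h1

end ModularClosure

end

end FermionicZesting

theorem mainTheorem3 (B : FermionicZesting.URFC.{u₁, v₁}) (f : B.Obj) (hf : B.IsSuperModular f) :
    -- zesting a modular closure gives a modular closure, inequivalent to the given one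
    (∀ C : FermionicZesting.ModularClosure.{u₁, v₁, u₂, v₂} B,
      ∃ D : FermionicZesting.ModularClosure.{u₁, v₁, u₂, v₂} B,
        Nonempty (FermionicZesting.Zesting f C D)) ∧
    (∀ C D : FermionicZesting.ModularClosure.{u₁, v₁, u₂, v₂} B,
      Nonempty (FermionicZesting.Zesting f C D) → ¬ C.Equivalent D) ∧
    -- the `S`-matrix, the twists and the central charge of the zesting
    (∀ (C D : FermionicZesting.ModularClosure.{u₁, v₁, u₂, v₂} B)
        (Z : FermionicZesting.Zesting f C D),
      (∀ X : C.cat.Obj, Simple X → ∃ σ, FermionicZesting.HasParity (C.ι.obj f) σ X) ∧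
      (∀ (σ τ : Bool) (X Y : C.cat.Obj), Simple X → Simple Y →
        FermionicZesting.HasParity (C.ι.obj f) σ X → FermionicZesting.HasParity (C.ι.obj f) τ Y →
        FermionicZesting.sEntry (Z.Φ.obj X) (Z.Φ.obj Y) =
          (if σ && τ then Complex.I else 1) * FermionicZesting.sEntry X Y) ∧
      (∀ (σ : Bool) (X : C.cat.Obj), Simple X → FermionicZesting.HasParity (C.ι.obj f) σ X →
        FermionicZesting.twistScalar (Z.Φ.obj X) =
          (if σ then Complex.exp (Real.pi * Complex.I / 4) else 1) *
            FermionicZesting.twistScalar X) ∧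
      D.cat.centralCharge =
        Complex.exp (Real.pi * Complex.I / 4) * C.cat.centralCharge) ∧
    -- zesting defines a free action of `ℤ/8` on the set of equivalence classes
    (∃ _ : AddAction (ZMod 8)
        (FermionicZesting.ModularClosure.Classes.{u₁, v₁, u₂, v₂} B),
      (∀ C D : FermionicZesting.ModularClosure.{u₁, v₁, u₂, v₂} B,
        Nonempty (FermionicZesting.Zesting f C D) → (1 : ZMod 8) +ᵥ C.toClass = D.toClass) ∧
      ∀ (k : ZMod 8) (c : FermionicZesting.ModularClosure.Classes.{u₁, v₁, u₂, v₂} B),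
        k +ᵥ c = c → k = 0) :=
  ⟨fun C => ⟨C.zest hf, FermionicZesting.ModularClosure.nonempty_zesting_zest hf C⟩,
    fun C D ⟨Z⟩ => FermionicZesting.ModularClosure.not_equivalent_of_zesting hf Z,
    FermionicZesting.ModularClosure.zesting_data hf,
    FermionicZesting.ModularClosure.zestAction hf,
    fun C D ⟨Z⟩ => FermionicZesting.ModularClosure.zestClass_toClass hf Z,
    FermionicZesting.ModularClosure.zestAction_free hf⟩
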